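/- **Corollary (Global flow box for $C^\infty$ real vector fields).** Let $\mathbb S^2=\mathbb R^2\cup\{\infty\}$. Let $\mathfrak S\subset\mathbb R^2$ be closed with at most finitely many accumulation points, let $X$ be a $C^\infty$ vector field on $\mathbb R^2\setminus\mathfrak S$ with zero set $\mathcal Z(X)$, put $\mathfrak P=\mathfrak S\cup\mathcal Z(X)$, and assume that $\mathfrak P$ is totally disconnected (so that $\mathbb R^2\setminus\mathfrak P$ is a plane with topological punctures). Let $J$ be a complex structure on $\mathbb R^2\setminus\mathfrak P$, given by a holomorphic atlas compatible with the $C^\infty$ structure, and let $\mathbb X$ be a complex analytic vector field on the Riemann surface $(\mathbb R^2\setminus\mathfrak P,J)$ with $X=\Re\mathbb X$ there. Trajectories are the maximal integral curves of $X$ in $\mathbb R^2\setminus\mathfrak P$; a trajectory is incomplete if it is not defined for all real times; a set of trajectories is locally finite if each point of $\mathbb R^2\setminus\mathfrak P$ has a neighbourhood that meets only finitely many of them. Assume that the set of incomplete trajectories is locally finite. Then: 1. The set of separatrix trajectories of $X$ is locally finite in $\mathbb R^2\setminus\mathfrak P$. Here a trajectory is a separatrix if it has no invariant open neighbourhood in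 $\mathbb R^2\setminus\mathfrak P$ filled by trajectories of the same topology, that is, neither one filled by periodic trajectories, nor one that is the interior of a closed parallel strip of non-periodic trajectories $E(\mathbb R\times\{y\})$, $y\in[-1,1]$ ($E$ injective and continuous, preserving the direction, with the given trajectory at $y=0$), all having the same $\alpha$-limit set $\alpha$ and the same $\omega$-limit set $\omega$ in $\mathbb S^2$, and such that the closure of the strip in $\mathbb S^2$ is contained in the union of the strip with $\alpha\cup\omega$. 2. Each periodic trajectory of $X$ has identity holonomy: on each sufficiently small $C^\infty$ transversal at each of its points the first return map is defined and is the identity. Each polycycle has identity holonomy: if $\Lambda\subset\mathbb S^2$ is homeomorphic to a circle and is a union of separatrix trajectories and of at least one point of $\mathfrak P\cup\{\infty\}$, and if on a $C^\infty$ half transversal, on either side of $\Lambda$, at a regular point of $\Lambda$ the germ of a first return map fixing the base point is defined, then this germ is the identity. 3. The holonomy of each topological hyperbolic sector of $X$ with vertex $q\in\mathfrak P\cup\{\infty\}$ is a $C^\infty$ diffeomorphism. Here a topological hyperbolic sector is the image $H$ of an embedding $h:[-1,1]\times[0,1]\to\mathbb S^2$ with $h(0,0)=q$ that maps the other points into $\mathbb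 R^2\setminus\mathfrak P$ and takes the horizontal segments avoiding $(0,0)$ to trajectory arcs of $X$, preserving the direction. The statement means that for any $C^\infty$ half transversals $\sigma_1,\sigma_2$ inside $H$ which start at points of the incoming separatrix $h([-1,0)\times\{0\})$ and of the outgoing one $h((0,1]\times\{0\})$ respectively, the map from $\sigma_1$ to $\sigma_2$ that follows the trajectories inside $H$, and takes the initial point of $\sigma_1$ to that of $\sigma_2$, is defined near the initial point and its germ is a $C^\infty$ diffeomorphism of manifolds with boundary. 4. Let $k\ge0$ and let $q\in\mathfrak P\cup\{\infty\}$ be a topological multi-saddle of $X$ with $2k+2$ hyperbolic sectors: a neighbourhood of $q$ is the union of $2k+2$ topological hyperbolic sectors with vertex $q$, in cyclic order, meeting only along boundary separatrices and $q$, consecutive ones sharing alternately their outgoing and their incoming separatrix. Then $X$ is $C^\infty$ equivalent to $\Re(z^{-k}\partial_z)=\Re(z^{-k})\,\partial_x+\Im(z^{-k})\,\partial_y$ in a punctured neighbourhood of $q$: there are a $C^\infty$ diffeomorphism $\Xi$ from a punctured neighbourhood of $q$ onto a punctured neighbourhood of $0\in\mathbb C$, with $\Xi(p)\to0$ as $p\to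 q$, and a positive $C^\infty$ function $\rho$ such that $\Xi_*X$ equals $\Re(z^{-k}\partial_z)$ multiplied by $\rho\circ\Xi^{-1}$. -/

import Mathlib

open Set Filter Topology
open scoped ContDiff

namespace FlowBox

/-- The real plane `ℝ²`, with `(x, y)` written as `x + i y`. Only its real structure is used
for smoothness and for vector fields; a real vector field is a map `Plane → Plane`. -/
abbrev Plane : Type := ℂ

/-- The sphere `𝕊² = ℝ² ∪ {∞}`. -/
abbrev Sphere : Type := OnePoint Plane

/-- The inclusion of the plane in the sphere. -/
def toSphere (p : Plane) : Sphere := (p : OnePoint Plane)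

/-! ### Singular set -/

/-- The zeros of `X` outside `S`. -/
def smoothZeros (X : Plane → Plane) (S : Set Plane) : Set Plane := {p | p ∉ S ∧ X p = 0}

/-- The set of all singular points: wide singularities and smooth zeros. -/
def punctures (X : Plane → Plane) (S : Set Plane) : Set Plane := S ∪ smoothZeros X S

/-- The points of `P ∪ {∞}` in the sphere. -/
def singularPoints (P : Set Plane) : Set Sphere := insert OnePoint.infty (toSphere '' P)

/-! ### Complex structures and complex analytic vector fields -/

/-- A complex structure on the open set `U` of the plane, making it a Riemann surface, compatible
with its `C^∞` structure: an atlas of `C^∞` charts with values in `ℂ` whose transition maps are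
holomorphic. -/
structure ComplexStructure (U : Set Plane) where
  atlas : Set (OpenPartialHomeomorph Plane ℂ)
  source_subset : ∀ e ∈ atlas, e.source ⊆ U
  covers : ∀ p ∈ U, ∃ e ∈ atlas, p ∈ e.source
  smooth : ∀ e ∈ atlas, ContDiffOn ℝ ∞ e e.source
  smooth_symm : ∀ e ∈ atlas, ContDiffOn ℝ ∞ e.symm e.target
  holomorphic : ∀ e ∈ atlas, ∀ e' ∈ atlas,
    DifferentiableOn ℂ (fun z => e' (e.symm z)) (e.target ∩ e.symm ⁻¹' e'.source)

/-- A complex analytic vector field on the Riemann surface `(U, J)`: in each chart it is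
`coeff e z ∂/∂z` with `coeff e` holomorphic, and the local expressions correspond to each other
under the changes of charts. -/
structure AnalyticVectorField {U : Set Plane} (J : ComplexStructure U) where
  coeff : OpenPartialHomeomorph Plane ℂ → ℂ → ℂ
  holomorphic : ∀ e ∈ J.atlas, DifferentiableOn ℂ (coeff e) e.target
  change : ∀ e ∈ J.atlas, ∀ e' ∈ J.atlas, ∀ p ∈ e.source ∩ e'.source,
    coeff e' (e' p) = deriv (fun z => e' (e.symm z)) (e p) * coeff e (e p)

/-- `X` is the real part of `V` on `U`. In a chart, the real part of `(u + i v) ∂/∂z` is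
`u ∂/∂x + v ∂/∂y`. -/
def IsRealPart {U : Set Plane} {J : ComplexStructure U} (V : AnalyticVectorField J)
    (X : Plane → Plane) : Prop :=
  ∀ e ∈ J.atlas, ∀ p ∈ e.source, fderiv ℝ e p (X p) = V.coeff e (e p)

/-! ### Trajectories -/

/-- `γ` is an integral curve of `X` inside `U`, on the time interval between `0` and `t`
(`t` may be negative). -/
def IsIntegralArc (X : Plane → Plane) (U : Set Plane) (γ : ℝ → Plane) (t : ℝ) : Prop :=
  ∀ s ∈ uIcc 0 t, γ s ∈ U ∧ HasDerivWithinAt γ (X (γ s)) (uIcc 0 t) s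

/-- The flow of `X` on `U` is defined at `p` for the time `t`, and takes `p` to `b`. -/
def FlowsTo (X : Plane → Plane) (U : Set Plane) (p : Plane) (t : ℝ) (b : Plane) : Prop :=
  ∃ γ : ℝ → Plane, IsIntegralArc X U γ t ∧ γ 0 = p ∧ γ t = b

/-- `A` is a trajectory arc of `X` in `U`, run through in a positive time from `p` to `b`. -/
def IsOrbitArc (X : Plane → Plane) (U : Set Plane) (p b : Plane) (A : Set Plane) : Prop :=
  ∃ t : ℝ, 0 < t ∧ ∃ γ : ℝ → Plane,
    IsIntegralArc X U γ t ∧ γ 0 = p ∧ γ t = b ∧ γ '' Icc 0 t = A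

def trajectory (X : Plane → Plane) (U : Set Plane) (p : Plane) : Set Plane :=
  {b | ∃ t : ℝ, FlowsTo X U p t b}

def forwardOrbit (X : Plane → Plane) (U : Set Plane) (p : Plane) : Set Plane :=
  {b | ∃ t : ℝ, 0 ≤ t ∧ FlowsTo X U p t b}

def backwardOrbit (X : Plane → Plane) (U : Set Plane) (p : Plane) : Set Plane :=
  {b | ∃ t : ℝ, t ≤ 0 ∧ FlowsTo X U p t b}

/-- The `ω`-limit set, in the sphere, of the trajectory of `p`, whether or not the trajectory is
defined for all positive times. -/
def omegaLimitSet (X : Plane → Plane) (U : Set Plane) (p : Plane) : Set Sphere :=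
  ⋂ b ∈ forwardOrbit X U p, closure (toSphere '' forwardOrbit X U b)

/-- The `α`-limit set, in the sphere, of the trajectory of `p`. -/
def alphaLimitSet (X : Plane → Plane) (U : Set Plane) (p : Plane) : Set Sphere :=
  ⋂ b ∈ backwardOrbit X U p, closure (toSphere '' backwardOrbit X U b)

def IsPeriodicPt (X : Plane → Plane) (U : Set Plane) (p : Plane) : Prop :=
  ∃ t : ℝ, 0 < t ∧ FlowsTo X U p t p

/-- The trajectory of `p` is incomplete: it is not defined for all real times. -/
def IsIncomplete (X : Plane → Plane) (U : Set Plane) (p : Plane) : Prop :=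
  ¬ ∀ t : ℝ, ∃ b, FlowsTo X U p t b

/-- The set of the trajectories of the points of `U` with the property `C` is locally finite
in `U`. -/
def LocallyFiniteTrajectories (X : Plane → Plane) (U : Set Plane) (C : Plane → Prop) : Prop :=
  ∀ p ∈ U, ∃ V ∈ 𝓝 p,
    {T : Set Plane | ∃ b ∈ U, C b ∧ T = trajectory X U b ∧ (T ∩ V).Nonempty}.Finite

/-! ### Separatrices -/

/-- The trajectory of `p` has an invariant open neighbourhood in `U` filled by periodic
trajectories. -/
def HasPeriodicNeighbourhood (X : Plane → Plane) (U : Set Plane) (p : Plane) : Prop :=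
  ∃ N : Set Plane, IsOpen N ∧ p ∈ N ∧ N ⊆ U ∧
    ∀ b ∈ N, trajectory X U b ⊆ N ∧ IsPeriodicPt X U b

/-- The trajectory of `p` has an invariant open neighbourhood in `U` filled by non-periodic
trajectories of the same topological type: the neighbourhood is the interior of a closed parallel
strip of trajectories `E (ℝ × {y})`, `-1 ≤ y ≤ 1`, all these trajectories have the same limit
sets in the sphere, and in the sphere the strip accumulates, outside itself, only on these
limit sets. -/
def HasParallelNeighbourhood (X : Plane → Plane) (U : Set Plane) (p : Plane) : Prop :=
  ∃ E : ℝ × ℝ → Plane,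
    ContinuousOn E (univ ×ˢ Icc (-1 : ℝ) 1) ∧
    InjOn E (univ ×ˢ Icc (-1 : ℝ) 1) ∧
    E (0, 0) = p ∧
    MapsTo E (univ ×ˢ Icc (-1 : ℝ) 1) U ∧
    IsOpen (E '' (univ ×ˢ Ioo (-1 : ℝ) 1)) ∧
    (∀ y ∈ Icc (-1 : ℝ) 1, ∀ x : ℝ,
      trajectory X U (E (x, y)) = range (fun x' : ℝ => E (x', y)) ∧
      (∀ x' : ℝ, x < x' → ∃ t : ℝ, 0 < t ∧ FlowsTo X U (E (x, y)) t (E (x', y))) ∧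
      alphaLimitSet X U (E (x, y)) = alphaLimitSet X U p ∧
      omegaLimitSet X U (E (x, y)) = omegaLimitSet X U p) ∧
    closure (toSphere '' (E '' (univ ×ˢ Icc (-1 : ℝ) 1))) ⊆
      toSphere '' (E '' (univ ×ˢ Icc (-1 : ℝ) 1)) ∪ alphaLimitSet X U p ∪ omegaLimitSet X U p

/-- The trajectory of `p` is a separatrix: it has no open neighbourhood in `U` filled by
trajectories with the same topology. -/
def IsSeparatrixPt (X : Plane → Plane) (U : Set Plane) (p : Plane) : Prop :=
  ¬ (HasPeriodicNeighbourhood X U p ∨ HasParallelNeighbourhood X U p)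

/-- A polycycle: a subset of the sphere, homeomorphic to a circle, that is a union of separatrix
trajectories and of at least one point of `P ∪ {∞}`. -/
structure IsPolycycle (X : Plane → Plane) (P : Set Plane) (L : Set Sphere) : Prop where
  circle : Nonempty (L ≃ₜ Circle)
  vertex : (L ∩ singularPoints P).Nonempty
  regular : ∀ p ∈ Pᶜ, toSphere p ∈ L →
    IsSeparatrixPt X Pᶜ p ∧ toSphere '' trajectory X Pᶜ p ⊆ L

/-! ### Transversals and first return maps -/

/-- `σ` is a `C^∞` injective curve in `U`, parametrized by the interval `I`, transversal
to `X`. -/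
structure IsTransversal (X : Plane → Plane) (U : Set Plane) (σ : ℝ → Plane) (I : Set ℝ) :
    Prop where
  smooth : ContDiffOn ℝ ∞ σ I
  inj : InjOn σ I
  mapsTo : MapsTo σ I U
  transverse : ∀ s ∈ I, LinearIndependent ℝ ![X (σ s), derivWithin σ I s]

/-- The trajectory that starts at `σ s` returns to `σ '' I` for the first time at `σ s'`. -/
def IsFirstReturn (X : Plane → Plane) (U : Set Plane) (σ : ℝ → Plane) (I : Set ℝ)
    (s s' : ℝ) : Prop :=
  s' ∈ I ∧ ∃ t : ℝ, 0 < t ∧ FlowsTo X U (σ s) t (σ s') ∧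
    ∀ r ∈ Ioo 0 t, ∀ b, FlowsTo X U (σ s) r b → b ∉ σ '' I

/-- The periodic trajectory of `p` has identity first return map: on each transversal at `p`, cut
down to a small neighbourhood of `p`, the first return map is defined and is the identity. -/
def PeriodicHolonomyIsIdentity (X : Plane → Plane) (U : Set Plane) (p : Plane) : Prop :=
  ∀ (σ : ℝ → Plane) (ε : ℝ), 0 < ε → IsTransversal X U σ (Ioo (-ε) ε) → σ 0 = p →
    ∀ᶠ e in 𝓝[>] (0 : ℝ), ∀ s ∈ Ioo (-e) e, IsFirstReturn X U σ (Ioo (-e) e) s s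

/-- The polycycle `L` has identity holonomy: on each half transversal (on either side of `L`)
at a regular point of `L` on which the germ at `0` of a first return map `R` fixing `0` is
defined, this germ is the identity. -/
def PolycycleHolonomyIsIdentity (X : Plane → Plane) (U : Set Plane) (L : Set Sphere) : Prop :=
  ∀ (σ : ℝ → Plane) (ε : ℝ) (R : ℝ → ℝ), 0 < ε → IsTransversal X U σ (Ico 0 ε) →
    toSphere (σ 0) ∈ L →
    (∀ᶠ s in 𝓝[>] (0 : ℝ), IsFirstReturn X U σ (Ioo 0 ε) s (R s)) →
    Tendsto R (𝓝[>] 0) (𝓝 0) →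
    ∀ᶠ s in 𝓝[>] (0 : ℝ), R s = s

/-! ### Hyperbolic sectors -/

/-- The model of a hyperbolic sector: a half neighbourhood of the origin in the closed upper half
plane, with the horizontal vector field. -/
def sectorModel : Set (ℝ × ℝ) := Icc (-1 : ℝ) 1 ×ˢ Icc (0 : ℝ) 1

/-- `h` parametrizes a topological hyperbolic sector `h '' sectorModel` of `X` with vertex `q`:
it is a homeomorphism onto its image that takes the origin to `q` and the horizontal segments
that avoid the origin to trajectory arcs of `X` in `U`, preserving the direction. The arc
`h ([-1, 0) × {0})` of the incoming separatrix then tends to `q`, and the arc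
`h ((0, 1] × {0})` of the outgoing separatrix leaves `q`. -/
structure IsHyperbolicSector (X : Plane → Plane) (U : Set Plane) (q : Sphere)
    (h : ℝ × ℝ → Sphere) : Prop where
  continuousOn : ContinuousOn h sectorModel
  inj : InjOn h sectorModel
  vertex : h (0, 0) = q
  regular : ∀ z ∈ sectorModel, z ≠ (0, 0) → h z ∈ toSphere '' U
  orbit : ∀ y ∈ Icc (0 : ℝ) 1, ∀ x ∈ Icc (-1 : ℝ) 1, ∀ x' ∈ Icc (-1 : ℝ) 1, x < x' →
    (0 < y ∨ x' < 0 ∨ 0 < x) →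
    ∃ (p b : Plane) (A : Set Plane), IsOrbitArc X U p b A ∧ toSphere p = h (x, y) ∧
      toSphere b = h (x', y) ∧ toSphere '' A = (fun u : ℝ => h (u, y)) '' Icc x x'

/-- `φ : [0, a) → [0, b)` is a `C^∞` diffeomorphism of manifolds with boundary. -/
def IsBoundaryDiffeo (φ : ℝ → ℝ) (a b : ℝ) : Prop :=
  φ 0 = 0 ∧ MapsTo φ (Ico 0 a) (Ico 0 b) ∧ ContDiffOn ℝ ∞ φ (Ico 0 a) ∧
    ∃ ψ : ℝ → ℝ, MapsTo ψ (Ico 0 b) (Ico 0 a) ∧ ContDiffOn ℝ ∞ ψ (Ico 0 b) ∧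
      InvOn ψ φ (Ico 0 a) (Ico 0 b)

/-- The holonomy of the hyperbolic sector parametrized by `h` is a `C^∞` diffeomorphism: for all
half transversals `σ₁`, `σ₂` inside the sector, starting at a point of the incoming and of the
outgoing separatrix, the germ of the map `hol` that follows the trajectories inside the sector
from `σ₁` to `σ₂` and takes `σ₁ 0` to `σ₂ 0` is a `C^∞` diffeomorphism of manifolds with
boundary. -/
def SectorHolonomyIsDiffeo (X : Plane → Plane) (U : Set Plane) (h : ℝ × ℝ → Sphere) : Prop :=
  ∀ (σ₁ σ₂ : ℝ → Plane) (ε₁ ε₂ : ℝ), 0 < ε₁ → 0 < ε₂ →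
    IsTransversal X U σ₁ (Ico 0 ε₁) → IsTransversal X U σ₂ (Ico 0 ε₂) →
    (∀ s ∈ Ico 0 ε₁, toSphere (σ₁ s) ∈ h '' sectorModel) →
    (∀ s ∈ Ico 0 ε₂, toSphere (σ₂ s) ∈ h '' sectorModel) →
    (∃ x ∈ Ico (-1 : ℝ) 0, toSphere (σ₁ 0) = h (x, 0)) →
    (∃ x ∈ Ioc (0 : ℝ) 1, toSphere (σ₂ 0) = h (x, 0)) →
    ∃ (δ₁ δ₂ : ℝ) (hol : ℝ → ℝ), 0 < δ₁ ∧ δ₁ ≤ ε₁ ∧ 0 < δ₂ ∧ δ₂ ≤ ε₂ ∧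
      (∀ s ∈ Ioo 0 δ₁, hol s ∈ Ioo 0 δ₂ ∧ ∃ A : Set Plane,
        IsOrbitArc X U (σ₁ s) (σ₂ (hol s)) A ∧ toSphere '' A ⊆ h '' sectorModel) ∧
      IsBoundaryDiffeo hol δ₁ δ₂

/-! ### Multi-saddles -/

/-- `q` is a topological multi-saddle of `X` with `2k + 2` hyperbolic sectors: a neighbourhood of
`q` is the union of `2k + 2` hyperbolic sectors with vertex `q`, in cyclic order, any two of them
meeting at most along their boundary separatrices and `q`, and two consecutive ones sharing,
alternately, their outgoing and their incoming separatrix. -/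
def IsMultiSaddle (X : Plane → Plane) (U : Set Plane) (q : Sphere) (k : ℕ) : Prop :=
  ∃ h : ℕ → ℝ × ℝ → Sphere,
    (∀ i, h (i + (2 * k + 2)) = h i) ∧
    (∀ i, IsHyperbolicSector X U q (h i)) ∧
    (∀ i, Even i → ∀ x ∈ Icc (0 : ℝ) 1, h i (x, 0) = h (i + 1) (x, 0)) ∧
    (∀ i, Odd i → ∀ x ∈ Icc (-1 : ℝ) 0, h i (x, 0) = h (i + 1) (x, 0)) ∧
    (∀ i j, i < j → j < 2 * k + 2 → ∀ z ∈ sectorModel, ∀ w ∈ sectorModel,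
      h i z = h j w → z.2 = 0 ∧ w.2 = 0) ∧
    (⋃ i ∈ Finset.range (2 * k + 2), h i '' sectorModel) ∈ 𝓝 q

/-- In a punctured neighbourhood of `q`, `X` is `C^∞` equivalent to `ℜ (z⁻ᵏ ∂/∂z)` in a punctured
neighbourhood of the origin: there is a `C^∞` diffeomorphism `Ξ` between the two punctured
neighbourhoods that takes `X` to a positive `C^∞` multiple of the model. -/
def IsSmoothlyEquivalentToModel (X : Plane → Plane) (U : Set Plane) (q : Sphere) (k : ℕ) :
    Prop :=
  ∃ (Ξ : OpenPartialHomeomorph Plane ℂ) (ρ : Plane → ℝ),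
    Ξ.source ⊆ U ∧ q ∉ toSphere '' Ξ.source ∧ insert q (toSphere '' Ξ.source) ∈ 𝓝 q ∧
    (0 : ℂ) ∉ Ξ.target ∧ insert 0 Ξ.target ∈ 𝓝 (0 : ℂ) ∧
    ContDiffOn ℝ ∞ Ξ Ξ.source ∧ ContDiffOn ℝ ∞ Ξ.symm Ξ.target ∧
    Tendsto Ξ (comap toSphere (𝓝[≠] q)) (𝓝[≠] 0) ∧
    ContDiffOn ℝ ∞ ρ Ξ.source ∧
    ∀ p ∈ Ξ.source, 0 < ρ p ∧ fderiv ℝ Ξ p (X p) = (ρ p : ℂ) * ((Ξ p) ^ k)⁻¹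

end FlowBox

/-! A zero-free complex analytic field `f ∂/∂z` has the holomorphic time form `dz / f`. Its local
primitives are charts that carry the field to `∂/∂z`, hence `X` to the constant field `1`, and two
primitives differ by a constant. So `Pᶜ` carries an atlas in which `X` is constant and all
transition maps are translations (`exists_isTranslationAtlas`). The flow is then a translation in
these charts (`holonomy`, `flow_joint`), and the imaginary part of a chart, its height, is a
transverse coordinate that the flow preserves up to additive constants. The analytic structure is
not used beyond this.

Holonomy. In the height coordinate a return map is locally a translation. Around a periodic
trajectory the flow for one period is the identity. Along a polycycle the height increment of the
return map is locally constant on one side and tends to zero, so it vanishes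
(`firstReturn_eventually_eq`).

Hyperbolic sectors. Continuing a chart backwards along the horizontal segments from the exit side
gives one height function of the ordinate `y` of the model, valid in every chart along the sector.
The vertex blocks the continuation only at `y = 0`, where continuity takes over (`height_germ`).
Both half transversals read off this same function, smoothly and with positive derivative up to one
common sign, so the holonomy is `f₂⁻¹ ∘ f₁` with `f₁`, `f₂` smooth up to the boundary.

Multi-saddles. The heights of consecutive sectors have opposite signs. A smooth function `τ` is
built that increases along trajectories and tends to zero at the vertex (`exists_time_function`):
the difference of an integral of a bump function around the outgoing separatrices and the same
object for `-X`. Then `w = τ + i · height` maps the `2k + 2` sectors alternately to upper and lower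
half discs, and the branches of `w ^ (1 / (k + 1))` glue to an injective map `Ξ`. From `Ξ ^ (k + 1)
= w` and `dw(X) = dτ(X) > 0` follows `dΞ(X) = dτ(X) / (k + 1) · Ξ⁻ᵏ`; the real factor is `ρ`.

Separatrices. It suffices that a complete trajectory is never a separatrix (`not_isSeparatrixPt`). A
periodic one has periodic neighbours of the same period. For a non-periodic one, successive returns
to the vertical axis of a flow box are monotone, as in Poincaré–Bendixson theory; the Jordan curve
theorem is replaced by lifting a circle-valued map on the plane (`lt_of_isFirstHit`). Hence the
trajectory does not return to a smaller axis, and a connectedness argument, in which incomplete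
trajectories are the only obstruction and are finite in number, excludes returns of the neighbours.
A strip of complete trajectories without returns leaves every compact subset of `Pᶜ`
(`flow_proper`), so each of its ends accumulates on a connected subset of the totally disconnected
singular set, that is, at one point. -/

namespace FlowBox

/-! ### Translation atlases, and the flow as a partial action of the real numbers -/

/-- A set of charts of `U` that straighten `X` to the constant field `1`, whose transition maps
are locally translations. -/
structure IsTranslationAtlas (X : Plane → Plane) (U : Set Plane)
    (T : Set (OpenPartialHomeomorph Plane ℂ)) : Prop where
  isOpen : IsOpen U
  source_subset : ∀ e ∈ T, e.source ⊆ U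
  covers : ∀ p ∈ U, ∃ e ∈ T, p ∈ e.source
  smooth : ∀ e ∈ T, ContDiffOn ℝ ∞ e e.source
  smooth_symm : ∀ e ∈ T, ContDiffOn ℝ ∞ e.symm e.target
  straighten : ∀ e ∈ T, ∀ p ∈ e.source, fderiv ℝ e p (X p) = 1
  transition : ∀ e ∈ T, ∀ e' ∈ T, ∀ p ∈ e.source ∩ e'.source,
    ∀ᶠ z in 𝓝 p, e' z - e z = e' p - e p

/-- `γ` is an integral curve of `X` in `U` on the set of times `I`. -/
def IsArc (X : Plane → Plane) (U : Set Plane) (γ : ℝ → Plane) (I : Set ℝ) : Prop :=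
  ∀ s ∈ I, γ s ∈ U ∧ HasDerivWithinAt γ (X (γ s)) I s

variable {X : Plane → Plane} {U : Set Plane} {γ γ' : ℝ → Plane} {I I' : Set ℝ}
  {T : Set (OpenPartialHomeomorph Plane ℂ)} {e e' : OpenPartialHomeomorph Plane ℂ}
  {p b c : Plane} {s t : ℝ}

theorem IsArc.mono (h : IsArc X U γ I) (hI : I' ⊆ I) : IsArc X U γ I' := fun s hs =>
  ⟨(h s (hI hs)).1, (h s (hI hs)).2.mono hI⟩

theorem IsArc.continuousOn (h : IsArc X U γ I) : ContinuousOn γ I := fun s hs =>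
  (h s hs).2.continuousWithinAt

theorem IsArc.shift (h : IsArc X U γ I) (a : ℝ) :
    IsArc X U (fun s => γ (s + a)) ((fun s => s + a) ⁻¹' I) := by
  intro s hs
  refine ⟨(h _ hs).1, ?_⟩
  have h1 : HasDerivWithinAt (fun s : ℝ => s + a) 1 ((fun s => s + a) ⁻¹' I) s :=
    ((hasDerivAt_id s).add_const a).hasDerivWithinAt
  simpa [Function.comp_def] using
    HasDerivWithinAt.scomp s (h _ hs).2 h1 (fun x hx => hx)

theorem IsArc.glue {a m d : ℝ} (h : IsArc X U γ (Icc a m)) (h' : IsArc X U γ' (Icc m d))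
    (hm : γ m = γ' m) (ham : a ≤ m) (hmd : m ≤ d) :
    IsArc X U (fun s => if s ≤ m then γ s else γ' s) (Icc a d) := by
  have e1 : ∀ s ∈ Icc a m, (fun s => if s ≤ m then γ s else γ' s) s = γ s := by
    intro s hs; simp [hs.2]
  have e2 : ∀ s ∈ Icc m d, (fun s => if s ≤ m then γ s else γ' s) s = γ' s := by
    intro s hs
    rcases hs.1.eq_or_lt with rfl | hlt
    · simp [hm]
    · simp [hlt.not_ge]
  have hU : Icc a d = Icc a m ∪ Icc m d := (Icc_union_Icc_eq_Icc ham hmd).symm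
  intro s hs
  rcases lt_trichotomy s m with hlt | rfl | hlt
  · have hs' : s ∈ Icc a m := ⟨hs.1, hlt.le⟩
    refine ⟨by rw [e1 s hs']; exact (h s hs').1, ?_⟩
    rw [e1 s hs']
    refine ((h s hs').2.congr e1 (e1 s hs')).mono_of_mem_nhdsWithin ?_
    filter_upwards [self_mem_nhdsWithin, mem_nhdsWithin_of_mem_nhds (Iio_mem_nhds hlt)] with x hx hx'
    exact ⟨hx.1, hx'.le⟩
  · have hs1 : s ∈ Icc a s := ⟨ham, le_rfl⟩
    have hs2 : s ∈ Icc s d := ⟨le_rfl, hmd⟩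
    refine ⟨by rw [e1 s hs1]; exact (h s hs1).1, ?_⟩
    rw [hU, e1 s hs1]
    refine ((h s hs1).2.congr e1 (e1 s hs1)).union ?_
    have := (h' s hs2).2.congr e2 (e2 s hs2)
    rwa [hm]
  · have hs' : s ∈ Icc m d := ⟨hlt.le, hs.2⟩
    refine ⟨by rw [e2 s hs']; exact (h' s hs').1, ?_⟩
    rw [e2 s hs']
    refine ((h' s hs').2.congr e2 (e2 s hs')).mono_of_mem_nhdsWithin ?_
    filter_upwards [self_mem_nhdsWithin, mem_nhdsWithin_of_mem_nhds (Ioi_mem_nhds hlt)] with x hx hx'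
    exact ⟨hx'.le, hx.2⟩

theorem IsArc.flowsTo (h : IsArc X U γ I) (hI : I.OrdConnected) (hs : s ∈ I) (ht : t ∈ I) :
    FlowsTo X U (γ s) (t - s) (γ t) := by
  refine ⟨fun r => γ (r + s), (h.shift s).mono ?_, by simp, by simp⟩
  intro r hr
  refine hI.uIcc_subset hs ht ?_
  rw [mem_uIcc] at hr ⊢
  rcases hr with hr | hr
  · left; constructor <;> linarith [hr.1, hr.2]
  · right; constructor <;> linarith [hr.1, hr.2]

theorem FlowsTo.exists_arc (h : FlowsTo X U p t b) :
    ∃ γ : ℝ → Plane, IsArc X U γ (uIcc 0 t) ∧ γ 0 = p ∧ γ t = b := h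

theorem FlowsTo.refl (hp : p ∈ U) : FlowsTo X U p 0 p := by
  refine ⟨fun _ => p, ?_, rfl, rfl⟩
  intro s hs
  simp only [uIcc_self, mem_singleton_iff] at hs
  subst hs
  refine ⟨hp, ?_⟩
  simp only [uIcc_self]
  exact hasDerivWithinAt_iff_hasFDerivWithinAt.2 .singleton

theorem FlowsTo.left_mem (h : FlowsTo X U p t b) : p ∈ U := by
  obtain ⟨γ, hγ, rfl, rfl⟩ := h
  exact (hγ 0 left_mem_uIcc).1

theorem FlowsTo.right_mem (h : FlowsTo X U p t b) : b ∈ U := by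
  obtain ⟨γ, hγ, rfl, rfl⟩ := h
  exact (hγ t right_mem_uIcc).1

theorem FlowsTo.symm (h : FlowsTo X U p t b) : FlowsTo X U b (-t) p := by
  obtain ⟨γ, hγ, rfl, rfl⟩ := h
  simpa using IsArc.flowsTo hγ ordConnected_uIcc right_mem_uIcc left_mem_uIcc

theorem FlowsTo.exists_of_mem (h : FlowsTo X U p t b) (hs : s ∈ uIcc 0 t) :
    ∃ c, FlowsTo X U p s c ∧ FlowsTo X U c (t - s) b := by
  obtain ⟨γ, hγ, rfl, rfl⟩ := h
  refine ⟨γ s, ?_, IsArc.flowsTo hγ ordConnected_uIcc hs right_mem_uIcc⟩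
  simpa using IsArc.flowsTo hγ ordConnected_uIcc left_mem_uIcc hs

namespace IsTranslationAtlas

variable (hT : IsTranslationAtlas X U T)
include hT

/-- In a straightening chart the difference between the curve and the time has zero derivative, and
`I` is convex. -/
theorem chart_arc (he : e ∈ T) (h : IsArc X U γ I) (hI : Convex ℝ I)
    (hsub : ∀ s ∈ I, γ s ∈ e.source) (hs : s ∈ I) (ht : t ∈ I) :
    e (γ t) = e (γ s) + ((t - s : ℝ) : ℂ) := by
  have hd : ∀ r ∈ I, HasDerivWithinAt (fun r => e (γ r) - (r : ℂ)) 0 I r := by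
    intro r hr
    have h1 : HasFDerivAt e (fderiv ℝ e (γ r)) (γ r) :=
      (((hT.smooth e he).contDiffAt (e.open_source.mem_nhds (hsub r hr))).differentiableAt
        (by simp)).hasFDerivAt
    have h2 := h1.comp_hasDerivWithinAt r (h r hr).2
    rw [hT.straighten e he _ (hsub r hr)] at h2
    have h3 : HasDerivWithinAt (fun r : ℝ => (r : ℂ)) 1 I r :=
      Complex.ofRealCLM.hasDerivAt.hasDerivWithinAt
    have h4 := h2.sub h3
    rw [sub_self] at h4
    exact h4
  have := hI.norm_image_sub_le_of_norm_hasDerivWithin_le (C := 0) hd (by simp) hs ht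
  simp only [zero_mul, norm_le_zero_iff] at this
  push_cast
  linear_combination this

theorem chart_arc_eventually (he : e ∈ T) (h : IsArc X U γ I) (hI : Convex ℝ I)
    (hs : s ∈ I) (hse : γ s ∈ e.source) :
    ∀ᶠ t in 𝓝[I] s, γ t ∈ e.source ∧ e (γ t) = e (γ s) + ((t - s : ℝ) : ℂ) := by
  have h1 := (h s hs).2.continuousWithinAt (e.open_source.mem_nhds hse)
  obtain ⟨δ, hδ, hb⟩ := Metric.mem_nhdsWithin_iff.1 h1
  rw [Filter.Eventually, Metric.mem_nhdsWithin_iff]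
  refine ⟨δ, hδ, fun t ht => ⟨hb ht, ?_⟩⟩
  exact hT.chart_arc he (h.mono inter_subset_right) ((convex_ball s δ).inter hI)
    (fun r hr => hb hr) ⟨Metric.mem_ball_self hδ, hs⟩ ht

/-- Agreement is open, because in a chart both curves move with speed `1` from a common point, and
disagreement is open because the plane is Hausdorff. Convex sets of times are connected. -/
theorem arc_unique (h : IsArc X U γ I) (h' : IsArc X U γ' I) (hI : Convex ℝ I)
    (hs : s ∈ I) (heq : γ s = γ' s) (ht : t ∈ I) : γ t = γ' t := by
  refine (hI.isPreconnected.induction₂ (fun s t => γ s = γ' s ↔ γ t = γ' t) ?_ ?_ ?_ hs ht).1 heq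
  · intro r hr
    by_cases hrr : γ r = γ' r
    · obtain ⟨e, he, hre⟩ := hT.covers _ (h r hr).1
      filter_upwards [hT.chart_arc_eventually he h hI hr hre,
        hT.chart_arc_eventually he h' hI hr (hrr ▸ hre)] with u hu hu'
      simp only [hrr, true_iff]
      exact e.injOn hu.1 hu'.1 (by rw [hu.2, hu'.2, hrr])
    · have := ((h r hr).2.continuousWithinAt.prodMk (h' r hr).2.continuousWithinAt)
        (isOpen_ne_fun continuous_fst continuous_snd |>.mem_nhds (x := (γ r, γ' r)) hrr)
      filter_upwards [this] with u hu
      simp only [hrr, false_iff]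
      exact hu
  · intro x y z _ _ _ h1 h2; exact h1.trans h2
  · intro x y _ _ h1; exact h1.symm

theorem flowsTo_unique (h : FlowsTo X U p t b) (h' : FlowsTo X U p t c) : b = c := by
  obtain ⟨γ, hγ, h0, rfl⟩ := h
  obtain ⟨γ', hγ', h0', rfl⟩ := h'
  exact hT.arc_unique hγ hγ' (convex_uIcc 0 t) left_mem_uIcc (h0.trans h0'.symm) right_mem_uIcc

theorem flowsTo_injective (h : FlowsTo X U p t b) (h' : FlowsTo X U c t b) : p = c :=
  hT.flowsTo_unique h.symm h'.symm

theorem flowsTo_zero (h : FlowsTo X U p 0 b) : b = p :=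
  hT.flowsTo_unique h (FlowsTo.refl h.left_mem)

omit hT in
theorem _root_.FlowBox.FlowsTo.trans_nonneg (h : FlowsTo X U p s b) (h' : FlowsTo X U b t c)
    (hs : 0 ≤ s) (ht : 0 ≤ t) : FlowsTo X U p (s + t) c := by
  obtain ⟨γ, hγ, rfl, rfl⟩ := h
  obtain ⟨γ', hγ', h0, rfl⟩ := h'
  replace hγ : IsArc X U γ (uIcc 0 s) := hγ
  replace hγ' : IsArc X U γ' (uIcc 0 t) := hγ'
  rw [uIcc_of_le hs] at hγ
  rw [uIcc_of_le ht] at hγ'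
  have h1 := hγ'.shift (-s)
  have h2 : (fun r : ℝ => r + -s) ⁻¹' Icc 0 t = Icc s (s + t) := by
    ext r; simp only [mem_preimage, mem_Icc]; constructor <;> intro hr <;>
      constructor <;> linarith [hr.1, hr.2]
  rw [h2] at h1
  have h3 := hγ.glue h1 (by simp [h0]) hs (by linarith)
  have h4 := h3.flowsTo (s := 0) (t := s + t) ordConnected_Icc ⟨le_rfl, by linarith⟩
    ⟨by linarith, le_rfl⟩
  simp only [hs, if_true, sub_zero] at h4
  rcases ht.eq_or_lt with rfl | hlt
  · simpa [h0] using h4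
  · rw [if_neg (by linarith)] at h4
    simpa using h4

/-- Times of equal sign are concatenated. For opposite signs the shorter piece retraces the longer
one by uniqueness, so the endpoint already lies on the longer arc. -/
theorem flowsTo_trans (h : FlowsTo X U p s b) (h' : FlowsTo X U b t c) :
    FlowsTo X U p (s + t) c := by
  have mixed : s + t ∈ uIcc 0 s → FlowsTo X U p (s + t) c := by
    intro hm
    obtain ⟨d, hd, hd'⟩ := h.exists_of_mem hm
    have h2 := hd'.symm
    rw [show -(s - (s + t)) = t by ring] at h2
    rwa [hT.flowsTo_unique h' h2]
  have mixed' : -s ∈ uIcc 0 t → FlowsTo X U p (s + t) c := by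
    intro hm
    obtain ⟨d, hd, hd'⟩ := h'.exists_of_mem hm
    rw [hT.flowsTo_unique h.symm hd]
    rwa [show t - -s = s + t by ring] at hd'
  rcases le_total 0 s with hs | hs <;> rcases le_total 0 t with ht | ht
  · exact h.trans_nonneg h' hs ht
  · rcases le_total 0 (s + t) with hst | hst
    · exact mixed (by rw [mem_uIcc]; left; constructor <;> linarith)
    · exact mixed' (by rw [mem_uIcc]; right; constructor <;> linarith)
  · rcases le_total 0 (s + t) with hst | hst
    · exact mixed' (by rw [mem_uIcc]; left; constructor <;> linarith)
    · exact mixed (by rw [mem_uIcc]; right; constructor <;> linarith)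
  · have := (h'.symm.trans_nonneg h.symm (by linarith) (by linarith)).symm
    rwa [show -(-t + -s) = s + t by ring] at this

/-- Two points on a common trajectory, reached from a third one. -/
theorem flowsTo_of_flowsTo (h : FlowsTo X U p s b) (h' : FlowsTo X U p t c) :
    FlowsTo X U b (t - s) c := by
  have := hT.flowsTo_trans h.symm h'
  rwa [show -s + t = t - s by ring] at this

theorem hasFDerivAt_symm (he : e ∈ T) (hp : p ∈ e.source) :
    ∃ A : Plane ≃L[ℝ] ℂ, HasFDerivAt e (A : Plane →L[ℝ] ℂ) p ∧
      HasFDerivAt e.symm (A.symm : ℂ →L[ℝ] Plane) (e p) ∧ A (X p) = 1 := by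
  have h1 : HasFDerivAt e (fderiv ℝ e p) p :=
    (((hT.smooth e he).contDiffAt (e.open_source.mem_nhds hp)).differentiableAt
      (by simp)).hasFDerivAt
  have h2 : HasFDerivAt e.symm (fderiv ℝ e.symm (e p)) (e p) :=
    (((hT.smooth_symm e he).contDiffAt (e.open_target.mem_nhds (e.map_source hp))).differentiableAt
      (by simp)).hasFDerivAt
  have h3 : (fderiv ℝ e.symm (e p)).comp (fderiv ℝ e p) = ContinuousLinearMap.id ℝ _ := by
    refine (h2.comp p h1).unique ((hasFDerivAt_id p).congr_of_eventuallyEq ?_)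
    filter_upwards [e.open_source.mem_nhds hp] with z hz
    simp [e.left_inv hz]
  have h2' : HasFDerivAt e.symm (fderiv ℝ e.symm (e p)) (e p) := h2
  have h1' : HasFDerivAt e (fderiv ℝ e p) (e.symm (e p)) := by rwa [e.left_inv hp]
  have h4 : (fderiv ℝ e p).comp (fderiv ℝ e.symm (e p)) = ContinuousLinearMap.id ℝ _ := by
    refine (h1'.comp (e p) h2').unique ((hasFDerivAt_id (e p)).congr_of_eventuallyEq ?_)
    filter_upwards [e.open_target.mem_nhds (e.map_source hp)] with z hz
    simp [e.right_inv hz]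
  refine ⟨ContinuousLinearEquiv.equivOfInverse (fderiv ℝ e p) (fderiv ℝ e.symm (e p))
    (fun v => by simpa using congrArg (fun L => L v) h3)
    (fun v => by simpa using congrArg (fun L => L v) h4), h1, h2, ?_⟩
  exact hT.straighten e he p hp

/-- The preimage of a horizontal segment run through at unit speed is an integral curve, since the
inverse chart carries `1` back to `X`. -/
theorem flowsTo_of_chart (he : e ∈ T) (hp : p ∈ e.source)
    (h : ∀ s ∈ uIcc 0 t, e p + (s : ℂ) ∈ e.target) : FlowsTo X U p t (e.symm (e p + (t : ℂ))) := by
  refine ⟨fun s => e.symm (e p + (s : ℂ)), ?_, by simp [e.left_inv hp], rfl⟩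
  intro s hs
  have hm := e.map_target (h s hs)
  refine ⟨hT.source_subset e he hm, ?_⟩
  obtain ⟨A, -, hA, hA1⟩ := hT.hasFDerivAt_symm he hm
  rw [e.right_inv (h s hs)] at hA
  have h3 : HasDerivWithinAt (fun r : ℝ => e p + (r : ℂ)) 1 (uIcc 0 t) s := by
    simpa using (Complex.ofRealCLM.hasDerivAt (x := s)).hasDerivWithinAt.const_add (e p)
  have h4 := hA.comp_hasDerivWithinAt s h3
  have h5 : A.symm 1 = X (e.symm (e p + (s : ℂ))) := by
    rw [← hA1, A.symm_apply_apply]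
  rw [← h5]; exact h4

end IsTranslationAtlas
end FlowBox


/-! ### The flow is a translation in the charts -/

namespace FlowBox

variable {X : Plane → Plane} {U : Set Plane} {γ γ' : ℝ → Plane} {I I' : Set ℝ}
  {T : Set (OpenPartialHomeomorph Plane ℂ)} {e e' : OpenPartialHomeomorph Plane ℂ}
  {p b c : Plane} {s t : ℝ}

theorem tendsto_symm_add {α : Type*} {l : Filter α} {f : α → ℂ} (hp : p ∈ e.source)
    (hf : Tendsto f l (𝓝 0)) : Tendsto (fun a => e.symm (e p + f a)) l (𝓝 p) := by
  have h1 : Tendsto (fun a => e p + f a) l (𝓝 (e p)) := by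
    simpa using (tendsto_const_nhds (x := e p)).add hf
  have h2 := (e.continuousAt_symm (e.map_source hp)).tendsto
  rw [e.left_inv hp] at h2
  exact h2.comp h1

theorem eventually_add_mem_target {α : Type*} {l : Filter α} {f : α → ℂ} (hp : p ∈ e.source)
    (hf : Tendsto f l (𝓝 0)) : ∀ᶠ a in l, e p + f a ∈ e.target := by
  have h1 : Tendsto (fun a => e p + f a) l (𝓝 (e p)) := by
    simpa using (tendsto_const_nhds (x := e p)).add hf
  exact h1 (e.open_target.mem_nhds (e.map_source hp))

theorem tendsto_chart_sub (hp : p ∈ e.source) : Tendsto (fun z => e z - e p) (𝓝 p) (𝓝 0) := by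
  have := (e.continuousAt hp).tendsto.sub_const (e p)
  simpa using this

namespace IsTranslationAtlas

variable (hT : IsTranslationAtlas X U T)
include hT

theorem symm_transition (he : e ∈ T) (he' : e' ∈ T) (hp : p ∈ e.source) (hp' : p ∈ e'.source) :
    ∀ᶠ u in 𝓝 (0 : ℂ), e'.symm (e' p + u) = e.symm (e p + u) := by
  have h1 := tendsto_symm_add (l := 𝓝 (0 : ℂ)) (f := id) hp tendsto_id
  have h2 := h1.eventually (hT.transition e he e' he' p ⟨hp, hp'⟩)
  have h3 := h1 (e'.open_source.mem_nhds hp')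
  have h4 := eventually_add_mem_target (l := 𝓝 (0 : ℂ)) (f := id) hp tendsto_id
  filter_upwards [h2, h3, h4] with u hu hu' hu''
  simp only [id, mem_preimage] at hu hu' hu''
  rw [e.right_inv hu''] at hu
  rw [show e' p + u = e' (e.symm (e p + u)) by linear_combination -hu, e'.left_inv hu']

theorem flow_local (he : e ∈ T) (hp : p ∈ e.source) :
    ∀ᶠ w in 𝓝 ((e p, 0) : ℂ × ℝ), w.1 ∈ e.target ∧ w.1 + (w.2 : ℂ) ∈ e.target ∧
      FlowsTo X U (e.symm w.1) w.2 (e.symm (w.1 + (w.2 : ℂ))) := by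
  obtain ⟨r, hr, hb⟩ := Metric.isOpen_iff.1 e.open_target _ (e.map_source hp)
  have h1 : ∀ᶠ w in 𝓝 ((e p, 0) : ℂ × ℝ), ‖w.1 - e p‖ + |w.2| < r := by
    refine Tendsto.eventually_lt_const (u := r) (v := ‖e p - e p‖ + |(0 : ℝ)|) (by simpa) ?_
    exact Continuous.tendsto' (by fun_prop) _ _ rfl
  filter_upwards [h1] with w hw
  have key : ∀ s ∈ uIcc 0 w.2, w.1 + (s : ℂ) ∈ e.target := by
    intro s hs
    apply hb
    have hs' : |s| ≤ |w.2| := by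
      simpa using abs_sub_left_of_mem_uIcc hs
    rw [Metric.mem_ball, dist_eq_norm]
    calc ‖w.1 + (s : ℂ) - e p‖ = ‖(w.1 - e p) + (s : ℂ)‖ := by ring_nf
      _ ≤ ‖w.1 - e p‖ + ‖(s : ℂ)‖ := norm_add_le _ _
      _ < r := by rw [Complex.norm_real, Real.norm_eq_abs]; linarith
  have h0 : w.1 ∈ e.target := by simpa using key 0 left_mem_uIcc
  refine ⟨h0, key _ right_mem_uIcc, ?_⟩
  have := hT.flowsTo_of_chart he (e.map_target h0) (t := w.2) (by rwa [e.right_inv h0])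
  rwa [e.right_inv h0] at this

/-- True for short times inside one chart, and stable under composition and inversion because
transition maps are translations; the general case follows by connectedness of the time interval. -/
theorem holonomy (h : FlowsTo X U p t b) (he : e ∈ T) (he' : e' ∈ T) (hp : p ∈ e.source)
    (hb : b ∈ e'.source) : ∀ᶠ z in 𝓝 p, FlowsTo X U z t (e'.symm (e' b + (e z - e p))) := by
  obtain ⟨γ, hγ, rfl, rfl⟩ := h
  replace hγ : IsArc X U γ (uIcc 0 t) := hγ
  -- The relation quantifies over all charts at both ends, so that it is symmetric and transitive
  -- whatever charts are used at intermediate points.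
  let P : ℝ → ℝ → Prop := fun s s' => ∀ e ∈ T, ∀ e' ∈ T, γ s ∈ e.source → γ s' ∈ e'.source →
    ∀ᶠ z in 𝓝 (γ s), FlowsTo X U z (s' - s) (e'.symm (e' (γ s') + (e z - e (γ s))))
  have key : P 0 t := by
    refine (convex_uIcc (0 : ℝ) t).isPreconnected.induction₂ P ?_ ?_ ?_ left_mem_uIcc
      right_mem_uIcc
    · intro s hs
      obtain ⟨e₀, he₀, hs₀⟩ := hT.covers _ (hγ s hs).1
      have h1 := hT.flow_local he₀ hs₀
      rw [nhds_prod_eq] at h1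
      obtain ⟨pa, hpa, pb, hpb, hpab⟩ := Filter.eventually_prod_iff.1 h1
      have h2 : ∀ᶠ s' in 𝓝[uIcc 0 t] s, pb (s' - s) := by
        have : Tendsto (fun s' : ℝ => s' - s) (𝓝[uIcc 0 t] s) (𝓝 0) :=
          (Continuous.tendsto' (by fun_prop) _ _ (by simp)).mono_left nhdsWithin_le_nhds
        exact this.eventually hpb
      filter_upwards [h2, hT.chart_arc_eventually he₀ hγ (convex_uIcc _ _) hs hs₀]
        with s' hs' ⟨hs₁, hs₂⟩ e he e' he' hse hse'
      have h3 := (e₀.continuousAt hs₀).tendsto.eventually hpa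
      have h5 := (tendsto_chart_sub hse).eventually (hT.symm_transition he₀ he' hs₁ hse')
      filter_upwards [h3, hT.transition e he e₀ he₀ _ ⟨hse, hs₀⟩, h5,
        e₀.open_source.mem_nhds hs₀] with z hz hz' hz'' hz0
      have := (hpab hz hs').2.2
      rw [e₀.left_inv hz0] at this
      rw [hz'', hs₂, show e₀ (γ s) + ((s' - s : ℝ) : ℂ) + (e z - e (γ s)) =
        e₀ z + ((s' - s : ℝ) : ℂ) by linear_combination -hz']
      exact this
    · intro x y z hx hy hz hxy hyz e he e' he' hxe hze
      obtain ⟨e₁, he₁, hy₁⟩ := hT.covers _ (hγ y hy).1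
      have h1 := hxy e he e₁ he₁ hxe hy₁
      have h2 := (tendsto_symm_add hy₁ (tendsto_chart_sub hxe)).eventually
        (hyz e₁ he₁ e' he' hy₁ hze)
      filter_upwards [h1, h2, eventually_add_mem_target hy₁ (tendsto_chart_sub hxe)] with w h1 h2 h3
      have := hT.flowsTo_trans h1 h2
      rw [e₁.right_inv h3] at this
      convert this using 2 <;> ring
    · intro x y hx hy hxy e he e' he' hye hxe
      have h2 := (tendsto_symm_add hxe (tendsto_chart_sub hye)).eventually
        (hxy e' he' e he hxe hye)
      filter_upwards [h2, eventually_add_mem_target hxe (tendsto_chart_sub hye),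
        e.open_source.mem_nhds hye] with w h2 h3 h4
      rw [e'.right_inv h3, show e (γ y) + (e' (γ x) + (e w - e (γ y)) - e' (γ x)) = e w by ring,
        e.left_inv h4] at h2
      have := h2.symm
      rwa [show -(y - x) = x - y by ring] at this
  have := key e he e' he' hp hb
  rwa [sub_zero] at this

/-- The flow is a translation in the charts, jointly in the point and in the time. -/
theorem flow_joint (h : FlowsTo X U p t b) (he : e ∈ T) (he' : e' ∈ T) (hp : p ∈ e.source)
    (hb : b ∈ e'.source) : ∀ᶠ w in 𝓝 ((p, t) : Plane × ℝ),
      e' b + ((e w.1 - e p) + ((w.2 - t : ℝ) : ℂ)) ∈ e'.target ∧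
      FlowsTo X U w.1 w.2 (e'.symm (e' b + ((e w.1 - e p) + ((w.2 - t : ℝ) : ℂ)))) := by
  have h1 : Tendsto (fun w : Plane × ℝ => (e' b + (e w.1 - e p), w.2 - t)) (𝓝 (p, t))
      (𝓝 (e' b, 0)) := by
    refine Tendsto.prodMk_nhds ?_ (Continuous.tendsto' (by fun_prop) _ _ (by simp))
    have := ((tendsto_chart_sub hp).comp (continuous_fst.tendsto (p, t))).const_add (e' b)
    simpa using this
  have h2 := h1.eventually (hT.flow_local he' hb)
  have h3 := (continuous_fst.tendsto (p, t)).eventually (hT.holonomy h he he' hp hb)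
  filter_upwards [h2, h3] with w hw hw'
  rw [← add_assoc]
  refine ⟨hw.2.1, ?_⟩
  have := hT.flowsTo_trans hw' hw.2.2
  rwa [add_sub_cancel] at this

theorem flow_eventually_mem (h : FlowsTo X U p t b) {N : Set Plane} (hN : N ∈ 𝓝 b) :
    ∀ᶠ w in 𝓝 ((p, t) : Plane × ℝ), ∃ c ∈ N, FlowsTo X U w.1 w.2 c := by
  obtain ⟨e, he, hp⟩ := hT.covers _ h.left_mem
  obtain ⟨e', he', hb⟩ := hT.covers _ h.right_mem
  have h1 : Tendsto (fun w : Plane × ℝ => (e w.1 - e p) + ((w.2 - t : ℝ) : ℂ)) (𝓝 (p, t))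
      (𝓝 0) := by
    have h2 : Tendsto (fun w : Plane × ℝ => ((w.2 - t : ℝ) : ℂ)) (𝓝 (p, t)) (𝓝 0) :=
      Continuous.tendsto' (by fun_prop) _ _ (by simp)
    simpa using ((tendsto_chart_sub hp).comp (continuous_fst.tendsto (p, t))).add h2
  filter_upwards [hT.flow_joint h he he' hp hb, (tendsto_symm_add hb h1) hN] with w hw hw'
  exact ⟨_, hw', hw.2⟩

theorem flow_compact {a d : ℝ} {N : Set Plane} (hN : IsOpen N)
    (h : ∀ t ∈ Icc a d, ∃ b ∈ N, FlowsTo X U p t b) :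
    ∀ᶠ z in 𝓝 p, ∀ t ∈ Icc a d, ∃ b ∈ N, FlowsTo X U z t b := by
  refine isCompact_Icc.eventually_forall_of_forall_eventually
    (P := fun z t => ∃ b ∈ N, FlowsTo X U z t b) ?_
  intro t ht
  obtain ⟨b, hb, hf⟩ := h t ht
  exact hT.flow_eventually_mem hf (hN.mem_nhds hb)

end IsTranslationAtlas

theorem FlowsTo.neg (h : FlowsTo X U p t b) : FlowsTo (-X) U p (-t) b := by
  obtain ⟨γ, hγ, rfl, rfl⟩ := h
  refine ⟨fun s => γ (-s), ?_, by simp, by simp⟩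
  intro s hs
  have hs' : -s ∈ uIcc 0 t := by
    rw [mem_uIcc] at hs ⊢
    rcases hs with hs | hs
    · right; constructor <;> linarith [hs.1, hs.2]
    · left; constructor <;> linarith [hs.1, hs.2]
  refine ⟨(hγ _ hs').1, ?_⟩
  have h1 : HasDerivWithinAt (fun s : ℝ => -s) (-1) (uIcc 0 (-t)) s :=
    (hasDerivAt_neg s).hasDerivWithinAt
  have := HasDerivWithinAt.scomp s (hγ _ hs').2 h1 (fun x hx => by
    change x ∈ uIcc 0 (-t) at hx
    rw [mem_uIcc] at hx ⊢
    rcases hx with hs | hs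
    · right; constructor <;> linarith [hs.1, hs.2]
    · left; constructor <;> linarith [hs.1, hs.2])
  simpa [Function.comp_def] using this

theorem flowsTo_neg_iff : FlowsTo (-X) U p t b ↔ FlowsTo X U p (-t) b :=
  ⟨fun h => by simpa using h.neg, fun h => by simpa using h.neg⟩

/-- The charts are replaced by their negatives. Time reversal later turns incoming separatrices of a
saddle into outgoing ones. -/
theorem IsTranslationAtlas.neg (hT : IsTranslationAtlas X U T) :
    IsTranslationAtlas (-X) U ((fun e => e.transHomeomorph (Homeomorph.neg ℂ)) '' T) where
  isOpen := hT.isOpen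
  source_subset := by rintro _ ⟨e, he, rfl⟩; exact hT.source_subset e he
  covers := by
    intro p hp
    obtain ⟨e, he, hpe⟩ := hT.covers p hp
    exact ⟨_, ⟨e, he, rfl⟩, hpe⟩
  smooth := by rintro _ ⟨e, he, rfl⟩; exact (hT.smooth e he).neg
  smooth_symm := by
    rintro _ ⟨e, he, rfl⟩
    exact (hT.smooth_symm e he).comp (contDiff_neg.contDiffOn) (fun x hx => hx)
  straighten := by
    rintro _ ⟨e, he, rfl⟩ p hp
    have h : fderiv ℝ (fun z => -(e z)) p (-X p) = 1 := by
      rw [fderiv_fun_neg]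
      simpa using hT.straighten e he p hp
    exact h
  transition := by
    rintro _ ⟨e, he, rfl⟩ _ ⟨e', he', rfl⟩ p hp
    filter_upwards [hT.transition e he e' he' p hp] with z hz
    change -(e' z) - -(e z) = -(e' p) - -(e p)
    linear_combination -hz

end FlowBox


/-! ### Straightening charts from the time form of the analytic field -/

namespace FlowBox

theorem exists_openPartialHomeomorph_of_contDiffOn {f : Plane → ℂ} {N : Set Plane}
    (hN : IsOpen N) (hf : ContDiffOn ℝ ∞ f N)
    (hinv : ∀ p ∈ N, ∃ A : Plane ≃L[ℝ] ℂ, HasFDerivAt f (A : Plane →L[ℝ] ℂ) p)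
    {p : Plane} (hp : p ∈ N) : ∃ φ : OpenPartialHomeomorph Plane ℂ, ⇑φ = f ∧ φ.source ⊆ N ∧
      p ∈ φ.source ∧ ContDiffOn ℝ ∞ φ.symm φ.target := by
  obtain ⟨A, hA⟩ := hinv p hp
  have h1 : ContDiffAt ℝ ∞ f p := hf.contDiffAt (hN.mem_nhds hp)
  let φ := (h1.toOpenPartialHomeomorph f hA (by simp)).restrOpen N hN
  have hφ : ⇑φ = f := rfl
  have hs : φ.source ⊆ N := inter_subset_right
  refine ⟨φ, rfl, hs, ⟨h1.mem_toOpenPartialHomeomorph_source hA (by simp), hp⟩, ?_⟩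
  intro z hz
  obtain ⟨B, hB⟩ := hinv _ (hs (φ.map_target hz))
  exact (φ.contDiffAt_symm hz (by rw [hφ]; exact hB)
    (hf.contDiffAt (hN.mem_nhds (hs (φ.map_target hz))))).contDiffWithinAt

theorem isOpen_compl_punctures {X : Plane → Plane} {S : Set Plane} (hS : IsClosed S)
    (hX : ContDiffOn ℝ ∞ X Sᶜ) : IsOpen (punctures X S)ᶜ := by
  have h : (punctures X S)ᶜ = Sᶜ ∩ X ⁻¹' {0}ᶜ := by
    ext p
    simp only [punctures, smoothZeros, mem_compl_iff, mem_union, mem_ofPred_eq, mem_inter_iff,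
      mem_preimage, mem_singleton_iff]
    tauto
  rw [h]
  exact hX.continuousOn.isOpen_inter_preimage hS.isOpen_compl isOpen_compl_singleton

section
variable {X : Plane → Plane} {U : Set Plane} {J : ComplexStructure U} {e : OpenPartialHomeomorph Plane ℂ} {p : Plane}

theorem ComplexStructure.exists_hasFDerivAt (J : ComplexStructure U) (he : e ∈ J.atlas)
    (hp : p ∈ e.source) : ∃ A : Plane ≃L[ℝ] ℂ, HasFDerivAt e (A : Plane →L[ℝ] ℂ) p := by
  have h1 : HasFDerivAt e (fderiv ℝ e p) p :=
    (((J.smooth e he).contDiffAt (e.open_source.mem_nhds hp)).differentiableAt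
      (by simp)).hasFDerivAt
  have h2 : HasFDerivAt e.symm (fderiv ℝ e.symm (e p)) (e p) :=
    (((J.smooth_symm e he).contDiffAt (e.open_target.mem_nhds (e.map_source hp))).differentiableAt
      (by simp)).hasFDerivAt
  have h3 : (fderiv ℝ e.symm (e p)).comp (fderiv ℝ e p) = ContinuousLinearMap.id ℝ _ := by
    refine (h2.comp p h1).unique ((hasFDerivAt_id p).congr_of_eventuallyEq ?_)
    filter_upwards [e.open_source.mem_nhds hp] with z hz
    simp [e.left_inv hz]
  have h1' : HasFDerivAt e (fderiv ℝ e p) (e.symm (e p)) := by rwa [e.left_inv hp]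
  have h4 : (fderiv ℝ e p).comp (fderiv ℝ e.symm (e p)) = ContinuousLinearMap.id ℝ _ := by
    refine (h1'.comp (e p) h2).unique ((hasFDerivAt_id (e p)).congr_of_eventuallyEq ?_)
    filter_upwards [e.open_target.mem_nhds (e.map_source hp)] with z hz
    simp [e.right_inv hz]
  exact ⟨ContinuousLinearEquiv.equivOfInverse (fderiv ℝ e p) (fderiv ℝ e.symm (e p))
    (fun v => by simpa using congrArg (fun L => L v) h3)
    (fun v => by simpa using congrArg (fun L => L v) h4), h1⟩

theorem IsRealPart.coeff_ne_zero {V : AnalyticVectorField J} (hV : IsRealPart V X)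
    (hX : ∀ p ∈ U, X p ≠ 0) (he : e ∈ J.atlas) (hp : p ∈ e.source) : V.coeff e (e p) ≠ 0 := by
  obtain ⟨A, hA⟩ := J.exists_hasFDerivAt he hp
  rw [← hV e he p hp, hA.fderiv]
  intro h0
  exact hX p (J.source_subset e he hp) (A.map_eq_zero_iff.1 h0)

/-- `φ` is a local primitive of the time form `dz / coeff` of `V`. -/
def IsTimePrimitive (V : AnalyticVectorField J) (φ : Plane → ℂ) (p : Plane) : Prop :=
  ∀ e ∈ J.atlas, p ∈ e.source →
    HasFDerivAt φ ((V.coeff e (e p))⁻¹ • fderiv ℝ e p) p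

/-- On a disc in a chart the holomorphic function `1 / coeff` has a primitive `G`, and `G ∘ e` is
the required map. The rule `change` for the coefficients makes the time form independent of the
chart, so the condition holds in every other chart too; the derivative of `G` does not vanish, which
gives local invertibility. -/
theorem exists_timePrimitive {V : AnalyticVectorField J} (hV : IsRealPart V X)
    (hX : ∀ p ∈ U, X p ≠ 0) (hp : p ∈ U) :
    ∃ φ : OpenPartialHomeomorph Plane ℂ, p ∈ φ.source ∧ φ.source ⊆ U ∧
      ContDiffOn ℝ ∞ φ φ.source ∧ ContDiffOn ℝ ∞ φ.symm φ.target ∧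
      ∀ z ∈ φ.source, IsTimePrimitive V φ z := by
  obtain ⟨e, he, hpe⟩ := J.covers p hp
  obtain ⟨r, hr, hb⟩ := Metric.isOpen_iff.1 e.open_target _ (e.map_source hpe)
  have hne : ∀ z ∈ e.target, V.coeff e z ≠ 0 := by
    intro z hz
    have := hV.coeff_ne_zero hX he (e.map_target hz)
    rwa [e.right_inv hz] at this
  have hhol : DifferentiableOn ℂ (fun z => (V.coeff e z)⁻¹) (Metric.ball (e p) r) :=
    ((V.holomorphic e he).mono hb).inv (fun z hz => hne z (hb hz))
  obtain ⟨G, hG⟩ := hhol.isExactOn_ball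
  have hGs : ContDiffOn ℝ ∞ G (Metric.ball (e p) r) := by
    have h1 : DifferentiableOn ℂ G (Metric.ball (e p) r) := fun z hz =>
      (hG z hz).differentiableAt.differentiableWithinAt
    exact (h1.contDiffOn Metric.isOpen_ball).restrict_scalars ℝ
  let N := e.source ∩ e ⁻¹' Metric.ball (e p) r
  have hN : IsOpen N := e.isOpen_inter_preimage Metric.isOpen_ball
  have hsm : ContDiffOn ℝ ∞ (fun z => G (e z)) N :=
    hGs.comp ((J.smooth e he).mono inter_subset_left) (fun z hz => hz.2)
  have hprim : ∀ z ∈ N, IsTimePrimitive V (fun z => G (e z)) z := by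
    intro z hz e' he' hze'
    obtain ⟨A, hA⟩ := J.exists_hasFDerivAt he hz.1
    have h1 : HasDerivAt (fun w => e' (e.symm w)) (deriv (fun w => e' (e.symm w)) (e z)) (e z) := by
      refine ((J.holomorphic e he e' he').differentiableAt ?_).hasDerivAt
      refine (e.isOpen_inter_preimage_symm e'.open_source).mem_nhds ⟨e.map_source hz.1, ?_⟩
      simpa [e.left_inv hz.1] using hze'
    have h2 := V.change e he e' he' z ⟨hz.1, hze'⟩
    set d := deriv (fun w => e' (e.symm w)) (e z)
    have h3 : HasFDerivAt e' (d • fderiv ℝ e z) z := by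
      have := (h1.hasFDerivAt.restrictScalars ℝ).comp z (hA.differentiableAt.hasFDerivAt)
      refine (this.congr_of_eventuallyEq ?_).congr_fderiv ?_
      · filter_upwards [e.open_source.mem_nhds hz.1] with w hw
        simp [e.left_inv hw]
      · ext v
        simp [mul_comm]
    have h4 := (((hG _ hz.2).hasFDerivAt.restrictScalars ℝ).comp z
      (hA.differentiableAt.hasFDerivAt))
    refine h4.congr_fderiv ?_
    have hc' := hV.coeff_ne_zero hX he' hze'
    have hc := hV.coeff_ne_zero hX he hz.1
    have hd : d ≠ 0 := by rintro h; rw [h2, h] at hc'; simp at hc'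
    rw [h3.fderiv, h2]
    ext v
    simp
    field_simp
  have hpN : p ∈ N := ⟨hpe, Metric.mem_ball_self hr⟩
  obtain ⟨φ, hφ, hφN, hpφ, hφs⟩ := exists_openPartialHomeomorph_of_contDiffOn hN hsm (by
    intro z hz
    obtain ⟨A, hA⟩ := J.exists_hasFDerivAt he hz.1
    have hc := hV.coeff_ne_zero hX he hz.1
    refine ⟨A.trans ((ContinuousLinearEquiv.unitsEquivAut ℂ
      (Units.mk0 _ (inv_ne_zero hc))).restrictScalars ℝ), ?_⟩
    refine (hprim z hz e he hz.1).congr_fderiv ?_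
    rw [hA.fderiv]
    ext v
    simp [mul_comm]) hpN
  refine ⟨φ, hpφ, hφN.trans (fun z hz => J.source_subset e he hz.1), ?_, hφs, ?_⟩
  · rw [hφ]; exact hsm.mono hφN
  · intro z hz; rw [hφ]; exact hprim z (hφN hz)

/-- A nonvanishing real part of an analytic vector field has a translation atlas. -/
theorem exists_isTranslationAtlas {V : AnalyticVectorField J} (hV : IsRealPart V X)
    (hU : IsOpen U) (hX : ∀ p ∈ U, X p ≠ 0) : ∃ T, IsTranslationAtlas X U T := by
  refine ⟨{φ | φ.source ⊆ U ∧ ContDiffOn ℝ ∞ φ φ.source ∧ ContDiffOn ℝ ∞ φ.symm φ.target ∧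
      ∀ z ∈ φ.source, IsTimePrimitive V φ z}, hU, fun φ h => h.1, ?_, fun φ h => h.2.1,
      fun φ h => h.2.2.1, ?_, ?_⟩
  · intro p hp
    obtain ⟨φ, h1, h2⟩ := exists_timePrimitive hV hX hp
    exact ⟨φ, h2, h1⟩
  · intro φ hφ p hp
    obtain ⟨e, he, hpe⟩ := J.covers p (hφ.1 hp)
    rw [(hφ.2.2.2 p hp e he hpe).fderiv]
    simp only [FunLike.coe_smul, Pi.smul_apply]
    rw [hV e he p hpe, smul_eq_mul, inv_mul_cancel₀ (hV.coeff_ne_zero hX he hpe)]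
  · intro φ hφ φ' hφ' p hp
    -- Two primitives of the same form have equal derivatives, so their difference is constant on a
    -- ball.
    obtain ⟨r, hr, hb⟩ := Metric.isOpen_iff.1 (φ.open_source.inter φ'.open_source) p hp
    have hd : ∀ z ∈ Metric.ball p r,
        HasFDerivWithinAt (fun z => φ' z - φ z) (0 : Plane →L[ℝ] ℂ) (Metric.ball p r) z := by
      intro z hz
      obtain ⟨e, he, hze⟩ := J.covers z (hφ.1 (hb hz).1)
      have h1 := hφ.2.2.2 z (hb hz).1 e he hze
      have h2 := hφ'.2.2.2 z (hb hz).2 e he hze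
      have h3 := (h2.sub h1).hasFDerivWithinAt (s := Metric.ball p r)
      rw [sub_self] at h3
      exact h3
    filter_upwards [Metric.ball_mem_nhds p hr] with z hz
    have := (convex_ball p r).norm_image_sub_le_of_norm_hasFDerivWithin_le (C := 0) hd (by simp)
      (Metric.mem_ball_self hr) hz
    simp only [zero_mul, norm_le_zero_iff] at this
    linear_combination this
end
end FlowBox


/-! ### Transversals, first hits and the holonomy of periodic trajectories -/

namespace FlowBox

theorem eq_of_eventually_eq {α β : Type*} [TopologicalSpace α] {s : Set α} {g : α → β}
    (hs : IsPreconnected s) (h : ∀ x ∈ s, ∀ᶠ y in 𝓝[s] x, g y = g x) {x y : α} (hx : x ∈ s)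
    (hy : y ∈ s) : g x = g y :=
  hs.induction₂ (fun x y => g x = g y) (fun x hx => (h x hx).mono fun _ h => h.symm)
    (fun _ _ _ _ _ _ h1 h2 => h1.trans h2) (fun _ _ _ _ h1 => h1.symm) hx hy

theorem exists_strictMonoOn_of_derivWithin_pos {f : ℝ → ℝ} {I : Set ℝ} {s₀ : ℝ}
    (hI : Convex ℝ I) (hU : UniqueDiffOn ℝ I) (hf : ContDiffOn ℝ ∞ f I) (hs : s₀ ∈ I)
    (hd : 0 < derivWithin f I s₀) : ∃ δ > 0, (∀ s ∈ I ∩ Ioo (s₀ - δ) (s₀ + δ),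
      0 < derivWithin f I s) ∧ StrictMonoOn f (I ∩ Ioo (s₀ - δ) (s₀ + δ)) := by
  have h1 : ContinuousOn (derivWithin f I) I := hf.continuousOn_derivWithin hU (by simp)
  have h2 : ∀ᶠ s in 𝓝[I] s₀, 0 < derivWithin f I s := (h1 s₀ hs).eventually_const_lt hd
  obtain ⟨δ, hδ, hb⟩ := Metric.mem_nhdsWithin_iff.1 h2
  rw [Real.ball_eq_Ioo] at hb
  have hpos : ∀ s ∈ I ∩ Ioo (s₀ - δ) (s₀ + δ), 0 < derivWithin f I s := fun s hs =>
    hb ⟨hs.2, hs.1⟩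
  refine ⟨δ, hδ, hpos, ?_⟩
  refine strictMonoOn_of_deriv_pos (hI.inter (convex_Ioo _ _))
    (hf.continuousOn.mono inter_subset_left) ?_
  intro x hx
  have hxI : I ∈ 𝓝 x := mem_of_superset (isOpen_interior.mem_nhds hx)
    (interior_subset.trans inter_subset_left)
  rw [← derivWithin_of_mem_nhds hxI]
  exact hpos x (interior_subset hx)

variable {X : Plane → Plane} {U : Set Plane} {σ : ℝ → Plane} {I : Set ℝ}
  {T : Set (OpenPartialHomeomorph Plane ℂ)} {e e' : OpenPartialHomeomorph Plane ℂ}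
  {p b c : Plane} {s t ε : ℝ}

theorem IsTransversal.inter_isOpen (h : IsTransversal X U σ I) {N : Set ℝ} (hN : IsOpen N) :
    IsTransversal X U σ (I ∩ N) where
  smooth := h.smooth.mono inter_subset_left
  inj := h.inj.mono inter_subset_left
  mapsTo := h.mapsTo.mono_left inter_subset_left
  transverse := by
    intro s hs
    rw [derivWithin_inter (hN.mem_nhds hs.2)]
    exact h.transverse s hs.1

namespace IsTranslationAtlas

variable (hT : IsTranslationAtlas X U T)
include hT

theorem flow_joint' (h : FlowsTo X U p t b) (he : e ∈ T) (he' : e' ∈ T) (hp : p ∈ e.source)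
    (hb : b ∈ e'.source) : ∀ᶠ w in 𝓝 ((p, t) : Plane × ℝ), ∃ c ∈ e'.source,
      FlowsTo X U w.1 w.2 c ∧ e' c = e' b + ((e w.1 - e p) + ((w.2 - t : ℝ) : ℂ)) := by
  filter_upwards [hT.flow_joint h he he' hp hb] with w hw
  exact ⟨_, e'.map_target hw.1, hw.2, e'.right_inv hw.1⟩

/-- The hitting times form a closed set by continuity of the flow, so there is a least one. The
lower bound `τ` allows a trivial hit at time zero to be discarded. -/
theorem exists_first_hit {K : Set Plane} (hK : IsClosed K) {τ t₁ : ℝ} (hτ : 0 ≤ τ) (hτt : τ ≤ t₁)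
    (h : FlowsTo X U p t₁ b) (hb : b ∈ K) : ∃ t₀ ∈ Icc τ t₁, ∃ b ∈ K, FlowsTo X U p t₀ b ∧
      ∀ t ∈ Ico τ t₀, ∀ b, FlowsTo X U p t b → b ∉ K := by
  let A : Set ℝ := {t | t ∈ Icc τ t₁ ∧ ∃ b ∈ K, FlowsTo X U p t b}
  have hA : IsClosed A := by
    refine isClosed_of_closure_subset fun t ht => ?_
    have htI : t ∈ Icc τ t₁ := closure_minimal (fun s hs => hs.1) isClosed_Icc ht
    obtain ⟨c, hc, -⟩ := h.exists_of_mem (s := t) (by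
      rw [uIcc_of_le (hτ.trans hτt)]; exact ⟨hτ.trans htI.1, htI.2⟩)
    refine ⟨htI, c, ?_, hc⟩
    by_contra hcK
    have h1 := hT.flow_eventually_mem hc (hK.isOpen_compl.mem_nhds hcK)
    have h2 : ∀ᶠ s in 𝓝 t, ∃ d ∈ Kᶜ, FlowsTo X U p s d :=
      (Continuous.tendsto (f := fun s : ℝ => (p, s)) (by fun_prop) t).eventually h1
    obtain ⟨s, ⟨d, hd, hd'⟩, hs⟩ := (h2.and_frequently (mem_closure_iff_frequently.1 ht)).exists
    obtain ⟨d', hdK, hd''⟩ := hs.2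
    exact hd (hT.flowsTo_unique hd' hd'' ▸ hdK)
  have hAc : IsCompact A := isCompact_Icc.of_isClosed_subset hA (fun s hs => hs.1)
  obtain ⟨t₀, ht₀, hmin⟩ := hAc.exists_isLeast ⟨t₁, ⟨hτt, le_rfl⟩, b, hb, h⟩
  obtain ⟨hI, d, hd, hd'⟩ := ht₀
  refine ⟨t₀, hI, d, hd, hd', fun t ht b' hb' hK' => ?_⟩
  exact absurd (hmin ⟨⟨ht.1, ht.2.le.trans hI.2⟩, b', hK', hb'⟩) (not_le.2 ht.2)

/-- In a straightening chart, a transversal is locally strictly monotone in the height. -/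
theorem exists_height (h : IsTransversal X U σ I) (hI : Convex ℝ I) (hU : UniqueDiffOn ℝ I)
    (he : e ∈ T) (hs : s ∈ I) (hse : σ s ∈ e.source) :
    ∃ δ > 0, ∃ a : ℝ, (a = 1 ∨ a = -1) ∧ (∀ r ∈ I ∩ Ioo (s - δ) (s + δ), σ r ∈ e.source) ∧
      ContDiffOn ℝ ∞ (fun r => a * (e (σ r)).im) (I ∩ Ioo (s - δ) (s + δ)) ∧
      (∀ r ∈ I ∩ Ioo (s - δ) (s + δ), 0 < derivWithin (fun r => a * (e (σ r)).im)
        (I ∩ Ioo (s - δ) (s + δ)) r) ∧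
      StrictMonoOn (fun r => a * (e (σ r)).im) (I ∩ Ioo (s - δ) (s + δ)) := by
  have h1 := h.smooth.continuousOn s hs (e.open_source.mem_nhds hse)
  obtain ⟨δ, hδ, hb⟩ := Metric.mem_nhdsWithin_iff.1 h1
  rw [Real.ball_eq_Ioo] at hb
  set I' := I ∩ Ioo (s - δ) (s + δ) with hI'
  have h' : IsTransversal X U σ I' := h.inter_isOpen isOpen_Ioo
  have hI'c : Convex ℝ I' := hI.inter (convex_Ioo _ _)
  have hI'U : UniqueDiffOn ℝ I' := hU.inter isOpen_Ioo
  have hsI' : s ∈ I' := ⟨hs, by constructor <;> linarith⟩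
  have hsrc : ∀ r ∈ I', σ r ∈ e.source := fun r hr => hb ⟨hr.2, hr.1⟩
  have hsm : ContDiffOn ℝ ∞ (fun r => (e (σ r)).im) I' := by
    have := (hT.smooth e he).comp h'.smooth hsrc
    exact Complex.imCLM.contDiff.comp_contDiffOn this
  have hne : derivWithin (fun r => (e (σ r)).im) I' s ≠ 0 := by
    obtain ⟨A, hA, -, hA1⟩ := hT.hasFDerivAt_symm he hse
    have h2 : HasDerivWithinAt σ (derivWithin σ I' s) I' s :=
      ((h'.smooth.differentiableOn (by simp)) s hsI').hasDerivWithinAt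
    have h3 := hA.comp_hasDerivWithinAt s h2
    have h4 : HasDerivWithinAt (fun r => (e (σ r)).im) (A (derivWithin σ I' s)).im I' s :=
      Complex.imCLM.hasFDerivAt.comp_hasDerivWithinAt s h3
    rw [h4.derivWithin (hI'U s hsI')]
    -- A vanishing height derivative makes the velocity of `σ` a real multiple of `X`, against
    -- transversality.
    intro h0
    have h5 := LinearIndependent.pair_iff.1 (h'.transverse s hsI')
      (A (derivWithin σ I' s)).re (-1) ?_
    · simp at h5
    · apply A.injective
      rw [map_add, map_smul, map_smul, hA1, map_zero]
      apply Complex.ext <;> simp [h0]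
  have main : ∀ a : ℝ, (a = 1 ∨ a = -1) → 0 < derivWithin (fun r => a * (e (σ r)).im) I' s →
      ∃ δ > 0, ∃ a : ℝ, (a = 1 ∨ a = -1) ∧ (∀ r ∈ I ∩ Ioo (s - δ) (s + δ), σ r ∈ e.source) ∧
      ContDiffOn ℝ ∞ (fun r => a * (e (σ r)).im) (I ∩ Ioo (s - δ) (s + δ)) ∧
      (∀ r ∈ I ∩ Ioo (s - δ) (s + δ), 0 < derivWithin (fun r => a * (e (σ r)).im)
        (I ∩ Ioo (s - δ) (s + δ)) r) ∧
      StrictMonoOn (fun r => a * (e (σ r)).im) (I ∩ Ioo (s - δ) (s + δ)) := by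
    intro a ha hpos
    obtain ⟨δ', hδ', hd, hm⟩ := exists_strictMonoOn_of_derivWithin_pos hI'c hI'U
      (contDiffOn_const.mul hsm) hsI' hpos
    have hsub : I ∩ Ioo (s - min δ δ') (s + min δ δ') ⊆ I' ∩ Ioo (s - δ') (s + δ') := by
      intro r hr
      have := min_le_left δ δ'
      have := min_le_right δ δ'
      exact ⟨⟨hr.1, by constructor <;> linarith [hr.2.1, hr.2.2]⟩,
        by constructor <;> linarith [hr.2.1, hr.2.2]⟩
    refine ⟨min δ δ', lt_min hδ hδ', a, ha, fun r hr => hsrc r (hsub hr).1,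
      (contDiffOn_const.mul hsm).mono (hsub.trans inter_subset_left), ?_, hm.mono hsub⟩
    intro r hr
    have h6 := hd r (hsub hr)
    rw [derivWithin_inter (isOpen_Ioo.mem_nhds hr.2)]
    rwa [derivWithin_inter (isOpen_Ioo.mem_nhds (hsub hr).1.2)] at h6
  rcases lt_or_gt_of_ne hne with hlt | hgt
  · refine main (-1) (Or.inr rfl) ?_
    rw [derivWithin_const_mul_field]
    linarith
  · exact main 1 (Or.inl rfl) (by simpa using hgt)

/-- The flow for the least period is the identity near `p`, which supplies the return. The remaining
point is that no return is earlier: for times close to zero or to the period the chart shows it,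
because the transversal is injective in height, and for the times between a compactness argument
does. -/
theorem periodicHolonomyIsIdentity (hper : IsPeriodicPt X U p) :
    PeriodicHolonomyIsIdentity X U p := by
  obtain ⟨t₁, ht₁, hper⟩ := hper
  intro σ ε hε hσ h0
  have hpU := hper.left_mem
  obtain ⟨e, he, hpe⟩ := hT.covers p hpU
  obtain ⟨δ, hδ, a, ha, hsrc, -, -, hmono⟩ := hT.exists_height hσ (convex_Ioo _ _)
    isOpen_Ioo.uniqueDiffOn he (s := 0) (by constructor <;> linarith) (h0 ▸ hpe)
  have hinj : ∀ r ∈ Ioo (-ε) ε ∩ Ioo (0 - δ) (0 + δ), ∀ r' ∈ Ioo (-ε) ε ∩ Ioo (0 - δ) (0 + δ),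
      ∀ x : ℝ, e (σ r) = e (σ r') + (x : ℂ) → r = r' ∧ x = 0 := by
    intro r hr r' hr' x hx
    have : r = r' := hmono.injOn hr hr' (by simp [hx])
    subst this
    simpa using hx
  have hzero := hT.flow_joint' (FlowsTo.refl hpU) he he hpe hpe
  have hz1 : ∀ᶠ t in 𝓝 (0 : ℝ), ∀ b, FlowsTo X U p t b → e b = e p + (t : ℂ) := by
    have := (Continuous.tendsto (f := fun s : ℝ => (p, s)) (by fun_prop) 0).eventually hzero
    filter_upwards [this] with t ht b hb
    obtain ⟨c, -, hc, hc'⟩ := ht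
    rw [hT.flowsTo_unique hb hc, hc']; simp
  obtain ⟨τ, hτ, hτb⟩ := Metric.eventually_nhds_iff.1 hz1
  have hno : ∀ t ∈ Ioo 0 τ, ¬ FlowsTo X U p t p := by
    intro t ht h
    have := hτb (by rw [dist_zero_right, Real.norm_eq_abs, abs_of_pos ht.1]; exact ht.2) p h
    simp at this
    linarith [ht.1]
  -- Before the time `τ` the trajectory cannot be back at `p`, so the search for the least period
  -- starts at the positive time `τ / 2`.
  have hτt : τ / 2 ≤ t₁ := by
    by_contra hcon
    exact hno t₁ ⟨ht₁, by linarith⟩ hper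
  obtain ⟨T₀, hT₀, b₀, hb₀, hper₀, hmin⟩ := hT.exists_first_hit (isClosed_singleton (x := p))
    (by linarith) hτt hper (mem_singleton p)
  rw [mem_singleton_iff.1 hb₀] at hper₀
  have hT₀pos : 0 < T₀ := by linarith [hT₀.1]
  have hmin' : ∀ t ∈ Ioo 0 T₀, ∀ b', FlowsTo X U p t b' → b' ≠ p := by
    intro t ht b' hb hbp
    rcases lt_or_ge t τ with h | h
    · exact hno t ⟨ht.1, h⟩ (hbp ▸ hb)
    · exact hmin t ⟨by linarith, ht.2⟩ _ hb hbp
  have hone := hT.flow_joint' hper₀ he he hpe hpe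
  rw [nhds_prod_eq] at hzero hone
  obtain ⟨pa, hpa, pb, hpb, hpab⟩ := eventually_prod_iff.1 hzero
  obtain ⟨qa, hqa, qb, hqb, hqab⟩ := eventually_prod_iff.1 hone
  obtain ⟨κ₁, hκ₁, hκb₁⟩ := Metric.eventually_nhds_iff.1 hpb
  obtain ⟨κ₂, hκ₂, hκb₂⟩ := Metric.eventually_nhds_iff.1 hqb
  set κ := min κ₁ κ₂
  have hκ : 0 < κ := lt_min hκ₁ hκ₂
  -- At intermediate times the trajectory of `p` avoids `p`. Moving both the initial point and the
  -- target keeps them apart, uniformly in time, which covers all pairs of points of a short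
  -- transversal.
  have hmid : ∀ᶠ w in 𝓝 ((p, p) : Plane × Plane), ∀ t ∈ Icc (κ / 2) (T₀ - κ / 2),
      ∃ b, FlowsTo X U w.1 t b ∧ b ≠ w.2 := by
    refine isCompact_Icc.eventually_forall_of_forall_eventually
      (P := fun (w : Plane × Plane) t => ∃ b, FlowsTo X U w.1 t b ∧ b ≠ w.2) ?_
    intro t ht
    obtain ⟨b, hb, -⟩ := hper₀.exists_of_mem (s := t) (by
      rw [uIcc_of_le hT₀pos.le]; constructor <;> linarith [ht.1, ht.2])
    have hbp := hmin' t ⟨by linarith [ht.1], by linarith [ht.2]⟩ b hb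
    obtain ⟨A, B, hA, hB, hbA, hpB, hAB⟩ := t2_separation hbp
    have h1 := hT.flow_eventually_mem hb (hA.mem_nhds hbA)
    have h2 : ∀ᶠ w in 𝓝 (((p, p), t) : (Plane × Plane) × ℝ), ∃ c ∈ A, FlowsTo X U w.1.1 w.2 c :=
      (Continuous.tendsto (f := fun w : (Plane × Plane) × ℝ => (w.1.1, w.2)) (by fun_prop)
        ((p, p), t)).eventually h1
    have h3 : ∀ᶠ w in 𝓝 (((p, p), t) : (Plane × Plane) × ℝ), w.1.2 ∈ B :=
      (Continuous.tendsto (f := fun w : (Plane × Plane) × ℝ => w.1.2) (by fun_prop)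
        ((p, p), t)).eventually (hB.mem_nhds hpB)
    filter_upwards [h2, h3] with w ⟨c, hc, hc'⟩ hw
    exact ⟨c, hc', fun h => disjoint_left.1 hAB hc (h ▸ hw)⟩
  rw [nhds_prod_eq] at hmid
  obtain ⟨ra, hra, rb, hrb, hrab⟩ := eventually_prod_iff.1 hmid
  have hσc : ContinuousAt σ 0 := hσ.smooth.continuousOn.continuousAt
    (isOpen_Ioo.mem_nhds (by constructor <;> linarith))
  have hall : ∀ᶠ s in 𝓝 (0 : ℝ), pa (σ s) ∧ qa (σ s) ∧ ra (σ s) ∧ rb (σ s) ∧ s ∈ Ioo (-ε) ε ∧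
      s ∈ Ioo (0 - δ) (0 + δ) := by
    have hσ0 : Tendsto σ (𝓝 0) (𝓝 p) := by rw [← h0]; exact hσc
    filter_upwards [hσ0.eventually hpa, hσ0.eventually hqa, hσ0.eventually hra,
      hσ0.eventually hrb, isOpen_Ioo.mem_nhds (show (0 : ℝ) ∈ Ioo (-ε) ε by constructor <;> linarith),
      isOpen_Ioo.mem_nhds (show (0 : ℝ) ∈ Ioo (0 - δ) (0 + δ) by constructor <;> linarith)]
      with s h1 h2 h3 h4 h5 h6
    exact ⟨h1, h2, h3, h4, h5, h6⟩
  obtain ⟨ε₁, hε₁, hb⟩ := Metric.eventually_nhds_iff.1 hall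
  filter_upwards [Ioo_mem_nhdsGT hε₁] with e₁ he₁ s hs
  have hgood : ∀ s ∈ Ioo (-e₁) e₁, pa (σ s) ∧ qa (σ s) ∧ ra (σ s) ∧ rb (σ s) ∧ s ∈ Ioo (-ε) ε ∧
      s ∈ Ioo (0 - δ) (0 + δ) := by
    intro s hs
    apply hb
    rw [dist_zero_right, Real.norm_eq_abs, abs_lt]
    constructor <;> linarith [hs.1, hs.2, he₁.2]
  obtain ⟨hs1, hs2, hs3, -, hs5, hs6⟩ := hgood s hs
  refine ⟨hs, T₀, hT₀pos, ?_, ?_⟩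
  · obtain ⟨c, hc, hc', hc''⟩ := hqab hs2 (hκb₂ (y := T₀) (by simpa using hκ₂))
    have : c = σ s := e.injOn hc (hsrc s ⟨hs5, hs6⟩) (by rw [hc'']; simp)
    exact this ▸ hc'
  · rintro r hr _ hb ⟨s', hs', rfl⟩
    obtain ⟨-, -, -, hs4', hs5', hs6'⟩ := hgood s' hs'
    have hκ1 : κ ≤ κ₁ := min_le_left _ _
    have hκ2 : κ ≤ κ₂ := min_le_right _ _
    rcases lt_or_ge r κ with h1 | h1
    · obtain ⟨c, hc, hc', hc''⟩ := hpab hs1 (hκb₁ (y := r) (by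
        rw [dist_zero_right, Real.norm_eq_abs, abs_of_pos hr.1]; linarith))
      rw [hT.flowsTo_unique hc' hb] at hc''
      have := (hinj s' ⟨hs5', hs6'⟩ s ⟨hs5, hs6⟩ r (by rw [hc'']; push_cast; ring)).2
      linarith [hr.1]
    · rcases lt_or_ge (T₀ - κ) r with h2 | h2
      · obtain ⟨c, hc, hc', hc''⟩ := hqab hs2 (hκb₂ (y := r) (by
          rw [Real.dist_eq, abs_lt]; constructor <;> linarith [hr.1, hr.2]))
        rw [hT.flowsTo_unique hc' hb] at hc''
        have := (hinj s' ⟨hs5', hs6'⟩ s ⟨hs5, hs6⟩ (r - T₀) (by rw [hc'']; push_cast; ring)).2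
        linarith [hr.2]
      · obtain ⟨c, hc, hc'⟩ := hrab hs3 hs4' r ⟨by linarith, by linarith⟩
        exact hc' (hT.flowsTo_unique hc hb)

end IsTranslationAtlas
end FlowBox


/-! ### Holonomy of polycycles -/

namespace FlowBox

namespace IsTranslationAtlas

variable {X : Plane → Plane} {U : Set Plane} {σ : ℝ → Plane} {ε : ℝ}
  {T : Set (OpenPartialHomeomorph Plane ℂ)} (hT : IsTranslationAtlas X U T)
include hT

/-- The points of a half transversal whose trajectory hits its initial point before it returns to
the half transversal: there is at most one. -/
theorem eventually_not_hit_endpoint (hinj : InjOn σ (Ico 0 ε))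
    (hε : 0 < ε) : ∀ᶠ s in 𝓝[>] (0 : ℝ), ¬ ∃ t : ℝ, 0 < t ∧ FlowsTo X U (σ s) t (σ 0) ∧
      ∀ r ∈ Ioo 0 t, ∀ b, FlowsTo X U (σ s) r b → b ∉ σ '' Ioo 0 ε := by
  set B := {s | s ∈ Ioo 0 ε ∧ ∃ t : ℝ, 0 < t ∧ FlowsTo X U (σ s) t (σ 0) ∧
      ∀ r ∈ Ioo 0 t, ∀ b, FlowsTo X U (σ s) r b → b ∉ σ '' Ioo 0 ε} with hB
  have hsub : ∀ s ∈ B, ∀ s' ∈ B, s = s' := by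
    -- If `σ s'` takes longer than `σ s` to reach `σ 0`, then by uniqueness it passes through `σ s`
    -- on the way, which is a forbidden return. Equal times force equal points.
    have key : ∀ s ∈ B, ∀ s' ∈ B, ∀ t t' : ℝ, FlowsTo X U (σ s) t (σ 0) →
        FlowsTo X U (σ s') t' (σ 0) →
        (∀ r ∈ Ioo 0 t', ∀ b, FlowsTo X U (σ s') r b → b ∉ σ '' Ioo 0 ε) → 0 < t → t ≤ t' →
        s = s' := by
      intro s hs s' hs' t t' h h' hn htpos htt
      rcases htt.eq_or_lt with rfl | hlt
      · exact hinj ⟨hs.1.1.le, hs.1.2⟩ ⟨hs'.1.1.le, hs'.1.2⟩ (hT.flowsTo_injective h h')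
      · exfalso
        have h1 := hT.flowsTo_trans h' h.symm
        exact hn _ ⟨by linarith, by linarith⟩ _ h1 ⟨s, hs.1, rfl⟩
    intro s hs s' hs'
    obtain ⟨-, t, ht, h, hn⟩ := id hs
    obtain ⟨-, t', ht', h', hn'⟩ := id hs'
    rcases le_total t t' with hle | hle
    · exact key s hs s' hs' t t' h h' hn' ht hle
    · exact (key s' hs' s hs t' t h' h hn ht' hle).symm
  by_cases hne : ∃ s₁, s₁ ∈ B
  · obtain ⟨s₁, hs₁⟩ := hne
    filter_upwards [Ioo_mem_nhdsGT (lt_min hε hs₁.1.1)] with s hs hcon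
    have := hsub s ⟨⟨hs.1, hs.2.trans_le (min_le_left _ _)⟩, hcon⟩ s₁ hs₁
    have h2 := hs.2.trans_le (min_le_right ε s₁)
    linarith
  · filter_upwards [Ioo_mem_nhdsGT hε] with s hs hcon
    exact hne ⟨s, hs, hcon⟩

/-- A germ of a first return map on a half transversal that fixes the initial point is the
identity. -/
theorem firstReturn_eventually_eq (hε : 0 < ε) (hσ : IsTransversal X U σ (Ico 0 ε)) {R : ℝ → ℝ}
    (hR : ∀ᶠ s in 𝓝[>] (0 : ℝ), IsFirstReturn X U σ (Ioo 0 ε) s (R s))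
    (hR0 : Tendsto R (𝓝[>] 0) (𝓝 0)) : ∀ᶠ s in 𝓝[>] (0 : ℝ), R s = s := by
  have h0I : (0 : ℝ) ∈ Ico 0 ε := ⟨le_rfl, hε⟩
  obtain ⟨e, he, h0e⟩ := hT.covers _ (hσ.mapsTo h0I)
  obtain ⟨δ₀, hδ₀, a, ha, hsrc, hsm, -, hmono⟩ := hT.exists_height hσ (convex_Ico _ _)
    (uniqueDiffOn_Ico 0 ε) he h0I h0e
  set f : ℝ → ℝ := fun r => a * (e (σ r)).im with hf
  obtain ⟨c, hc, hcε, hcδ⟩ : ∃ c > 0, c < ε ∧ c < δ₀ :=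
    ⟨min ε δ₀ / 2, by positivity, by linarith [min_le_left ε δ₀, lt_min hε hδ₀],
      by linarith [min_le_right ε δ₀, lt_min hε hδ₀]⟩
  have hsub : Icc 0 c ⊆ Ico 0 ε ∩ Ioo (0 - δ₀) (0 + δ₀) := fun r hr =>
    ⟨⟨hr.1, by linarith [hr.2]⟩, by constructor <;> linarith [hr.1, hr.2]⟩
  have hfc : ContinuousOn f (Icc 0 c) := hsm.continuousOn.mono hsub
  have hfm : StrictMonoOn f (Icc 0 c) := hmono.mono hsub
  have hse : ∀ r ∈ Icc 0 c, σ r ∈ e.source := fun r hr => hsrc r (hsub hr)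
  have hσc : ContinuousOn σ (Icc 0 c) := hσ.smooth.continuousOn.mono (fun r hr => (hsub hr).1)
  have ha2 : a * a = 1 := by rcases ha with rfl | rfl <;> norm_num
  have hrec : ∀ r ∈ Icc 0 c, ∀ q ∈ e.source, ∀ x : ℝ, e (σ r) = e q + (x : ℂ) →
      a * (e q).im = f r := by
    intro r hr q hq x hx
    simp [hf, hx]
  -- First returns are measured on the open part of the transversal, while compactness needs its
  -- closure, which contains `σ 0`. Discarding the exceptional parameter of
  -- `eventually_not_hit_endpoint` removes the difference.
  have hall := ((hR.and (hT.eventually_not_hit_endpoint hσ.inj hε)).and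
    (hR0.eventually (gt_mem_nhds hc))).and (Ioo_mem_nhdsGT hc)
  obtain ⟨δ, hδ, hball⟩ := mem_nhdsGT_iff_exists_Ioo_subset.1 hall
  -- The return map is a translation in the height `f`, so its increment is locally constant. No
  -- continuity of `R` inside the interval is assumed; it comes from showing that the first return
  -- of nearby points happens near the time `T₀`.
  have hloc : ∀ s₀ ∈ Ioo 0 δ, ∀ᶠ s in 𝓝[Ioo 0 δ] s₀, f (R s) - f s = f (R s₀) - f s₀ := by
    intro s₀ hs₀
    obtain ⟨⟨⟨⟨hr₀, T₀, hT₀, hfl, hfirst⟩, hnb⟩, hRc⟩, hs₀c⟩ := hball hs₀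
    set r₀ := R s₀
    have hr₀c : r₀ ∈ Ioo 0 c := ⟨hr₀.1, hRc⟩
    have hp := hse s₀ (Ioo_subset_Icc_self hs₀c)
    have hq := hse r₀ (Ioo_subset_Icc_self hr₀c)
    have hzero := hT.flow_joint' (FlowsTo.refl hfl.left_mem) he he hp hp
    have hone := hT.flow_joint' hfl he he hp hq
    rw [nhds_prod_eq] at hzero hone
    obtain ⟨pa, hpa, pb, hpb, hpab⟩ := eventually_prod_iff.1 hzero
    obtain ⟨qa, hqa, qb, hqb, hqab⟩ := eventually_prod_iff.1 hone
    obtain ⟨κ₁, hκ₁, hκb₁⟩ := Metric.eventually_nhds_iff.1 hpb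
    obtain ⟨κ₂, hκ₂, hκb₂⟩ := Metric.eventually_nhds_iff.1 hqb
    set κ := min (min κ₁ κ₂) T₀
    have hκ : 0 < κ := lt_min (lt_min hκ₁ hκ₂) hT₀
    have hκ1 : κ ≤ κ₁ := (min_le_left _ _).trans (min_le_left _ _)
    have hκ2 : κ ≤ κ₂ := (min_le_left _ _).trans (min_le_right _ _)
    have hκT : κ ≤ T₀ := min_le_right _ _
    have hK : IsClosed (σ '' Icc 0 c) := (isCompact_Icc.image_of_continuousOn hσc).isClosed
    have hmid := hT.flow_compact (p := σ s₀) (a := κ / 2) (d := T₀ - κ / 2) hK.isOpen_compl (by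
      intro t ht
      obtain ⟨b, hb, -⟩ := hfl.exists_of_mem (s := t) (by
        rw [uIcc_of_le hT₀.le]; constructor <;> linarith [ht.1, ht.2])
      have htI : t ∈ Ioo 0 T₀ := ⟨by linarith [ht.1], by linarith [ht.2]⟩
      refine ⟨b, ?_, hb⟩
      rintro ⟨r, hr, rfl⟩
      rcases hr.1.eq_or_lt with rfl | hlt
      · exact hnb ⟨t, htI.1, hb, fun u hu => hfirst u ⟨hu.1, hu.2.trans htI.2⟩⟩
      · exact hfirst t htI _ hb ⟨r, ⟨hlt, by linarith [hr.2]⟩, rfl⟩)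
    have hσs : Tendsto σ (𝓝[Ioo 0 δ] s₀) (𝓝 (σ s₀)) := by
      have h1 : ContinuousAt σ s₀ := hσc.continuousAt (Icc_mem_nhds hs₀c.1 hs₀c.2)
      exact h1.tendsto.mono_left nhdsWithin_le_nhds
    have hfs : Tendsto f (𝓝[Ioo 0 δ] s₀) (𝓝 (f s₀)) :=
      (hfc.continuousAt (Icc_mem_nhds hs₀c.1 hs₀c.2)).tendsto.mono_left nhdsWithin_le_nhds
    -- the real part of the chart along the transversal
    have hre : ContinuousOn (fun r => (e (σ r)).re) (Icc 0 c) :=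
      Complex.continuous_re.comp_continuousOn (e.continuousOn.comp hσc hse)
    obtain ⟨ρ, hρ, hρb⟩ := Metric.continuousAt_iff.1
      (hre.continuousAt (Icc_mem_nhds hr₀c.1 hr₀c.2)) (κ / 2) (by linarith)
    obtain ⟨ρ', hρ', hρρ, hρ0, hρc⟩ : ∃ ρ' > 0, ρ' < ρ ∧ 0 < r₀ - ρ' ∧ r₀ + ρ' < c := by
      have h3 : 0 < min ρ (min r₀ (c - r₀)) := lt_min hρ (lt_min hr₀c.1 (by linarith [hr₀c.2]))
      refine ⟨min ρ (min r₀ (c - r₀)) / 2, by linarith, ?_, ?_, ?_⟩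
      · linarith [min_le_left ρ (min r₀ (c - r₀))]
      · linarith [min_le_right ρ (min r₀ (c - r₀)), min_le_left r₀ (c - r₀)]
      · linarith [min_le_right ρ (min r₀ (c - r₀)), min_le_right r₀ (c - r₀)]
    have hsubρ : Icc (r₀ - ρ') (r₀ + ρ') ⊆ Icc 0 c := Icc_subset_Icc hρ0.le hρc.le
    have hlt1 : f (r₀ - ρ') < f r₀ := hfm ⟨hρ0.le, by linarith⟩
      (Ioo_subset_Icc_self hr₀c) (by linarith)
    have hlt2 : f r₀ < f (r₀ + ρ') := hfm (Ioo_subset_Icc_self hr₀c)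
      ⟨by linarith, hρc.le⟩ (by linarith)
    have hheight : ∀ᶠ s in 𝓝[Ioo 0 δ] s₀,
        f r₀ + (f s - f s₀) ∈ Icc (f (r₀ - ρ')) (f (r₀ + ρ')) := by
      have h1 : Tendsto (fun s => f r₀ + (f s - f s₀)) (𝓝[Ioo 0 δ] s₀) (𝓝 (f r₀)) := by
        simpa using (hfs.sub_const (f s₀)).const_add (f r₀)
      exact h1.eventually (Icc_mem_nhds hlt1 hlt2)
    have hres : ∀ᶠ s in 𝓝[Ioo 0 δ] s₀, |(e (σ s)).re - (e (σ s₀)).re| < κ / 2 := by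
      have h1 : Tendsto (fun r => (e (σ r)).re) (𝓝[Ioo 0 δ] s₀) (𝓝 (e (σ s₀)).re) :=
        (hre.continuousAt (Icc_mem_nhds hs₀c.1 hs₀c.2)).tendsto.mono_left nhdsWithin_le_nhds
      have := (Metric.tendsto_nhds.1 h1) (κ / 2) (by linarith)
      simpa [Real.dist_eq] using this
    filter_upwards [hσs.eventually hpa, hσs.eventually hqa, hσs.eventually hmid, hheight, hres,
      self_mem_nhdsWithin] with s h1 h2 h3 h4 h5 hs
    obtain ⟨⟨⟨⟨hr, T₁, hT₁, hfl₁, hfirst₁⟩, -⟩, hRc₁⟩, hsc⟩ := hball hs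
    have hsI := Ioo_subset_Icc_self hsc
    have hRI : R s ∈ Icc 0 c := ⟨hr.1.le, hRc₁.le⟩
    -- the trajectory of `σ s` hits the transversal at a time close to `T₀`
    obtain ⟨r, hrI, hfr⟩ := intermediate_value_Icc (by linarith) (hfc.mono hsubρ) h4
    have hrc := hsubρ hrI
    have hrre : |(e (σ r)).re - (e (σ r₀)).re| < κ / 2 := by
      have := hρb (x := r) (by rw [Real.dist_eq, abs_lt]; constructor <;> linarith [hrI.1, hrI.2])
      rwa [Real.dist_eq] at this
    -- The transversal need not be vertical in the chart. The time is corrected by the differences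
    -- of the real parts at its two ends.
    set t := T₀ + ((e (σ r)).re - (e (σ r₀)).re) - ((e (σ s)).re - (e (σ s₀)).re) with ht
    rw [abs_lt] at hrre h5
    have htκ : |t - T₀| < κ := by rw [abs_lt]; constructor <;> linarith [hrre.1, hrre.2, h5.1, h5.2]
    obtain ⟨c', hc', hflc, hec⟩ := hqab h2 (hκb₂ (y := t) (by rw [Real.dist_eq]; linarith))
    have hc'r : c' = σ r := by
      refine e.injOn hc' (hse r hrc) ?_
      rw [hec]
      apply Complex.ext
      · simp [ht]; ring
      · have h6 : a * (e (σ r)).im = a * ((e (σ r₀)).im + ((e (σ s)).im - (e (σ s₀)).im)) := by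
          change f r = _
          rw [hfr]; simp only [hf]; ring
        have h7 := congrArg (a * ·) h6
        simp only [← mul_assoc, ha2, one_mul] at h7
        simp [h7]
    rw [hc'r] at hflc
    rw [abs_lt] at htκ
    have htpos : 0 < t := by linarith [htκ.1]
    have hTt : T₁ ≤ t := by
      by_contra hcon
      exact hfirst₁ t ⟨htpos, not_le.1 hcon⟩ _ hflc
        ⟨r, ⟨by linarith [hrI.1], by linarith [hrI.2]⟩, rfl⟩
    -- A return before `κ` contradicts the chart at `σ s₀`, and one between `κ` and `T₀ - κ`
    -- contradicts compactness. So `T₁` is close to `T₀`, where the flow is the expected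
    -- translation.
    rcases lt_or_ge T₁ κ with hcase | hcase
    · exfalso
      obtain ⟨c₁, hc₁, hfc₁, hec₁⟩ := hpab h1 (hκb₁ (y := T₁) (by
        rw [dist_zero_right, Real.norm_eq_abs, abs_of_pos hT₁]; linarith))
      rw [hT.flowsTo_unique hfc₁ hfl₁] at hec₁
      have h8 := hrec (R s) hRI _ (hse s hsI) T₁ (by rw [hec₁]; push_cast; ring)
      have h9 : s = R s := hfm.injOn hsI hRI h8
      rw [← h9] at hec₁
      have := congrArg Complex.re hec₁
      simp at this
      linarith
    · rcases lt_or_ge (T₀ - κ) T₁ with hcase' | hcase'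
      · obtain ⟨c₁, hc₁, hfc₁, hec₁⟩ := hqab h2 (hκb₂ (y := T₁) (by
          rw [Real.dist_eq, abs_lt]; constructor <;> linarith [htκ.2]))
        rw [hT.flowsTo_unique hfc₁ hfl₁] at hec₁
        have := congrArg Complex.im hec₁
        simp at this
        simp only [hf, this]
        ring
      · exfalso
        obtain ⟨b, hb, hb'⟩ := h3 T₁ ⟨by linarith, by linarith⟩
        exact hb (hT.flowsTo_unique hb' hfl₁ ▸ ⟨R s, hRI, rfl⟩)
  -- Both `s` and `R s` tend to the endpoint, so the constant increment is zero.
  have hlim : Tendsto (fun s => f (R s) - f s) (𝓝[>] 0) (𝓝 0) := by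
    have h1 : Tendsto f (𝓝[Icc 0 c] 0) (𝓝 (f 0)) := hfc 0 ⟨le_rfl, hc.le⟩
    have h2 : Tendsto R (𝓝[>] 0) (𝓝[Icc 0 c] 0) := by
      refine tendsto_nhdsWithin_iff.2 ⟨hR0, ?_⟩
      filter_upwards [hall] with s hs
      exact ⟨hs.1.1.1.1.1.le, hs.1.2.le⟩
    have h3 : Tendsto (fun s : ℝ => s) (𝓝[>] 0) (𝓝[Icc 0 c] 0) := by
      refine tendsto_nhdsWithin_iff.2 ⟨nhdsWithin_le_nhds, ?_⟩
      filter_upwards [Ioo_mem_nhdsGT hc] with s hs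
      exact Ioo_subset_Icc_self hs
    simpa using (h1.comp h2).sub (h1.comp h3)
  filter_upwards [Ioo_mem_nhdsGT hδ] with s hs
  have hconst : f (R s) - f s = 0 := by
    refine tendsto_nhds_unique (tendsto_const_nhds.congr' ?_) hlim
    filter_upwards [Ioo_mem_nhdsGT hδ] with s' hs'
    exact eq_of_eventually_eq (g := fun s => f (R s) - f s) isPreconnected_Ioo hloc hs hs'
  obtain ⟨⟨⟨⟨hr, -⟩, -⟩, hRc⟩, hsc⟩ := hball hs
  exact hfm.injOn ⟨hr.1.le, hRc.le⟩ (Ioo_subset_Icc_self hsc) (by linarith)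

theorem polycycleHolonomyIsIdentity (L : Set Sphere) : PolycycleHolonomyIsIdentity X U L :=
  fun _ _ _ hε hσ _ hR hR0 => hT.firstReturn_eventually_eq hε hσ hR hR0

end IsTranslationAtlas
end FlowBox


/-! ### One-variable tools: inverse functions up to the boundary, monotonicity -/

namespace FlowBox

/-- The part of `K` outside `N` has a compact image that misses `b`. For an injective `f` this is
continuity of the inverse without mention of an inverse map. -/
theorem eventually_mem_of_isCompact {α β : Type*} [TopologicalSpace α] [TopologicalSpace β]
    [T2Space β] {K : Set α} {f : α → β} (hK : IsCompact K) (hf : ContinuousOn f K) {N : Set α}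
    (hN : IsOpen N) {b : β} (h : ∀ x ∈ K, f x = b → x ∈ N) :
    ∀ᶠ y in 𝓝 b, ∀ x ∈ K, f x = y → x ∈ N := by
  have hc : IsClosed (f '' (K \ N)) :=
    ((hK.diff hN).image_of_continuousOn (hf.mono sdiff_subset)).isClosed
  have hb : b ∉ f '' (K \ N) := by
    rintro ⟨x, hx, rfl⟩
    exact hx.2 (h x hx.1 rfl)
  filter_upwards [hc.isOpen_compl.mem_nhds hb] with y hy x hx hxy
  by_contra hxN
  exact hy ⟨x, ⟨hx, hxN⟩, hxy⟩

/-- The inverse function theorem at the end point of an interval. -/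
theorem exists_boundary_inverse {f : ℝ → ℝ} {c c' : ℝ} (hc' : 0 < c') (hcc : c' < c)
    (h0 : f 0 = 0) (hf : ContDiffOn ℝ ∞ f (Ico 0 c))
    (hd : ∀ s ∈ Ico 0 c, 0 < derivWithin f (Ico 0 c) s) (hm : StrictMonoOn f (Ico 0 c)) :
    ∃ g : ℝ → ℝ, MapsTo f (Ico 0 c') (Ico 0 (f c')) ∧ MapsTo g (Ico 0 (f c')) (Ico 0 c') ∧
      ContDiffOn ℝ ∞ g (Ico 0 (f c')) ∧ InvOn g f (Ico 0 c') (Ico 0 (f c')) := by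
  have hsub : Icc 0 c' ⊆ Ico 0 c := fun s hs => ⟨hs.1, hs.2.trans_lt hcc⟩
  have hfc : ContinuousOn f (Icc 0 c') := hf.continuousOn.mono hsub
  have hmaps : MapsTo f (Ico 0 c') (Ico 0 (f c')) := by
    intro s hs
    have hs' := hsub ⟨hs.1, hs.2.le⟩
    refine ⟨?_, hm hs' ⟨hc'.le, hcc⟩ hs.2⟩
    rw [← h0]
    exact hm.monotoneOn ⟨le_rfl, hc'.trans hcc⟩ hs' hs.1
  have hsurj : ∀ y ∈ Ico 0 (f c'), ∃ s ∈ Ico 0 c', f s = y := by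
    intro y hy
    obtain ⟨s, hs, hsy⟩ := intermediate_value_Ico hc'.le hfc (show y ∈ Ico (f 0) (f c') by
      rwa [h0])
    exact ⟨s, hs, hsy⟩
  choose! g hg hfg using hsurj
  have hleft : LeftInvOn g f (Ico 0 c') := by
    intro s hs
    have h1 := hg _ (hmaps hs)
    exact hm.injOn (hsub ⟨h1.1, h1.2.le⟩) (hsub ⟨hs.1, hs.2.le⟩) (hfg _ (hmaps hs))
  have hgcont : ContinuousOn g (Ico 0 (f c')) := by
    intro y hy
    have hgy := hg y hy
    refine tendsto_order.2 ⟨fun a ha => ?_, fun a ha => ?_⟩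
    · have := eventually_mem_of_isCompact isCompact_Icc hfc (isOpen_Ioi (a := a)) (b := y) (by
        intro x hx hxy
        have : x = g y := hm.injOn (hsub hx) (hsub ⟨hgy.1, hgy.2.le⟩) (by rw [hxy, hfg y hy])
        exact this ▸ ha)
      filter_upwards [nhdsWithin_le_nhds this, self_mem_nhdsWithin] with y' h1 h2
      exact h1 _ ⟨(hg y' h2).1, (hg y' h2).2.le⟩ (hfg y' h2)
    · have := eventually_mem_of_isCompact isCompact_Icc hfc (isOpen_Iio (a := a)) (b := y) (by
        intro x hx hxy
        have : x = g y := hm.injOn (hsub hx) (hsub ⟨hgy.1, hgy.2.le⟩) (by rw [hxy, hfg y hy])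
        exact this ▸ ha)
      filter_upwards [nhdsWithin_le_nhds this, self_mem_nhdsWithin] with y' h1 h2
      exact h1 _ ⟨(hg y' h2).1, (hg y' h2).2.le⟩ (hfg y' h2)
  have hpos : 0 < f c' := by rw [← h0]; exact hm ⟨le_rfl, hc'.trans hcc⟩ ⟨hc'.le, hcc⟩ hc'
  have hgmaps : MapsTo g (Ico 0 (f c')) (Ico 0 c) := fun y hy =>
    hsub ⟨(hg y hy).1, (hg y hy).2.le⟩
  have hderiv : ∀ y ∈ Ico 0 (f c'), HasDerivWithinAt g (derivWithin f (Ico 0 c) (g y))⁻¹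
      (Ico 0 (f c')) y := by
    intro y hy
    have h1 : HasDerivWithinAt f (derivWithin f (Ico 0 c) (g y)) (Ico 0 c) (g y) :=
      (hf.differentiableOn (by simp) _ (hgmaps hy)).hasDerivWithinAt
    have hne := (hd _ (hgmaps hy)).ne'
    have h2 : HasFDerivWithinAt f ((ContinuousLinearEquiv.unitsEquivAut ℝ
        (Units.mk0 _ hne) : ℝ ≃L[ℝ] ℝ) : ℝ →L[ℝ] ℝ) (Ico 0 c) (g y) := by
      refine h1.hasFDerivWithinAt.congr_fderiv ?_
      ext; simp
    have h3 := HasFDerivWithinAt.of_local_left_inverse (g := g) (s := Ico 0 (f c')) (a := y)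
      (tendsto_nhdsWithin_iff.2 ⟨hgcont y hy, by
        filter_upwards [self_mem_nhdsWithin] with x hx using hgmaps hx⟩) h2 hy (by
        filter_upwards [self_mem_nhdsWithin] with x hx using hfg x hx)
    have h4 := h3.hasDerivWithinAt
    simpa using h4
  have hU : UniqueDiffOn ℝ (Ico 0 (f c')) := uniqueDiffOn_Ico _ _
  -- Bootstrapping: the derivative of `g` is `1 / f'(g)`, so a `C^n` inverse is `C^(n+1)`.
  have hsm : ∀ n : ℕ, ContDiffOn ℝ n g (Ico 0 (f c')) := by
    intro n
    induction n with
    | zero => exact contDiffOn_zero.2 hgcont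
    | succ n ih =>
      push_cast
      rw [contDiffOn_succ_iff_derivWithin hU]
      refine ⟨fun y hy => (hderiv y hy).differentiableWithinAt, by simp, ?_⟩
      have h1 : ContDiffOn ℝ n (fun y => (derivWithin f (Ico 0 c) (g y))⁻¹) (Ico 0 (f c')) := by
        have h2 : ContDiffOn ℝ n (derivWithin f (Ico 0 c)) (Ico 0 c) :=
          hf.derivWithin (uniqueDiffOn_Ico _ _) (by exact_mod_cast le_top)
        exact (h2.comp ih hgmaps).inv fun y hy => (hd _ (hgmaps hy)).ne'
      exact h1.congr fun y hy => (hderiv y hy).derivWithin (hU y hy)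
  exact ⟨g, hmaps, hg, contDiffOn_infty.2 hsm, hleft, hfg⟩

/-- The map is `f₂⁻¹ ∘ f₁`. The bounds `δ₁` and `δ₂` are the preimages of one common value `m`,
which makes the two half-open intervals correspond exactly. -/
theorem exists_boundaryDiffeo {f₁ f₂ : ℝ → ℝ} {c : ℝ} (hc : 0 < c)
    (h₁0 : f₁ 0 = 0) (h₁ : ContDiffOn ℝ ∞ f₁ (Ico 0 c))
    (hd₁ : ∀ s ∈ Ico 0 c, 0 < derivWithin f₁ (Ico 0 c) s) (hm₁ : StrictMonoOn f₁ (Ico 0 c))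
    (h₂0 : f₂ 0 = 0) (h₂ : ContDiffOn ℝ ∞ f₂ (Ico 0 c))
    (hd₂ : ∀ s ∈ Ico 0 c, 0 < derivWithin f₂ (Ico 0 c) s) (hm₂ : StrictMonoOn f₂ (Ico 0 c)) :
    ∃ (δ₁ δ₂ : ℝ) (φ : ℝ → ℝ), 0 < δ₁ ∧ δ₁ ≤ c ∧ 0 < δ₂ ∧ δ₂ ≤ c ∧
      (∀ s ∈ Ioo 0 δ₁, φ s ∈ Ioo 0 δ₂ ∧ f₂ (φ s) = f₁ s) ∧ IsBoundaryDiffeo φ δ₁ δ₂ := by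
  have hc2 : 0 < c / 2 := by linarith
  have hcc : c / 2 < c := by linarith
  have h0c : (0 : ℝ) ∈ Ico 0 c := ⟨le_rfl, hc⟩
  have h2c : c / 2 ∈ Ico 0 c := ⟨hc2.le, hcc⟩
  have hsubc : Icc 0 (c / 2) ⊆ Ico 0 c := fun s hs => ⟨hs.1, hs.2.trans_lt hcc⟩
  have hp₁ : 0 < f₁ (c / 2) := by rw [← h₁0]; exact hm₁ h0c h2c hc2
  have hp₂ : 0 < f₂ (c / 2) := by rw [← h₂0]; exact hm₂ h0c h2c hc2
  set m := min (f₁ (c / 2)) (f₂ (c / 2)) with hm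
  have hmpos : 0 < m := lt_min hp₁ hp₂
  obtain ⟨δ₁, hδ₁, hδm₁⟩ := intermediate_value_Icc hc2.le (h₁.continuousOn.mono hsubc)
    (show m ∈ Icc (f₁ 0) (f₁ (c / 2)) from ⟨by rw [h₁0]; exact hmpos.le, min_le_left _ _⟩)
  obtain ⟨δ₂, hδ₂, hδm₂⟩ := intermediate_value_Icc hc2.le (h₂.continuousOn.mono hsubc)
    (show m ∈ Icc (f₂ 0) (f₂ (c / 2)) from ⟨by rw [h₂0]; exact hmpos.le, min_le_right _ _⟩)
  have hpos₁ : 0 < δ₁ := hδ₁.1.lt_of_ne (by rintro rfl; rw [h₁0] at hδm₁; linarith)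
  have hpos₂ : 0 < δ₂ := hδ₂.1.lt_of_ne (by rintro rfl; rw [h₂0] at hδm₂; linarith)
  obtain ⟨g₁, hf₁, hg₁, hgs₁, hinv₁⟩ := exists_boundary_inverse hpos₁
    (hδ₁.2.trans_lt hcc) h₁0 h₁ hd₁ hm₁
  obtain ⟨g₂, hf₂, hg₂, hgs₂, hinv₂⟩ := exists_boundary_inverse hpos₂
    (hδ₂.2.trans_lt hcc) h₂0 h₂ hd₂ hm₂
  rw [hδm₁] at hf₁ hg₁ hgs₁ hinv₁
  rw [hδm₂] at hf₂ hg₂ hgs₂ hinv₂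
  have hs₁ : Ico 0 δ₁ ⊆ Ico 0 c := Ico_subset_Ico_right (by linarith [hδ₁.2])
  have hs₂ : Ico 0 δ₂ ⊆ Ico 0 c := Ico_subset_Ico_right (by linarith [hδ₂.2])
  have hzero : g₂ 0 = 0 := by
    have := hinv₂.1 (show (0 : ℝ) ∈ Ico 0 δ₂ from ⟨le_rfl, hpos₂⟩)
    rwa [h₂0] at this
  refine ⟨δ₁, δ₂, fun s => g₂ (f₁ s), hpos₁, by linarith [hδ₁.2], hpos₂, by linarith [hδ₂.2],
    ?_, by simp [h₁0, hzero], hg₂.comp hf₁, hgs₂.comp (h₁.mono hs₁) hf₁, fun s => g₁ (f₂ s),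
    hg₁.comp hf₂, hgs₁.comp (h₂.mono hs₂) hf₂, ?_, ?_⟩
  · intro s hs
    have h1 := hf₁ ⟨hs.1.le, hs.2⟩
    have h2 := hg₂ h1
    have h3 := hinv₂.2 h1
    refine ⟨⟨h2.1.lt_of_ne ?_, h2.2⟩, h3⟩
    intro h4
    rw [← h4, h₂0] at h3
    have h5 := hm₁ h0c (hs₁ ⟨hs.1.le, hs.2⟩) hs.1
    rw [h₁0] at h5
    linarith
  · intro s hs
    change g₁ (f₂ (g₂ (f₁ s))) = s
    rw [hinv₂.2 (hf₁ hs), hinv₁.1 hs]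
  · intro s hs
    change g₂ (f₁ (g₁ (f₂ s))) = s
    rw [hinv₁.2 (hf₂ hs), hinv₂.1 hs]

/-- The condition looks only to the right of each point; a closed set that can always be prolonged
to the right fills the interval. -/
theorem strictMonoOn_of_eventually_lt {f : ℝ → ℝ} {a b : ℝ} (hf : ContinuousOn f (Icc a b))
    (h : ∀ s ∈ Ico a b, ∀ᶠ r in 𝓝[>] s, r ∈ Icc a b → f s < f r) : StrictMonoOn f (Icc a b) := by
  have hmono : ∀ x ∈ Icc a b, ∀ y ∈ Icc a b, x ≤ y → f x ≤ f y := by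
    intro x hx y hy hxy
    have hsub : Icc x y ⊆ Icc a b := Icc_subset_Icc hx.1 hy.2
    have hcl : IsClosed ({r | f x ≤ f r} ∩ Icc x y) := by
      rw [inter_comm]
      exact (hf.mono hsub).preimage_isClosed_of_isClosed isClosed_Icc isClosed_Ici
    refine hcl.Icc_subset_of_forall_mem_nhdsWithin (show f x ≤ f x from le_rfl) ?_ ⟨hxy, le_rfl⟩
    intro r hr
    filter_upwards [h r ⟨hx.1.trans hr.2.1, hr.2.2.trans_le hy.2⟩,
      Ioo_mem_nhdsGT hr.2.2] with u hu hur
    exact hr.1.trans (hu ⟨by linarith [hx.1, hr.2.1, hur.1], by linarith [hur.2, hy.2]⟩).le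
  intro x hx y hy hxy
  obtain ⟨r, hr, hr'⟩ := ((h x ⟨hx.1, hxy.trans_le hy.2⟩).and (Ioo_mem_nhdsGT hxy)).exists
  have hrI : r ∈ Icc a b := ⟨hx.1.trans hr'.1.le, hr'.2.le.trans hy.2⟩
  exact (hr hrI).trans_le (hmono r hrI y hy hr'.2.le)

end FlowBox


/-! ### Sectors without their vertex, and travel times along the segments -/

namespace FlowBox

/-- The model sector without its vertex. -/
def puncturedModel : Set (ℝ × ℝ) := sectorModel \ {(0, 0)}

/-- The part of the model sector that lies on trajectories ending at the side `x = 1`. -/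
def outgoingModel : Set (ℝ × ℝ) := {z | z ∈ sectorModel ∧ (0 < z.2 ∨ 0 < z.1)}

/-- A hyperbolic sector without its vertex, as a map to the plane. -/
structure IsRegularSector (X : Plane → Plane) (U : Set Plane) (g : ℝ × ℝ → Plane) : Prop where
  continuousOn : ContinuousOn g puncturedModel
  inj : InjOn g puncturedModel
  mapsTo : MapsTo g puncturedModel U
  orbit : ∀ y ∈ Icc (0 : ℝ) 1, ∀ x ∈ Icc (-1 : ℝ) 1, ∀ x' ∈ Icc (-1 : ℝ) 1, x < x' →
    (0 < y ∨ x' < 0 ∨ 0 < x) →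
    IsOrbitArc X U (g (x, y)) (g (x', y)) ((fun u : ℝ => g (u, y)) '' Icc x x')

/-- The flow takes `g (x, y)` to `g (x', y)` in the time `t` along the segment at height `y`. -/
def StripTime (X : Plane → Plane) (U : Set Plane) (g : ℝ × ℝ → Plane) (y x x' t : ℝ) : Prop :=
  0 < t ∧ FlowsTo X U (g (x, y)) t (g (x', y)) ∧
    ∀ s ∈ Icc 0 t, ∃ u ∈ Icc x x', FlowsTo X U (g (x, y)) s (g (u, y))

variable {X : Plane → Plane} {U : Set Plane} {g : ℝ × ℝ → Plane} {x x' x'' y t t' : ℝ}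
  {T : Set (OpenPartialHomeomorph Plane ℂ)} {e e' : OpenPartialHomeomorph Plane ℂ}
  {z₀ : ℝ × ℝ}

theorem outgoingModel_subset : outgoingModel ⊆ puncturedModel := by
  rintro z ⟨h1, h2⟩
  refine ⟨h1, ?_⟩
  rintro rfl
  simp at h2

theorem isCompact_sectorModel : IsCompact sectorModel := isCompact_Icc.prod isCompact_Icc

theorem IsRegularSector.exists_stripTime (hg : IsRegularSector X U g) (hy : y ∈ Icc (0 : ℝ) 1)
    (hx : x ∈ Icc (-1 : ℝ) 1) (hx' : x' ∈ Icc (-1 : ℝ) 1) (hlt : x < x')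
    (hc : 0 < y ∨ x' < 0 ∨ 0 < x) : ∃ t, StripTime X U g y x x' t := by
  obtain ⟨t, ht, γ, hγ, h0, h1, him⟩ := hg.orbit y hy x hx x' hx' hlt hc
  replace hγ : IsArc X U γ (uIcc 0 t) := hγ
  refine ⟨t, ht, h0 ▸ h1 ▸ ⟨γ, hγ, rfl, rfl⟩, fun s hs => ?_⟩
  obtain ⟨u, hu, hus⟩ := him.subset ⟨s, hs, rfl⟩
  refine ⟨u, hu, ?_⟩
  change g (u, y) = γ s at hus
  rw [hus, ← h0]
  have := hγ.flowsTo (s := 0) (t := s) ordConnected_uIcc left_mem_uIcc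
    (by rw [uIcc_of_le ht.le]; exact hs)
  simpa using this

theorem mem_puncturedModel_of_cond (hy : y ∈ Icc (0 : ℝ) 1) (hx : x ∈ Icc (-1 : ℝ) 1)
    (hx' : x' ∈ Icc (-1 : ℝ) 1) (hc : 0 < y ∨ x' < 0 ∨ 0 < x) {u : ℝ} (hu : u ∈ Icc x x') :
    (u, y) ∈ puncturedModel := by
  refine ⟨⟨⟨hx.1.trans hu.1, hu.2.trans hx'.2⟩, hy⟩, ?_⟩
  intro h
  simp only [mem_singleton_iff, Prod.mk.injEq] at h
  obtain ⟨rfl, rfl⟩ := h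
  rcases hc with h | h | h
  · exact h.false
  · linarith [hu.2]
  · linarith [hu.1]

namespace IsTranslationAtlas

variable (hT : IsTranslationAtlas X U T)
include hT

theorem stripTime_add (h : StripTime X U g y x x' t) (h' : StripTime X U g y x' x'' t')
    (hx : x ≤ x') (hx' : x' ≤ x'') : StripTime X U g y x x'' (t + t') := by
  refine ⟨add_pos h.1 h'.1, hT.flowsTo_trans h.2.1 h'.2.1, fun s hs => ?_⟩
  rcases le_total s t with hst | hst
  · obtain ⟨u, hu, hf⟩ := h.2.2 s ⟨hs.1, hst⟩
    exact ⟨u, ⟨hu.1, hu.2.trans hx'⟩, hf⟩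
  · obtain ⟨u, hu, hf⟩ := h'.2.2 (s - t) ⟨by linarith, by linarith [hs.2]⟩
    have := hT.flowsTo_trans h.2.1 hf
    rw [add_sub_cancel] at this
    exact ⟨u, ⟨hx.trans hu.1, hu.2⟩, this⟩

theorem chart_stripTime (he : e ∈ T) (h : StripTime X U g y x x' t)
    (hsrc : ∀ u ∈ Icc x x', g (u, y) ∈ e.source) : e (g (x', y)) = e (g (x, y)) + (t : ℂ) := by
  obtain ⟨ht, ⟨γ, hγ, h0, h1⟩, hu⟩ := h
  replace hγ : IsArc X U γ (uIcc 0 t) := hγ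
  have hs : ∀ s ∈ uIcc 0 t, γ s ∈ e.source := by
    intro s hs
    rw [uIcc_of_le ht.le] at hs
    obtain ⟨u, hu, hf⟩ := hu s hs
    have h2 := hγ.flowsTo (s := 0) (t := s) ordConnected_uIcc left_mem_uIcc
      (by rw [uIcc_of_le ht.le]; exact hs)
    rw [h0, sub_zero] at h2
    rw [hT.flowsTo_unique h2 hf]
    exact hsrc u hu
  have := hT.chart_arc he hγ (convex_uIcc 0 t) hs left_mem_uIcc right_mem_uIcc
  rwa [h0, h1, sub_zero] at this

/-- Near a point of a regular sector, the segments are horizontal in a straightening chart. -/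
theorem exists_sector_box (hg : IsRegularSector X U g) (he : e ∈ T) (hz : z₀ ∈ puncturedModel)
    (hze : g z₀ ∈ e.source) : ∃ δ > 0,
      (∀ z ∈ sectorModel, z.1 ∈ Ioo (z₀.1 - δ) (z₀.1 + δ) → z.2 ∈ Ioo (z₀.2 - δ) (z₀.2 + δ) →
        z ∈ puncturedModel ∧ g z ∈ e.source) ∧
      ∀ y ∈ Icc (0 : ℝ) 1, y ∈ Ioo (z₀.2 - δ) (z₀.2 + δ) →
        ∀ x ∈ Icc (-1 : ℝ) 1, x ∈ Ioo (z₀.1 - δ) (z₀.1 + δ) →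
        ∀ x' ∈ Icc (-1 : ℝ) 1, x' ∈ Ioo (z₀.1 - δ) (z₀.1 + δ) → x < x' →
          (0 < y ∨ x' < 0 ∨ 0 < x) ∧ (∃ t, StripTime X U g y x x' t) ∧
          ∀ t, StripTime X U g y x x' t → e (g (x', y)) = e (g (x, y)) + (t : ℂ) := by
  have h1 := hg.continuousOn z₀ hz (e.open_source.mem_nhds hze)
  obtain ⟨δ₁, hδ₁, hb⟩ := Metric.mem_nhdsWithin_iff.1 h1
  have hpos : 0 < max |z₀.1| z₀.2 := by
    by_contra hcon
    push Not at hcon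
    have h2 : |z₀.1| ≤ 0 := (le_max_left _ _).trans hcon
    have h3 : z₀.2 ≤ 0 := (le_max_right _ _).trans hcon
    exact hz.2 (Prod.ext (abs_nonpos_iff.1 h2) (le_antisymm h3 hz.1.2.1))
  -- With this size the box either stays at positive heights or stays strictly on one side of `x =
  -- 0`, so no segment inside it meets the vertex.
  set δ := min δ₁ (max |z₀.1| z₀.2) with hδ
  have hδpos : 0 < δ := lt_min hδ₁ hpos
  have hδ1 : δ ≤ δ₁ := min_le_left _ _
  have hδ2 : δ ≤ max |z₀.1| z₀.2 := min_le_right _ _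
  have hcond : ∀ y, y ∈ Ioo (z₀.2 - δ) (z₀.2 + δ) → ∀ x ∈ Ioo (z₀.1 - δ) (z₀.1 + δ),
      ∀ x' ∈ Ioo (z₀.1 - δ) (z₀.1 + δ), (0 < y ∨ x' < 0 ∨ 0 < x) := by
    intro y hy x hx x' hx'
    rcases le_max_iff.1 hδ2 with h | h
    · rcases le_abs.1 h with h | h
      · right; right; linarith [hx.1]
      · right; left; linarith [hx'.2]
    · left; linarith [hy.1]
  have hsrc : ∀ z ∈ sectorModel, z.1 ∈ Ioo (z₀.1 - δ) (z₀.1 + δ) →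
      z.2 ∈ Ioo (z₀.2 - δ) (z₀.2 + δ) → z ∈ puncturedModel ∧ g z ∈ e.source := by
    intro z hz h1 h2
    have hzp : z ∈ puncturedModel := by
      refine ⟨hz, ?_⟩
      rintro rfl
      rcases hcond _ h2 _ h1 _ h1 with h | h | h <;> exact lt_irrefl _ h
    refine ⟨hzp, hb ⟨?_, hzp⟩⟩
    rw [Metric.mem_ball, Prod.dist_eq, max_lt_iff, Real.dist_eq, Real.dist_eq, abs_lt, abs_lt]
    refine ⟨⟨?_, ?_⟩, ?_, ?_⟩ <;> linarith [h1.1, h1.2, h2.1, h2.2]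
  refine ⟨δ, hδpos, hsrc, ?_⟩
  intro y hy hy' x hx hxδ x' hx' hxδ' hlt
  have hc := hcond y hy' x hxδ x' hxδ'
  refine ⟨hc, hg.exists_stripTime hy hx hx' hlt hc, fun t ht => ?_⟩
  refine hT.chart_stripTime he ht fun u hu => ?_
  exact (hsrc (u, y) ⟨⟨hx.1.trans hu.1, hu.2.trans hx'.2⟩, hy⟩
    ⟨hxδ.1.trans_le hu.1, hu.2.trans_lt hxδ'.2⟩ hy').2

/-- An orbit arc is only known to have the segment as its image. The abscissa `f s` reached at time
`s` is continuous by compactness and injectivity, and in a straightening chart a step backwards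
would need negative time; so the segment is traversed without turning back. -/
theorem stripTime_strictMono (hg : IsRegularSector X U g) (hy : y ∈ Icc (0 : ℝ) 1)
    (hx : x ∈ Icc (-1 : ℝ) 1) (hx' : x' ∈ Icc (-1 : ℝ) 1)
    (hc : 0 < y ∨ x' < 0 ∨ 0 < x) (h : StripTime X U g y x x' t) :
    ∃ f : ℝ → ℝ, StrictMonoOn f (Icc 0 t) ∧
      ∀ s ∈ Icc 0 t, f s ∈ Icc x x' ∧ FlowsTo X U (g (x, y)) s (g (f s, y)) := by
  obtain ⟨ht, ⟨γ, hγ, h0, h1⟩, hu⟩ := h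
  replace hγ : IsArc X U γ (uIcc 0 t) := hγ
  rw [uIcc_of_le ht.le] at hγ
  have hγf : ∀ s ∈ Icc 0 t, FlowsTo X U (g (x, y)) s (γ s) := by
    intro s hs
    have h2 := hγ.flowsTo (s := 0) (t := s) ordConnected_Icc ⟨le_rfl, ht.le⟩ hs
    rwa [h0, sub_zero] at h2
  choose! f hf hff using hu
  have hgf : ∀ s ∈ Icc 0 t, g (f s, y) = γ s := fun s hs =>
    hT.flowsTo_unique (hff s hs) (hγf s hs)
  have hpm : ∀ u ∈ Icc x x', (u, y) ∈ puncturedModel := fun u hu =>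
    mem_puncturedModel_of_cond hy hx hx' hc hu
  have hgc : ContinuousOn (fun u => g (u, y)) (Icc x x') :=
    hg.continuousOn.comp (by fun_prop) hpm
  have hloc : ∀ s ∈ Icc 0 t, ∀ N : Set ℝ, IsOpen N → f s ∈ N → ∀ᶠ r in 𝓝[Icc 0 t] s, f r ∈ N := by
    intro s hs N hN hfN
    have h2 := eventually_mem_of_isCompact isCompact_Icc hgc hN (b := γ s) (by
      intro u hu hus
      have : (u, y) = (f s, y) := hg.inj (hpm u hu) (hpm _ (hf s hs)) (by rw [hus, hgf s hs])
      have h3 : u = f s := (Prod.ext_iff.1 this).1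
      rw [h3]; exact hfN)
    filter_upwards [(hγ.continuousOn s hs).eventually h2, self_mem_nhdsWithin] with r hr hrI
    exact hr (f r) (hf r hrI) (hgf r hrI)
  have hcont : ContinuousOn f (Icc 0 t) := by
    intro s hs
    exact tendsto_order.2 ⟨fun a ha => hloc s hs _ isOpen_Ioi ha,
      fun a ha => hloc s hs _ isOpen_Iio ha⟩
  refine ⟨f, strictMonoOn_of_eventually_lt hcont ?_, fun s hs => ⟨hf s hs, hff s hs⟩⟩
  intro s hs
  have hsI : s ∈ Icc 0 t := Ico_subset_Icc_self hs
  obtain ⟨e, he, hes⟩ := hT.covers _ (hg.mapsTo (hpm _ (hf s hsI)))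
  obtain ⟨δ, hδ, hsrc, hbox⟩ := hT.exists_sector_box hg he (hpm _ (hf s hsI)) hes
  have hfN := hloc s hsI (Ioo (f s - δ) (f s + δ)) isOpen_Ioo (by constructor <;> linarith)
  have harc := hT.chart_arc_eventually he hγ (convex_Icc _ _) hsI (by rwa [← hgf s hsI])
  have hle : 𝓝[Icc s t] s ≤ 𝓝[Icc 0 t] s := nhdsWithin_mono _ (Icc_subset_Icc_left hs.1)
  have hle' : 𝓝[>] s ≤ 𝓝[Icc s t] s := by
    refine le_inf nhdsWithin_le_nhds (le_principal_iff.2 ?_)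
    filter_upwards [Ioo_mem_nhdsGT hs.2] with r hr using ⟨hr.1.le, hr.2.le⟩
  filter_upwards [hle' (hle hfN), hle' (hle harc), self_mem_nhdsWithin] with r hr hr' hsr hrI
  have hsr' : s < r := hsr
  rw [← hgf s hsI, ← hgf r hrI] at hr'
  have hyδ : y ∈ Ioo (y - δ) (y + δ) := by constructor <;> linarith
  have hxs : f s ∈ Icc (-1 : ℝ) 1 := (hpm _ (hf s hsI)).1.1
  have hxr : f r ∈ Icc (-1 : ℝ) 1 := (hpm _ (hf r hrI)).1.1
  rcases lt_trichotomy (f s) (f r) with h | h | h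
  · exact h
  · exfalso
    rw [h] at hr'
    have := congrArg Complex.re hr'.2
    simp at this
    linarith
  · exfalso
    obtain ⟨-, ⟨t', ht'⟩, hall⟩ := hbox y hy hyδ (f r) hxr hr (f s) hxs
      (by constructor <;> simp <;> linarith) h
    have h2 := hall t' ht'
    rw [hr'.2] at h2
    have := congrArg Complex.re h2
    simp at this
    linarith [ht'.1]

/-- A trajectory could a priori pass through the endpoint several times; by monotonicity of the
abscissa only one of these times stays within the segment. -/
theorem stripTime_unique (hg : IsRegularSector X U g) (hy : y ∈ Icc (0 : ℝ) 1)
    (hx : x ∈ Icc (-1 : ℝ) 1) (hx' : x' ∈ Icc (-1 : ℝ) 1) (hlt : x < x')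
    (hc : 0 < y ∨ x' < 0 ∨ 0 < x) (h : StripTime X U g y x x' t)
    (h' : StripTime X U g y x x' t') : t = t' := by
  have key : ∀ t t', StripTime X U g y x x' t → StripTime X U g y x x' t' → ¬ t < t' := by
    intro t t' h h' htt
    obtain ⟨f, hf, hff⟩ := hT.stripTime_strictMono hg hy hx hx' hc h'
    have h1 : t ∈ Icc 0 t' := ⟨h.1.le, htt.le⟩
    have h2 : t' ∈ Icc 0 t' := ⟨h'.1.le, le_rfl⟩
    have key2 : ∀ s ∈ Icc 0 t', FlowsTo X U (g (x, y)) s (g (x', y)) → f s = x' := by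
      intro s hs hfl
      have h3 := hT.flowsTo_unique (hff s hs).2 hfl
      have h4 := hg.inj (mem_puncturedModel_of_cond hy hx hx' hc (hff s hs).1)
        (mem_puncturedModel_of_cond hy hx hx' hc ⟨hlt.le, le_rfl⟩) h3
      exact (Prod.ext_iff.1 h4).1
    have h5 := hf h1 h2 htt
    rw [key2 t h1 h.2.1, key2 t' h2 h'.2.1] at h5
    exact h5.false
  exact le_antisymm (not_lt.1 (key _ _ h' h)) (not_lt.1 (key _ _ h h'))

end IsTranslationAtlas
end FlowBox


/-! ### Developing map and height function of a sector -/

namespace FlowBox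

open Classical in
/-- The time that the flow takes from `g z` to the side `x = 1` of the sector. -/
noncomputable def exitTime (X : Plane → Plane) (U : Set Plane) (g : ℝ × ℝ → Plane) (z : ℝ × ℝ) :
    ℝ :=
  if h : z.1 < 1 ∧ ∃ t, StripTime X U g z.2 z.1 1 t then h.2.choose else 0

/-- The developing map of the sector `g`: the analytic continuation, along the segments, of the
straightening chart `e` at the point `g (1, 0)`. -/
noncomputable def dev (X : Plane → Plane) (U : Set Plane) (g : ℝ × ℝ → Plane)
    (e : OpenPartialHomeomorph Plane ℂ) (z : ℝ × ℝ) : ℂ :=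
  e (g (1, z.2)) - e (g (1, 0)) - (exitTime X U g z : ℂ)

/-- The height function of the sector `g`. -/
noncomputable def sectorHeight (g : ℝ × ℝ → Plane) (e : OpenPartialHomeomorph Plane ℂ) (y : ℝ) :
    ℝ :=
  (e (g (1, y)) - e (g (1, 0))).im

variable {X : Plane → Plane} {U : Set Plane} {g : ℝ × ℝ → Plane} {x x' x'' y t t' δ : ℝ}
  {T : Set (OpenPartialHomeomorph Plane ℂ)} {e e' e₁ : OpenPartialHomeomorph Plane ℂ}
  {z z' z₀ : ℝ × ℝ}

theorem dev_im : (dev X U g e z).im = sectorHeight g e z.2 := by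
  simp [dev, sectorHeight]

theorem sectorHeight_zero : sectorHeight g e 0 = 0 := by simp [sectorHeight]

/-- The default value `0` of the definition is the correct one on the exit side. -/
theorem exitTime_one : exitTime X U g (1, y) = 0 := by simp [exitTime]

namespace IsRegularSector

theorem stripTime_exitTime (hg : IsRegularSector X U g) (hz : z ∈ outgoingModel) (h1 : z.1 < 1) :
    StripTime X U g z.2 z.1 1 (exitTime X U g z) := by
  have h : z.1 < 1 ∧ ∃ t, StripTime X U g z.2 z.1 1 t :=
    ⟨h1, hg.exists_stripTime hz.1.2 hz.1.1 (by norm_num) h1 (hz.2.imp_right Or.inr)⟩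
  rw [exitTime, dif_pos h]
  exact h.2.choose_spec

end IsRegularSector

namespace IsTranslationAtlas

variable (hT : IsTranslationAtlas X U T) (hg : IsRegularSector X U g)
include hT hg

theorem exitTime_add (hz : (x, y) ∈ outgoingModel) (hx' : x' ≤ 1) (hlt : x < x')
    (h : StripTime X U g y x x' t) : exitTime X U g (x, y) = t + exitTime X U g (x', y) := by
  have hx1 : x < 1 := hlt.trans_le hx'
  have h1 := hg.stripTime_exitTime hz hx1
  have hc : 0 < y ∨ (1 : ℝ) < 0 ∨ 0 < x := by have := hz.2; simp only at this; tauto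
  have h1I : (1 : ℝ) ∈ Icc (-1 : ℝ) 1 := by norm_num
  rcases hx'.eq_or_lt with rfl | hx'
  · rw [exitTime_one, add_zero]
    exact hT.stripTime_unique hg hz.1.2 hz.1.1 h1I hx1 hc h1 h
  · have hz' : (x', y) ∈ outgoingModel := by
      refine ⟨⟨⟨hz.1.1.1.trans hlt.le, hx'.le⟩, hz.1.2⟩, ?_⟩
      rcases hz.2 with h | h
      · exact Or.inl h
      · exact Or.inr (lt_trans h hlt)
    have h2 := hg.stripTime_exitTime hz' hx'
    exact hT.stripTime_unique hg hz.1.2 hz.1.1 h1I hx1 hc h1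
      (hT.stripTime_add h h2 hlt.le hx'.le)

theorem dev_sub_of_lt (hz : (x, y) ∈ outgoingModel) (hx' : x' ≤ 1) (hlt : x < x')
    (h : StripTime X U g y x x' t) :
    dev X U g e₁ (x', y) - dev X U g e₁ (x, y) = (t : ℂ) := by
  simp only [dev]
  rw [hT.exitTime_add hg hz hx' hlt h]
  push_cast
  ring

theorem dev_re_strictMono (hz : (x, y) ∈ outgoingModel) (hx' : x' ≤ 1) (hlt : x < x') :
    (dev X U g e₁ (x, y)).re < (dev X U g e₁ (x', y)).re := by
  obtain ⟨t, ht⟩ := hg.exists_stripTime hz.1.2 hz.1.1 ⟨hz.1.1.1.trans hlt.le, hx'⟩ hlt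
    (by have := hz.2; simp only at this; tauto)
  have := congrArg Complex.re (hT.dev_sub_of_lt hg (e₁ := e₁) hz hx' hlt ht)
  simp only [Complex.sub_re, Complex.ofReal_re] at this
  linarith [ht.1]

/-- The developing map continues the straightening charts. -/
theorem dev_germ (he₁ : e₁ ∈ T) (hδ : ∀ y ∈ Icc (0 : ℝ) 1, y < δ → g (1, y) ∈ e₁.source)
    (hz : z₀ ∈ outgoingModel) (hzδ : z₀.2 < δ) (he : e ∈ T) (hze : g z₀ ∈ e.source) :
    ∀ᶠ z in 𝓝[sectorModel] z₀,
      dev X U g e₁ z - dev X U g e₁ z₀ = e (g z) - e (g z₀) := by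
  obtain ⟨x₀, y₀⟩ := z₀
  have hy₀ := hz.1.2
  simp only at hzδ hy₀
  set I : Set ℝ := {x | (x, y₀) ∈ outgoingModel} with hI
  have hIc : IsPreconnected I := by
    have : I.OrdConnected := by
      refine ⟨fun a ha b hb c hc => ?_⟩
      refine ⟨⟨⟨ha.1.1.1.trans hc.1, hc.2.trans hb.1.1.2⟩, hy₀⟩, ?_⟩
      rcases ha.2 with h | h
      · exact Or.inl h
      · exact Or.inr (lt_of_lt_of_le h hc.1)
    exact this.isPreconnected
  have h1I : (1 : ℝ) ∈ I := ⟨⟨by norm_num, hy₀⟩, Or.inr (by norm_num)⟩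
  -- The claim at the abscissa `x`, for all charts at once; by `hone` one chart suffices. It is
  -- carried along the row from `x = 1`.
  let P : ℝ → Prop := fun x => ∀ e ∈ T, g (x, y₀) ∈ e.source →
    ∀ᶠ z in 𝓝[sectorModel] (x, y₀),
      dev X U g e₁ z - dev X U g e₁ (x, y₀) = e (g z) - e (g (x, y₀))
  have hgt : ∀ x ∈ I, Tendsto g (𝓝[sectorModel] (x, y₀)) (𝓝 (g (x, y₀))) := by
    intro x hx
    have h1 := hg.continuousOn _ (outgoingModel_subset hx)
    have h2 : 𝓝[sectorModel] (x, y₀) ≤ 𝓝[puncturedModel] (x, y₀) := by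
      refine le_inf nhdsWithin_le_nhds (le_principal_iff.2 ?_)
      have h3 : ({(0, 0)}ᶜ : Set (ℝ × ℝ)) ∈ 𝓝 (x, y₀) :=
        isOpen_compl_singleton.mem_nhds (outgoingModel_subset hx).2
      filter_upwards [self_mem_nhdsWithin, nhdsWithin_le_nhds h3] with w hw hw' using ⟨hw, hw'⟩
    exact h1.mono_left h2
  have hone : ∀ x ∈ I, ∀ e' ∈ T, g (x, y₀) ∈ e'.source →
      (∀ᶠ z in 𝓝[sectorModel] (x, y₀),
        dev X U g e₁ z - dev X U g e₁ (x, y₀) = e' (g z) - e' (g (x, y₀))) → P x := by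
    intro x hx e' he' hxe' h e he hxe
    filter_upwards [h, (hgt x hx).eventually (hT.transition e he e' he' _ ⟨hxe, hxe'⟩)] with w hw hw'
    rw [hw]; linear_combination hw'
  have hbox : ∀ x ∈ I, ∀ e' ∈ T, g (x, y₀) ∈ e'.source → ∃ ρ > 0,
      (∀ z ∈ sectorModel, z.1 ∈ Ioo (x - ρ) (x + ρ) → z.2 ∈ Ioo (y₀ - ρ) (y₀ + ρ) →
        g z ∈ e'.source) ∧
      ∀ y ∈ Icc (0 : ℝ) 1, y ∈ Ioo (y₀ - ρ) (y₀ + ρ) → ∀ x₁ x₂,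
        (x₁, y) ∈ outgoingModel → (x₂, y) ∈ outgoingModel → x₁ ∈ Ioo (x - ρ) (x + ρ) →
        x₂ ∈ Ioo (x - ρ) (x + ρ) →
        dev X U g e₁ (x₂, y) - dev X U g e₁ (x₁, y) = e' (g (x₂, y)) - e' (g (x₁, y)) := by
    intro x hx e' he' hxe'
    obtain ⟨ρ, hρ, hsrc, hall⟩ := hT.exists_sector_box hg he' (outgoingModel_subset hx) hxe'
    refine ⟨ρ, hρ, fun z h1 h2 h3 => (hsrc z h1 h2 h3).2, ?_⟩
    intro y hy hyρ x₁ x₂ h₁ h₂ hx₁ hx₂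
    have key : ∀ x₁ x₂, (x₁, y) ∈ outgoingModel → (x₂, y) ∈ outgoingModel →
        x₁ ∈ Ioo (x - ρ) (x + ρ) → x₂ ∈ Ioo (x - ρ) (x + ρ) → x₁ < x₂ →
        dev X U g e₁ (x₂, y) - dev X U g e₁ (x₁, y) = e' (g (x₂, y)) - e' (g (x₁, y)) := by
      intro x₁ x₂ h₁ h₂ hx₁ hx₂ hlt
      obtain ⟨-, ⟨t, ht⟩, h⟩ := hall y hy hyρ x₁ h₁.1.1 hx₁ x₂ h₂.1.1 hx₂ hlt
      rw [hT.dev_sub_of_lt hg h₁ h₂.1.1.2 hlt ht, h t ht]; ring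
    rcases lt_trichotomy x₁ x₂ with h | rfl | h
    · exact key _ _ h₁ h₂ hx₁ hx₂ h
    · simp
    · have := key _ _ h₂ h₁ hx₂ hx₁ h
      linear_combination -this
  -- points of the sector close to a point of `I` are in the outgoing part
  have hout : ∀ x ∈ I, ∀ᶠ z in 𝓝[sectorModel] (x, y₀), z ∈ outgoingModel := by
    intro x hx
    have hop : IsOpen {z : ℝ × ℝ | 0 < z.2 ∨ 0 < z.1} :=
      (isOpen_lt continuous_const continuous_snd).union (isOpen_lt continuous_const continuous_fst)
    filter_upwards [self_mem_nhdsWithin, nhdsWithin_le_nhds (hop.mem_nhds hx.2)] with w hw hw'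
      using ⟨hw, hw'⟩
  have hnear : ∀ x : ℝ, ∀ ρ > 0, ∀ᶠ z in 𝓝[sectorModel] (x, y₀),
      z.1 ∈ Ioo (x - ρ) (x + ρ) ∧ z.2 ∈ Ioo (y₀ - ρ) (y₀ + ρ) := by
    intro x ρ hρ
    refine nhdsWithin_le_nhds (((isOpen_Ioo.preimage continuous_fst).inter
      (isOpen_Ioo.preimage continuous_snd)).mem_nhds ?_)
    refine ⟨⟨?_, ?_⟩, ?_, ?_⟩ <;> simp [hρ]
  -- On the exit side the developing map is the chart `e₁` itself up to a constant, and nearby exit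
  -- times are differences of real parts in `e₁`.
  have hP1 : P 1 := by
    have h1e : g (1, y₀) ∈ e₁.source := hδ y₀ hy₀ hzδ
    refine hone 1 h1I e₁ he₁ h1e ?_
    obtain ⟨ρ, hρ, hsrc, hall⟩ := hbox 1 h1I e₁ he₁ h1e
    filter_upwards [hout 1 h1I, hnear 1 ρ hρ] with w hw ⟨hw1, hw2⟩
    have hw' : (1, w.2) ∈ outgoingModel := ⟨⟨by norm_num, hw.1.2⟩, Or.inr (by norm_num)⟩
    have h2 := hall w.2 hw.1.2 hw2 w.1 1 hw hw' hw1 (by constructor <;> linarith)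
    have h3 : ∀ y, dev X U g e₁ (1, y) = e₁ (g (1, y)) - e₁ (g (1, 0)) := by
      intro y; simp [dev, exitTime_one]
    rw [h3] at h2 ⊢
    change e₁ (g (1, w.2)) - e₁ (g (1, 0)) - dev X U g e₁ w = e₁ (g (1, w.2)) - e₁ (g w) at h2
    linear_combination -h2
  have hstep : ∀ x ∈ I, ∀ᶠ x' in 𝓝[I] x, (P x ↔ P x') := by
    intro x hx
    obtain ⟨e', he', hxe'⟩ := hT.covers _ (hg.mapsTo (outgoingModel_subset hx))
    obtain ⟨ρ, hρ, hsrc, hall⟩ := hbox x hx e' he' hxe'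
    have h1 : ∀ᶠ x' in 𝓝[I] x, x' ∈ Ioo (x - ρ) (x + ρ) :=
      nhdsWithin_le_nhds (isOpen_Ioo.mem_nhds (by constructor <;> linarith))
    have hyρ : y₀ ∈ Ioo (y₀ - ρ) (y₀ + ρ) := by constructor <;> linarith
    have hxρ : x ∈ Ioo (x - ρ) (x + ρ) := by constructor <;> linarith
    have hmove : ∀ x₁ ∈ I, ∀ x₂ ∈ I, x₁ ∈ Ioo (x - ρ) (x + ρ) → x₂ ∈ Ioo (x - ρ) (x + ρ) →
        P x₁ → P x₂ := by
      intro x₁ hx₁ x₂ hx₂ h₁ h₂ hP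
      have hs₁ := hsrc (x₁, y₀) hx₁.1 h₁ hyρ
      have hs₂ := hsrc (x₂, y₀) hx₂.1 h₂ hyρ
      refine hone x₂ hx₂ e' he' hs₂ ?_
      have h2 := hP e' he' hs₁
      have hmap : Tendsto (fun w : ℝ × ℝ => (x₁, w.2)) (𝓝[sectorModel] (x₂, y₀))
          (𝓝[sectorModel] (x₁, y₀)) := by
        refine tendsto_nhdsWithin_iff.2 ⟨?_, ?_⟩
        · exact (Continuous.tendsto' (by fun_prop) _ _ rfl).mono_left nhdsWithin_le_nhds
        · filter_upwards [self_mem_nhdsWithin] with w hw using ⟨hx₁.1.1, hw.2⟩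
      have hnear₂ : ∀ᶠ w in 𝓝[sectorModel] (x₂, y₀), w.1 ∈ Ioo (x - ρ) (x + ρ) ∧
          w.2 ∈ Ioo (y₀ - ρ) (y₀ + ρ) :=
        nhdsWithin_le_nhds (((isOpen_Ioo.preimage continuous_fst).inter
          (isOpen_Ioo.preimage continuous_snd)).mem_nhds ⟨h₂, hyρ⟩)
      filter_upwards [hmap.eventually h2, hmap.eventually (hout x₁ hx₁), hout x₂ hx₂, hnear₂]
        with w hw1 hw2 hw3 hw4
      have h3 := hall w.2 hw3.1.2 hw4.2 x₁ w.1 hw2 hw3 h₁ hw4.1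
      have h4 := hall y₀ hy₀ hyρ x₁ x₂ hx₁ hx₂ h₁ h₂
      change dev X U g e₁ w - dev X U g e₁ (x₁, w.2) = e' (g w) - e' (g (x₁, w.2)) at h3
      linear_combination h3 - h4 + hw1
    filter_upwards [h1, self_mem_nhdsWithin] with x' hx' hx'I
    exact ⟨hmove x hx x' hx'I hxρ hx', hmove x' hx'I x hx hx' hxρ⟩
  have hfin : P x₀ := (hIc.induction₂ (fun x x' => P x ↔ P x') hstep
    (fun _ _ _ _ _ _ h1 h2 => h1.trans h2) (fun _ _ _ _ h => h.symm) h1I hz).1 hP1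
  exact hfin e he hze

omit hT in
theorem continuousOn_sectorHeight (hδ : ∀ y ∈ Icc (0 : ℝ) 1, y < δ → g (1, y) ∈ e₁.source) :
    ContinuousOn (sectorHeight g e₁) (Icc 0 1 ∩ Iio δ) := by
  have h1 : ContinuousOn (fun y : ℝ => g (1, y)) (Icc 0 1 ∩ Iio δ) := by
    refine hg.continuousOn.comp (by fun_prop) fun y hy => ⟨⟨by norm_num, hy.1⟩, by simp⟩
  have h2 : ContinuousOn (fun y : ℝ => e₁ (g (1, y)) - e₁ (g (1, 0))) (Icc 0 1 ∩ Iio δ) :=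
    (e₁.continuousOn.comp h1 fun y hy => hδ y hy.1 hy.2).sub continuousOn_const
  exact Complex.continuous_im.comp_continuousOn h2

/-- In a straightening chart, the height of the points of a sector depends only on their height
in the model, through the height function of the sector. -/
theorem height_germ (he₁ : e₁ ∈ T) (hδ : ∀ y ∈ Icc (0 : ℝ) 1, y < δ → g (1, y) ∈ e₁.source)
    (hz : z₀ ∈ puncturedModel) (hzδ : z₀.2 < δ) (he : e ∈ T) (hze : g z₀ ∈ e.source) :
    ∀ᶠ z in 𝓝[sectorModel] z₀,
      (e (g z)).im - (e (g z₀)).im = sectorHeight g e₁ z.2 - sectorHeight g e₁ z₀.2 := by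
  have hout : ∀ z₀ ∈ outgoingModel, z₀.2 < δ → ∀ e ∈ T, g z₀ ∈ e.source →
      ∀ᶠ z in 𝓝[sectorModel] z₀,
      (e (g z)).im - (e (g z₀)).im = sectorHeight g e₁ z.2 - sectorHeight g e₁ z₀.2 := by
    intro z₀ hz hzδ e he hze
    filter_upwards [hT.dev_germ hg he₁ hδ hz hzδ he hze] with w hw
    have := congrArg Complex.im hw
    simp only [Complex.sub_im, dev_im] at this
    exact this.symm
  by_cases hzo : z₀ ∈ outgoingModel
  · exact hout z₀ hzo hzδ e he hze
  obtain ⟨x₀, y₀⟩ := z₀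
  have hy0 : y₀ = 0 := by
    by_contra hne
    exact hzo ⟨hz.1, Or.inl (lt_of_le_of_ne hz.1.2.1 (Ne.symm hne))⟩
  subst hy0
  simp only at hzδ
  obtain ⟨ρ, hρ, hsrc, hall⟩ := hT.exists_sector_box hg he hz hze
  simp only at hsrc hall
  have hx₀ : x₀ ∈ Icc (-1 : ℝ) 1 := hz.1.1
  have hx₀ρ : x₀ ∈ Ioo (x₀ - ρ) (x₀ + ρ) := by constructor <;> linarith
  obtain ⟨m, hm, hm1, hmδ, hmρ⟩ : ∃ m > 0, m ≤ 1 ∧ m ≤ δ ∧ m ≤ ρ :=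
    ⟨min 1 (min δ ρ), by positivity, min_le_left _ _, (min_le_right _ _).trans (min_le_left _ _),
      (min_le_right _ _).trans (min_le_right _ _)⟩
  have hyρ : ∀ y ∈ Ico 0 m, y ∈ Ioo (0 - ρ) (0 + ρ) := fun y hy => by
    constructor <;> linarith [hy.1, hy.2]
  have hyI : ∀ y ∈ Ico 0 m, y ∈ Icc (0 : ℝ) 1 := fun y hy => ⟨hy.1, by linarith [hy.2]⟩
  -- The remaining points lie on the incoming separatrix, whose trajectory never reaches the exit
  -- side. The difference of the two heights is locally constant for `y > 0` and continuous at `y =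
  -- 0`.
  set G : ℝ → ℝ := fun y => (e (g (x₀, y))).im - sectorHeight g e₁ y with hG
  have hGc : ContinuousOn G (Ico 0 m) := by
    have h1 : ContinuousOn (fun y : ℝ => g (x₀, y)) (Ico 0 m) :=
      hg.continuousOn.comp (by fun_prop) fun y hy =>
        (hsrc (x₀, y) ⟨hx₀, hyI y hy⟩ hx₀ρ (hyρ y hy)).1
    have h2 : ContinuousOn (fun y : ℝ => (e (g (x₀, y))).im) (Ico 0 m) :=
      Complex.continuous_im.comp_continuousOn (e.continuousOn.comp h1 fun y hy =>
        (hsrc (x₀, y) ⟨hx₀, hyI y hy⟩ hx₀ρ (hyρ y hy)).2)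
    exact h2.sub ((continuousOn_sectorHeight hg hδ).mono fun y hy =>
      ⟨hyI y hy, hy.2.trans_le hmδ⟩)
  have hloc : ∀ y ∈ Ioo 0 m, ∀ᶠ y' in 𝓝[Ioo 0 m] y, G y' = G y := by
    intro y hy
    have hyy := hyI y ⟨hy.1.le, hy.2⟩
    have h1 := hout (x₀, y) ⟨⟨hx₀, hyy⟩, Or.inl hy.1⟩ (hy.2.trans_le hmδ) e he
      (hsrc (x₀, y) ⟨hx₀, hyy⟩ hx₀ρ (hyρ y ⟨hy.1.le, hy.2⟩)).2
    have hmap : Tendsto (fun y' : ℝ => (x₀, y')) (𝓝[Ioo 0 m] y) (𝓝[sectorModel] (x₀, y)) := by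
      refine tendsto_nhdsWithin_iff.2 ⟨?_, ?_⟩
      · exact (Continuous.tendsto' (by fun_prop) _ _ rfl).mono_left nhdsWithin_le_nhds
      · filter_upwards [self_mem_nhdsWithin] with w hw using ⟨hx₀, hyI w ⟨hw.1.le, hw.2⟩⟩
    filter_upwards [hmap.eventually h1] with y' hy'
    simp only [hG]
    linarith
  have hconst : ∀ y ∈ Ico 0 m, G y = G 0 := by
    intro y hy
    rcases hy.1.eq_or_lt with rfl | hpos
    · rfl
    have hle : 𝓝[>] (0 : ℝ) ≤ 𝓝[Ico 0 m] 0 := by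
      refine le_inf nhdsWithin_le_nhds (le_principal_iff.2 ?_)
      filter_upwards [Ioo_mem_nhdsGT hm] with r hr using ⟨hr.1.le, hr.2⟩
    have hlim : Tendsto G (𝓝[>] 0) (𝓝 (G 0)) := (hGc 0 ⟨le_rfl, hm⟩).mono_left hle
    refine tendsto_nhds_unique (tendsto_const_nhds.congr' ?_) hlim
    filter_upwards [Ioo_mem_nhdsGT hm] with r hr
    exact eq_of_eventually_eq isPreconnected_Ioo hloc ⟨hpos, hy.2⟩ hr
  have hnear : ∀ᶠ z in 𝓝[sectorModel] (x₀, (0 : ℝ)), z.1 ∈ Ioo (x₀ - ρ) (x₀ + ρ) ∧ z.2 < m :=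
    nhdsWithin_le_nhds (((isOpen_Ioo.preimage continuous_fst).inter
      (isOpen_Iio.preimage continuous_snd)).mem_nhds ⟨hx₀ρ, hm⟩)
  filter_upwards [self_mem_nhdsWithin, hnear] with w hw ⟨hw1, hw2⟩
  have hwI : w.2 ∈ Ico 0 m := ⟨hw.2.1, hw2⟩
  have h1 : (e (g w)).im = (e (g (x₀, w.2))).im := by
    rcases lt_trichotomy w.1 x₀ with h | h | h
    · obtain ⟨-, ⟨t, ht⟩, h2⟩ := hall w.2 hw.2 (hyρ _ hwI) w.1 hw.1 hw1 x₀ hx₀ hx₀ρ h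
      have := congrArg Complex.im (h2 t ht)
      simpa using this.symm
    · rw [← h]
    · obtain ⟨-, ⟨t, ht⟩, h2⟩ := hall w.2 hw.2 (hyρ _ hwI) x₀ hx₀ hx₀ρ w.1 hw.1 hw1 h
      have := congrArg Complex.im (h2 t ht)
      simpa using this
  have h2 := hconst w.2 hwI
  simp only [hG] at h2
  linarith

/-- The height in a straightening chart is injective along the vertical segments. -/
theorem height_injective (he : e ∈ T) (hz : z₀ ∈ puncturedModel) (hze : g z₀ ∈ e.source) :
    ∃ δ > 0, ∀ y ∈ Icc (0 : ℝ) 1, ∀ y' ∈ Icc (0 : ℝ) 1, y ∈ Ioo (z₀.2 - δ) (z₀.2 + δ) →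
      y' ∈ Ioo (z₀.2 - δ) (z₀.2 + δ) → (e (g (z₀.1, y))).im = (e (g (z₀.1, y'))).im → y = y' := by
  obtain ⟨x₀, y₀⟩ := z₀
  obtain ⟨ρ, hρ, hsrc, hall⟩ := hT.exists_sector_box hg he hz hze
  simp only at hsrc hall ⊢
  have hx₀ : x₀ ∈ Icc (-1 : ℝ) 1 := hz.1.1
  have hy₀ : y₀ ∈ Icc (0 : ℝ) 1 := hz.1.2
  have hx₀ρ : x₀ ∈ Ioo (x₀ - ρ) (x₀ + ρ) := by constructor <;> linarith
  have hy₀ρ : y₀ ∈ Ioo (y₀ - ρ) (y₀ + ρ) := by constructor <;> linarith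
  -- A second abscissa turns each row into a horizontal segment of nonzero length in the chart, with
  -- ends `A y` and `B y`. Two nearby rows at the same chart height would overlap, against the
  -- injectivity of `g`.
  obtain ⟨x₁, hx₁, hx₁ρ, hne⟩ : ∃ x₁ ∈ Icc (-1 : ℝ) 1, x₁ ∈ Ioo (x₀ - ρ) (x₀ + ρ) ∧ x₁ ≠ x₀ := by
    have h2 : 0 < min ρ 1 := lt_min hρ one_pos
    have h3 := min_le_left ρ 1
    have h4 := min_le_right ρ 1
    rcases le_total x₀ 0 with h | h
    · exact ⟨x₀ + min ρ 1 / 2, ⟨by linarith [hx₀.1], by linarith⟩,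
        ⟨by linarith, by linarith⟩, by linarith⟩
    · exact ⟨x₀ - min ρ 1 / 2, ⟨by linarith, by linarith [hx₀.2]⟩,
        ⟨by linarith, by linarith⟩, by linarith⟩
  have hsub : ∀ u ∈ uIcc x₀ x₁, u ∈ Icc (-1 : ℝ) 1 ∧ u ∈ Ioo (x₀ - ρ) (x₀ + ρ) := fun u hu =>
    ⟨ordConnected_Icc.uIcc_subset hx₀ hx₁ hu, ordConnected_Ioo.uIcc_subset hx₀ρ hx₁ρ hu⟩
  have him : ∀ y ∈ Icc (0 : ℝ) 1, y ∈ Ioo (y₀ - ρ) (y₀ + ρ) → ∀ u ∈ uIcc x₀ x₁,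
      (e (g (u, y))).im = (e (g (x₀, y))).im := by
    intro y hy hyρ u hu
    rcases lt_trichotomy u x₀ with h | rfl | h
    · obtain ⟨-, ⟨t, ht⟩, h2⟩ := hall y hy hyρ u (hsub u hu).1 (hsub u hu).2 x₀ hx₀ hx₀ρ h
      simpa using (congrArg Complex.im (h2 t ht)).symm
    · rfl
    · obtain ⟨-, ⟨t, ht⟩, h2⟩ := hall y hy hyρ x₀ hx₀ hx₀ρ u (hsub u hu).1 (hsub u hu).2 h
      simpa using congrArg Complex.im (h2 t ht)
  set I := Icc (0 : ℝ) 1 ∩ Ioo (y₀ - ρ) (y₀ + ρ) with hI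
  have hrec : ∀ u ∈ uIcc x₀ x₁, ContinuousOn (fun y => (e (g (u, y))).re) I := by
    intro u hu
    have h1 : ContinuousOn (fun y : ℝ => g (u, y)) I :=
      hg.continuousOn.comp (by fun_prop) fun y hy =>
        (hsrc (u, y) ⟨(hsub u hu).1, hy.1⟩ (hsub u hu).2 hy.2).1
    exact Complex.continuous_re.comp_continuousOn (e.continuousOn.comp h1 fun y hy =>
        (hsrc (u, y) ⟨(hsub u hu).1, hy.1⟩ (hsub u hu).2 hy.2).2)
  have hA := hrec x₀ left_mem_uIcc
  have hB := hrec x₁ right_mem_uIcc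
  set A : ℝ → ℝ := fun y => (e (g (x₀, y))).re with hAdef
  set B : ℝ → ℝ := fun y => (e (g (x₁, y))).re with hBdef
  have hABne : A y₀ ≠ B y₀ := by
    rcases lt_or_gt_of_ne hne with h | h
    · obtain ⟨-, ⟨t, ht⟩, h2⟩ := hall y₀ hy₀ hy₀ρ x₁ hx₁ hx₁ρ x₀ hx₀ hx₀ρ h
      have := congrArg Complex.re (h2 t ht)
      simp at this
      simp only [hAdef, hBdef]
      linarith [ht.1]
    · obtain ⟨-, ⟨t, ht⟩, h2⟩ := hall y₀ hy₀ hy₀ρ x₀ hx₀ hx₀ρ x₁ hx₁ hx₁ρ h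
      have := congrArg Complex.re (h2 t ht)
      simp at this
      simp only [hAdef, hBdef]
      linarith [ht.1]
  have hy₀I : y₀ ∈ I := ⟨hy₀, hy₀ρ⟩
  -- near `y₀`, the value `A y'` lies between `A y` and `B y`, or the other way round
  obtain ⟨δ, hδ, hδρ, hbt⟩ : ∃ δ > 0, δ ≤ ρ ∧ ∀ y ∈ Icc (0 : ℝ) 1, ∀ y' ∈ Icc (0 : ℝ) 1,
      y ∈ Ioo (y₀ - δ) (y₀ + δ) → y' ∈ Ioo (y₀ - δ) (y₀ + δ) →
      A y' ∈ uIcc (A y) (B y) ∨ A y ∈ uIcc (A y') (B y') := by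
    set κ := |B y₀ - A y₀| with hκ
    have hκpos : 0 < κ := abs_pos.2 (sub_ne_zero.2 (Ne.symm hABne))
    obtain ⟨δA, hδA, hbA⟩ := Metric.continuousOn_iff.1 hA y₀ hy₀I (κ / 4) (by linarith)
    obtain ⟨δB, hδB, hbB⟩ := Metric.continuousOn_iff.1 hB y₀ hy₀I (κ / 4) (by linarith)
    refine ⟨min ρ (min δA δB), by positivity, min_le_left _ _, ?_⟩
    intro y hy y' hy' hyd hyd'
    have l1 := min_le_left ρ (min δA δB)
    have l2 := (min_le_right ρ (min δA δB)).trans (min_le_left _ _)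
    have l3 := (min_le_right ρ (min δA δB)).trans (min_le_right _ _)
    have hd : ∀ y ∈ Icc (0 : ℝ) 1, y ∈ Ioo (y₀ - min ρ (min δA δB)) (y₀ + min ρ (min δA δB)) →
        |A y - A y₀| < κ / 4 ∧ |B y - B y₀| < κ / 4 := by
      intro y hy hyd
      have hyI : y ∈ I := ⟨hy, by constructor <;> linarith [hyd.1, hyd.2]⟩
      refine ⟨hbA y hyI ?_, hbB y hyI ?_⟩ <;> rw [Real.dist_eq, abs_lt] <;>
        constructor <;> linarith [hyd.1, hyd.2]
    obtain ⟨a1, b1⟩ := hd y hy hyd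
    obtain ⟨a2, b2⟩ := hd y' hy' hyd'
    rw [abs_lt] at a1 b1 a2 b2
    rw [mem_uIcc, mem_uIcc]
    rcases le_total (A y₀) (B y₀) with h | h
    · rw [abs_of_nonneg (by linarith)] at hκ
      rcases le_total (A y) (A y') with h' | h'
      · left; left; constructor <;> linarith [a1.1, a1.2, b1.1, b1.2, a2.1, a2.2, b2.1, b2.2]
      · right; left; constructor <;> linarith [a1.1, a1.2, b1.1, b1.2, a2.1, a2.2, b2.1, b2.2]
    · rw [abs_of_nonpos (by linarith)] at hκ
      rcases le_total (A y) (A y') with h' | h'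
      · right; right; constructor <;> linarith [a1.1, a1.2, b1.1, b1.2, a2.1, a2.2, b2.1, b2.2]
      · left; right; constructor <;> linarith [a1.1, a1.2, b1.1, b1.2, a2.1, a2.2, b2.1, b2.2]
  have key : ∀ y ∈ Icc (0 : ℝ) 1, ∀ y' ∈ Icc (0 : ℝ) 1, y ∈ Ioo (y₀ - δ) (y₀ + δ) →
      y' ∈ Ioo (y₀ - δ) (y₀ + δ) → (e (g (x₀, y))).im = (e (g (x₀, y'))).im →
      A y' ∈ uIcc (A y) (B y) → y = y' := by
    intro y hy y' hy' hyd hyd' heq hmem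
    have hyρ : y ∈ Ioo (y₀ - ρ) (y₀ + ρ) := by constructor <;> linarith [hyd.1, hyd.2]
    have hyρ' : y' ∈ Ioo (y₀ - ρ) (y₀ + ρ) := by constructor <;> linarith [hyd'.1, hyd'.2]
    have hc : ContinuousOn (fun u => (e (g (u, y))).re) (uIcc x₀ x₁) := by
      have h1 : ContinuousOn (fun u : ℝ => g (u, y)) (uIcc x₀ x₁) :=
        hg.continuousOn.comp (by fun_prop) fun u hu =>
          (hsrc (u, y) ⟨(hsub u hu).1, hy⟩ (hsub u hu).2 hyρ).1
      exact Complex.continuous_re.comp_continuousOn (e.continuousOn.comp h1 fun u hu =>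
        (hsrc (u, y) ⟨(hsub u hu).1, hy⟩ (hsub u hu).2 hyρ).2)
    obtain ⟨u, hu, hur⟩ := intermediate_value_uIcc hc hmem
    have h1 := hsrc (u, y) ⟨(hsub u hu).1, hy⟩ (hsub u hu).2 hyρ
    have h2 := hsrc (x₀, y') ⟨hx₀, hy'⟩ hx₀ρ hyρ'
    have h3 : e (g (u, y)) = e (g (x₀, y')) :=
      Complex.ext hur ((him y hy hyρ u hu).trans heq)
    have h4 := hg.inj h1.1 h2.1 (e.injOn h1.2 h2.2 h3)
    exact (Prod.ext_iff.1 h4).2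
  refine ⟨δ, hδ, fun y hy y' hy' hyd hyd' heq => ?_⟩
  rcases hbt y hy y' hy' hyd hyd' with h | h
  · exact key y hy y' hy' hyd hyd' heq h
  · exact (key y' hy' y hy hyd' hyd heq.symm h).symm

end IsTranslationAtlas
end FlowBox


/-! ### Holonomy of hyperbolic sectors -/

namespace FlowBox

theorem toSphere_injective : Function.Injective toSphere := OnePoint.coe_injective

theorem isOpenEmbedding_toSphere : IsOpenEmbedding toSphere := OnePoint.isOpenEmbedding_coe

/-- A map to the sphere that avoids `∞`, as a map to the plane. -/
noncomputable def toPlane (h : ℝ × ℝ → Sphere) (z : ℝ × ℝ) : Plane := Function.invFun toSphere (h z)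

variable {X : Plane → Plane} {U : Set Plane} {g : ℝ × ℝ → Plane} {x x' y t δ ε : ℝ}
  {T : Set (OpenPartialHomeomorph Plane ℂ)} {e e' e₁ : OpenPartialHomeomorph Plane ℂ}
  {z z' z₀ : ℝ × ℝ} {h : ℝ × ℝ → Sphere} {q : Sphere} {p : Plane} {σ : ℝ → Plane}

theorem toPlane_eq (hp : h z = toSphere p) : toPlane h z = p := by
  rw [toPlane, hp]
  exact Function.leftInverse_invFun toSphere_injective p

namespace IsHyperbolicSector

theorem toSphere_toPlane (hh : IsHyperbolicSector X U q h) (hz : z ∈ puncturedModel) :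
    toSphere (toPlane h z) = h z := by
  obtain ⟨p, -, hp⟩ := hh.regular z hz.1 hz.2
  rw [toPlane_eq hp.symm, hp]

theorem toPlane_mem (hh : IsHyperbolicSector X U q h) (hz : z ∈ puncturedModel) :
    toPlane h z ∈ U := by
  obtain ⟨p, hpU, hp⟩ := hh.regular z hz.1 hz.2
  rwa [toPlane_eq hp.symm]

theorem isRegularSector (hh : IsHyperbolicSector X U q h) : IsRegularSector X U (toPlane h) where
  continuousOn := by
    rw [isOpenEmbedding_toSphere.isInducing.continuousOn_iff]
    exact (hh.continuousOn.mono sdiff_subset).congr fun z hz => hh.toSphere_toPlane hz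
  inj := fun z hz z' hz' hzz => hh.inj hz.1 hz'.1 (by
    rw [← hh.toSphere_toPlane hz, ← hh.toSphere_toPlane hz', hzz])
  mapsTo := fun z hz => hh.toPlane_mem hz
  orbit := by
    intro y hy x hx x' hx' hlt hc
    obtain ⟨p, b, A, hA, hp, hb, him⟩ := hh.orbit y hy x hx x' hx' hlt hc
    rw [toPlane_eq hp.symm, toPlane_eq hb.symm]
    convert hA
    refine toSphere_injective.image_injective ?_
    rw [him, image_image]
    exact image_congr fun u hu => hh.toSphere_toPlane (mem_puncturedModel_of_cond hy hx hx' hc hu)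

theorem eventually_mem (hh : IsHyperbolicSector X U q h) (hz₀ : z₀ ∈ sectorModel)
    {N : Set (ℝ × ℝ)} (hN : IsOpen N) (hz₀N : z₀ ∈ N) :
    ∀ᶠ w in 𝓝 (h z₀), ∀ z ∈ sectorModel, h z = w → z ∈ N :=
  eventually_mem_of_isCompact isCompact_sectorModel hh.continuousOn hN fun z hz hzz => by
    rwa [hh.inj hz hz₀ hzz]

end IsHyperbolicSector

namespace IsTranslationAtlas

variable (hT : IsTranslationAtlas X U T)
include hT

/-- The height function of a sector is strictly monotone near zero. -/
theorem exists_sectorHeight (hg : IsRegularSector X U g) (he : e ∈ T) (he1 : g (1, 0) ∈ e.source) :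
    ∃ δ > 0, δ ≤ 1 ∧ (∀ y ∈ Icc (0 : ℝ) 1, y < δ → g (1, y) ∈ e.source) ∧
      ∃ a : ℝ, (a = 1 ∨ a = -1) ∧ StrictMonoOn (fun y => a * sectorHeight g e y) (Ico 0 δ) := by
  have h10 : ((1, 0) : ℝ × ℝ) ∈ puncturedModel := ⟨⟨by norm_num, by norm_num⟩, by simp⟩
  obtain ⟨δ₁, hδ₁, hsrc, -⟩ := hT.exists_sector_box hg he h10 he1
  obtain ⟨δ₂, hδ₂, hinj⟩ := hT.height_injective hg he h10 he1
  simp only at hsrc hinj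
  have hm : 0 < min 1 (min δ₁ δ₂) := by positivity
  have hm1 : min 1 (min δ₁ δ₂) ≤ 1 := min_le_left _ _
  have hm2 : min 1 (min δ₁ δ₂) ≤ δ₁ := (min_le_right _ _).trans (min_le_left _ _)
  have hm3 : min 1 (min δ₁ δ₂) ≤ δ₂ := (min_le_right _ _).trans (min_le_right _ _)
  set m := min 1 (min δ₁ δ₂)
  have hs : ∀ y ∈ Icc (0 : ℝ) 1, y < m → g (1, y) ∈ e.source := fun y hy hym =>
    (hsrc (1, y) ⟨by norm_num, hy⟩ (by constructor <;> simp [hδ₁])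
      (by constructor <;> simp <;> linarith [hy.1])).2
  have hc : ContinuousOn (sectorHeight g e) (Ico 0 m) :=
    (continuousOn_sectorHeight hg hs).mono fun y hy => ⟨⟨hy.1, by linarith [hy.2]⟩, hy.2⟩
  have hi : InjOn (sectorHeight g e) (Ico 0 m) := by
    intro y hy y' hy' hyy
    refine hinj y ⟨hy.1, by linarith [hy.2]⟩ y' ⟨hy'.1, by linarith [hy'.2]⟩
      ⟨by linarith [hy.1], by linarith [hy.2]⟩ ⟨by linarith [hy'.1], by linarith [hy'.2]⟩ ?_
    simpa [sectorHeight] using hyy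
  -- Halving gives a closed interval on which a continuous injective function is strictly monotone,
  -- in a direction recorded by the sign `a`.
  refine ⟨m / 2, by linarith, by linarith, fun y hy hym => hs y hy (by linarith), ?_⟩
  have hsub : Icc 0 (m / 2) ⊆ Ico 0 m := fun y hy => ⟨hy.1, by linarith [hy.2]⟩
  rcases (hc.mono hsub).strictMonoOn_of_injOn_Icc' (by linarith) (hi.mono hsub) with h | h
  · exact ⟨1, Or.inl rfl, by simpa using h.mono Ico_subset_Icc_self⟩
  · refine ⟨-1, Or.inr rfl, fun y hy y' hy' hyy => ?_⟩
    have := h (Ico_subset_Icc_self hy) (Ico_subset_Icc_self hy') hyy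
    simp only
    linarith

/-- The chart height along the transversal is smooth with nonzero derivative, and `height_germ`
identifies its increment with the height function of the sector. This links a smooth parameter to
the merely topological ordinate of the model; the set `N` keeps track of the side of the sector. -/
theorem transversal_sectorHeight (hh : IsHyperbolicSector X U q h) (he₁ : e₁ ∈ T)
    (hδ0 : 0 < δ)
    (hδ : ∀ y ∈ Icc (0 : ℝ) 1, y < δ → toPlane h (1, y) ∈ e₁.source) {a : ℝ}
    (ha : a = 1 ∨ a = -1)
    (hmono : StrictMonoOn (fun y => a * sectorHeight (toPlane h) e₁ y) (Ico 0 δ)) (hε : 0 < ε)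
    (hσ : IsTransversal X U σ (Ico 0 ε)) (hσh : ∀ s ∈ Ico 0 ε, toSphere (σ s) ∈ h '' sectorModel)
    (hz₀ : (x, 0) ∈ puncturedModel) (h0 : toSphere (σ 0) = h (x, 0)) {N : Set ℝ} (hN : IsOpen N)
    (hxN : x ∈ N) :
    ∃ (f : ℝ → ℝ) (c : ℝ), 0 < c ∧ c ≤ ε ∧ f 0 = 0 ∧ ContDiffOn ℝ ∞ f (Ico 0 c) ∧
      (∀ s ∈ Ico 0 c, 0 < derivWithin f (Ico 0 c) s) ∧ StrictMonoOn f (Ico 0 c) ∧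
      ∀ s ∈ Ico 0 c, ∃ z ∈ sectorModel, z.1 ∈ N ∧ z.2 < δ ∧ h z = toSphere (σ s) ∧
        f s = a * sectorHeight (toPlane h) e₁ z.2 := by
  have hg := hh.isRegularSector
  have h0' : toPlane h (x, 0) = σ 0 := toPlane_eq h0.symm
  have h0I : (0 : ℝ) ∈ Ico 0 ε := ⟨le_rfl, hε⟩
  obtain ⟨e, he, hes⟩ := hT.covers _ (hσ.mapsTo h0I)
  obtain ⟨δ', hδ', a', ha', hsrc, hsm, hder, hstr⟩ := hT.exists_height hσ (convex_Ico _ _)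
    (uniqueDiffOn_Ico _ _) he h0I hes
  have hgerm := hT.height_germ hg he₁ hδ hz₀ hδ0 he (by rwa [h0'])
  obtain ⟨M, hM, hMz, hMg⟩ := mem_nhdsWithin.1 hgerm
  have hev : ∀ᶠ s in 𝓝[Ico 0 ε] (0 : ℝ), ∀ z ∈ sectorModel, h z = toSphere (σ s) →
      z ∈ M ∩ (N ×ˢ Iio δ) := by
    have h1 := hh.eventually_mem hz₀.1 (hM.inter (hN.prod isOpen_Iio)) ⟨hMz, hxN, hδ0⟩
    have h2 : Tendsto (fun s => toSphere (σ s)) (𝓝[Ico 0 ε] 0) (𝓝 (h (x, 0))) := by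
      rw [← h0]
      exact (isOpenEmbedding_toSphere.continuous.tendsto _).comp (hσ.smooth.continuousOn 0 h0I)
    exact h2.eventually h1
  obtain ⟨c', hc', hcb⟩ := Metric.mem_nhdsWithin_iff.1 hev
  obtain ⟨c, hc, hcε, hcδ, hcc⟩ : ∃ c > 0, c ≤ ε ∧ c ≤ δ' ∧ c ≤ c' :=
    ⟨min ε (min δ' c'), by positivity, min_le_left _ _, (min_le_right _ _).trans (min_le_left _ _),
      (min_le_right _ _).trans (min_le_right _ _)⟩
  have hsub : Ico 0 c ⊆ Ico 0 ε ∩ Ioo (0 - δ') (0 + δ') := fun s hs =>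
    ⟨⟨hs.1, hs.2.trans_le hcε⟩, by linarith [hs.1], by linarith [hs.2]⟩
  have hex : ∀ s ∈ Ico 0 c, ∃ z ∈ sectorModel, z.1 ∈ N ∧ z.2 < δ ∧ h z = toSphere (σ s) ∧
      (e (σ s)).im - (e (σ 0)).im = sectorHeight (toPlane h) e₁ z.2 := by
    intro s hs
    have hsε : s ∈ Ico 0 ε := ⟨hs.1, hs.2.trans_le hcε⟩
    obtain ⟨z, hz, hzs⟩ := hσh s hsε
    have h1 := hcb ⟨by
      rw [Metric.mem_ball, Real.dist_eq, sub_zero, abs_of_nonneg hs.1]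
      exact hs.2.trans_le hcc, hsε⟩ z hz hzs
    refine ⟨z, hz, h1.2.1, h1.2.2, hzs, ?_⟩
    have h2 := hMg ⟨h1.1, hz⟩
    simp only [mem_ofPred_eq] at h2
    rwa [sectorHeight_zero, sub_zero, h0', toPlane_eq hzs] at h2
  have hpos : ∀ z : ℝ × ℝ, z ∈ sectorModel → z.2 < δ →
      0 ≤ a * sectorHeight (toPlane h) e₁ z.2 := by
    intro z hz hzδ
    have := hmono.monotoneOn (⟨le_rfl, hδ0⟩ : (0 : ℝ) ∈ Ico 0 δ) ⟨hz.2.1, hzδ⟩ hz.2.1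
    simpa [sectorHeight_zero] using this
  -- Both signs make the same increment nonnegative, and it is nonzero at `c / 2`.
  have haa : a' = a := by
    have hc2 : c / 2 ∈ Ico 0 c := ⟨by linarith, by linarith⟩
    obtain ⟨z, hz, -, hzδ, -, heq⟩ := hex (c / 2) hc2
    have h1 := hstr (hsub ⟨le_rfl, hc⟩) (hsub hc2) (by linarith : (0 : ℝ) < c / 2)
    have h2 := hpos z hz hzδ
    rw [← heq] at h2
    simp only at h1
    rcases ha with rfl | rfl <;> rcases ha' with rfl | rfl <;> first | rfl | (exfalso; linarith)
  subst haa
  have hIco : Ico 0 c = (Ico 0 ε ∩ Ioo (0 - δ') (0 + δ')) ∩ Iio c := by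
    ext s
    exact ⟨fun hs => ⟨hsub hs, hs.2⟩, fun hs => ⟨hs.1.1.1, hs.2⟩⟩
  refine ⟨fun s => a' * (e (σ s)).im - a' * (e (σ 0)).im, c, hc, hcε, by simp,
    (hsm.mono hsub).sub contDiffOn_const, ?_, ?_, ?_⟩
  · intro s hs
    rw [derivWithin_sub_const, hIco, derivWithin_inter (Iio_mem_nhds hs.2)]
    exact hder s (hsub hs)
  · intro s hs s' hs' hss
    have := hstr (hsub hs) (hsub hs') hss
    simp only at this ⊢
    linarith
  · intro s hs
    obtain ⟨z, hz, hzN, hzδ, hzs, heq⟩ := hex s hs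
    exact ⟨z, hz, hzN, hzδ, hzs, by rw [← heq]; ring⟩

/-- The holonomy of a hyperbolic sector is a smooth diffeomorphism. -/
theorem sectorHolonomyIsDiffeo (hh : IsHyperbolicSector X U q h) :
    SectorHolonomyIsDiffeo X U h := by
  intro σ₁ σ₂ ε₁ ε₂ hε₁ hε₂ hσ₁ hσ₂ hin₁ hin₂ ⟨x₁, hx₁, h₁⟩ ⟨x₂, hx₂, h₂⟩
  have hg := hh.isRegularSector
  have hz1 : ((1, 0) : ℝ × ℝ) ∈ puncturedModel := ⟨⟨by norm_num, by norm_num⟩, by simp⟩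
  obtain ⟨e, he, hes⟩ := hT.covers _ (hg.mapsTo hz1)
  obtain ⟨δ, hδ0, -, hδ, a, ha, hmono⟩ := hT.exists_sectorHeight hg he hes
  have hp₁ : (x₁, (0 : ℝ)) ∈ puncturedModel :=
    ⟨⟨⟨hx₁.1, by linarith [hx₁.2]⟩, by norm_num⟩, by simp [hx₁.2.ne]⟩
  have hp₂ : (x₂, (0 : ℝ)) ∈ puncturedModel :=
    ⟨⟨⟨by linarith [hx₂.1], hx₂.2⟩, by norm_num⟩, by simp [hx₂.1.ne']⟩
  obtain ⟨f₁, c₁, hc₁, hcε₁, hf₁0, hf₁, hd₁, hm₁, hall₁⟩ := hT.transversal_sectorHeight hh he hδ0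
    hδ ha hmono hε₁ hσ₁ hin₁ hp₁ h₁ isOpen_Iio (show x₁ ∈ Iio 0 from hx₁.2)
  obtain ⟨f₂, c₂, hc₂, hcε₂, hf₂0, hf₂, hd₂, hm₂, hall₂⟩ := hT.transversal_sectorHeight hh he hδ0
    hδ ha hmono hε₂ hσ₂ hin₂ hp₂ h₂ isOpen_Ioi (show x₂ ∈ Ioi 0 from hx₂.1)
  have hc : 0 < min c₁ c₂ := lt_min hc₁ hc₂
  have hs₁ : Ico 0 (min c₁ c₂) ⊆ Ico 0 c₁ := Ico_subset_Ico_right (min_le_left _ _)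
  have hs₂ : Ico 0 (min c₁ c₂) ⊆ Ico 0 c₂ := Ico_subset_Ico_right (min_le_right _ _)
  have hder : ∀ (f : ℝ → ℝ) (c c' : ℝ), c ≤ c' →
      (∀ s ∈ Ico 0 c', 0 < derivWithin f (Ico 0 c') s) →
      ∀ s ∈ Ico 0 c, 0 < derivWithin f (Ico 0 c) s := by
    intro f c c' hcc hd s hs
    have : Ico 0 c = Ico 0 c' ∩ Iio c := by
      ext r
      exact ⟨fun hr => ⟨⟨hr.1, hr.2.trans_le hcc⟩, hr.2⟩, fun hr => ⟨hr.1.1, hr.2⟩⟩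
    rw [this, derivWithin_inter (Iio_mem_nhds hs.2)]
    exact hd s ⟨hs.1, hs.2.trans_le hcc⟩
  -- The holonomy preserves the ordinate of the model, so it is the map that matches the values of
  -- `f₁` and `f₂`.
  obtain ⟨δ₁, δ₂, φ, hδ₁, hδc₁, hδ₂, hδc₂, hφ, hdiff⟩ := exists_boundaryDiffeo hc hf₁0 (hf₁.mono hs₁)
    (hder f₁ _ _ (min_le_left _ _) hd₁) (hm₁.mono hs₁) hf₂0 (hf₂.mono hs₂)
    (hder f₂ _ _ (min_le_right _ _) hd₂) (hm₂.mono hs₂)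
  have hδc₁' := hδc₁.trans (min_le_left _ _)
  have hδc₂' := hδc₂.trans (min_le_right _ _)
  refine ⟨δ₁, δ₂, φ, hδ₁, hδc₁'.trans hcε₁, hδ₂, hδc₂'.trans hcε₂, fun s hs => ?_, hdiff⟩
  obtain ⟨hφs, hfs⟩ := hφ s hs
  refine ⟨hφs, ?_⟩
  have hsI : s ∈ Ico 0 c₁ := ⟨hs.1.le, hs.2.trans_le hδc₁'⟩
  obtain ⟨z, hz, hzN, hzδ, hzs, hzf⟩ := hall₁ s hsI
  obtain ⟨z', hz', hzN', hzδ', hzs', hzf'⟩ := hall₂ (φ s) ⟨hφs.1.le, hφs.2.trans_le hδc₂'⟩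
  have heq : z.2 = z'.2 := hmono.injOn ⟨hz.2.1, hzδ⟩ ⟨hz'.2.1, hzδ'⟩ (by
    rw [← hzf, ← hzf', hfs])
  have hpos : 0 < z.2 := by
    refine lt_of_le_of_ne hz.2.1 fun h0 => ?_
    have := hm₁ ⟨le_rfl, hc₁⟩ hsI hs.1
    rw [hf₁0, hzf, ← h0, sectorHeight_zero] at this
    simp at this
  obtain ⟨x, y⟩ := z
  obtain ⟨x', y'⟩ := z'
  simp only at heq hpos hzN hzN'
  subst heq
  have harc := hg.orbit y hz.2 x hz.1 x' hz'.1 (lt_trans hzN hzN') (Or.inl hpos)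
  rw [toPlane_eq hzs, toPlane_eq hzs'] at harc
  refine ⟨_, harc, ?_⟩
  rintro _ ⟨_, ⟨u, hu, rfl⟩, rfl⟩
  have hup := mem_puncturedModel_of_cond hz.2 hz.1 hz'.1 (Or.inl hpos) hu
  exact ⟨_, hup.1, (hh.toSphere_toPlane hup).symm⟩

end IsTranslationAtlas
end FlowBox


/-! ### Smooth primitives with a parameter; half discs filled by sectors -/

namespace FlowBox

open MeasureTheory in
/-- The primitive of a smooth function of two variables with respect to the first one. -/
theorem contDiff_primitive {g : ℝ × ℝ → ℝ} (hg : ContDiff ℝ ∞ g)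
    (h0 : ∀ s y, s ∉ Icc (-2 : ℝ) 2 → g (s, y) = 0) :
    ContDiff ℝ ∞ (fun w : ℝ × ℝ => ∫ s in (-2)..w.1, g (s, w.2)) := by
  -- The primitive is the convolution with the Heaviside function, so smoothness in the upper limit
  -- and the parameter follows from that of convolutions with a compactly supported factor.
  set f : ℝ → ℝ := (Ici 0).indicator 1 with hf
  have hint : ∀ y, Integrable (fun s => g (s, y)) := fun y => by
    refine Continuous.integrable_of_hasCompactSupport (hg.continuous.comp (by fun_prop)) ?_
    exact HasCompactSupport.intro isCompact_Icc fun s hs => h0 s y hs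
  have hfl : LocallyIntegrable f := by
    refine (locallyIntegrable_const (1 : ℝ)).indicator measurableSet_Ici
  have h1 := contDiffOn_convolution_right_with_param (𝕜 := ℝ) (n := ⊤) (μ := volume)
    (ContinuousLinearMap.mul ℝ ℝ) (g := fun y s => g (s, y)) isOpen_univ isCompact_Icc
    (fun y s _ hs => h0 s y hs) hfl
    (hg.comp (contDiff_snd.prodMk contDiff_fst)).contDiffOn
  rw [univ_prod_univ, contDiffOn_univ] at h1
  have h2 := h1.comp (contDiff_snd.prodMk contDiff_fst : ContDiff ℝ ∞ (Prod.swap : ℝ × ℝ → ℝ × ℝ))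
  convert h2 using 1
  ext ⟨u, y⟩
  symm
  have h3 : ∀ v ≤ (-2 : ℝ), ∫ s in Iic v, g (s, y) = 0 := by
    intro v hv
    rw [integral_Iic_eq_integral_Iio]
    exact setIntegral_eq_zero_of_forall_eq_zero fun s hs => h0 s y fun h => by
      have : s < v := hs
      linarith [h.1]
  have h4 := intervalIntegral.integral_Iic_sub_Iic (f := fun s => g (s, y)) (μ := volume)
    (a := -2) (b := u) (hint y).integrableOn (hint y).integrableOn
  rw [h3 _ le_rfl, sub_zero] at h4
  simp only [Function.comp_apply, convolution, ContinuousLinearMap.mul_apply']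
  rw [← h4, ← integral_indicator measurableSet_Iic,
    ← integral_sub_left_eq_self (fun s => (Iic u).indicator (fun s => g (s, y)) s) volume u]
  congr 1
  ext r
  by_cases hr : 0 ≤ r
  · simp [hf, hr]
  · simp [hf, hr]

variable {X : Plane → Plane} {U : Set Plane} {g : ℝ × ℝ → Plane} {x x' y t δ a : ℝ}
  {T : Set (OpenPartialHomeomorph Plane ℂ)} {e e' e₁ : OpenPartialHomeomorph Plane ℂ}
  {z z' z₀ : ℝ × ℝ}

namespace IsTranslationAtlas

variable (hT : IsTranslationAtlas X U T)
include hT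

/-- Near an inner point of a side, a sector fills a half disc; near an inner point, a disc. -/
theorem eventually_mem_sector (hg : IsRegularSector X U g) (he₁ : e₁ ∈ T)
    (hδ1 : δ ≤ 1) (hδ : ∀ y ∈ Icc (0 : ℝ) 1, y < δ → g (1, y) ∈ e₁.source)
    (hmono : StrictMonoOn (fun y => a * sectorHeight g e₁ y) (Ico 0 δ))
    (hz : z₀ ∈ puncturedModel) (hzδ : z₀.2 < δ) (hz1 : |z₀.1| < 1) (he : e ∈ T)
    (hze : g z₀ ∈ e.source) :
    ∀ᶠ p in 𝓝 (g z₀), (z₀.2 = 0 → 0 ≤ a * ((e p).im - (e (g z₀)).im)) →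
      ∃ z ∈ puncturedModel, g z = p ∧
        (e p).im - (e (g z₀)).im = sectorHeight g e₁ z.2 - sectorHeight g e₁ z₀.2 ∧
        z.2 < δ ∧ (z₀.2 = 0 → 0 < a * ((e p).im - (e (g z₀)).im) → 0 < z.2) := by
  obtain ⟨x₀, y₀⟩ := z₀
  obtain ⟨hx₀a, hx₀b⟩ := abs_lt.1 hz1
  simp only at hzδ hx₀a hx₀b ⊢
  have hy₀ : y₀ ∈ Icc (0 : ℝ) 1 := hz.1.2
  obtain ⟨ρ₁, hρ₁, hsrc, hall⟩ := hT.exists_sector_box hg he hz hze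
  have hger := hT.height_germ hg he₁ hδ hz hzδ he hze
  obtain ⟨ρ₂, hρ₂, hgerm⟩ := Metric.mem_nhdsWithin_iff.1 hger
  simp only at hsrc hall
  obtain ⟨ρ, hρ, hr1, hr2, hr3, hr4, hr5⟩ : ∃ ρ > 0, ρ < ρ₁ ∧ ρ < ρ₂ ∧ ρ < 1 - x₀ ∧ ρ < 1 + x₀ ∧
      ρ < δ - y₀ := by
    have hm : 0 < min (min ρ₁ ρ₂) (min (min (1 - x₀) (1 + x₀)) (δ - y₀)) := by
      refine lt_min (lt_min hρ₁ hρ₂) (lt_min (lt_min ?_ ?_) ?_) <;> linarith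
    obtain ⟨ρ, hρ0, hρm⟩ := exists_between hm
    rw [lt_min_iff, lt_min_iff, lt_min_iff, lt_min_iff] at hρm
    exact ⟨ρ, hρ0, hρm.1.1, hρm.1.2, hρm.2.1.1, hρm.2.1.2, hρm.2.2⟩
  -- the lower end of the interval of heights
  obtain ⟨y₁, hy₁0, hy₁, hy₁ρ, hy₁z⟩ : ∃ y₁, 0 ≤ y₁ ∧ y₁ ≤ y₀ ∧ y₀ - ρ ≤ y₁ ∧
      (y₀ ≠ 0 → y₁ < y₀) := by
    refine ⟨max 0 (y₀ - ρ), le_max_left _ _, max_le hy₀.1 (by linarith), le_max_right _ _, ?_⟩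
    intro hne
    exact max_lt (lt_of_le_of_ne hy₀.1 (Ne.symm hne)) (by linarith)
  have hyδ : ∀ y ∈ Icc y₁ (y₀ + ρ), y ∈ Ico 0 δ := fun y hy =>
    ⟨hy₁0.trans hy.1, by linarith [hy.2]⟩
  have hyI : ∀ y ∈ Icc y₁ (y₀ + ρ), y ∈ Icc (0 : ℝ) 1 := fun y hy =>
    ⟨hy₁0.trans hy.1, by linarith [hy.2]⟩
  have hxI : ∀ x ∈ Icc (x₀ - ρ) (x₀ + ρ), x ∈ Icc (-1 : ℝ) 1 := fun x hx =>
    ⟨by linarith [hx.1], by linarith [hx.2]⟩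
  have hbox : ∀ x ∈ Icc (x₀ - ρ) (x₀ + ρ), ∀ y ∈ Icc y₁ (y₀ + ρ),
      (x, y) ∈ puncturedModel ∧ g (x, y) ∈ e.source := fun x hx y hy =>
    hsrc (x, y) ⟨hxI x hx, hyI y hy⟩ ⟨by linarith [hx.1], by linarith [hx.2]⟩
      ⟨by linarith [hy.1], by linarith [hy.2]⟩
  have him : ∀ x ∈ Icc (x₀ - ρ) (x₀ + ρ), ∀ y ∈ Icc y₁ (y₀ + ρ),
      (e (g (x, y))).im - (e (g (x₀, y₀))).im = sectorHeight g e₁ y - sectorHeight g e₁ y₀ := by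
    intro x hx y hy
    refine hgerm ⟨?_, hxI x hx, hyI y hy⟩
    rw [Metric.mem_ball, Prod.dist_eq, max_lt_iff, Real.dist_eq, Real.dist_eq, abs_lt, abs_lt]
    refine ⟨⟨?_, ?_⟩, ?_, ?_⟩ <;> linarith [hx.1, hx.2, hy.1, hy.2]
  have hcont : ContinuousOn (fun z => (e (g z)).re)
      (Icc (x₀ - ρ) (x₀ + ρ) ×ˢ Icc y₁ (y₀ + ρ)) := by
    refine Complex.continuous_re.comp_continuousOn (e.continuousOn.comp (hg.continuousOn.mono ?_) ?_)
    · exact fun z hz => (hbox z.1 hz.1 z.2 hz.2).1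
    · exact fun z hz => (hbox z.1 hz.1 z.2 hz.2).2
  have hxl : x₀ - ρ ∈ Icc (x₀ - ρ) (x₀ + ρ) := ⟨le_rfl, by linarith⟩
  have hxm : x₀ ∈ Icc (x₀ - ρ) (x₀ + ρ) := ⟨by linarith, by linarith⟩
  have hxr : x₀ + ρ ∈ Icc (x₀ - ρ) (x₀ + ρ) := ⟨by linarith, le_rfl⟩
  have hym : y₀ ∈ Icc y₁ (y₀ + ρ) := ⟨hy₁, by linarith⟩
  have hlt : ∀ x ∈ Icc (x₀ - ρ) (x₀ + ρ), ∀ x' ∈ Icc (x₀ - ρ) (x₀ + ρ), x < x' →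
      (e (g (x, y₀))).re < (e (g (x', y₀))).re := by
    intro x hx x' hx' hxx
    obtain ⟨-, ⟨t, ht⟩, h⟩ := hall y₀ hy₀ (by constructor <;> linarith) x (hxI x hx)
      ⟨by linarith [hx.1], by linarith [hx.2]⟩ x' (hxI x' hx')
      ⟨by linarith [hx'.1], by linarith [hx'.2]⟩ hxx
    have := congrArg Complex.re (h t ht)
    simp at this
    linarith [ht.1]
  set c := (e (g (x₀, y₀))).re with hc
  -- The row at `y₀` overshoots by `2κ` on both sides and the ends of nearby rows move by less than
  -- `κ`. So every nearby row covers `(c - κ, c + κ)`: the intermediate value theorem gives first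
  -- the row of the point, then its abscissa.
  obtain ⟨κ, hκ, hκl, hκr⟩ : ∃ κ > 0, (e (g (x₀ - ρ, y₀))).re < c - 2 * κ ∧
      c + 2 * κ < (e (g (x₀ + ρ, y₀))).re := by
    have h1 := hlt _ hxl _ hxm (by linarith)
    have h2 := hlt _ hxm _ hxr (by linarith)
    refine ⟨min (c - (e (g (x₀ - ρ, y₀))).re) ((e (g (x₀ + ρ, y₀))).re - c) / 4, ?_, ?_, ?_⟩
    · have : 0 < min (c - (e (g (x₀ - ρ, y₀))).re) ((e (g (x₀ + ρ, y₀))).re - c) :=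
        lt_min (by linarith) (by linarith)
      linarith
    · have := min_le_left (c - (e (g (x₀ - ρ, y₀))).re) ((e (g (x₀ + ρ, y₀))).re - c)
      linarith
    · have := min_le_right (c - (e (g (x₀ - ρ, y₀))).re) ((e (g (x₀ + ρ, y₀))).re - c)
      linarith
  have hvert : ∀ x ∈ Icc (x₀ - ρ) (x₀ + ρ), ∃ r > 0, ∀ y ∈ Icc y₁ (y₀ + ρ), |y - y₀| < r →
      |(e (g (x, y))).re - (e (g (x, y₀))).re| < κ := by
    intro x hx
    have h1 : ContinuousOn (fun y : ℝ => (e (g (x, y))).re) (Icc y₁ (y₀ + ρ)) :=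
      hcont.comp (by fun_prop) fun y hy => ⟨hx, hy⟩
    exact Metric.continuousOn_iff.1 h1 y₀ hym κ hκ
  obtain ⟨r₁, hr₁, hv₁⟩ := hvert _ hxl
  obtain ⟨r₂, hr₂, hv₂⟩ := hvert _ hxr
  obtain ⟨r, hr, hra, hrb, hrc⟩ : ∃ r > 0, r < r₁ ∧ r < r₂ ∧ r ≤ ρ := by
    have hm : 0 < min (min r₁ r₂) ρ := lt_min (lt_min hr₁ hr₂) hρ
    refine ⟨min (min r₁ r₂) ρ / 2, by linarith, ?_, ?_, ?_⟩
    · linarith [(min_le_left (min r₁ r₂) ρ).trans (min_le_left _ _)]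
    · linarith [(min_le_left (min r₁ r₂) ρ).trans (min_le_right _ _)]
    · linarith [min_le_right (min r₁ r₂) ρ]
  -- the interval of heights that is used
  obtain ⟨y₂, hy₂, hy₂', hy₂r, hy₂z⟩ : ∃ y₂, y₁ ≤ y₂ ∧ y₂ ≤ y₀ ∧ y₀ - r ≤ y₂ ∧
      (y₀ ≠ 0 → y₂ < y₀) :=
    ⟨max y₁ (y₀ - r), le_max_left _ _, max_le hy₁ (by linarith), le_max_right _ _,
      fun hne => max_lt (hy₁z hne) (by linarith)⟩
  set η : ℝ → ℝ := fun y => a * sectorHeight g e₁ y with hη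
  have hηc : ContinuousOn η (Icc y₂ (y₀ + r)) :=
    continuousOn_const.mul ((continuousOn_sectorHeight hg hδ).mono fun y hy =>
      ⟨hyI y ⟨hy₂.trans hy.1, by linarith [hy.2]⟩, (hyδ y ⟨hy₂.trans hy.1, by linarith [hy.2]⟩).2⟩)
  have hIcc : ∀ y ∈ Icc y₂ (y₀ + r), y ∈ Icc y₁ (y₀ + ρ) := fun y hy =>
    ⟨hy₂.trans hy.1, by linarith [hy.2]⟩
  have hup : η y₀ < η (y₀ + r) := hmono (hyδ _ hym) (hyδ _ (hIcc _ ⟨by linarith, le_rfl⟩))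
    (by linarith)
  have hlow : y₀ ≠ 0 → η y₂ < η y₀ := fun hne =>
    hmono (hyδ _ (hIcc _ ⟨le_rfl, by linarith⟩)) (hyδ _ hym) (hy₂z hne)
  have ha : a ≠ 0 := by
    rintro rfl
    simp [hη] at hup
  have hec : Tendsto e (𝓝 (g (x₀, y₀))) (𝓝 (e (g (x₀, y₀)))) := e.continuousAt hze
  have hre : Tendsto (fun p => (e p).re) (𝓝 (g (x₀, y₀))) (𝓝 c) :=
    (Complex.continuous_re.tendsto _).comp hec
  have hht : Tendsto (fun p => η y₀ + a * ((e p).im - (e (g (x₀, y₀))).im)) (𝓝 (g (x₀, y₀)))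
      (𝓝 (η y₀)) := by
    have h1 := (((Complex.continuous_im.tendsto _).comp hec).sub_const
      (e (g (x₀, y₀))).im).const_mul a |>.const_add (η y₀)
    simpa using h1
  have hE1 : ∀ᶠ p in 𝓝 (g (x₀, y₀)), y₀ ≠ 0 → η y₂ < η y₀ + a * ((e p).im - (e (g (x₀, y₀))).im) := by
    by_cases hne : y₀ = 0
    · simp [hne]
    · filter_upwards [hht.eventually (lt_mem_nhds (hlow hne))] with p hp _ using hp
  filter_upwards [e.open_source.mem_nhds hze, hre.eventually (Ioo_mem_nhds (by linarith : c - κ < c)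
    (by linarith : c < c + κ)), hht.eventually (gt_mem_nhds hup), hE1] with p hp hpre hpu hpl h0
  have hmem : η y₀ + a * ((e p).im - (e (g (x₀, y₀))).im) ∈ Icc (η y₂) (η (y₀ + r)) := by
    refine ⟨?_, hpu.le⟩
    by_cases hne : y₀ = 0
    · have : y₂ = y₀ := le_antisymm hy₂' (by rw [hne]; exact hy₁0.trans hy₂)
      rw [this]
      linarith [h0 hne]
    · exact (hpl hne).le
  obtain ⟨y, hy, hyη⟩ := intermediate_value_Icc (by linarith : y₂ ≤ y₀ + r) hηc hmem
  have hy' := hIcc y hy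
  have habs : |y - y₀| ≤ r := by rw [abs_le]; constructor <;> linarith [hy.1, hy.2]
  have hw₁ := abs_lt.1 (hv₁ y hy' (by linarith))
  have hw₂ := abs_lt.1 (hv₂ y hy' (by linarith))
  have hhc : ContinuousOn (fun x : ℝ => (e (g (x, y))).re) (Icc (x₀ - ρ) (x₀ + ρ)) :=
    hcont.comp (by fun_prop) fun x hx => ⟨hx, hy'⟩
  obtain ⟨x, hx, hxe⟩ := intermediate_value_Icc (by linarith : x₀ - ρ ≤ x₀ + ρ) hhc
    (⟨by linarith [hw₁.2, hpre.1], by linarith [hw₂.1, hpre.2]⟩ :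
      (e p).re ∈ Icc (e (g (x₀ - ρ, y))).re (e (g (x₀ + ρ, y))).re)
  have hyh : (e p).im - (e (g (x₀, y₀))).im = sectorHeight g e₁ y - sectorHeight g e₁ y₀ := by
    refine mul_left_cancel₀ ha ?_
    simp only [hη] at hyη
    linarith
  refine ⟨(x, y), (hbox x hx y hy').1, ?_, hyh, (hyδ y hy').2, ?_⟩
  · refine e.injOn (hbox x hx y hy').2 hp (Complex.ext hxe ?_)
    linarith [him x hx y hy']
  · intro hz0 hpos
    refine lt_of_le_of_ne (hyδ y hy').1 fun hy0 => ?_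
    simp only at hy0
    rw [hyh, ← hy0, hz0] at hpos
    simp at hpos

end IsTranslationAtlas
end FlowBox


/-! ### Frames of multi-saddles and gluing over the sectors -/

namespace FlowBox

/-- The inner part of the model sector, up to the height `δ`. -/
def cell (δ : ℝ) : Set (ℝ × ℝ) := {z | z ∈ puncturedModel ∧ |z.1| < 1 ∧ z.2 < δ}

/-- The sectors of a multi-saddle, with straightening charts at the ends of the outgoing
separatrices in which the heights of the sectors are monotone below `δ`. -/
structure SaddleFrame (X : Plane → Plane) (U : Set Plane) (T : Set (OpenPartialHomeomorph Plane ℂ))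
    (q : Sphere) (k : ℕ) (h : ℕ → ℝ × ℝ → Sphere) (e : ℕ → OpenPartialHomeomorph Plane ℂ)
    (a : ℕ → ℝ) (δ : ℝ) : Prop where
  period : ∀ i, h (i + (2 * k + 2)) = h i
  sector : ∀ i, IsHyperbolicSector X U q (h i)
  outgoing : ∀ i, Even i → ∀ x ∈ Icc (0 : ℝ) 1, h i (x, 0) = h (i + 1) (x, 0)
  incoming : ∀ i, Odd i → ∀ x ∈ Icc (-1 : ℝ) 0, h i (x, 0) = h (i + 1) (x, 0)
  disjoint : ∀ i j, i % (2 * k + 2) ≠ j % (2 * k + 2) → ∀ z ∈ sectorModel, ∀ w ∈ sectorModel,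
    h i z = h j w → z.2 = 0 ∧ w.2 = 0
  nhds : (⋃ i ∈ Finset.range (2 * k + 2), h i '' sectorModel) ∈ 𝓝 q
  chart_mem : ∀ i, e i ∈ T
  chart_period : ∀ i, e (i + (2 * k + 2)) = e i
  chart_even : ∀ i, Even i → e (i + 1) = e i
  pos : 0 < δ
  le_one : δ ≤ 1
  chart_source : ∀ i, ∀ y ∈ Icc (0 : ℝ) 1, y < δ → toPlane (h i) (1, y) ∈ (e i).source
  sign : ∀ i, a i = 1 ∨ a i = -1
  mono : ∀ i, StrictMonoOn (fun y => a i * sectorHeight (toPlane (h i)) (e i) y) (Ico 0 δ)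

/-- The sectors `i` and `l = i + 1` share the point at `(x, 0)`. -/
def SharesSide (i l : ℕ) (x : ℝ) : Prop := l = i + 1 ∧ (Even i ∧ 0 < x ∨ Odd i ∧ x < 0)

theorem exists_sharesSide (k i : ℕ) {x : ℝ} (hx : x ≠ 0) :
    ∃ i' l, i' % (2 * k + 2) = i % (2 * k + 2) ∧ (SharesSide i' l x ∨ SharesSide l i' x) := by
  rcases lt_or_gt_of_ne hx with h | h <;> rcases Nat.even_or_odd i with hi | hi
  -- The partner is the preceding sector; adding a period avoids subtracting from `0`.
  · refine ⟨i + (2 * k + 2), i + (2 * k + 1), by simp, Or.inr ⟨by ring, Or.inr ⟨?_, h⟩⟩⟩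
    rw [Nat.odd_iff]; rw [Nat.even_iff] at hi; omega
  · exact ⟨i, i + 1, rfl, Or.inl ⟨rfl, Or.inr ⟨hi, h⟩⟩⟩
  · exact ⟨i, i + 1, rfl, Or.inl ⟨rfl, Or.inl ⟨hi, h⟩⟩⟩
  · refine ⟨i, i - 1, rfl, Or.inr ⟨?_, Or.inl ⟨?_, h⟩⟩⟩
    · rw [Nat.odd_iff] at hi; omega
    · rw [Nat.even_iff]; rw [Nat.odd_iff] at hi; omega

/-- The period is even, so reduction keeps the parity, and consecutive numbers differ in it. This
includes `k = 0`, where the same two sectors meet along both separatrices. -/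
theorem SharesSide.mod_ne {i l : ℕ} {x : ℝ} (h : SharesSide i l x) (k : ℕ) :
    i % (2 * k + 2) ≠ l % (2 * k + 2) := by
  intro heq
  have hd : 2 ∣ 2 * k + 2 := ⟨k + 1, by ring⟩
  have := congrArg (· % 2) heq
  simp only [Nat.mod_mod_of_dvd _ hd] at this
  have := h.1
  omega

variable {X : Plane → Plane} {U : Set Plane} {x x' y t δ : ℝ}
  {T : Set (OpenPartialHomeomorph Plane ℂ)} {q : Sphere} {k : ℕ} {h : ℕ → ℝ × ℝ → Sphere}
  {e : ℕ → OpenPartialHomeomorph Plane ℂ} {a : ℕ → ℝ} {c : OpenPartialHomeomorph Plane ℂ}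
  {z z' z₀ : ℝ × ℝ} {p : Plane} {i l m : ℕ}

theorem eq_of_mod_eq {α : Type*} {F : ℕ → α} (hF : ∀ i, F (i + (2 * k + 2)) = F i)
    (h : i % (2 * k + 2) = m % (2 * k + 2)) : F i = F m := by
  have hp : Function.Periodic F (2 * k + 2) := hF
  rw [← hp.map_mod_nat i, ← hp.map_mod_nat m, h]

theorem cell_mem_nhdsWithin (hz : z ∈ cell δ) : cell δ ∈ 𝓝[sectorModel] z := by
  have h1 : IsOpen ({z : ℝ × ℝ | |z.1| < 1} ∩ {z | z.2 < δ} ∩ {(0, 0)}ᶜ) :=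
    ((isOpen_lt (by fun_prop) continuous_const).inter
      (isOpen_lt continuous_snd continuous_const)).inter isOpen_compl_singleton
  filter_upwards [self_mem_nhdsWithin, nhdsWithin_le_nhds (h1.mem_nhds ⟨⟨hz.2.1, hz.2.2⟩, hz.1.2⟩)]
    with w hw hw' using ⟨⟨hw, hw'.2⟩, hw'.1⟩

theorem mem_cell_of_ne_zero (hδ : 0 < δ) (hx : |x| < 1) (hx0 : x ≠ 0) :
    (x, 0) ∈ cell δ := by
  obtain ⟨h1, h2⟩ := abs_lt.1 hx
  exact ⟨⟨⟨⟨h1.le, h2.le⟩, by norm_num⟩, by simp [hx0]⟩, hx, hδ⟩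

namespace SaddleFrame

variable (hF : SaddleFrame X U T q k h e a δ)
include hF

theorem regular (i : ℕ) : IsRegularSector X U (toPlane (h i)) := (hF.sector i).isRegularSector

theorem toPlane_mem (hz : z ∈ cell δ) : toPlane (h i) z ∈ U := (hF.sector i).toPlane_mem hz.1

theorem sharesSide_eq (hs : SharesSide i l x) (hx : |x| ≤ 1) : h i (x, 0) = h l (x, 0) := by
  obtain ⟨rfl, h⟩ := hs
  obtain ⟨h1, h2⟩ := abs_le.1 hx
  rcases h with ⟨hi, hx⟩ | ⟨hi, hx⟩
  · exact hF.outgoing i hi x ⟨hx.le, h2⟩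
  · exact hF.incoming i hi x ⟨h1, hx.le⟩

theorem sharesSide_toPlane_eq (hs : SharesSide i l x) (hx : |x| ≤ 1) :
    toPlane (h i) (x, 0) = toPlane (h l) (x, 0) := by
  rw [toPlane, toPlane, hF.sharesSide_eq hs hx]

theorem eventually_mem_sector (hT : IsTranslationAtlas X U T) (hz : z ∈ cell δ) (hc : c ∈ T)
    (hzc : toPlane (h i) z ∈ c.source) :
    ∀ᶠ p in 𝓝 (toPlane (h i) z), (z.2 = 0 → 0 ≤ a i * ((c p).im - (c (toPlane (h i) z)).im)) →
      ∃ w ∈ sectorModel, h i w = toSphere p ∧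
        (z.2 = 0 → 0 < a i * ((c p).im - (c (toPlane (h i) z)).im) → 0 < w.2) := by
  filter_upwards [hT.eventually_mem_sector (hF.regular i) (hF.chart_mem i) hF.le_one
    (hF.chart_source i) (hF.mono i) hz.1 hz.2.2 hz.2.1 hc hzc] with p hp h0
  obtain ⟨w, hw, hwp, -, -, hpos⟩ := hp h0
  exact ⟨w, hw.1, by rw [← hwp, (hF.sector i).toSphere_toPlane hw], hpos⟩

/-- With equal signs both sectors would fill the same half disc along the common separatrix, so a
point at positive height of one would lie in the other, against `disjoint`. -/
theorem sign_sharesSide (hT : IsTranslationAtlas X U T) (hs : SharesSide i l x) (hx : |x| < 1) :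
    a l = -a i := by
  by_contra hne
  have hal : a l = a i := by
    rcases hF.sign i with h1 | h1 <;> rcases hF.sign l with h2 | h2 <;> simp_all
  have hx0 : x ≠ 0 := by
    rcases hs.2 with h | h
    · exact h.2.ne'
    · exact h.2.ne
  have hz : (x, 0) ∈ cell δ := mem_cell_of_ne_zero hF.pos hx hx0
  obtain ⟨c, hc, hzc⟩ := hT.covers _ (hF.toPlane_mem (i := i) hz)
  have heq := hF.sharesSide_toPlane_eq hs hx.le
  have h1 := hF.eventually_mem_sector hT (i := i) hz hc hzc
  have h2 := hF.eventually_mem_sector hT (i := l) hz hc (by rwa [← heq])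
  rw [← heq, hal] at h2
  set p := toPlane (h i) (x, 0)
  have hline : Tendsto (fun s : ℝ => c.symm (c p + ((a i * s : ℝ) : ℂ) * Complex.I)) (𝓝 0) (𝓝 p) := by
    have h3 : Tendsto (fun s : ℝ => c p + ((a i * s : ℝ) : ℂ) * Complex.I) (𝓝 0) (𝓝 (c p)) :=
      Continuous.tendsto' (by fun_prop) _ _ (by simp)
    have h4 := (c.continuousAt_symm (c.map_source hzc)).tendsto.comp h3
    rwa [c.left_inv hzc] at h4
  have htar : ∀ᶠ s : ℝ in 𝓝 0, c p + ((a i * s : ℝ) : ℂ) * Complex.I ∈ c.target := by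
    have h3 : Tendsto (fun s : ℝ => c p + ((a i * s : ℝ) : ℂ) * Complex.I) (𝓝 0) (𝓝 (c p)) :=
      Continuous.tendsto' (by fun_prop) _ _ (by simp)
    exact h3.eventually (c.open_target.mem_nhds (c.map_source hzc))
  have hev := (hline.eventually (h1.and h2)).and htar
  obtain ⟨s, ⟨⟨hs1, hs2⟩, hst⟩, hspos⟩ :=
    ((hev.filter_mono nhdsWithin_le_nhds).and (self_mem_nhdsWithin (s := Ioi (0 : ℝ)))).exists
  have hspos' : (0 : ℝ) < s := hspos
  have him : a i * ((c (c.symm (c p + ((a i * s : ℝ) : ℂ) * Complex.I))).im - (c p).im) = s := by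
    rw [c.right_inv hst]
    rcases hF.sign i with h3 | h3 <;> simp [h3]
  rw [him] at hs1 hs2
  obtain ⟨w, hw, hwp, hwpos⟩ := hs1 fun _ => hspos'.le
  obtain ⟨w', hw', hwp', -⟩ := hs2 fun _ => hspos'.le
  have := hF.disjoint i l (hs.mod_ne k) w hw w' hw' (by rw [hwp, hwp'])
  exact (hwpos rfl hspos').ne' this.1

theorem sign_succ (hT : IsTranslationAtlas X U T) (i : ℕ) : a (i + 1) = -a i := by
  rcases Nat.even_or_odd i with hi | hi
  · exact hF.sign_sharesSide hT (x := 1 / 2) ⟨rfl, Or.inl ⟨hi, by norm_num⟩⟩ (by rw [abs_lt]; norm_num)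
  · exact hF.sign_sharesSide hT (x := -(1 / 2)) ⟨rfl, Or.inr ⟨hi, by norm_num⟩⟩
      (by rw [abs_lt]; norm_num)

theorem sign_eq (hT : IsTranslationAtlas X U T) (i : ℕ) : a i = (-1) ^ i * a 0 := by
  induction i with
  | zero => simp
  | succ i ih => rw [hF.sign_succ hT, ih, pow_succ]; ring

theorem sign_mod (hT : IsTranslationAtlas X U T) (h : i % (2 * k + 2) = m % (2 * k + 2)) :
    a i = a m := by
  refine eq_of_mod_eq (fun i => ?_) h
  rw [hF.sign_eq hT, hF.sign_eq hT i, pow_add, show 2 * k + 2 = 2 * (k + 1) by ring, pow_mul]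
  simp

/-- Any point of a sector near `toPlane (h i) z` lies in the sector `i` or in the one that shares
the separatrix. -/
theorem exists_partner (hT : IsTranslationAtlas X U T) (hz : z ∈ cell δ) :
    ∃ i' l, i' % (2 * k + 2) = i % (2 * k + 2) ∧
      (z.2 = 0 → (SharesSide i' l z.1 ∨ SharesSide l i' z.1)) ∧
      ∀ᶠ p in 𝓝 (toPlane (h i) z), (∃ w ∈ sectorModel, h i w = toSphere p) ∨
        z.2 = 0 ∧ ∃ w ∈ sectorModel, h l w = toSphere p := by
  obtain ⟨c, hc, hzc⟩ := hT.covers _ (hF.toPlane_mem (i := i) hz)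
  have h1 := hF.eventually_mem_sector hT (i := i) hz hc hzc
  by_cases hz0 : z.2 = 0
  · have hx0 : z.1 ≠ 0 := fun h0 => hz.1.2 (Prod.ext h0 hz0)
    obtain ⟨i', l, hmod, hs⟩ := exists_sharesSide k i hx0
    have hi' : h i' = h i := eq_of_mod_eq hF.period hmod
    have hai : a i' = a i := hF.sign_mod hT hmod
    have hal : a l = -a i := by
      rcases hs with hs | hs
      · rw [hF.sign_sharesSide hT hs hz.2.1, hai]
      · have := hF.sign_sharesSide hT hs hz.2.1
        rw [← hai]; linarith
    have hzz : z = (z.1, 0) := Prod.ext rfl hz0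
    have heq : toPlane (h i) z = toPlane (h l) z := by
      rw [hzz, ← hi']
      rcases hs with hs | hs
      · exact hF.sharesSide_toPlane_eq hs hz.2.1.le
      · exact (hF.sharesSide_toPlane_eq hs hz.2.1.le).symm
    have h2 := hF.eventually_mem_sector hT (i := l) hz hc (by rwa [← heq])
    rw [← heq, hal] at h2
    refine ⟨i', l, hmod, fun _ => hs, ?_⟩
    filter_upwards [h1, h2] with p hp1 hp2
    -- The two sectors fill the two opposite half discs, because their signs are opposite.
    rcases le_total 0 (a i * ((c p).im - (c (toPlane (h i) z)).im)) with h3 | h3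
    · obtain ⟨w, hw, hwp, -⟩ := hp1 fun _ => h3
      exact Or.inl ⟨w, hw, hwp⟩
    · obtain ⟨w, hw, hwp, -⟩ := hp2 fun _ => by linarith
      exact Or.inr ⟨hz0, w, hw, hwp⟩
  · refine ⟨i, i, rfl, fun h0 => absurd h0 hz0, ?_⟩
    filter_upwards [h1] with p hp
    obtain ⟨w, hw, hwp, -⟩ := hp fun h0 => absurd h0 hz0
    exact Or.inl ⟨w, hw, hwp⟩

/-- Data on the sectors that agree on the shared separatrices agree at all common points. -/
theorem compat (hT : IsTranslationAtlas X U T) {α : Type*} {f : ℕ → ℝ × ℝ → α}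
    (hf : ∀ i, f (i + (2 * k + 2)) = f i)
    (hfs : ∀ i l x, SharesSide i l x → |x| < 1 → f i (x, 0) = f l (x, 0))
    (hz : z ∈ cell δ) (hz' : z' ∈ sectorModel) (heq : h i z = h m z') :
    z = z' ∧ f i z = f m z' := by
  by_cases him : i % (2 * k + 2) = m % (2 * k + 2)
  · have h1 : z = z' := (hF.sector m).inj hz.1.1 hz' (by
      rw [← heq, eq_of_mod_eq hF.period him])
    exact ⟨h1, by rw [h1, eq_of_mod_eq hf him]⟩
  obtain ⟨hz0, hz0'⟩ := hF.disjoint i m him z hz.1.1 z' hz' heq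
  obtain ⟨i', l, hmod, hs, hev⟩ := hF.exists_partner hT (i := i) hz
  replace hs := hs hz0
  have hzz : z = (z.1, 0) := Prod.ext rfl hz0
  have hx0 : z.1 ≠ 0 := fun h0 => hz.1.2 (Prod.ext h0 hz0)
  have hhl : h i z = h l z ∧ f i z = f l z := by
    rw [← eq_of_mod_eq hF.period hmod, ← eq_of_mod_eq hf hmod, hzz]
    rcases hs with hs | hs
    · exact ⟨hF.sharesSide_eq hs hz.2.1.le, hfs _ _ _ hs hz.2.1⟩
    · exact ⟨(hF.sharesSide_eq hs hz.2.1.le).symm, (hfs _ _ _ hs hz.2.1).symm⟩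
  by_cases hlm : l % (2 * k + 2) = m % (2 * k + 2)
  · have h1 : z = z' := (hF.sector m).inj hz.1.1 hz' (by
      rw [← heq, hhl.1, eq_of_mod_eq hF.period hlm])
    exact ⟨h1, by rw [hhl.2, h1, eq_of_mod_eq hf hlm]⟩
  -- A third sector through the same point would contain, arbitrarily close to it, points of
  -- positive height; these are covered by the sectors `i` and `l`, which meet the sector `m` only
  -- at height zero.
  exfalso
  have hzp' : z' ∈ puncturedModel := by
    refine ⟨hz', fun h0 => ?_⟩
    rw [mem_singleton_iff.1 h0, (hF.sector m).vertex, ← (hF.sector i).vertex] at heq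
    exact hz.1.2 ((hF.sector i).inj hz.1.1 (by simp [sectorModel]) heq)
  have hpp : toPlane (h m) z' = toPlane (h i) z := by rw [toPlane, toPlane, heq]
  rw [← hpp] at hev
  have hmap : Tendsto (fun y : ℝ => toPlane (h m) (z'.1, y)) (𝓝[>] 0) (𝓝 (toPlane (h m) z')) := by
    have h1 := (hF.regular m).continuousOn z' hzp'
    refine h1.tendsto.comp (tendsto_nhdsWithin_iff.2 ⟨?_, ?_⟩)
    · exact (Continuous.tendsto' (f := fun y : ℝ => (z'.1, y)) (by fun_prop) 0 z'
        (Prod.ext rfl hz0'.symm)).mono_left nhdsWithin_le_nhds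
    · filter_upwards [Ioo_mem_nhdsGT (zero_lt_one' ℝ)] with y hy
      exact ⟨⟨hz'.1, hy.1.le, hy.2.le⟩, fun h0 => hy.1.ne' (Prod.ext_iff.1 h0).2⟩
  obtain ⟨y, hy, hy01⟩ := ((hmap.eventually hev).and (Ioo_mem_nhdsGT (zero_lt_one' ℝ))).exists
  have hyp : (z'.1, y) ∈ puncturedModel :=
    ⟨⟨hz'.1, hy01.1.le, hy01.2.le⟩, fun h0 => hy01.1.ne' (Prod.ext_iff.1 h0).2⟩
  rw [(hF.sector m).toSphere_toPlane hyp] at hy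
  rcases hy with ⟨w, hw, hwe⟩ | ⟨-, w, hw, hwe⟩
  · exact hy01.1.ne' (hF.disjoint i m him w hw _ hyp.1 hwe).2
  · exact hy01.1.ne' (hF.disjoint l m hlm w hw _ hyp.1 hwe).2

theorem compat_toPlane (hT : IsTranslationAtlas X U T) {α : Type*} {f : ℕ → ℝ × ℝ → α}
    (hf : ∀ i, f (i + (2 * k + 2)) = f i)
    (hfs : ∀ i l x, SharesSide i l x → |x| < 1 → f i (x, 0) = f l (x, 0))
    (hz : z ∈ cell δ) (hz' : z' ∈ puncturedModel) (heq : toPlane (h i) z = toPlane (h m) z') :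
    z = z' ∧ f i z = f m z' :=
  hF.compat hT hf hfs hz hz'.1 (by
    rw [← (hF.sector i).toSphere_toPlane hz.1, heq, (hF.sector m).toSphere_toPlane hz'])

/-- A property of the points near an inner point of the saddle can be tested in the sectors. -/
theorem eventually_of_sectors (hT : IsTranslationAtlas X U T) (hz : z ∈ cell δ) {Q : Plane → Prop}
    (H : ∀ m, toPlane (h m) z = toPlane (h i) z →
      ∀ᶠ w in 𝓝[sectorModel] z, Q (toPlane (h m) w)) :
    ∀ᶠ p in 𝓝 (toPlane (h i) z), Q p := by
  have key : ∀ m, ∀ᶠ p in 𝓝 (toPlane (h i) z), ∀ w ∈ sectorModel, h m w = toSphere p → Q p := by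
    intro m
    obtain ⟨N, hN, hzN, hNQ⟩ : ∃ N : Set (ℝ × ℝ), IsOpen N ∧
        (∀ w ∈ sectorModel, h m w = h i z → w ∈ N) ∧
        ∀ w ∈ sectorModel, w ∈ N → Q (toPlane (h m) w) := by
      by_cases hm : toPlane (h m) z = toPlane (h i) z
      · obtain ⟨N, hN, hzN, hsub⟩ := mem_nhdsWithin.1 (H m hm)
        refine ⟨N, hN, fun w hw hwz => ?_, fun w hw hwN => hsub ⟨hwN, hw⟩⟩
        rwa [← (hF.compat hT (f := fun _ _ => ()) (fun _ => rfl) (fun _ _ _ _ _ => rfl) hz hw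
          hwz.symm).1]
      -- By `compat` a sector can reach the point only with the parameter `z`. If it does not, it
      -- misses the point altogether.
      · refine ⟨∅, isOpen_empty, fun w hw hwz => ?_, fun w _ hwN => absurd hwN (notMem_empty w)⟩
        have := (hF.compat hT (f := fun _ _ => ()) (fun _ => rfl) (fun _ _ _ _ _ => rfl) hz hw
          hwz.symm).1
        exact absurd (by rw [toPlane, toPlane, this, hwz, this]) hm
    have h1 := eventually_mem_of_isCompact isCompact_sectorModel (hF.sector m).continuousOn hN hzN
    rw [← (hF.sector i).toSphere_toPlane hz.1] at h1
    filter_upwards [(isOpenEmbedding_toSphere.continuous.tendsto _).eventually h1] with p hp w hw hwp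
    have := hNQ w hw (hp w hw hwp)
    rwa [toPlane_eq hwp] at this
  obtain ⟨i', l, -, -, hev⟩ := hF.exists_partner hT (i := i) hz
  filter_upwards [hev, key i, key l] with p hp h1 h2
  rcases hp with ⟨w, hw, hwp⟩ | ⟨-, w, hw, hwp⟩
  · exact h1 w hw hwp
  · exact h2 w hw hwp

open Classical in
/-- Compatible functions on the sectors define a function on the plane. -/
theorem exists_glued (hT : IsTranslationAtlas X U T) {α : Type*} [Inhabited α] {f : ℕ → ℝ × ℝ → α}
    (hf : ∀ i, f (i + (2 * k + 2)) = f i)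
    (hfs : ∀ i l x, SharesSide i l x → |x| < 1 → f i (x, 0) = f l (x, 0)) :
    ∃ φ : Plane → α, ∀ i, ∀ z ∈ cell δ, φ (toPlane (h i) z) = f i z := by
  refine ⟨fun p => if hp : ∃ iz : ℕ × ℝ × ℝ, iz.2 ∈ cell δ ∧ toPlane (h iz.1) iz.2 = p then
    f hp.choose.1 hp.choose.2 else default, fun i z hz => ?_⟩
  have hp : ∃ iz : ℕ × ℝ × ℝ, iz.2 ∈ cell δ ∧ toPlane (h iz.1) iz.2 = toPlane (h i) z :=
    ⟨(i, z), hz, rfl⟩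
  simp only [dif_pos hp]
  exact (hF.compat_toPlane hT hf hfs hp.choose_spec.1 hz.1 hp.choose_spec.2).2

end SaddleFrame

/-- The chart is chosen as a function of the end point of the outgoing separatrix, so it is
automatically periodic and common to the two sectors that share this separatrix. The signs are read
at the residue of `i`, since a common height bound exists only for finitely many sectors. -/
theorem IsTranslationAtlas.exists_saddleFrame (hT : IsTranslationAtlas X U T)
    (hk : ∀ i, h (i + (2 * k + 2)) = h i) (hs : ∀ i, IsHyperbolicSector X U q (h i))
    (hout : ∀ i, Even i → ∀ x ∈ Icc (0 : ℝ) 1, h i (x, 0) = h (i + 1) (x, 0))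
    (hin : ∀ i, Odd i → ∀ x ∈ Icc (-1 : ℝ) 0, h i (x, 0) = h (i + 1) (x, 0))
    (hd : ∀ i j, i % (2 * k + 2) ≠ j % (2 * k + 2) → ∀ z ∈ sectorModel, ∀ w ∈ sectorModel,
      h i z = h j w → z.2 = 0 ∧ w.2 = 0)
    (hn : (⋃ i ∈ Finset.range (2 * k + 2), h i '' sectorModel) ∈ 𝓝 q) :
    ∃ e a δ, SaddleFrame X U T q k h e a δ := by
  have : Nonempty (OpenPartialHomeomorph Plane ℂ) := ⟨OpenPartialHomeomorph.refl ℂ⟩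
  choose! c hc hcs using hT.covers
  have h1 : ((1, 0) : ℝ × ℝ) ∈ puncturedModel := ⟨⟨by norm_num, by norm_num⟩, by simp⟩
  have hU : ∀ i, toPlane (h i) (1, 0) ∈ U := fun i => (hs i).toPlane_mem h1
  set e : ℕ → OpenPartialHomeomorph Plane ℂ := fun i => c (toPlane (h i) (1, 0)) with he
  have hex := fun i => hT.exists_sectorHeight (hs i).isRegularSector (hc _ (hU i)) (hcs _ (hU i))
  choose δ hδ hδ1 hsrc a ha hmono using hex
  have hper : ∀ i, h (i % (2 * k + 2)) = h i := fun i => eq_of_mod_eq hk (Nat.mod_mod _ _)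
  obtain ⟨d, hd0, hdδ⟩ : ∃ d > 0, ∀ i < 2 * k + 2, d ≤ δ i := by
    have hev : ∀ᶠ d in 𝓝[>] (0 : ℝ), ∀ i ∈ Finset.range (2 * k + 2), d ≤ δ i := by
      rw [eventually_all_finset]
      intro i _
      filter_upwards [Ioo_mem_nhdsGT (hδ i)] with d hd using hd.2.le
    obtain ⟨d, hd, hd0⟩ := (hev.and self_mem_nhdsWithin).exists
    exact ⟨d, hd0, fun i hi => hd i (Finset.mem_range.2 hi)⟩
  have hlt : ∀ i, i % (2 * k + 2) < 2 * k + 2 := fun i => Nat.mod_lt _ (by omega)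
  refine ⟨e, fun i => a (i % (2 * k + 2)), d, ?_⟩
  refine ⟨hk, hs, hout, hin, hd, hn, fun i => hc _ (hU i), fun i => ?_, fun i hi => ?_, hd0,
    (hdδ 0 (by omega)).trans (hδ1 0), fun i y hy hyd => ?_, fun i => ha _, fun i => ?_⟩
  · simp only [he, hk]
  · simp only [he, toPlane, hout i hi 1 (by norm_num)]
  · have := hsrc (i % (2 * k + 2)) y hy (hyd.trans_le (hdδ _ (hlt i)))
    rw [hper] at this
    exact this
  · have := (hmono (i % (2 * k + 2))).mono (Ico_subset_Ico_right (hdδ _ (hlt i)))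
    rw [hper] at this
    exact this

end FlowBox


/-! ### Developing maps across the outgoing separatrices -/

namespace FlowBox

open Classical in
/-- The developing map of the sector `i` of a saddle on the trajectories ending at the side `x = 1`,
with the number of the outgoing separatrix of the sector. -/
noncomputable def outgoingData (X : Plane → Plane) (U : Set Plane) (k : ℕ)
    (h : ℕ → ℝ × ℝ → Sphere) (e : ℕ → OpenPartialHomeomorph Plane ℂ) (i : ℕ) (z : ℝ × ℝ) :
    Option (ℂ × ℕ) :=
  if 0 < z.2 ∨ 0 < z.1 then some (dev X U (toPlane (h i)) (e i) z, i % (2 * k + 2) / 2) else none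

/-- The values of the developing maps in the part `-y < x` of the two sectors with the outgoing
separatrix `j`. -/
def outgoingRange (X : Plane → Plane) (U : Set Plane) (k : ℕ) (h : ℕ → ℝ × ℝ → Sphere)
    (e : ℕ → OpenPartialHomeomorph Plane ℂ) (δ : ℝ) (j : ℕ) : Set ℂ :=
  {w | ∃ m z, z ∈ cell δ ∧ -z.2 < z.1 ∧ outgoingData X U k h e m z = some (w, j)}

variable {X : Plane → Plane} {U : Set Plane} {x x' y t δ : ℝ}
  {T : Set (OpenPartialHomeomorph Plane ℂ)} {q : Sphere} {k : ℕ} {h : ℕ → ℝ × ℝ → Sphere}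
  {e : ℕ → OpenPartialHomeomorph Plane ℂ} {a : ℕ → ℝ} {c : OpenPartialHomeomorph Plane ℂ}
  {z z' z₀ : ℝ × ℝ} {p : Plane} {i l m j : ℕ} {w : ℂ}

theorem outgoing_of_lt (hz : z ∈ sectorModel) (hlt : -z.2 < z.1) : 0 < z.2 ∨ 0 < z.1 := by
  rcases hz.2.1.eq_or_lt with h | h
  · right; linarith
  · exact Or.inl h

theorem sharesSide_of_half_eq (k : ℕ) (hm : m % (2 * k + 2) / 2 = i % (2 * k + 2) / 2)
    (hne : m % (2 * k + 2) ≠ i % (2 * k + 2)) (hx : 0 < x) :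
    SharesSide (m % (2 * k + 2)) (i % (2 * k + 2)) x ∨
      SharesSide (i % (2 * k + 2)) (m % (2 * k + 2)) x := by
  generalize m % (2 * k + 2) = m at *
  generalize i % (2 * k + 2) = i at *
  rcases Nat.even_or_odd m with h | h
  · refine Or.inl ⟨?_, Or.inl ⟨h, hx⟩⟩
    rw [Nat.even_iff] at h; omega
  · refine Or.inr ⟨?_, Or.inl ⟨?_, hx⟩⟩
    · rw [Nat.odd_iff] at h; omega
    · rw [Nat.even_iff]; rw [Nat.odd_iff] at h; omega

theorem half_succ_eq (k : ℕ) (hi : Even i) : (i + 1) % (2 * k + 2) / 2 = i % (2 * k + 2) / 2 := by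
  have hd : 2 ∣ 2 * k + 2 := ⟨k + 1, by ring⟩
  have h1 : i % (2 * k + 2) % 2 = 0 := by rw [Nat.mod_mod_of_dvd _ hd]; exact Nat.even_iff.1 hi
  have h2 : i % (2 * k + 2) < 2 * k + 2 := Nat.mod_lt _ (by omega)
  rw [Nat.add_mod, Nat.mod_eq_of_lt (a := 1) (by omega),
    Nat.mod_eq_of_lt (a := i % (2 * k + 2) + 1) (by omega)]
  omega

theorem StripTime.congr {g g' : ℝ × ℝ → Plane} (h : StripTime X U g y x x' t) (hx : x ≤ x')
    (hg : ∀ u ∈ Icc x x', g (u, y) = g' (u, y)) : StripTime X U g' y x x' t := by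
  obtain ⟨ht, h1, h2⟩ := h
  rw [hg x ⟨le_rfl, hx⟩, hg x' ⟨hx, le_rfl⟩] at h1
  refine ⟨ht, h1, fun s hs => ?_⟩
  obtain ⟨u, hu, hf⟩ := h2 s hs
  rw [hg x ⟨le_rfl, hx⟩, hg u hu] at hf
  exact ⟨u, hu, hf⟩

namespace SaddleFrame

variable (hF : SaddleFrame X U T q k h e a δ)
include hF

theorem outgoingData_period (i : ℕ) :
    outgoingData X U k h e (i + (2 * k + 2)) = outgoingData X U k h e i := by
  ext z : 1
  simp only [outgoingData, hF.period, hF.chart_period, Nat.add_mod_right]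

/-- On a shared outgoing separatrix the segments, the exit times and the charts coincide. On a
shared incoming one neither sector has a developing map, and both values are `none`. -/
theorem outgoingData_sharesSide (hT : IsTranslationAtlas X U T) (hs : SharesSide i l x)
    (hx : |x| < 1) : outgoingData X U k h e i (x, 0) = outgoingData X U k h e l (x, 0) := by
  rcases hs with ⟨rfl, ⟨hi, hx0⟩ | ⟨-, hx0⟩⟩
  · have hx1 : x < 1 := (abs_lt.1 hx).2
    have hpl : ∀ u ∈ Icc x 1, toPlane (h i) (u, 0) = toPlane (h (i + 1)) (u, 0) := fun u hu => by
      rw [toPlane, toPlane, hF.outgoing i hi u ⟨hx0.le.trans hu.1, hu.2⟩]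
    have hz : (x, (0 : ℝ)) ∈ outgoingModel :=
      ⟨⟨⟨by linarith, hx1.le⟩, by norm_num⟩, Or.inr hx0⟩
    have h1 := ((hF.regular i).stripTime_exitTime hz hx1).congr hx1.le hpl
    have h2 := (hF.regular (i + 1)).stripTime_exitTime hz hx1
    have h3 := hT.stripTime_unique (hF.regular (i + 1)) (by norm_num) hz.1.1 (by norm_num) hx1
      (Or.inr (Or.inr hx0)) h1 h2
    rw [outgoingData, outgoingData, half_succ_eq k hi]
    simp only [dev, h3, hF.chart_even i hi, hpl 1 ⟨hx1.le, le_rfl⟩]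
  · have : ¬ ((0 : ℝ) < 0 ∨ 0 < x) := by push Not; exact ⟨le_rfl, hx0.le⟩
    rw [outgoingData, outgoingData, if_neg this, if_neg this]

theorem outgoingData_eq_of_half_eq (hT : IsTranslationAtlas X U T)
    (hm : m % (2 * k + 2) / 2 = i % (2 * k + 2) / 2) (hx0 : 0 < x) (hx : |x| < 1) :
    outgoingData X U k h e m (x, 0) = outgoingData X U k h e i (x, 0) := by
  rw [← eq_of_mod_eq hF.outgoingData_period (Nat.mod_mod m (2 * k + 2)),
    ← eq_of_mod_eq hF.outgoingData_period (Nat.mod_mod i (2 * k + 2))]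
  by_cases hne : m % (2 * k + 2) = i % (2 * k + 2)
  · rw [hne]
  · rcases sharesSide_of_half_eq k hm hne hx0 with hs | hs
    · exact hF.outgoingData_sharesSide hT hs hx
    · exact (hF.outgoingData_sharesSide hT hs hx).symm

theorem height_nonneg (hz : z ∈ cell δ) :
    0 ≤ a i * sectorHeight (toPlane (h i)) (e i) z.2 := by
  have := (hF.mono i).monotoneOn (⟨le_rfl, hF.pos⟩ : (0 : ℝ) ∈ Ico 0 δ) ⟨hz.1.1.2.1, hz.2.2⟩
    hz.1.1.2.1
  simpa [sectorHeight_zero] using this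

theorem height_injOn (hz : z ∈ cell δ) (hz' : z' ∈ cell δ)
    (heq : sectorHeight (toPlane (h i)) (e i) z.2 = sectorHeight (toPlane (h i)) (e i) z'.2) :
    z.2 = z'.2 :=
  (hF.mono i).injOn ⟨hz.1.1.2.1, hz.2.2⟩ ⟨hz'.1.1.2.1, hz'.2.2⟩ (by simp only [heq])

/-- Points of two sectors with a common outgoing separatrix and the same developed height have
the same height. -/
theorem height_eq (hT : IsTranslationAtlas X U T)
    (hm : m % (2 * k + 2) / 2 = i % (2 * k + 2) / 2) (hz : z ∈ cell δ) (hz' : z' ∈ cell δ)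
    (heq : sectorHeight (toPlane (h m)) (e m) z.2 = sectorHeight (toPlane (h i)) (e i) z'.2) :
    z.2 = z'.2 ∧ (m % (2 * k + 2) = i % (2 * k + 2) ∨ z.2 = 0) := by
  by_cases hmi : m % (2 * k + 2) = i % (2 * k + 2)
  · rw [eq_of_mod_eq hF.period hmi, eq_of_mod_eq hF.chart_period hmi] at heq
    exact ⟨hF.height_injOn hz hz' heq, Or.inl hmi⟩
  have ham : a (m % (2 * k + 2)) = - a (i % (2 * k + 2)) := by
    rcases sharesSide_of_half_eq k hm hmi (x := 1 / 2) (by norm_num) with hs | hs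
    · have := hF.sign_sharesSide hT hs (by rw [abs_lt]; norm_num)
      linarith
    · exact hF.sign_sharesSide hT hs (by rw [abs_lt]; norm_num)
  rw [hF.sign_mod hT (Nat.mod_mod m _), hF.sign_mod hT (Nat.mod_mod i _)] at ham
  have h1 := hF.height_nonneg (i := m) hz
  have h2 := hF.height_nonneg (i := i) hz'
  rw [heq, ham] at h1
  have h3 : sectorHeight (toPlane (h i)) (e i) z'.2 = 0 := by
    rcases hF.sign i with h4 | h4 <;> rw [h4] at h1 h2 <;> linarith
  have hz0 : ∀ (i : ℕ) (z : ℝ × ℝ), z ∈ cell δ → sectorHeight (toPlane (h i)) (e i) z.2 = 0 →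
      z.2 = 0 := fun i z hz h0 =>
    (hF.mono i).injOn ⟨hz.1.1.2.1, hz.2.2⟩ ⟨le_rfl, hF.pos⟩ (by simp [h0, sectorHeight_zero])
  have h5 := hz0 m z hz (heq.trans h3)
  exact ⟨h5.trans (hz0 i z' hz' h3).symm, Or.inr h5⟩

/-- Points of `outgoingRange` with the developed height of `z` come from points at the same
height as `z`. -/
theorem exists_of_mem_outgoingRange (hT : IsTranslationAtlas X U T) (hz : z ∈ cell δ)
    (hw : w ∈ outgoingRange X U k h e δ (i % (2 * k + 2) / 2))
    (him : w.im = sectorHeight (toPlane (h i)) (e i) z.2) :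
    ∃ x, (x, z.2) ∈ cell δ ∧ -z.2 < x ∧ w = dev X U (toPlane (h i)) (e i) (x, z.2) := by
  obtain ⟨m, ⟨x, y⟩, hz', hlt, hd⟩ := hw
  have ho' := outgoing_of_lt hz'.1.1 hlt
  have hd' := hd
  rw [outgoingData, if_pos ho'] at hd'
  simp only [Option.some.injEq, Prod.mk.injEq] at hd'
  have h1 := hF.height_eq hT hd'.2 hz' hz (by rw [← him, ← hd'.1, dev_im])
  obtain ⟨h2, h3⟩ := h1
  simp only at h2 hlt ho'
  subst h2
  refine ⟨x, hz', hlt, ?_⟩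
  rcases h3 with h3 | h3
  · rw [← hd'.1, eq_of_mod_eq hF.period h3, eq_of_mod_eq hF.chart_period h3]
  · simp only at h3
    rw [h3] at hd ho' hz' ⊢
    have hx0 : 0 < x := by simpa using ho'
    rw [hF.outgoingData_eq_of_half_eq hT hd'.2 hx0 hz'.2.1, outgoingData, if_pos ho'] at hd
    simp only [Option.some.injEq, Prod.mk.injEq] at hd
    exact hd.1.symm

/-- The developing map continues the straightening charts in all the sectors around a point. -/
theorem outgoingData_germ (hT : IsTranslationAtlas X U T) (hz : z ∈ cell δ)
    (ho : 0 < z.2 ∨ 0 < z.1) (hc : c ∈ T) (hzc : toPlane (h i) z ∈ c.source)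
    (heq : toPlane (h m) z = toPlane (h i) z) :
    ∀ᶠ z' in 𝓝[sectorModel] z, z' ∈ cell δ ∧ (-z.2 < z.1 → -z'.2 < z'.1) ∧
      outgoingData X U k h e m z' = some (dev X U (toPlane (h i)) (e i) z +
        (c (toPlane (h m) z') - c (toPlane (h i) z)), i % (2 * k + 2) / 2) := by
  have h1 := (hF.compat_toPlane hT hF.outgoingData_period
    (fun i l x hs hx => hF.outgoingData_sharesSide hT hs hx) hz hz.1 heq).2
  rw [outgoingData, outgoingData, if_pos ho, if_pos ho] at h1
  simp only [Option.some.injEq, Prod.mk.injEq] at h1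
  have h2 := hT.dev_germ (hF.regular m) (hF.chart_mem m) (hF.chart_source m) ⟨hz.1.1, ho⟩ hz.2.2 hc
    (by rwa [heq])
  have ho' : ∀ᶠ z' : ℝ × ℝ in 𝓝[sectorModel] z, 0 < z'.2 ∨ 0 < z'.1 := by
    refine nhdsWithin_le_nhds (IsOpen.mem_nhds ?_ ho)
    exact (isOpen_lt continuous_const continuous_snd).union
      (isOpen_lt continuous_const continuous_fst)
  have hlt : ∀ᶠ z' : ℝ × ℝ in 𝓝[sectorModel] z, -z.2 < z.1 → -z'.2 < z'.1 := by
    by_cases h0 : -z.2 < z.1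
    · have : IsOpen {z' : ℝ × ℝ | -z'.2 < z'.1} := isOpen_lt (by fun_prop) (by fun_prop)
      filter_upwards [nhdsWithin_le_nhds (this.mem_nhds h0)] with z' hz' _ using hz'
    · simp [h0]
  filter_upwards [h2, ho', cell_mem_nhdsWithin hz, hlt] with z' hz1 hz2 hz3 hz4
  refine ⟨hz3, hz4, ?_⟩
  rw [outgoingData, if_pos hz2]
  simp only [Option.some.injEq, Prod.mk.injEq]
  refine ⟨?_, h1.2⟩
  rw [← h1.1, ← heq]
  linear_combination hz1

/-- Near a point of the saddle the developing maps of all sectors through it are one and the same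
chart up to a translation, and a chart is open. -/
theorem isOpen_outgoingRange (hT : IsTranslationAtlas X U T) (j : ℕ) :
    IsOpen (outgoingRange X U k h e δ j) := by
  rw [isOpen_iff_mem_nhds]
  rintro w ⟨m, z, hz, hlt, hd⟩
  have ho := outgoing_of_lt hz.1.1 hlt
  rw [outgoingData, if_pos ho] at hd
  simp only [Option.some.injEq, Prod.mk.injEq] at hd
  obtain ⟨rfl, rfl⟩ := hd
  obtain ⟨c, hc, hzc⟩ := hT.covers _ (hF.toPlane_mem (i := m) hz)
  have h1 := hF.eventually_of_sectors hT hz (i := m) (Q := fun p =>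
    dev X U (toPlane (h m)) (e m) z + (c p - c (toPlane (h m) z)) ∈
      outgoingRange X U k h e δ (m % (2 * k + 2) / 2)) fun m' hm' => by
    filter_upwards [hF.outgoingData_germ hT hz ho hc hzc hm'] with z' hz'
    exact ⟨m', z', hz'.1, hz'.2.1 hlt, hz'.2.2⟩
  set w := dev X U (toPlane (h m)) (e m) z
  set p := toPlane (h m) z
  have h3 : Tendsto (fun w' : ℂ => c p + (w' - w)) (𝓝 w) (𝓝 (c p)) :=
    Continuous.tendsto' (by fun_prop) _ _ (by simp)
  have h4 := (c.continuousAt_symm (c.map_source hzc)).tendsto.comp h3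
  rw [c.left_inv hzc] at h4
  filter_upwards [h4.eventually h1, h3.eventually (c.open_target.mem_nhds (c.map_source hzc))]
    with w' hw' ht
  simp only [Function.comp_apply] at hw'
  rw [c.right_inv ht] at hw'
  convert hw' using 1
  ring

end SaddleFrame
end FlowBox


/-! ### A function increasing along the outgoing separatrices -/

namespace FlowBox

theorem neg_two_lt_arctan (r : ℝ) : -2 < Real.arctan r := by
  have := Real.neg_pi_div_two_lt_arctan r
  have := Real.pi_lt_d2
  linarith

/-- A bounded smooth function on the plane that increases to the right exactly in the right-hand
side of an open set. -/
theorem exists_smooth_primitive {R : Set ℂ} (hR : IsOpen R) :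
    ∃ Ψ : ℂ → ℝ, ContDiff ℝ ∞ Ψ ∧ (∀ w, 0 ≤ Ψ w) ∧ (∀ w, 0 ≤ fderiv ℝ Ψ w 1) ∧
      (∀ w ∈ R, 0 < fderiv ℝ Ψ w 1) ∧
      (∀ w, (∀ w' ∈ R, w'.im = w.im → w.re < w'.re) → Ψ w = 0) ∧
      (∀ w w', w'.im = w.im → w.re ≤ w'.re → Ψ w ≤ Ψ w') ∧
      ∀ (f : ℝ → ℂ) (y : ℝ), (∀ x ∈ Ioo (0 : ℝ) 1, (f x).im = y) →
        StrictMonoOn (fun x => (f x).re) (Ioo 0 1) →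
        (∀ w ∈ R, w.im = y → ∃ x ∈ Ioo (0 : ℝ) 1, w = f x) →
        ∀ ε > 0, ∃ x ∈ Ioo (0 : ℝ) 1, Ψ (f x) < ε := by
  -- The open set is compressed horizontally by `arctan`, so that integration from the left end
  -- makes sense; `-2` lies to the left of `-π / 2`. A nonnegative smooth function with support
  -- exactly `S` is integrated along horizontal lines.
  set S : Set (ℝ × ℝ) := {w | w.1 ∈ Ioo (-(Real.pi / 2)) (Real.pi / 2) ∧
    ((Real.tan w.1 : ℝ) : ℂ) + w.2 * Complex.I ∈ R} with hS
  have hSo : IsOpen S := by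
    have h1 : ContinuousOn (fun w : ℝ × ℝ => ((Real.tan w.1 : ℝ) : ℂ) + w.2 * Complex.I)
        (Ioo (-(Real.pi / 2)) (Real.pi / 2) ×ˢ univ) := by
      refine ContinuousOn.add ?_ (by fun_prop)
      refine Complex.continuous_ofReal.comp_continuousOn ?_
      exact Real.continuousOn_tan_Ioo.comp continuousOn_fst fun w hw => hw.1
    have h2 := h1.isOpen_inter_preimage (isOpen_Ioo.prod isOpen_univ) hR
    convert h2 using 1
    ext w
    simp [hS]
  obtain ⟨G, hGs, hGd, hGr⟩ := hSo.exists_contDiff_support_eq (n := ⊤)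
  have hG0 : ∀ w, 0 ≤ G w := fun w => (hGr ⟨w, rfl⟩).1
  have hGS : ∀ w, w ∈ S → 0 < G w := fun w hw =>
    lt_of_le_of_ne (hG0 w) (Ne.symm (by rw [← Function.mem_support, hGs]; exact hw))
  have hGn : ∀ w, w ∉ S → G w = 0 := fun w hw => by
    rwa [← Function.notMem_support, hGs]
  have hpi := Real.pi_lt_d2
  have hGI : ∀ s y, s ∉ Icc (-2 : ℝ) 2 → G (s, y) = 0 := fun s y hs => hGn _ fun h =>
    hs ⟨by linarith [h.1.1], by linarith [h.1.2]⟩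
  set Φ : ℝ × ℝ → ℝ := fun w => ∫ s in (-2)..w.1, G (s, w.2) with hΦ
  have hΦd : ContDiff ℝ ∞ Φ := contDiff_primitive hGd hGI
  set Ψ : ℂ → ℝ := fun w => Φ (Real.arctan w.re, w.im) with hΨ
  have hre : ContDiff ℝ ∞ (Complex.re) := Complex.reCLM.contDiff
  have him : ContDiff ℝ ∞ (Complex.im) := Complex.imCLM.contDiff
  have hΨd : ContDiff ℝ ∞ Ψ := hΦd.comp ((Real.contDiff_arctan.comp hre).prodMk him)
  have hGc : ∀ y, Continuous fun s => G (s, y) := fun y => hGd.continuous.comp (by fun_prop)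
  have hder : ∀ w, fderiv ℝ Ψ w 1 = G (Real.arctan w.re, w.im) * (1 / (1 + w.re ^ 2)) := by
    intro w
    have h1 : HasDerivAt (fun r : ℝ => w + (r : ℂ)) 1 0 := by
      simpa using (Complex.ofRealCLM.hasDerivAt (x := 0)).const_add w
    have h2 : HasFDerivAt Ψ (fderiv ℝ Ψ w) (w + ((0 : ℝ) : ℂ)) := by
      rw [Complex.ofReal_zero, add_zero]
      exact (hΨd.differentiable (by simp) w).hasFDerivAt
    have h3 := h2.comp_hasDerivAt (0 : ℝ) h1
    refine h3.unique ?_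
    have h4 : HasDerivAt (fun u : ℝ => ∫ s in (-2)..u, G (s, w.im)) (G (Real.arctan w.re, w.im))
        (Real.arctan (w.re + 0)) := by
      rw [add_zero]
      exact (hGc w.im).integral_hasStrictDerivAt _ _ |>.hasDerivAt
    have h5 : HasDerivAt (fun r : ℝ => Real.arctan (w.re + r)) (1 / (1 + w.re ^ 2)) 0 := by
      have := (Real.hasDerivAt_arctan (w.re + 0)).comp (0 : ℝ) ((hasDerivAt_id (0 : ℝ)).const_add w.re)
      simpa [Function.comp_def] using this
    have h6 := h4.comp (0 : ℝ) h5
    have heq : (Ψ ∘ fun r : ℝ => w + (r : ℂ)) =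
        (fun u : ℝ => ∫ s in (-2)..u, G (s, w.im)) ∘ fun r : ℝ => Real.arctan (w.re + r) := by
      ext r
      simp [hΨ, hΦ]
    rw [heq]
    exact h6
  have hint : ∀ y u v, IntervalIntegrable (fun s => G (s, y)) MeasureTheory.volume u v :=
    fun y u v => (hGc y).intervalIntegrable u v
  have hmem : ∀ s y r, s ≤ Real.arctan r → (s, y) ∈ S → ∃ w ∈ R, w.im = y ∧ w.re ≤ r ∧
      Real.arctan w.re = s := by
    intro s y r hs hsS
    refine ⟨⟨Real.tan s, y⟩, ?_, rfl, ?_, Real.arctan_tan hsS.1.1 hsS.1.2⟩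
    · rw [Complex.mk_eq_add_mul_I]
      exact hsS.2
    have : Real.arctan (Real.tan s) ≤ Real.arctan r := by rwa [Real.arctan_tan hsS.1.1 hsS.1.2]
    exact Real.arctan_strictMono.le_iff_le.1 this
  refine ⟨Ψ, hΨd, fun w => ?_, fun w => ?_, fun w hw => ?_, fun w hw => ?_, fun w w' hi hr => ?_, ?_⟩
  · exact intervalIntegral.integral_nonneg (neg_two_lt_arctan _).le fun s _ => hG0 _
  · rw [hder]
    exact mul_nonneg (hG0 _) (by positivity)
  · rw [hder]
    refine mul_pos (hGS _ ⟨⟨Real.neg_pi_div_two_lt_arctan _, Real.arctan_lt_pi_div_two _⟩, ?_⟩)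
      (by positivity)
    simp only [Real.tan_arctan]
    rwa [Complex.re_add_im]
  · simp only [hΨ, hΦ]
    refine intervalIntegral.integral_zero_ae (Eventually.of_forall fun s hs => ?_)
    rw [uIoc_of_le (neg_two_lt_arctan _).le] at hs
    refine hGn _ fun hsS => ?_
    obtain ⟨w', hw', hi, hr, -⟩ := hmem s _ _ hs.2 hsS
    exact (hw w' hw' hi).not_ge hr
  · simp only [hΨ, hΦ, hi]
    rw [← intervalIntegral.integral_add_adjacent_intervals (hint w.im (-2) (Real.arctan w.re))
      (hint w.im (Real.arctan w.re) (Real.arctan w'.re))]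
    have := intervalIntegral.integral_nonneg (μ := MeasureTheory.volume) (f := fun s => G (s, w.im))
      (Real.arctan_strictMono.monotone hr) fun s _ => hG0 _
    linarith
  · intro f y hfy hfm hfR ε hε
    set u : ℝ → ℝ := fun x => Real.arctan (f x).re with hu
    have hum : StrictMonoOn u (Ioo 0 1) := fun x hx x' hx' hlt =>
      Real.arctan_strictMono (hfm hx hx' hlt)
    have hbdd : BddBelow (u '' Ioo 0 1) := ⟨-2, by
      rintro _ ⟨x, -, rfl⟩
      exact (neg_two_lt_arctan _).le⟩
    have hne : (u '' Ioo 0 1).Nonempty := ⟨_, 1 / 2, by norm_num, rfl⟩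
    -- On the line of height `y` the open set has no point at or to the left of `u₀`. So the
    -- primitive vanishes there and, by continuity, is small on the curve close to its lower end.
    set u₀ := sInf (u '' Ioo 0 1) with hu₀
    have hlt : ∀ x ∈ Ioo (0 : ℝ) 1, u₀ < u x := by
      intro x hx
      have hx2 : x / 2 ∈ Ioo (0 : ℝ) 1 := ⟨by linarith [hx.1], by linarith [hx.1, hx.2]⟩
      exact (csInf_le hbdd ⟨_, hx2, rfl⟩).trans_lt (hum hx2 hx (by linarith [hx.1]))
    have h2 : -2 ≤ u₀ := le_csInf hne (by
      rintro _ ⟨x, -, rfl⟩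
      exact (neg_two_lt_arctan _).le)
    have hzero : Φ (u₀, y) = 0 := by
      simp only [hΦ]
      refine intervalIntegral.integral_zero_ae (Eventually.of_forall fun s hs => ?_)
      rw [uIoc_of_le h2] at hs
      refine hGn _ fun hsS => ?_
      obtain ⟨w, hw, hi, -, hr⟩ := hmem s y _ (hs.2.trans (hlt (1 / 2) (by norm_num)).le) hsS
      obtain ⟨x, hx, rfl⟩ := hfR w hw hi
      have := hlt x hx
      simp only [hu, hr] at this
      exact this.not_ge hs.2
    have hc : Continuous fun v => Φ (v, y) := hΦd.continuous.comp (by fun_prop)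
    have hev : ∀ᶠ v in 𝓝 u₀, Φ (v, y) < ε := by
      refine (hc.tendsto u₀).eventually (gt_mem_nhds ?_)
      rw [hzero]; exact hε
    obtain ⟨b, hb, hbε⟩ := Metric.eventually_nhds_iff.1 hev
    obtain ⟨_, ⟨x, hx, rfl⟩, hxu⟩ := exists_lt_of_csInf_lt hne (lt_add_of_pos_right u₀ hb)
    refine ⟨x, hx, ?_⟩
    have := hbε (y := u x) (by
      rw [Real.dist_eq, abs_of_pos (by linarith [hlt x hx])]; linarith)
    simpa [hΨ, hfy x hx] using this

variable {X : Plane → Plane} {U : Set Plane} {x x' y t δ : ℝ}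
  {T : Set (OpenPartialHomeomorph Plane ℂ)} {q : Sphere} {k : ℕ} {h : ℕ → ℝ × ℝ → Sphere}
  {e : ℕ → OpenPartialHomeomorph Plane ℂ} {a : ℕ → ℝ} {c : OpenPartialHomeomorph Plane ℂ}
  {z z' z₀ : ℝ × ℝ} {p : Plane} {i l m j : ℕ} {w : ℂ}

/-- A function that increases along the trajectories close to the outgoing separatrices of a
saddle and vanishes close to the incoming ones. -/
theorem SaddleFrame.exists_outgoing_function (hF : SaddleFrame X U T q k h e a δ)
    (hT : IsTranslationAtlas X U T) : ∃ B : Plane → ℝ,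
      (∀ i, ∀ z ∈ cell δ, ContDiffAt ℝ ∞ B (toPlane (h i) z) ∧ 0 ≤ B (toPlane (h i) z) ∧
        (z.1 ≤ -z.2 → B (toPlane (h i) z) = 0) ∧
        0 ≤ fderiv ℝ B (toPlane (h i) z) (X (toPlane (h i) z)) ∧
        (-z.2 < z.1 → 0 < fderiv ℝ B (toPlane (h i) z) (X (toPlane (h i) z)))) ∧
      ∀ i, Tendsto (fun z => B (toPlane (h i) z)) (𝓝[cell δ] (0, 0)) (𝓝 0) := by
  choose Ψ hΨd hΨ0 hΨn hΨp hΨz hΨm hΨl using fun j =>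
    exists_smooth_primitive (hF.isOpen_outgoingRange hT j)
  -- The value is `0` where there is no developing map, that is, on incoming separatrices. This fits
  -- smoothly, since `F` already vanishes on the whole part `x ≤ -y` of the cell.
  set F : ℕ → ℝ × ℝ → ℝ := fun i z => (outgoingData X U k h e i z).elim 0 fun d => Ψ d.2 d.1 with hFd
  obtain ⟨B, hB⟩ := hF.exists_glued hT (f := F)
    (fun i => by simp only [hFd, hF.outgoingData_period])
    (fun i l x hs hx => by simp only [hFd, hF.outgoingData_sharesSide hT hs hx])
  have hFo : ∀ i z, (0 < z.2 ∨ 0 < z.1) → F i z = Ψ (i % (2 * k + 2) / 2)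
      (dev X U (toPlane (h i)) (e i) z) := fun i z ho => by
    simp only [hFd, outgoingData, if_pos ho, Option.elim_some]
  have hFn : ∀ i z, ¬ (0 < z.2 ∨ 0 < z.1) → F i z = 0 := fun i z ho => by
    simp only [hFd, outgoingData, if_neg ho, Option.elim_none]
  have hF0 : ∀ i z, 0 ≤ F i z := fun i z => by
    by_cases ho : 0 < z.2 ∨ 0 < z.1
    · rw [hFo i z ho]; exact hΨ0 _ _
    · rw [hFn i z ho]
  have hFz : ∀ i, ∀ z ∈ cell δ, z.1 ≤ -z.2 → F i z = 0 := by
    intro i z hz hle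
    by_cases ho : 0 < z.2 ∨ 0 < z.1
    · rw [hFo i z ho]
      refine hΨz _ _ fun w hw him => ?_
      rw [dev_im] at him
      obtain ⟨x, hx, hlt, rfl⟩ := hF.exists_of_mem_outgoingRange hT hz hw him
      obtain ⟨x₀, y₀⟩ := z
      simp only at hle hlt ho hx ⊢
      refine hT.dev_re_strictMono (hF.regular i) ⟨hz.1.1, ho⟩ hx.1.1.1.2 (hle.trans_lt hlt)
    · exact hFn i z ho
  have hgerm : ∀ i, ∀ z ∈ cell δ, (0 < z.2 ∨ 0 < z.1) → ∀ c ∈ T, toPlane (h i) z ∈ c.source →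
      B =ᶠ[𝓝 (toPlane (h i) z)] fun p' => Ψ (i % (2 * k + 2) / 2)
        (dev X U (toPlane (h i)) (e i) z + (c p' - c (toPlane (h i) z))) :=
    fun i z hz ho c hc hzc => hF.eventually_of_sectors hT hz fun m hm => by
      filter_upwards [hF.outgoingData_germ hT hz ho hc hzc hm] with z' hz'
      rw [hB m z' hz'.1]
      simp only [hFd, hz'.2.2, Option.elim_some]
  refine ⟨B, fun i z hz => ?_, fun i => ?_⟩
  · obtain ⟨c, hc, hzc⟩ := hT.covers _ (hF.toPlane_mem (i := i) hz)
    set p := toPlane (h i) z with hp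
    suffices H : ContDiffAt ℝ ∞ B p ∧ 0 ≤ fderiv ℝ B p (X p) ∧
        (-z.2 < z.1 → 0 < fderiv ℝ B p (X p)) from
      ⟨H.1, hB i z hz ▸ hF0 i z, fun hle => (hB i z hz).trans (hFz i z hz hle), H.2⟩
    by_cases ho : 0 < z.2 ∨ 0 < z.1
    · set j := i % (2 * k + 2) / 2
      set D := dev X U (toPlane (h i)) (e i) z with hD
      have hev := hgerm i z hz ho c hc hzc
      obtain ⟨A, hA, -, hAX⟩ := hT.hasFDerivAt_symm hc hzc
      have hcd : ContDiffAt ℝ ∞ c p := (hT.smooth c hc).contDiffAt (c.open_source.mem_nhds hzc)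
      have hBd : ContDiffAt ℝ ∞ B p := by
        refine ContDiffAt.congr_of_eventuallyEq ?_ hev
        exact (hΨd j).contDiffAt.comp p (contDiffAt_const.add (hcd.sub contDiffAt_const))
      have hfd : fderiv ℝ B p (X p) = fderiv ℝ (Ψ j) D 1 := by
        have h1 : HasFDerivAt (fun p' => D + (c p' - c p)) (A : Plane →L[ℝ] ℂ) p :=
          (hA.sub_const _).const_add _
        have h2 : HasFDerivAt (Ψ j) (fderiv ℝ (Ψ j) D) (D + (c p - c p)) := by
          rw [sub_self, add_zero]
          exact ((hΨd j).differentiable (by simp) D).hasFDerivAt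
        have h3 := (h2.comp p h1).congr_of_eventuallyEq hev
        rw [h3.fderiv]
        simp [hAX]
      refine ⟨hBd, hfd ▸ hΨn j D, fun hlt => hfd ▸ hΨp j D ⟨i, z, hz, hlt, ?_⟩⟩
      rw [outgoingData, if_pos ho]
    · have hlt : z.1 < -z.2 := by
        push Not at ho
        have h2 : z.2 = 0 := le_antisymm ho.1 hz.1.1.2.1
        rw [h2, neg_zero]
        exact lt_of_le_of_ne ho.2 fun h0 => hz.1.2 (Prod.ext h0 h2)
      have hev : B =ᶠ[𝓝 p] fun _ => 0 := hF.eventually_of_sectors hT hz fun m hm => by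
        have h1 : IsOpen {z' : ℝ × ℝ | z'.1 < -z'.2} := isOpen_lt (by fun_prop) (by fun_prop)
        filter_upwards [cell_mem_nhdsWithin hz, nhdsWithin_le_nhds (h1.mem_nhds hlt)] with z' h2 h3
        rw [hB m z' h2]
        exact hFz m z' h2 (le_of_lt h3)
      have hfd : fderiv ℝ B p = 0 := by
        rw [hev.fderiv_eq]; simp
      refine ⟨contDiffAt_const.congr_of_eventuallyEq hev, by simp [hfd], fun h => ?_⟩
      exact absurd h hlt.not_gt
  · have hcellx : ∀ x ∈ Ioo (0 : ℝ) 1, (x, (0 : ℝ)) ∈ cell δ := fun x hx =>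
      mem_cell_of_ne_zero hF.pos (by rw [abs_lt]; constructor <;> linarith [hx.1, hx.2]) hx.1.ne'
    rw [Metric.tendsto_nhds]
    intro ε hε
    -- The function is below `ε` at one point of the outgoing separatrix, hence on a short vertical
    -- segment through it. By monotonicity along the rows it is below `ε` everywhere to the left of
    -- that segment.
    obtain ⟨x₁, hx₁, hΨε⟩ := hΨl (i % (2 * k + 2) / 2)
      (fun x => dev X U (toPlane (h i)) (e i) (x, 0)) 0
      (fun x hx => by rw [dev_im, sectorHeight_zero])
      (fun x hx x' hx' hlt => hT.dev_re_strictMono (hF.regular i) ⟨(hcellx x hx).1.1, Or.inr hx.1⟩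
        hx'.2.le hlt)
      (fun w hw him => by
        obtain ⟨x, hx, hlt, hw'⟩ := hF.exists_of_mem_outgoingRange hT (hcellx (1 / 2) (by norm_num))
          hw (by rw [him, sectorHeight_zero])
        rw [neg_zero] at hlt
        exact ⟨x, ⟨hlt, (abs_lt.1 hx.2.1).2⟩, hw'⟩) ε hε
    have hz₁ := hcellx x₁ hx₁
    rw [← hFo i (x₁, 0) (Or.inr hx₁.1), ← hB i _ hz₁] at hΨε
    have hcd : ContDiffAt ℝ ∞ B (toPlane (h i) (x₁, 0)) := by
      obtain ⟨c, hc, hzc⟩ := hT.covers _ (hF.toPlane_mem (i := i) hz₁)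
      have hev := hgerm i _ hz₁ (Or.inr hx₁.1) c hc hzc
      refine ContDiffAt.congr_of_eventuallyEq ?_ hev
      exact (hΨd _).contDiffAt.comp _ (contDiffAt_const.add
        (((hT.smooth c hc).contDiffAt (c.open_source.mem_nhds hzc)).sub contDiffAt_const))
    have hg := (hF.regular i).continuousOn _ hz₁.1
    have hev := (hcd.continuousAt.tendsto.comp hg).eventually (gt_mem_nhds hΨε)
    obtain ⟨b, hb, hball⟩ := Metric.mem_nhdsWithin_iff.1 hev
    have hnear : ∀ᶠ z : ℝ × ℝ in 𝓝[cell δ] (0, 0), z.1 < x₁ ∧ z.2 < b := by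
      refine nhdsWithin_le_nhds (((isOpen_Iio.preimage continuous_fst).inter
        (isOpen_Iio.preimage continuous_snd)).mem_nhds ⟨hx₁.1, hb⟩)
    filter_upwards [self_mem_nhdsWithin, hnear] with z hz ⟨hzx, hzb⟩
    have hz1 : (x₁, z.2) ∈ cell δ :=
      ⟨⟨⟨(hcellx x₁ hx₁).1.1.1, hz.1.1.2⟩, fun h0 => hx₁.1.ne' (Prod.ext_iff.1 h0).1⟩,
        (hcellx x₁ hx₁).2.1, hz.2.2⟩
    have hε1 : B (toPlane (h i) (x₁, z.2)) < ε := hball (by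
      refine ⟨?_, hz1.1⟩
      rw [Metric.mem_ball, Prod.dist_eq, max_lt_iff]
      simpa [abs_of_nonneg hz.1.1.2.1, hb] using hzb)
    have hle : B (toPlane (h i) z) ≤ B (toPlane (h i) (x₁, z.2)) := by
      rw [hB i _ hz, hB i _ hz1]
      by_cases ho : 0 < z.2 ∨ 0 < z.1
      · rw [hFo i z ho, hFo i (x₁, z.2) (Or.inr hx₁.1)]
        refine hΨm _ _ _ (by rw [dev_im, dev_im]) ?_
        exact (hT.dev_re_strictMono (hF.regular i) (x := z.1) (y := z.2) ⟨hz.1.1, ho⟩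
          hx₁.2.le hzx).le
      · rw [hFn i z ho]; exact hF0 _ _
    have h0 : 0 ≤ B (toPlane (h i) z) := by rw [hB i _ hz]; exact hF0 _ _
    rw [Real.dist_eq, sub_zero, abs_of_nonneg h0]
    exact hle.trans_lt hε1

end FlowBox


/-! ### Time reversal and the time function of a saddle -/

namespace FlowBox

variable {X : Plane → Plane} {U : Set Plane} {x x' y t δ δ' : ℝ}
  {T : Set (OpenPartialHomeomorph Plane ℂ)} {q : Sphere} {k : ℕ} {h : ℕ → ℝ × ℝ → Sphere}
  {e : ℕ → OpenPartialHomeomorph Plane ℂ} {a : ℕ → ℝ} {c : OpenPartialHomeomorph Plane ℂ}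
  {z z' z₀ : ℝ × ℝ} {p b : Plane} {i l m j : ℕ} {A : Set Plane}

theorem IsOrbitArc.neg (hA : IsOrbitArc X U p b A) : IsOrbitArc (-X) U b p A := by
  obtain ⟨t, ht, γ, hγ, rfl, rfl, rfl⟩ := hA
  refine ⟨t, ht, fun s => γ (t - s), ?_, by simp, by simp, ?_⟩
  · have hm : MapsTo (fun s => t - s) (uIcc 0 t) (uIcc 0 t) := fun s hs => by
      rw [uIcc_of_le ht.le] at hs ⊢
      constructor <;> linarith [hs.1, hs.2]
    intro s hs
    refine ⟨(hγ _ (hm hs)).1, ?_⟩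
    have h1 : HasDerivWithinAt (fun s : ℝ => t - s) (-1) (uIcc 0 t) s :=
      ((hasDerivAt_id s).const_sub t).hasDerivWithinAt
    have := HasDerivWithinAt.scomp s (hγ _ (hm hs)).2 h1 hm
    simpa [Function.comp_def] using this
  · ext w
    constructor
    · rintro ⟨s, hs, rfl⟩
      exact ⟨t - s, ⟨by linarith [hs.2], by linarith [hs.1]⟩, rfl⟩
    · rintro ⟨s, hs, rfl⟩
      exact ⟨t - s, ⟨by linarith [hs.2], by linarith [hs.1]⟩, by simp⟩

/-- The reflection of the model sector. -/
def flip (z : ℝ × ℝ) : ℝ × ℝ := (-z.1, z.2)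

theorem flip_flip (z : ℝ × ℝ) : flip (flip z) = z := by simp [flip]

theorem continuous_flip : Continuous flip := by unfold flip; fun_prop

theorem flip_mem_sectorModel (hz : z ∈ sectorModel) : flip z ∈ sectorModel :=
  ⟨⟨by simpa [flip] using hz.1.2, by simpa [flip] using neg_le.1 hz.1.1⟩, hz.2⟩

theorem flip_mem_puncturedModel (hz : z ∈ puncturedModel) : flip z ∈ puncturedModel := by
  refine ⟨flip_mem_sectorModel hz.1, fun h => hz.2 ?_⟩
  have h2 := Prod.ext_iff.1 (mem_singleton_iff.1 h)
  exact Prod.ext (by simpa [flip] using h2.1) h2.2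

theorem flip_mem_cell (hz : z ∈ cell δ) : flip z ∈ cell δ :=
  ⟨flip_mem_puncturedModel hz.1, by simpa [flip] using hz.2.1, hz.2.2⟩

theorem IsHyperbolicSector.neg {h : ℝ × ℝ → Sphere} (hh : IsHyperbolicSector X U q h) :
    IsHyperbolicSector (-X) U q (h ∘ flip) where
  continuousOn := hh.continuousOn.comp continuous_flip.continuousOn fun z => flip_mem_sectorModel
  inj := fun z hz z' hz' hzz => by
    have := hh.inj (flip_mem_sectorModel hz) (flip_mem_sectorModel hz') hzz
    rw [← flip_flip z, this, flip_flip]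
  vertex := by simpa [flip] using hh.vertex
  regular := fun z hz hne => by
    have := flip_mem_puncturedModel (z := z) ⟨hz, hne⟩
    exact hh.regular _ this.1 this.2
  orbit := by
    intro y hy x hx x' hx' hlt hc
    obtain ⟨p, b, A, hA, hp, hb, him⟩ := hh.orbit y hy (-x') ⟨by linarith [hx'.2], by linarith [hx'.1]⟩
      (-x) ⟨by linarith [hx.2], by linarith [hx.1]⟩ (by linarith) (by
        rcases hc with h | h | h
        · exact Or.inl h
        · right; right; linarith
        · right; left; linarith)
    refine ⟨b, p, A, hA.neg, hb, hp, ?_⟩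
    rw [him]
    ext w
    constructor
    · rintro ⟨u, hu, rfl⟩
      exact ⟨-u, ⟨by linarith [hu.2], by linarith [hu.1]⟩, by simp [flip]⟩
    · rintro ⟨u, hu, rfl⟩
      exact ⟨-u, ⟨by linarith [hu.2], by linarith [hu.1]⟩, by simp [flip]⟩

namespace SaddleFrame

variable (hF : SaddleFrame X U T q k h e a δ)
include hF

theorem mono_height (hδ' : 0 < δ') (hle : δ' ≤ δ) : SaddleFrame X U T q k h e a δ' where
  __ := hF
  pos := hδ'
  le_one := hle.trans hF.le_one
  chart_source := fun i y hy hyδ => hF.chart_source i y hy (hyδ.trans_le hle)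
  mono := fun i => (hF.mono i).mono (Ico_subset_Ico_right hle)

/-- Reversing time and reflecting the model exchanges incoming and outgoing separatrices. The shift
of the numbering by one restores the convention that even sectors share their outgoing side with the
next one. -/
theorem exists_neg (hT : IsTranslationAtlas X U T) : ∃ T' e' a' δ', IsTranslationAtlas (-X) U T' ∧
    SaddleFrame (-X) U T' q k (fun i => h (i + 1) ∘ flip) e' a' δ' := by
  obtain ⟨e', a', δ', h'⟩ := hT.neg.exists_saddleFrame (q := q) (k := k)
    (h := fun i => h (i + 1) ∘ flip)
    (fun i => by
      have := hF.period (i + 1)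
      rw [show i + 1 + (2 * k + 2) = i + (2 * k + 2) + 1 by ring] at this
      simp only [this])
    (fun i => (hF.sector (i + 1)).neg)
    (fun i hi x hx => hF.incoming (i + 1) hi.add_one (-x) ⟨by linarith [hx.2], by linarith [hx.1]⟩)
    (fun i hi x hx => hF.outgoing (i + 1) hi.add_one (-x) ⟨by linarith [hx.2], by linarith [hx.1]⟩)
    (fun i j hij z hz w hw hzw => hF.disjoint (i + 1) (j + 1)
      (fun h1 => hij (Nat.ModEq.add_right_cancel' 1 h1)) (flip z) (flip_mem_sectorModel hz) (flip w)
      (flip_mem_sectorModel hw) hzw)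
    (by
      refine mem_of_superset hF.nhds ?_
      refine iUnion₂_subset fun m _ => ?_
      rintro _ ⟨z, hz, rfl⟩
      have hpos : 0 < 2 * k + 2 := by omega
      refine mem_iUnion₂.2 ⟨(m + (2 * k + 1)) % (2 * k + 2),
        Finset.mem_range.2 (Nat.mod_lt _ hpos), flip z, flip_mem_sectorModel hz, ?_⟩
      have h1 : h ((m + (2 * k + 1)) % (2 * k + 2) + 1) = h m := by
        refine eq_of_mod_eq hF.period ?_
        rw [Nat.mod_add_mod, show m + (2 * k + 1) + 1 = m + (2 * k + 2) by ring, Nat.add_mod_right]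
      rw [h1, Function.comp_apply, flip_flip])
  exact ⟨_, e', a', δ', hT.neg, h'⟩

/-- Around a saddle there is a smooth function that increases along the trajectories and tends to
zero at the vertex. -/
theorem exists_time_function (hT : IsTranslationAtlas X U T) : ∃ (τ : Plane → ℝ) (δ' : ℝ),
    SaddleFrame X U T q k h e a δ' ∧
    (∀ i, ∀ z ∈ cell δ', ContDiffAt ℝ ∞ τ (toPlane (h i) z) ∧
      0 < fderiv ℝ τ (toPlane (h i) z) (X (toPlane (h i) z))) ∧
    ∀ i, Tendsto (fun z => τ (toPlane (h i) z)) (𝓝[cell δ'] (0, 0)) (𝓝 0) := by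
  obtain ⟨B, hB, hBl⟩ := hF.exists_outgoing_function hT
  obtain ⟨T', e', a', δ', hT', hF'⟩ := hF.exists_neg hT
  obtain ⟨B', hB', hBl'⟩ := hF'.exists_outgoing_function hT'
  have hsub : cell (min δ δ') ⊆ cell δ := fun z hz => ⟨hz.1, hz.2.1, hz.2.2.trans_le (min_le_left _ _)⟩
  have hsub' : cell (min δ δ') ⊆ cell δ' := fun z hz =>
    ⟨hz.1, hz.2.1, hz.2.2.trans_le (min_le_right _ _)⟩
  have hpl : ∀ i z, toPlane (h (i + (2 * k + 1) + 1) ∘ flip) (flip z) = toPlane (h i) z := by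
    intro i z
    rw [toPlane, Function.comp_apply, flip_flip, show i + (2 * k + 1) + 1 = i + (2 * k + 2) by ring,
      hF.period, toPlane]
  -- `B'` increases along `-X`, so its negative increases along `X`.
  refine ⟨fun p => B p - B' p, min δ δ', hF.mono_height (lt_min hF.pos hF'.pos) (min_le_left _ _),
    fun i z hz => ?_, fun i => ?_⟩
  · obtain ⟨h1, -, -, h2, h3⟩ := hB i z (hsub hz)
    obtain ⟨h1', -, -, h2', h3'⟩ := hB' (i + (2 * k + 1)) (flip z) (flip_mem_cell (hsub' hz))
    rw [hpl] at h1' h2' h3'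
    refine ⟨h1.sub h1', ?_⟩
    rw [fderiv_fun_sub (h1.differentiableAt (by simp)) (h1'.differentiableAt (by simp))]
    simp only [Pi.neg_apply, map_neg, flip, neg_lt_neg_iff] at h2' h3'
    rw [sub_apply]
    -- The regions `-y < x` and `x < y`, where `B` and `-B'` increase strictly, together cover the
    -- half disc without the vertex.
    rcases lt_or_ge (-z.2) z.1 with hlt | hle
    · linarith [h3 hlt]
    · have hlt : z.1 < z.2 := by
        have h0 := hz.1.1.2.1
        refine lt_of_le_of_ne (by linarith) fun heq => hz.1.2 ?_
        have : z.2 = 0 := by linarith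
        exact Prod.ext (by rw [heq, this]) this
      linarith [h3' hlt]
  · have h1 := (hBl i).mono_left (nhdsWithin_mono _ hsub)
    have hfl : Tendsto flip (𝓝[cell (min δ δ')] (0, 0)) (𝓝[cell δ'] (0, 0)) := by
      refine tendsto_nhdsWithin_iff.2 ⟨?_, ?_⟩
      · exact (continuous_flip.tendsto' _ _ (by simp [flip])).mono_left nhdsWithin_le_nhds
      · filter_upwards [self_mem_nhdsWithin] with z hz using flip_mem_cell (hsub' hz)
    have h2 := (hBl' (i + (2 * k + 1))).comp hfl
    have h3 := h1.sub h2
    rw [sub_zero] at h3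
    refine h3.congr fun z => ?_
    simp only [Function.comp_apply, hpl]

end SaddleFrame
end FlowBox


namespace FlowBox

/-! ### Roots in the closed upper half plane -/

/-- The inverse of the primitive root of unity `exp (π i / (k + 1))`. -/
noncomputable def unitRoot (k : ℕ) : ℂ := (Complex.exp (2 * Real.pi * Complex.I / (2 * k + 2 : ℕ)))⁻¹

/-- The branch of the `k + 1`-th root with argument in `[0, π / (k + 1)]` on the closed upper half
plane. -/
noncomputable def upperRoot (k : ℕ) (w : ℂ) : ℂ :=
  Complex.exp (Real.pi / 2 * Complex.I / (k + 1 : ℕ)) * (-Complex.I * w) ^ ((k + 1 : ℕ) : ℂ)⁻¹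

theorem natCast_succ_ne_zero (k : ℕ) : ((k + 1 : ℕ) : ℂ) ≠ 0 := Nat.cast_ne_zero.2 (by omega)

theorem isPrimitiveRoot_unitRoot (k : ℕ) : IsPrimitiveRoot (unitRoot k) (2 * k + 2) :=
  (Complex.isPrimitiveRoot_exp (2 * k + 2) (by omega)).inv

theorem unitRoot_ne_zero (k : ℕ) : unitRoot k ≠ 0 := inv_ne_zero (Complex.exp_ne_zero _)

theorem unitRoot_pow_succ (k : ℕ) : unitRoot k ^ (k + 1) = -1 := by
  rw [unitRoot, inv_pow, ← Complex.exp_nat_mul]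
  have : ((k + 1 : ℕ) : ℂ) * (2 * Real.pi * Complex.I / (2 * k + 2 : ℕ)) = Real.pi * Complex.I := by
    have h := natCast_succ_ne_zero k
    rw [show 2 * k + 2 = 2 * (k + 1) by ring]
    rw [Nat.cast_mul]
    field_simp
    simp
  rw [this, Complex.exp_pi_mul_I]
  norm_num

theorem upperRoot_pow (k : ℕ) (w : ℂ) : upperRoot k w ^ (k + 1) = w := by
  rw [upperRoot, mul_pow, ← Complex.exp_nat_mul, Complex.cpow_nat_inv_pow _ (by omega),
    mul_div_cancel₀ _ (natCast_succ_ne_zero k), Complex.exp_pi_div_two_mul_I]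
  linear_combination (-w) * Complex.I_mul_I

theorem upperRoot_ne_zero (k : ℕ) {w : ℂ} (hw : w ≠ 0) : upperRoot k w ≠ 0 := fun h => hw (by
  rw [← upperRoot_pow k w, h, zero_pow (by omega)])

/-- Rotation by `-i` moves the closed upper half plane to the closed right half plane, which without
the origin lies in the slit plane. So the branch is continuous up to both real half axes. -/
theorem continuousAt_upperRoot (k : ℕ) {w : ℂ} (hw : w ≠ 0) (him : 0 ≤ w.im) :
    ContinuousAt (upperRoot k) w := by
  refine continuousAt_const.mul ?_
  refine (continuousAt_id.const_mul (-Complex.I)).cpow continuousAt_const ?_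
  rw [Complex.mem_slitPlane_iff]
  rcases him.lt_or_eq with h | h
  · left; simpa using h
  · right
    intro h0
    refine hw (Complex.ext ?_ h.symm)
    simpa using h0

theorem upperRoot_neg_ofReal (k : ℕ) {r : ℝ} (hr : 0 < r) :
    upperRoot k (r : ℂ) = unitRoot k * upperRoot k (-(r : ℂ)) := by
  have hr0 : (r : ℂ) ≠ 0 := Complex.ofReal_ne_zero.2 hr.ne'
  have hN := natCast_succ_ne_zero k
  have h2N : ((2 * k + 2 : ℕ) : ℂ) = 2 * ((k + 1 : ℕ) : ℂ) := by push_cast; ring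
  have h1 : -Complex.I * (r : ℂ) = r * -Complex.I := by ring
  have h2 : -Complex.I * -(r : ℂ) = r * Complex.I := by ring
  have hI : (r : ℂ) * Complex.I ≠ 0 := mul_ne_zero hr0 Complex.I_ne_zero
  have hI' : (r : ℂ) * -Complex.I ≠ 0 := mul_ne_zero hr0 (neg_ne_zero.2 Complex.I_ne_zero)
  rw [upperRoot, upperRoot, h1, h2, Complex.cpow_def_of_ne_zero hI, Complex.cpow_def_of_ne_zero hI',
    Complex.log_ofReal_mul hr Complex.I_ne_zero,
    Complex.log_ofReal_mul hr (neg_ne_zero.2 Complex.I_ne_zero), Complex.log_I, Complex.log_neg_I,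
    unitRoot, ← Complex.exp_neg, ← Complex.exp_add, ← Complex.exp_add, ← Complex.exp_add, h2N]
  congr 1
  field_simp
  ring

theorem pow_mul_upperRoot_pow (k i : ℕ) (w : ℂ) :
    (unitRoot k ^ i * upperRoot k ((-1) ^ i * w)) ^ (k + 1) = w := by
  rw [mul_pow, upperRoot_pow, ← pow_mul, mul_comm i, pow_mul, unitRoot_pow_succ, ← mul_assoc,
    ← mul_pow]
  norm_num

theorem mod_eq_of_unitRoot_pow_eq {k i j : ℕ} (h : unitRoot k ^ i = unitRoot k ^ j) :
    i % (2 * k + 2) = j % (2 * k + 2) := by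
  have h1 := isPrimitiveRoot_unitRoot k
  rw [← pow_mod_orderOf, ← pow_mod_orderOf (n := j), ← h1.eq_orderOf] at h
  exact h1.pow_inj (Nat.mod_lt _ (by omega)) (Nat.mod_lt _ (by omega)) h

/-- Root number `s` is one solution, and the others differ from it by powers of the primitive `k +
1`-th root `unitRoot k ^ 2`. So all the solutions carry numbers of one prescribed parity. -/
theorem exists_eq_pow_mul_upperRoot (k s : ℕ) {ξ w : ℂ} (hw : w ≠ 0) (hξ : ξ ^ (k + 1) = w) :
    ∃ l, ξ = unitRoot k ^ (2 * l + s) * upperRoot k ((-1) ^ (2 * l + s) * w) := by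
  set R := unitRoot k ^ s * upperRoot k ((-1) ^ s * w) with hR
  have hR0 : R ≠ 0 := mul_ne_zero (pow_ne_zero _ (unitRoot_ne_zero k))
    (upperRoot_ne_zero k (mul_ne_zero (by simp) hw))
  have h2 : IsPrimitiveRoot (unitRoot k ^ 2) (k + 1) :=
    (isPrimitiveRoot_unitRoot k).pow (by omega) (by ring)
  have hone : (ξ / R) ^ (k + 1) = 1 := by
    rw [div_pow, hξ, hR, pow_mul_upperRoot_pow, div_self hw]
  obtain ⟨l, -, hl⟩ := h2.eq_pow_of_pow_eq_one hone
  refine ⟨l, ?_⟩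
  rw [eq_div_iff hR0] at hl
  rw [← hl, hR, pow_add, pow_add, pow_mul, pow_mul]
  simp [mul_assoc]

/-- A continuous root of a smooth function is smooth. -/
theorem contDiffAt_of_pow {k : ℕ} {f F : Plane → ℂ} {p : Plane} (hf : ContinuousAt f p)
    (h0 : f p ≠ 0) (hF : ContDiffAt ℝ ∞ F p) (hfF : ∀ᶠ p' in 𝓝 p, f p' ^ (k + 1) = F p') :
    ContDiffAt ℝ ∞ f p := by
  have hFp : f p ^ (k + 1) = F p := hfF.self_of_nhds
  have hr : Tendsto (fun p' => f p' / f p) (𝓝 p) (𝓝 1) := by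
    have := hf.tendsto.div_const (f p)
    rwa [div_self h0] at this
  have harg : Tendsto (fun p' => (f p' / f p).arg) (𝓝 p) (𝓝 0) := by
    have := (Complex.continuousAt_arg (x := 1) (by simp)).tendsto.comp hr
    simpa [Function.comp_def] using this
  have hpos : 0 < Real.pi / (k + 1 : ℕ) := by positivity
  -- Near `p` the ratio `f / f p` has small argument, so the principal branch of the root recovers
  -- it from its power.
  have hev : f =ᶠ[𝓝 p] fun p' => f p * (F p' / F p) ^ ((k + 1 : ℕ) : ℂ)⁻¹ := by
    filter_upwards [hfF, harg.eventually (Ioo_mem_nhds (neg_lt_zero.2 hpos) hpos)] with p' h1 h2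
    rw [← h1, ← hFp, ← div_pow, Complex.pow_cpow_nat_inv (by omega) h2.1 h2.2.le,
      mul_div_cancel₀ _ h0]
  refine ContDiffAt.congr_of_eventuallyEq ?_ hev
  refine contDiffAt_const.mul ?_
  have hFp0 : F p ≠ 0 := hFp ▸ pow_ne_zero _ h0
  have h1 : ContDiffAt ℂ ∞ (fun w : ℂ => w ^ ((k + 1 : ℕ) : ℂ)⁻¹) (F p / F p) := by
    rw [div_self hFp0]
    exact (analyticAt_id.cpow analyticAt_const (by simp)).contDiffAt
  exact (h1.restrict_scalars ℝ).comp p (hF.div_const _)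

/-- A smooth injective map with invertible derivatives is a diffeomorphism onto an open set. -/
theorem exists_openPartialHomeomorph_of_injOn {f : Plane → ℂ} {N : Set Plane}
    (hN : IsOpen N) (hf : ContDiffOn ℝ ∞ f N)
    (hinv : ∀ p ∈ N, ∃ A : Plane ≃L[ℝ] ℂ, HasFDerivAt f (A : Plane →L[ℝ] ℂ) p)
    (hinj : InjOn f N) : ∃ φ : OpenPartialHomeomorph Plane ℂ, ⇑φ = f ∧ φ.source = N ∧
      φ.target = f '' N ∧ ContDiffOn ℝ ∞ φ.symm φ.target := by
  set g := Function.invFunOn f N with hg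
  have hleft : ∀ p ∈ N, g (f p) = p := fun p hp => hinj.leftInvOn_invFunOn hp
  have hloc : ∀ w ∈ f '' N, ∃ V ∈ 𝓝 w, V ⊆ f '' N ∧ ContDiffOn ℝ ∞ g V := by
    rintro _ ⟨p, hp, rfl⟩
    obtain ⟨φ, hφf, hφN, hpφ, hφs⟩ := exists_openPartialHomeomorph_of_contDiffOn hN hf hinv hp
    have hmem : f p ∈ φ.target := by rw [← hφf]; exact φ.map_source hpφ
    refine ⟨φ.target, φ.open_target.mem_nhds hmem, fun w hw => ?_, ?_⟩
    · exact ⟨φ.symm w, hφN (φ.map_target hw), by rw [← hφf]; exact φ.right_inv hw⟩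
    · refine hφs.congr fun w hw => ?_
      have h1 : f (φ.symm w) = w := by rw [← hφf]; exact φ.right_inv hw
      rw [← h1, hleft _ (hφN (φ.map_target hw)), h1]
  have hop : IsOpen (f '' N) := isOpen_iff_mem_nhds.2 fun w hw => by
    obtain ⟨V, hV, hVN, -⟩ := hloc w hw
    exact mem_of_superset hV hVN
  have hgs : ContDiffOn ℝ ∞ g (f '' N) := fun w hw => by
    obtain ⟨V, hV, -, hVg⟩ := hloc w hw
    exact (hVg.contDiffAt hV).contDiffWithinAt
  let φ : OpenPartialHomeomorph Plane ℂ :=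
    { toFun := f
      invFun := g
      source := N
      target := f '' N
      map_source' := fun p hp => ⟨p, hp, rfl⟩
      map_target' := by
        rintro _ ⟨p, hp, rfl⟩
        rwa [hleft p hp]
      left_inv' := hleft
      right_inv' := by
        rintro _ ⟨p, hp, rfl⟩
        rw [hleft p hp]
      open_source := hN
      open_target := hop
      continuousOn_toFun := hf.continuousOn
      continuousOn_invFun := hgs.continuousOn }
  exact ⟨φ, rfl, rfl, rfl, hgs⟩

end FlowBox


/-! ### The complex coordinate given by time and height -/

namespace FlowBox

/-- A smooth function increasing along the trajectories of a saddle, with limit zero at the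
vertex. -/
structure IsSaddleTime (X : Plane → Plane) (q : Sphere) (h : ℕ → ℝ × ℝ → Sphere) (δ : ℝ)
    (τ : Plane → ℝ) : Prop where
  smooth : ∀ i, ∀ z ∈ cell δ, ContDiffAt ℝ ∞ τ (toPlane (h i) z)
  pos : ∀ i, ∀ z ∈ cell δ, 0 < fderiv ℝ τ (toPlane (h i) z) (X (toPlane (h i) z))
  tendsto : ∀ i, Tendsto (fun z => τ (toPlane (h i) z)) (𝓝[cell δ] (0, 0)) (𝓝 0)

/-- The complex coordinate of a saddle with the time function `τ`, in the sector `i`. -/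
noncomputable def saddleCoord (h : ℕ → ℝ × ℝ → Sphere) (e : ℕ → OpenPartialHomeomorph Plane ℂ)
    (a : ℕ → ℝ) (τ : Plane → ℝ) (i : ℕ) (z : ℝ × ℝ) : ℂ :=
  ⟨τ (toPlane (h i) z), a 0 * sectorHeight (toPlane (h i)) (e i) z.2⟩

variable {X : Plane → Plane} {U : Set Plane} {x x' y t δ δ' : ℝ}
  {T : Set (OpenPartialHomeomorph Plane ℂ)} {q : Sphere} {k : ℕ} {h : ℕ → ℝ × ℝ → Sphere}
  {e : ℕ → OpenPartialHomeomorph Plane ℂ} {a : ℕ → ℝ} {c : OpenPartialHomeomorph Plane ℂ}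
  {z z' z₀ : ℝ × ℝ} {p b : Plane} {i l m j : ℕ} {τ : Plane → ℝ} {w : ℂ}

theorem cell_of_mem_segment {u : ℝ} (hz : (x, y) ∈ cell δ) (hz' : (x', y) ∈ cell δ)
    (hc : 0 < y ∨ x' < 0 ∨ 0 < x) (hu : u ∈ Icc x x') : (u, y) ∈ cell δ := by
  refine ⟨mem_puncturedModel_of_cond hz.1.1.2 hz.1.1.1 hz'.1.1.1 hc hu, ?_, hz.2.2⟩
  have h1 := abs_lt.1 hz.2.1
  have h2 := abs_lt.1 hz'.2.1
  exact abs_lt.2 ⟨h1.1.trans_le hu.1, hu.2.trans_lt h2.2⟩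

namespace SaddleFrame

variable (hF : SaddleFrame X U T q k h e a δ) (hτ : IsSaddleTime X q h δ τ)
include hF hτ

theorem time_lt (hz : (x, y) ∈ cell δ) (hz' : (x', y) ∈ cell δ) (hlt : x < x')
    (hc : 0 < y ∨ x' < 0 ∨ 0 < x) : τ (toPlane (h i) (x, y)) < τ (toPlane (h i) (x', y)) := by
  obtain ⟨t, ht, γ, hγ, h0, h1, him⟩ := (hF.regular i).orbit y hz.1.1.2 x hz.1.1.1 x' hz'.1.1.1 hlt hc
  replace hγ : IsArc X U γ (uIcc 0 t) := hγ
  rw [uIcc_of_le ht.le] at hγ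
  have hcell : ∀ s ∈ Icc 0 t, ∃ u, (u, y) ∈ cell δ ∧ toPlane (h i) (u, y) = γ s := by
    intro s hs
    obtain ⟨u, hu, hus⟩ := him.subset ⟨s, hs, rfl⟩
    exact ⟨u, cell_of_mem_segment hz hz' hc hu, hus⟩
  have hd : ∀ s ∈ Icc 0 t, DifferentiableAt ℝ τ (γ s) ∧ 0 < fderiv ℝ τ (γ s) (X (γ s)) := by
    intro s hs
    obtain ⟨u, hu, hus⟩ := hcell s hs
    rw [← hus]
    exact ⟨(hτ.smooth i _ hu).differentiableAt (by simp), hτ.pos i _ hu⟩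
  have hmono : StrictMonoOn (fun s => τ (γ s)) (Icc 0 t) := by
    refine strictMonoOn_of_deriv_pos (convex_Icc 0 t) ?_ fun s hs => ?_
    · exact fun s hs => (hd s hs).1.continuousAt.comp_continuousWithinAt (hγ.continuousOn s hs)
    · rw [interior_Icc] at hs
      have hs' := Ioo_subset_Icc_self hs
      have h2 : HasDerivAt γ (X (γ s)) s := (hγ s hs').2.hasDerivAt (Icc_mem_nhds hs.1 hs.2)
      have h3 := (hd s hs').1.hasFDerivAt.comp_hasDerivAt s h2
      rw [show (fun s => τ (γ s)) = τ ∘ γ from rfl, h3.deriv]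
      exact (hd s hs').2
  have := hmono ⟨le_rfl, ht.le⟩ ⟨ht.le, le_rfl⟩ ht
  simpa only [h0, h1] using this

/-- The time tends to `0` at the vertex and increases along the outgoing separatrix; the point `x /
2` keeps the inequality strict. -/
theorem time_pos (hz : (x, 0) ∈ cell δ) (hx : 0 < x) : 0 < τ (toPlane (h i) (x, 0)) := by
  have hx1 := (abs_lt.1 hz.2.1).2
  have hcell : ∀ u ∈ Ioo 0 x, (u, (0 : ℝ)) ∈ cell δ := fun u hu =>
    mem_cell_of_ne_zero hF.pos (by rw [abs_lt]; constructor <;> linarith [hu.1, hu.2]) hu.1.ne'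
  have h1 : x / 2 ∈ Ioo 0 x := ⟨by linarith, by linarith⟩
  refine lt_of_le_of_lt ?_ (hF.time_lt hτ (hcell _ h1) hz h1.2 (Or.inr (Or.inr h1.1)))
  have h2 : Tendsto (fun u : ℝ => (u, (0 : ℝ))) (𝓝[>] 0) (𝓝[cell δ] (0, 0)) := by
    refine tendsto_nhdsWithin_iff.2 ⟨?_, ?_⟩
    · exact (Continuous.tendsto' (by fun_prop) _ _ rfl).mono_left nhdsWithin_le_nhds
    · filter_upwards [Ioo_mem_nhdsGT hx] with u hu using hcell u hu
  refine le_of_tendsto ((hτ.tendsto i).comp h2) ?_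
  filter_upwards [Ioo_mem_nhdsGT h1.1] with u hu
  exact (hF.time_lt hτ (hcell u ⟨hu.1, hu.2.trans h1.2⟩) (hcell _ h1) hu.2
    (Or.inr (Or.inr hu.1))).le

theorem time_neg (hz : (x, 0) ∈ cell δ) (hx : x < 0) : τ (toPlane (h i) (x, 0)) < 0 := by
  have hx1 := (abs_lt.1 hz.2.1).1
  have hcell : ∀ u ∈ Ioo x 0, (u, (0 : ℝ)) ∈ cell δ := fun u hu =>
    mem_cell_of_ne_zero hF.pos (by rw [abs_lt]; constructor <;> linarith [hu.1, hu.2]) hu.2.ne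
  have h1 : x / 2 ∈ Ioo x 0 := ⟨by linarith, by linarith⟩
  refine lt_of_lt_of_le (hF.time_lt hτ hz (hcell _ h1) h1.1 (Or.inr (Or.inl h1.2))) ?_
  have h2 : Tendsto (fun u : ℝ => (u, (0 : ℝ))) (𝓝[<] 0) (𝓝[cell δ] (0, 0)) := by
    refine tendsto_nhdsWithin_iff.2 ⟨?_, ?_⟩
    · exact (Continuous.tendsto' (by fun_prop) _ _ rfl).mono_left nhdsWithin_le_nhds
    · filter_upwards [Ioo_mem_nhdsLT hx] with u hu using hcell u hu
  refine ge_of_tendsto ((hτ.tendsto i).comp h2) ?_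
  filter_upwards [Ioo_mem_nhdsLT h1.2] with u hu
  exact (hF.time_lt hτ (hcell _ h1) (hcell u ⟨h1.1.trans hu.1, hu.2⟩) hu.1
    (Or.inr (Or.inl hu.2))).le

omit hτ in
theorem signed_im (hT : IsTranslationAtlas X U T) :
    (-1) ^ i * (saddleCoord h e a τ i z).im =
      a i * sectorHeight (toPlane (h i)) (e i) z.2 := by
  rw [hF.sign_eq hT i, saddleCoord]
  ring

theorem saddleCoord_ne_zero (hz : z ∈ cell δ) : saddleCoord h e a τ i z ≠ 0 := by
  intro h0
  have him : a 0 * sectorHeight (toPlane (h i)) (e i) z.2 = 0 := congrArg Complex.im h0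
  have hre : τ (toPlane (h i) z) = 0 := congrArg Complex.re h0
  have ha : a 0 ≠ 0 := by rcases hF.sign 0 with h1 | h1 <;> simp [h1]
  have hη : sectorHeight (toPlane (h i)) (e i) z.2 = 0 := (mul_eq_zero.1 him).resolve_left ha
  have hz2 : z.2 = 0 :=
    (hF.mono i).injOn ⟨hz.1.1.2.1, hz.2.2⟩ ⟨le_rfl, hF.pos⟩ (by simp [hη, sectorHeight_zero])
  have hzz : z = (z.1, 0) := Prod.ext rfl hz2
  rw [hzz] at hre hz
  rcases lt_trichotomy z.1 0 with h1 | h1 | h1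
  · exact (hF.time_neg hτ hz h1).ne hre
  · exact hz.1.2 (Prod.ext h1 rfl)
  · exact (hF.time_pos hτ hz h1).ne' hre

/-- The imaginary part determines the row. On it the time is strictly increasing, and on the row of
the vertex its sign tells the two separatrices apart. -/
theorem saddleCoord_injOn (i : ℕ) : InjOn (saddleCoord h e a τ i) (cell δ) := by
  intro z hz z' hz' heq
  have him : a 0 * sectorHeight (toPlane (h i)) (e i) z.2 =
      a 0 * sectorHeight (toPlane (h i)) (e i) z'.2 := congrArg Complex.im heq
  have hre : τ (toPlane (h i) z) = τ (toPlane (h i) z') := congrArg Complex.re heq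
  have ha : a 0 ≠ 0 := by rcases hF.sign 0 with h1 | h1 <;> simp [h1]
  have h2 := hF.height_injOn hz hz' (mul_left_cancel₀ ha him)
  obtain ⟨x, y⟩ := z
  obtain ⟨x', y'⟩ := z'
  simp only at h2
  subst h2
  have key : ∀ x x' : ℝ, (x, y) ∈ cell δ → (x', y) ∈ cell δ → x < x' →
      τ (toPlane (h i) (x, y)) ≠ τ (toPlane (h i) (x', y)) := by
    intro x x' hz hz' hlt
    rcases hz.1.1.2.1.eq_or_lt with h0 | hpos
    · simp only at h0
      subst h0
      rcases lt_trichotomy x 0 with h1 | h1 | h1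
      · rcases lt_trichotomy x' 0 with h2 | h2 | h2
        · exact (hF.time_lt hτ hz hz' hlt (Or.inr (Or.inl h2))).ne
        · exact (hz'.1.2 (Prod.ext h2 rfl)).elim
        · exact ((hF.time_neg hτ hz h1).trans (hF.time_pos hτ hz' h2)).ne
      · exact (hz.1.2 (Prod.ext h1 rfl)).elim
      · exact (hF.time_lt hτ hz hz' hlt (Or.inr (Or.inr h1))).ne
    · exact (hF.time_lt hτ hz hz' hlt (Or.inl hpos)).ne
  rcases lt_trichotomy x x' with h1 | h1 | h1
  · exact absurd hre (key _ _ hz hz' h1)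
  · rw [h1]
  · exact absurd hre.symm (key _ _ hz' hz h1)

/-- The complex coordinate of a sector takes all the values in a half disc. -/
theorem exists_saddleCoord_eq (hT : IsTranslationAtlas X U T) (i : ℕ) : ∃ κ > 0, ∀ w : ℂ, w ≠ 0 →
    ‖w‖ < κ → 0 ≤ (-1) ^ i * w.im → ∃ z ∈ cell δ, saddleCoord h e a τ i z = w := by
  set g := toPlane (h i) with hg
  have hcr : ((1 / 2 : ℝ), (0 : ℝ)) ∈ cell δ :=
    mem_cell_of_ne_zero hF.pos (by rw [abs_lt]; norm_num) (by norm_num)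
  have hcl : ((-(1 / 2) : ℝ), (0 : ℝ)) ∈ cell δ :=
    mem_cell_of_ne_zero hF.pos (by rw [abs_lt]; norm_num) (by norm_num)
  have hτc : ∀ z ∈ cell δ, Tendsto (fun z => τ (g z)) (𝓝[sectorModel] z) (𝓝 (τ (g z))) := by
    intro z hz
    have h1 : Tendsto g (𝓝[sectorModel] z) (𝓝 (g z)) :=
      ((hF.regular i).continuousOn z hz.1).mono_left
        (le_inf nhdsWithin_le_nhds (le_principal_iff.2
          (mem_of_superset (cell_mem_nhdsWithin hz) fun w hw => hw.1)))
    exact (hτ.smooth i z hz).continuousAt.tendsto.comp h1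
  -- At the abscissas `±1/2` the time stays beyond `±κ₀` on all sufficiently low rows, so each of
  -- these rows attains all real parts below `κ₀` in absolute value.
  set κ₀ := min (τ (g (1 / 2, 0))) (-τ (g (-(1 / 2), 0))) / 2 with hκ₀
  have hpos : 0 < min (τ (g (1 / 2, 0))) (-τ (g (-(1 / 2), 0))) :=
    lt_min (hF.time_pos hτ hcr (by norm_num))
      (by linarith [hF.time_neg hτ (i := i) hcl (by norm_num)])
  have hk1 := min_le_left (τ (g (1 / 2, 0))) (-τ (g (-(1 / 2), 0)))
  have hk2 := min_le_right (τ (g (1 / 2, 0))) (-τ (g (-(1 / 2), 0)))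
  have hv : ∀ x : ℝ, (x, (0 : ℝ)) ∈ cell δ →
      Tendsto (fun v : ℝ => (x, v)) (𝓝[Icc 0 1] 0) (𝓝[sectorModel] (x, 0)) := by
    intro x hx
    refine tendsto_nhdsWithin_iff.2 ⟨?_, ?_⟩
    · exact (Continuous.tendsto' (by fun_prop) _ _ rfl).mono_left nhdsWithin_le_nhds
    · filter_upwards [self_mem_nhdsWithin] with v hv using ⟨hx.1.1.1, hv⟩
  have hev : ∀ᶠ v in 𝓝[Icc 0 1] (0 : ℝ), κ₀ < τ (g (1 / 2, v)) ∧ τ (g (-(1 / 2), v)) < -κ₀ :=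
    (((hτc _ hcr).comp (hv _ hcr)).eventually (lt_mem_nhds (by linarith))).and
      (((hτc _ hcl).comp (hv _ hcl)).eventually (gt_mem_nhds (by linarith)))
  obtain ⟨r₀, hr₀, hball⟩ := Metric.mem_nhdsWithin_iff.1 hev
  obtain ⟨r, hr, hrδ, hrr⟩ : ∃ r > 0, r < δ ∧ r < r₀ := by
    obtain ⟨r, h1, h2⟩ := exists_between (lt_min hF.pos hr₀)
    exact ⟨r, h1, h2.trans_le (min_le_left _ _), h2.trans_le (min_le_right _ _)⟩
  have hδ1 := hF.le_one
  set η : ℝ → ℝ := fun v => a i * sectorHeight g (e i) v with hη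
  have hηr : 0 < η r := by
    have := hF.mono i (⟨le_rfl, hF.pos⟩ : (0 : ℝ) ∈ Ico 0 δ) ⟨hr.le, hrδ⟩ hr
    simpa [sectorHeight_zero] using this
  have hηc : ContinuousOn η (Icc 0 r) :=
    continuousOn_const.mul ((IsTranslationAtlas.continuousOn_sectorHeight (hF.regular i) (hF.chart_source i)).mono
      fun v hv => ⟨⟨hv.1, by linarith [hv.2]⟩, hv.2.trans_lt hrδ⟩)
  have hη0 : η 0 = 0 := by simp [hη, sectorHeight_zero]
  refine ⟨min κ₀ (η r), lt_min (by linarith) hηr, fun w hw0 hw him => ?_⟩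
  have hwre := abs_le.1 (Complex.abs_re_le_norm w)
  have hwim : (-1) ^ i * w.im ≤ ‖w‖ := by
    refine le_trans (le_abs_self _) ?_
    rw [abs_mul, abs_pow, abs_neg, abs_one, one_pow, one_mul]
    exact Complex.abs_im_le_norm w
  obtain ⟨hw1, hw2⟩ := lt_min_iff.1 hw
  obtain ⟨v, hvr, hvη⟩ := intermediate_value_Icc hr.le hηc
    (⟨by rw [hη0]; exact him, by linarith⟩ : (-1) ^ i * w.im ∈ Icc (η 0) (η r))
  have hvI : v ∈ Icc (0 : ℝ) 1 := ⟨hvr.1, by linarith [hvr.2]⟩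
  have hvτ := hball (⟨by
    rw [Metric.mem_ball, Real.dist_eq, sub_zero, abs_of_nonneg hvr.1]
    exact hvr.2.trans_lt hrr, hvI⟩ : v ∈ Metric.ball 0 r₀ ∩ Icc 0 1)
  simp only [mem_ofPred_eq] at hvτ
  -- On the lowest row the time is extended by its limit `0` at the vertex; the intermediate value
  -- theorem then applies to all rows alike.
  set f : ℝ → ℝ := fun x => if (x, v) = ((0 : ℝ), (0 : ℝ)) then 0 else τ (g (x, v)) with hf
  have hcell : ∀ x ∈ Icc (-(1 / 2) : ℝ) (1 / 2), (x, v) ≠ (0, 0) → (x, v) ∈ cell δ :=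
    fun x hx hne => ⟨⟨⟨⟨by linarith [hx.1], by linarith [hx.2]⟩, hvI⟩, hne⟩,
      by rw [abs_lt]; constructor <;> linarith [hx.1, hx.2], hvr.2.trans_lt hrδ⟩
  have hline : ∀ x, Tendsto (fun x : ℝ => (x, v)) (𝓝[Icc (-(1 / 2)) (1 / 2)] x)
      (𝓝 (x, v)) := fun x =>
    (Continuous.tendsto' (by fun_prop) _ _ rfl).mono_left nhdsWithin_le_nhds
  have hfc : ContinuousOn f (Icc (-(1 / 2)) (1 / 2)) := by
    intro x hx
    by_cases hx0 : (x, v) = ((0 : ℝ), (0 : ℝ))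
    · have hfx : f x = 0 := by simp only [hf, if_pos hx0]
      rw [ContinuousWithinAt, hfx, Metric.tendsto_nhds]
      intro ε hε
      have h1 := Metric.tendsto_nhds.1 (hτ.tendsto i) ε hε
      obtain ⟨s, hs, hsb⟩ := Metric.mem_nhdsWithin_iff.1 h1
      have h2 := (hline x).eventually (Metric.ball_mem_nhds (x, v) hs)
      filter_upwards [h2, self_mem_nhdsWithin] with x' hx' hxI
      by_cases h0 : (x', v) = ((0 : ℝ), (0 : ℝ))
      · simp only [hf, if_pos h0, dist_self, hε]
      · simp only [hf, if_neg h0]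
        rw [hx0] at hx'
        exact hsb ⟨hx', hcell x' hxI h0⟩
    · have hfx : f x = τ (g (x, v)) := by simp only [hf, if_neg hx0]
      have h1 : Tendsto (fun x : ℝ => (x, v)) (𝓝[Icc (-(1 / 2)) (1 / 2)] x)
          (𝓝[sectorModel] (x, v)) := by
        refine tendsto_nhdsWithin_iff.2 ⟨hline x, ?_⟩
        filter_upwards [self_mem_nhdsWithin] with x' hx'
        exact ⟨⟨by linarith [hx'.1], by linarith [hx'.2]⟩, hvI⟩
      rw [ContinuousWithinAt, hfx]
      refine ((hτc _ (hcell x hx hx0)).comp h1).congr' ?_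
      filter_upwards [(hline x).eventually (isOpen_compl_singleton.mem_nhds hx0)] with x' hx'
      have hx'' : (x', v) ≠ ((0 : ℝ), (0 : ℝ)) := hx'
      simp only [hf, if_neg hx'', Function.comp_apply]
  have hfl : f (-(1 / 2)) = τ (g (-(1 / 2), v)) := by
    simp only [hf]; rw [if_neg]; intro h0; have := (Prod.ext_iff.1 h0).1; norm_num at this
  have hfr : f (1 / 2) = τ (g (1 / 2, v)) := by
    simp only [hf]; rw [if_neg]; intro h0; have := (Prod.ext_iff.1 h0).1; norm_num at this
  obtain ⟨x, hx, hxw⟩ := intermediate_value_Icc (by norm_num : (-(1 / 2) : ℝ) ≤ 1 / 2) hfc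
    (⟨by rw [hfl]; linarith [hvτ.2], by rw [hfr]; linarith [hvτ.1]⟩ :
      w.re ∈ Icc (f (-(1 / 2))) (f (1 / 2)))
  have himw : a 0 * sectorHeight g (e i) v = w.im := by
    have h1 := hF.signed_im (τ := τ) (z := (x, v)) (i := i) hT
    rw [← hg] at h1
    have h2 : (-1 : ℝ) ^ i ≠ 0 := by simp
    exact mul_left_cancel₀ h2 (h1.trans hvη)
  have hne : (x, v) ≠ ((0 : ℝ), (0 : ℝ)) := by
    intro h0
    have hv0 : v = 0 := (Prod.ext_iff.1 h0).2
    simp only [hf, if_pos h0] at hxw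
    rw [hv0, sectorHeight_zero, mul_zero] at himw
    exact hw0 (Complex.ext hxw.symm himw.symm)
  simp only [hf, if_neg hne] at hxw
  exact ⟨(x, v), hcell x hx hne, Complex.ext hxw himw⟩

end SaddleFrame
end FlowBox


/-! ### The root of the coordinate as a diffeomorphism -/

namespace FlowBox

/-- The `k + 1`-th root of the complex coordinate of a saddle, in the sector `i`. -/
noncomputable def saddleRoot (k : ℕ) (h : ℕ → ℝ × ℝ → Sphere)
    (e : ℕ → OpenPartialHomeomorph Plane ℂ) (a : ℕ → ℝ) (τ : Plane → ℝ) (i : ℕ) (z : ℝ × ℝ) : ℂ :=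
  unitRoot k ^ i * upperRoot k ((-1) ^ i * saddleCoord h e a τ i z)

/-- The inner part of a neighbourhood of a saddle, without the saddle. -/
def saddleDomain (h : ℕ → ℝ × ℝ → Sphere) (δ : ℝ) : Set Plane := ⋃ i, toPlane (h i) '' cell δ

variable {X : Plane → Plane} {U : Set Plane} {x x' y t δ δ' : ℝ}
  {T : Set (OpenPartialHomeomorph Plane ℂ)} {q : Sphere} {k : ℕ} {h : ℕ → ℝ × ℝ → Sphere}
  {e : ℕ → OpenPartialHomeomorph Plane ℂ} {a : ℕ → ℝ} {c : OpenPartialHomeomorph Plane ℂ}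
  {z z' z₀ : ℝ × ℝ} {p b : Plane} {i l m j : ℕ} {τ : Plane → ℝ} {w : ℂ}

theorem saddleRoot_pow : saddleRoot k h e a τ i z ^ (k + 1) = saddleCoord h e a τ i z :=
  pow_mul_upperRoot_pow k i _

theorem neg_one_pow_mul_im (i : ℕ) (w : ℂ) : ((-1) ^ i * w).im = (-1) ^ i * w.im := by
  rcases Nat.even_or_odd i with hi | hi <;> simp [hi.neg_one_pow]

namespace SaddleFrame

variable (hF : SaddleFrame X U T q k h e a δ) (hτ : IsSaddleTime X q h δ τ)
include hF

theorem isOpen_saddleDomain (hT : IsTranslationAtlas X U T) : IsOpen (saddleDomain h δ) := by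
  rw [isOpen_iff_mem_nhds]
  intro p hp
  obtain ⟨i, z, hz, rfl⟩ := mem_iUnion.1 hp
  refine hF.eventually_of_sectors hT hz fun m _ => ?_
  filter_upwards [cell_mem_nhdsWithin hz] with z' hz' using mem_iUnion.2 ⟨m, z', hz', rfl⟩

theorem saddleRoot_period (i : ℕ) :
    saddleRoot k h e a τ (i + (2 * k + 2)) = saddleRoot k h e a τ i := by
  ext z
  rw [saddleRoot, saddleRoot, saddleCoord, saddleCoord, hF.period, hF.chart_period,
    pow_add (unitRoot k) i (2 * k + 2), pow_add (-1 : ℂ) i (2 * k + 2),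
    (isPrimitiveRoot_unitRoot k).pow_eq_one,
    (Even.neg_one_pow ⟨k + 1, by ring⟩ : (-1 : ℂ) ^ (2 * k + 2) = 1), mul_one, mul_one]

/-- The finitely many sectors cover a neighbourhood of the vertex, and by compactness the parameters
of points near the vertex are near the origin in each of them. -/
theorem exists_vertex_nhd {N : ℕ → Set (ℝ × ℝ)} (hN : ∀ i, IsOpen (N i))
    (h0 : ∀ i, ((0 : ℝ), (0 : ℝ)) ∈ N i) :
    ∀ᶠ s in 𝓝 q, s ≠ q → ∃ i, ∃ z ∈ cell δ, z ∈ N i ∧ h i z = s := by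
  have h1 : ∀ᶠ s in 𝓝 q, ∀ i ∈ Finset.range (2 * k + 2), ∀ z ∈ sectorModel, h i z = s →
      z ∈ N i ∩ {z | |z.1| < 1 ∧ z.2 < δ} := by
    rw [eventually_all_finset]
    intro i _
    have h2 : IsOpen {z : ℝ × ℝ | |z.1| < 1 ∧ z.2 < δ} :=
      (isOpen_lt (continuous_abs.comp continuous_fst) continuous_const).inter
        (isOpen_lt continuous_snd continuous_const)
    have := (hF.sector i).eventually_mem (z₀ := (0, 0)) (by simp [sectorModel])
      ((hN i).inter h2) ⟨h0 i, by simp, hF.pos⟩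
    rwa [(hF.sector i).vertex] at this
  filter_upwards [h1, hF.nhds] with s hs hsU hsq
  obtain ⟨i, hi, z, hz, rfl⟩ := mem_iUnion₂.1 hsU
  obtain ⟨h2, h3, h4⟩ := hs i hi z hz rfl
  refine ⟨i, z, ⟨⟨hz, ?_⟩, h3, h4⟩, h2, rfl⟩
  rintro rfl
  exact hsq (hF.sector i).vertex

include hτ

/-- On a separatrix the coordinate is real. The change of sign between consecutive sectors exchanges
`r` and `-r` for some `r > 0`, and the two boundary values of `upperRoot` differ by the factor
`unitRoot k` that is added in the next sector. The sectors thus follow each other clockwise. -/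
theorem saddleRoot_sharesSide (hs : SharesSide i l x) (hx : |x| < 1) :
    saddleRoot k h e a τ i (x, 0) = saddleRoot k h e a τ l (x, 0) := by
  have hpl := hF.sharesSide_toPlane_eq hs hx.le
  have hco : ∀ m, saddleCoord h e a τ m (x, 0) = ((τ (toPlane (h m) (x, 0)) : ℝ) : ℂ) := fun m =>
    Complex.ext rfl (by simp [saddleCoord, sectorHeight_zero])
  rw [saddleRoot, saddleRoot, hco, hco, ← hpl]
  obtain ⟨rfl, ⟨hi, hx0⟩ | ⟨hi, hx0⟩⟩ := hs
  · have hpos := hF.time_pos hτ (i := i) (mem_cell_of_ne_zero hF.pos hx hx0.ne') hx0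
    rw [hi.neg_one_pow, hi.add_one.neg_one_pow, one_mul, neg_one_mul, upperRoot_neg_ofReal k hpos,
      pow_succ, mul_assoc]
  · have hneg := hF.time_neg hτ (i := i) (mem_cell_of_ne_zero hF.pos hx hx0.ne) hx0
    rw [hi.neg_one_pow, hi.add_one.neg_one_pow, one_mul, neg_one_mul, ← Complex.ofReal_neg,
      upperRoot_neg_ofReal k (neg_pos.2 hneg), pow_succ, mul_assoc, Complex.ofReal_neg, neg_neg]

theorem exists_saddleMap (hT : IsTranslationAtlas X U T) :
    ∃ Ξ : Plane → ℂ, ∀ i, ∀ z ∈ cell δ, Ξ (toPlane (h i) z) = saddleRoot k h e a τ i z :=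
  hF.exists_glued hT hF.saddleRoot_period fun _ _ _ hs hx => hF.saddleRoot_sharesSide hτ hs hx

variable {Ξ : Plane → ℂ} (hΞ : ∀ i, ∀ z ∈ cell δ, Ξ (toPlane (h i) z) = saddleRoot k h e a τ i z)
include hΞ

theorem saddleMap_ne_zero (hp : p ∈ saddleDomain h δ) : Ξ p ≠ 0 := by
  obtain ⟨i, z, hz, rfl⟩ := mem_iUnion.1 hp
  rw [hΞ i z hz]
  exact mul_ne_zero (pow_ne_zero _ (unitRoot_ne_zero k))
    (upperRoot_ne_zero k (mul_ne_zero (by simp) (hF.saddleCoord_ne_zero hτ hz)))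

omit hτ in
/-- In a straightening chart, the power of the saddle map is given by the time function and the
height. -/
theorem saddleMap_pow_germ (hT : IsTranslationAtlas X U T) (hz : z ∈ cell δ) (hc : c ∈ T)
    (hzc : toPlane (h i) z ∈ c.source) :
    ∀ᶠ p in 𝓝 (toPlane (h i) z), Ξ p ^ (k + 1) = (⟨τ p, (saddleCoord h e a τ i z).im +
      a 0 * ((c p).im - (c (toPlane (h i) z)).im)⟩ : ℂ) := by
  refine hF.eventually_of_sectors hT hz fun m hm => ?_
  have h1 : (saddleCoord h e a τ m z).im = (saddleCoord h e a τ i z).im := by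
    rw [← saddleRoot_pow, ← saddleRoot_pow, ← hΞ m z hz, ← hΞ i z hz, hm]
  filter_upwards [hT.height_germ (hF.regular m) (hF.chart_mem m) (hF.chart_source m) hz.1 hz.2.2 hc
    (by rwa [hm]), cell_mem_nhdsWithin hz] with z' h2 h3
  rw [hΞ m z' h3, saddleRoot_pow, saddleCoord, ← h1, ← hm, h2, saddleCoord]
  congr 1
  ring

/-- By `saddleMap_pow_germ` the power is `τ` plus `i` times the height of a chart, up to constants.
Its differential takes `X` to the real number `dτ(X)`. A vector in the kernel has no height
component, so it is a multiple of `X`, and then `dτ(X) > 0` makes it zero. -/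
theorem saddleMap_pow_hasFDerivAt (hT : IsTranslationAtlas X U T) (hp : p ∈ saddleDomain h δ) :
    ContDiffAt ℝ ∞ (fun p => Ξ p ^ (k + 1)) p ∧ 0 < fderiv ℝ τ p (X p) ∧
      ∃ L : Plane →L[ℝ] ℂ, HasFDerivAt (fun p => Ξ p ^ (k + 1)) L p ∧
        L (X p) = ((fderiv ℝ τ p (X p) : ℝ) : ℂ) ∧ Function.Injective L := by
  obtain ⟨i, z, hz, rfl⟩ := mem_iUnion.1 hp
  obtain ⟨c, hc, hzc⟩ := hT.covers _ (hF.toPlane_mem (i := i) hz)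
  have hev := hF.saddleMap_pow_germ hΞ hT hz hc hzc
  set p := toPlane (h i) z
  obtain ⟨A, hA, -, hAX⟩ := hT.hasFDerivAt_symm hc hzc
  have hpos := hτ.pos i z hz
  have hτs := hτ.smooth i z hz
  have hcd : ContDiffAt ℝ ∞ c p := (hT.smooth c hc).contDiffAt (c.open_source.mem_nhds hzc)
  set b := (saddleCoord h e a τ i z).im
  have heq : (fun p' => (⟨τ p', b + a 0 * ((c p').im - (c p).im)⟩ : ℂ)) = fun p' =>
      Complex.ofRealCLM (τ p') + (Complex.ofRealCLM (b + a 0 * (Complex.imCLM (c p') - (c p).im))) *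
        Complex.I := by
    ext p'
    exact Complex.mk_eq_add_mul_I _ _
  have hev' : (fun p => Ξ p ^ (k + 1)) =ᶠ[𝓝 p] fun p' =>
      Complex.ofRealCLM (τ p') + (Complex.ofRealCLM (b + a 0 * (Complex.imCLM (c p') - (c p).im))) *
        Complex.I := by
    rw [← heq]; exact hev
  have hτd : HasFDerivAt τ (fderiv ℝ τ p) p := (hτs.differentiableAt (by simp)).hasFDerivAt
  have hI : HasFDerivAt (fun p' => b + a 0 * (Complex.imCLM (c p') - (c p).im))
      (a 0 • Complex.imCLM.comp (A : Plane →L[ℝ] ℂ)) p :=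
    (((Complex.imCLM.hasFDerivAt.comp p hA).sub_const _).const_mul (a 0)).const_add b
  have hL := ((Complex.ofRealCLM.hasFDerivAt.comp p hτd).add
    ((Complex.ofRealCLM.hasFDerivAt.comp p hI).mul_const Complex.I)).congr_of_eventuallyEq hev'
  have hLv : ∀ v, (Complex.ofRealCLM.comp (fderiv ℝ τ p) +
      Complex.I • Complex.ofRealCLM.comp (a 0 • Complex.imCLM.comp (A : Plane →L[ℝ] ℂ))) v =
      ⟨fderiv ℝ τ p v, a 0 * (A v).im⟩ := by
    intro v
    apply Complex.ext <;> simp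
  refine ⟨?_, hpos, _, hL, ?_, ?_⟩
  · refine ContDiffAt.congr_of_eventuallyEq ?_ hev'
    have h1 : ContDiffAt ℝ ∞ (fun p' => Complex.imCLM (c p')) p :=
      Complex.imCLM.contDiff.contDiffAt.comp p hcd
    exact (Complex.ofRealCLM.contDiff.contDiffAt.comp p hτs).add
      ((Complex.ofRealCLM.contDiff.contDiffAt.comp p (contDiffAt_const.add
        (contDiffAt_const.mul (h1.sub contDiffAt_const)))).mul contDiffAt_const)
  · rw [hLv]
    apply Complex.ext <;> simp [hAX]
  · rw [injective_iff_map_eq_zero]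
    intro v hv
    rw [hLv] at hv
    have hre : fderiv ℝ τ p v = 0 := congrArg Complex.re hv
    have him : a 0 * (A v).im = 0 := congrArg Complex.im hv
    have ha : a 0 ≠ 0 := by rcases hF.sign 0 with h1 | h1 <;> simp [h1]
    have him' : (A v).im = 0 := (mul_eq_zero.1 him).resolve_left ha
    have hvX : v = (A v).re • X p := by
      apply A.injective
      rw [map_smul, hAX]
      apply Complex.ext <;> simp [him']
    rw [hvX, map_smul, smul_eq_mul] at hre
    rw [hvX, (mul_eq_zero.1 hre).resolve_right hpos.ne', zero_smul]

/-- The power is already continuous. In each sector through the point the map is a fixed branch of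
the root on a closed half plane, away from the origin. -/
theorem continuousAt_saddleMap (hT : IsTranslationAtlas X U T) (hp : p ∈ saddleDomain h δ) :
    ContinuousAt Ξ p := by
  have hpow := (hF.saddleMap_pow_hasFDerivAt hτ hΞ hT hp).1.continuousAt
  obtain ⟨i, z, hz, rfl⟩ := mem_iUnion.1 hp
  intro N hN
  refine hF.eventually_of_sectors hT hz fun m hm => ?_
  rw [← hm] at hN hpow
  have hg : Tendsto (toPlane (h m)) (𝓝[sectorModel] z) (𝓝 (toPlane (h m) z)) :=
    ((hF.regular m).continuousOn z hz.1).mono_left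
      (le_inf nhdsWithin_le_nhds (le_principal_iff.2
        (mem_of_superset (cell_mem_nhdsWithin hz) fun w hw => hw.1)))
  have hco : Tendsto (saddleCoord h e a τ m) (𝓝[sectorModel] z) (𝓝 (saddleCoord h e a τ m z)) := by
    have h1 := hpow.tendsto.comp hg
    simp only [hΞ m z hz, saddleRoot_pow] at h1
    refine h1.congr' ?_
    filter_upwards [cell_mem_nhdsWithin hz] with z' hz'
    rw [Function.comp_apply, hΞ m z' hz', saddleRoot_pow]
  have hrt : ContinuousAt (upperRoot k) ((-1) ^ m * saddleCoord h e a τ m z) := by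
    refine continuousAt_upperRoot k (mul_ne_zero (by simp) (hF.saddleCoord_ne_zero hτ hz)) ?_
    rw [neg_one_pow_mul_im, hF.signed_im hT]
    exact hF.height_nonneg hz
  have h2 := (hrt.tendsto.comp (hco.const_mul ((-1) ^ m))).const_mul (unitRoot k ^ m)
  rw [hΞ m z hz] at hN
  filter_upwards [h2.eventually hN, cell_mem_nhdsWithin hz] with z' h3 h4
  have : Ξ (toPlane (h m) z') ∈ N := by rw [hΞ m z' h4]; exact h3
  exact this

/-- The saddle map takes the field to a positive multiple of the model. -/
theorem saddleMap_hasFDerivAt (hT : IsTranslationAtlas X U T) (hp : p ∈ saddleDomain h δ) :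
    ContDiffAt ℝ ∞ Ξ p ∧ 0 < fderiv ℝ τ p (X p) ∧ fderiv ℝ Ξ p (X p) =
      ((fderiv ℝ τ p (X p) / (k + 1 : ℕ) : ℝ) : ℂ) * (Ξ p ^ k)⁻¹ ∧
      ∃ A : Plane ≃L[ℝ] ℂ, HasFDerivAt Ξ (A : Plane →L[ℝ] ℂ) p := by
  obtain ⟨hs, hpos, L, hL, hLX, hLi⟩ := hF.saddleMap_pow_hasFDerivAt hτ hΞ hT hp
  have h0 := hF.saddleMap_ne_zero hτ hΞ hp
  have hΞs : ContDiffAt ℝ ∞ Ξ p := contDiffAt_of_pow (hF.continuousAt_saddleMap hτ hΞ hT hp) h0 hs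
    (Eventually.of_forall fun _ => rfl)
  have hd : HasFDerivAt Ξ (fderiv ℝ Ξ p) p := (hΞs.differentiableAt (by simp)).hasFDerivAt
  have hLeq : ∀ v, ((k + 1 : ℕ) : ℂ) * Ξ p ^ k * fderiv ℝ Ξ p v = L v := by
    intro v
    have h1 := (hd.pow (k + 1)).unique hL
    rw [← h1]
    simp
  have hk := natCast_succ_ne_zero k
  have hinj : Function.Injective (fderiv ℝ Ξ p) := by
    rw [injective_iff_map_eq_zero]
    intro v hv
    refine (injective_iff_map_eq_zero L).1 hLi v ?_
    rw [← hLeq, hv, mul_zero]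
  refine ⟨hΞs, hpos, ?_, ?_⟩
  · have h1 := hLeq (X p)
    rw [hLX] at h1
    have h2 : Ξ p ^ k ≠ 0 := pow_ne_zero _ h0
    rw [Complex.ofReal_div, ← h1]
    push_cast
    push_cast at hk
    field_simp
  · let B := (LinearEquiv.ofInjectiveEndo (fderiv ℝ Ξ p : Plane →ₗ[ℝ] ℂ) hinj).toContinuousLinearEquiv
    have hB : (B : Plane →L[ℝ] ℂ) = fderiv ℝ Ξ p := ContinuousLinearMap.ext fun v => rfl
    exact ⟨B, hB ▸ hd⟩

/-- Equal values have equal powers, hence equal coordinates. Off the real axis the sign of the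
height fixes the parity of the sector; points of separatrices are assigned to even sectors. For
equal parities the common root factor cancels, so the powers of `unitRoot k` agree and the two
sectors are the same. -/
theorem injOn_saddleMap (hT : IsTranslationAtlas X U T) : InjOn Ξ (saddleDomain h δ) := by
  have key : ∀ i m z z', z ∈ cell δ → z' ∈ cell δ → (Even i ↔ Even m) →
      Ξ (toPlane (h i) z) = Ξ (toPlane (h m) z') → toPlane (h i) z = toPlane (h m) z' := by
    intro i m z z' hz hz' him heq
    have hpow : saddleCoord h e a τ i z = saddleCoord h e a τ m z' := by
      rw [← saddleRoot_pow (k := k), ← saddleRoot_pow (k := k), ← hΞ i z hz, ← hΞ m z' hz', heq]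
    have hsgn : (-1 : ℂ) ^ i = (-1) ^ m := by
      by_cases hi : Even i
      · rw [hi.neg_one_pow, (him.1 hi).neg_one_pow]
      · rw [(Nat.not_even_iff_odd.1 hi).neg_one_pow,
          (Nat.not_even_iff_odd.1 (fun hm => hi (him.2 hm))).neg_one_pow]
    rw [hΞ i z hz, hΞ m z' hz', saddleRoot, saddleRoot, hpow, hsgn] at heq
    have hmod : i % (2 * k + 2) = m % (2 * k + 2) := mod_eq_of_unitRoot_pow_eq
      (mul_right_cancel₀ (upperRoot_ne_zero k (mul_ne_zero (by simp)
        (hF.saddleCoord_ne_zero hτ hz'))) heq)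
    have hh : h i = h m := eq_of_mod_eq hF.period hmod
    have hco : saddleCoord h e a τ i z = saddleCoord h e a τ m z := by
      rw [saddleCoord, saddleCoord, hh, eq_of_mod_eq hF.chart_period hmod]
    rw [hco] at hpow
    rw [hh, hF.saddleCoord_injOn hτ m hz hz' hpow]
  -- a point on a separatrix belongs to an even sector
  have heven : ∀ i, ∀ z ∈ cell δ, z.2 = 0 → ∃ m, Even m ∧ toPlane (h m) z = toPlane (h i) z := by
    intro i z hz h0
    have hzz : z = (z.1, 0) := Prod.ext rfl h0
    have hx0 : z.1 ≠ 0 := fun hx => hz.1.2 (Prod.ext hx h0)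
    rcases Nat.even_or_odd i with hi | hi
    · exact ⟨i, hi, rfl⟩
    obtain ⟨i', l, hmod, hs⟩ := exists_sharesSide k i hx0
    have hh : h i' = h i := eq_of_mod_eq hF.period hmod
    have hpar : i' % 2 = i % 2 := by
      have hd : 2 ∣ 2 * k + 2 := ⟨k + 1, by ring⟩
      rw [← Nat.mod_mod_of_dvd i' hd, hmod, Nat.mod_mod_of_dvd i hd]
    rw [Nat.odd_iff] at hi
    refine ⟨l, ?_, ?_⟩
    · rw [Nat.even_iff]
      rcases hs with hs | hs <;> have := hs.1 <;> omega
    · rw [hzz, ← hh]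
      rcases hs with hs | hs
      · exact (hF.sharesSide_toPlane_eq hs hz.2.1.le).symm
      · exact hF.sharesSide_toPlane_eq hs hz.2.1.le
  have hpos : ∀ i, ∀ z ∈ cell δ, z.2 ≠ 0 → 0 < (-1) ^ i * (saddleCoord h e a τ i z).im := by
    intro i z hz h0
    rw [hF.signed_im hT]
    have hz0 : 0 < z.2 := lt_of_le_of_ne hz.1.1.2.1 (Ne.symm h0)
    have := hF.mono i (⟨le_rfl, hF.pos⟩ : (0 : ℝ) ∈ Ico 0 δ) ⟨hz0.le, hz.2.2⟩ hz0
    simpa [sectorHeight_zero] using this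
  have hzero : ∀ i z, z.2 = 0 → (saddleCoord h e a τ i z).im = 0 := by
    intro i z h0
    simp [saddleCoord, h0, sectorHeight_zero]
  intro p hp p' hp' heq
  obtain ⟨i, z, hz, rfl⟩ := mem_iUnion.1 hp
  obtain ⟨m, z', hz', rfl⟩ := mem_iUnion.1 hp'
  have hpow : saddleCoord h e a τ i z = saddleCoord h e a τ m z' := by
    rw [← saddleRoot_pow (k := k), ← saddleRoot_pow (k := k), ← hΞ i z hz, ← hΞ m z' hz', heq]
  by_cases h0 : z.2 = 0
  · have h0' : z'.2 = 0 := by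
      by_contra hne
      have := hpos m z' hz' hne
      rw [← hpow, hzero i z h0] at this
      simp at this
    obtain ⟨i', hi', hpi⟩ := heven i z hz h0
    obtain ⟨m', hm', hpm⟩ := heven m z' hz' h0'
    rw [← hpi, ← hpm] at heq ⊢
    exact key i' m' z z' hz hz' (by simp [hi', hm']) heq
  · have h0' : z'.2 ≠ 0 := fun hz0 => by
      have := hpos i z hz h0
      rw [hpow, hzero m z' hz0] at this
      simp at this
    refine key i m z z' hz hz' ?_ heq
    have h1 := hpos i z hz h0
    have h2 := hpos m z' hz' h0'
    rw [hpow] at h1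
    rcases Nat.even_or_odd i with hi | hi <;> rcases Nat.even_or_odd m with hm | hm
    · simp [hi, hm]
    · rw [hi.neg_one_pow] at h1; rw [hm.neg_one_pow] at h2; linarith
    · rw [hi.neg_one_pow] at h1; rw [hm.neg_one_pow] at h2; linarith
    · simp [Nat.not_even_iff_odd.2 hi, Nat.not_even_iff_odd.2 hm]

/-- A small nonzero `ξ` is one of the roots of `w = ξ ^ (k + 1)`. The sign of `w.im` fixes the
parity of the admissible sectors, the root fixes the sector among them, and that sector attains the
coordinate `w`. -/
theorem saddleMap_image_mem_nhds (hT : IsTranslationAtlas X U T) :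
    insert 0 (Ξ '' saddleDomain h δ) ∈ 𝓝 (0 : ℂ) := by
  obtain ⟨κ₀, hκ₀, hall₀⟩ : ∃ κ > 0, ∀ i < 2 * k + 2, ∀ w : ℂ, w ≠ 0 → ‖w‖ < κ →
      0 ≤ (-1) ^ i * w.im → ∃ z ∈ cell δ, saddleCoord h e a τ i z = w := by
    choose κ hκ hall using fun i => hF.exists_saddleCoord_eq hτ hT i
    have hev : ∀ᶠ d in 𝓝[>] (0 : ℝ), ∀ i ∈ Finset.range (2 * k + 2), d ≤ κ i := by
      rw [eventually_all_finset]
      intro i _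
      filter_upwards [Ioo_mem_nhdsGT (hκ i)] with d hd using hd.2.le
    obtain ⟨d, hd, hd0⟩ := (hev.and self_mem_nhdsWithin).exists
    exact ⟨d, hd0, fun i hi w hw hwd him =>
      hall i w hw (hwd.trans_le (hd i (Finset.mem_range.2 hi))) him⟩
  have hball : ∀ᶠ ξ : ℂ in 𝓝 0, ‖ξ ^ (k + 1)‖ < κ₀ := by
    have : Continuous fun ξ : ℂ => ‖ξ ^ (k + 1)‖ := by fun_prop
    have h1 := this.tendsto 0
    simp only [zero_pow (Nat.succ_ne_zero k), norm_zero] at h1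
    exact h1.eventually (gt_mem_nhds hκ₀)
  filter_upwards [hball] with ξ hξ
  by_cases hξ0 : ξ = 0
  · exact Or.inl hξ0
  right
  set w := ξ ^ (k + 1) with hw
  have hw0 : w ≠ 0 := pow_ne_zero _ hξ0
  obtain ⟨s, hs⟩ : ∃ s : ℕ, 0 ≤ (-1) ^ s * w.im := by
    rcases le_total 0 w.im with h1 | h1
    · exact ⟨0, by simpa using h1⟩
    · exact ⟨1, by simpa using h1⟩
  obtain ⟨l, hl⟩ := exists_eq_pow_mul_upperRoot k s hw0 hw.symm
  have hd : 2 ∣ 2 * k + 2 := ⟨k + 1, by ring⟩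
  have hsgn : (-1 : ℝ) ^ ((2 * l + s) % (2 * k + 2)) = (-1) ^ s := by
    rw [neg_one_pow_eq_pow_mod_two, Nat.mod_mod_of_dvd _ hd, Nat.mul_add_mod,
      ← neg_one_pow_eq_pow_mod_two]
  obtain ⟨z, hz, hzw⟩ := hall₀ ((2 * l + s) % (2 * k + 2)) (Nat.mod_lt _ (by omega)) w hw0 hξ
    (by rw [hsgn]; exact hs)
  refine ⟨_, mem_iUnion.2 ⟨2 * l + s, z, hz, rfl⟩, ?_⟩
  have hco : saddleCoord h e a τ (2 * l + s) z = w := by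
    rw [← hzw, saddleCoord, saddleCoord, eq_of_mod_eq hF.period (Nat.mod_mod (2 * l + s) _),
      eq_of_mod_eq hF.chart_period (Nat.mod_mod (2 * l + s) _)]
  rw [hΞ _ z hz, saddleRoot, hco, ← hl]

theorem tendsto_saddleMap :
    Tendsto Ξ (comap toSphere (𝓝[≠] q)) (𝓝[≠] 0) := by
  have hsmall : ∀ ε > 0, ∀ i, ∃ N : Set (ℝ × ℝ), IsOpen N ∧ ((0 : ℝ), (0 : ℝ)) ∈ N ∧
      ∀ z ∈ cell δ, z ∈ N → ‖saddleRoot k h e a τ i z‖ < ε := by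
    intro ε hε i
    have h1 : Tendsto (saddleCoord h e a τ i) (𝓝[cell δ] (0, 0)) (𝓝 0) := by
      have him : Tendsto (fun z : ℝ × ℝ => a 0 * sectorHeight (toPlane (h i)) (e i) z.2)
          (𝓝[cell δ] (0, 0)) (𝓝 0) := by
        have h2 := IsTranslationAtlas.continuousOn_sectorHeight (hF.regular i) (hF.chart_source i)
          0 ⟨by norm_num, hF.pos⟩
        have h3 : Tendsto (fun z : ℝ × ℝ => z.2) (𝓝[cell δ] (0, 0)) (𝓝[Icc 0 1 ∩ Iio δ] 0) := by
          refine tendsto_nhdsWithin_iff.2 ⟨?_, ?_⟩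
          · exact (Continuous.tendsto' (by fun_prop) _ _ rfl).mono_left nhdsWithin_le_nhds
          · filter_upwards [self_mem_nhdsWithin] with z hz using ⟨hz.1.1.2, hz.2.2⟩
        have h4 := (h2.tendsto.comp h3).const_mul (a 0)
        rwa [sectorHeight_zero, mul_zero] at h4
      have h5 := ((Complex.continuous_ofReal.tendsto 0).comp (hτ.tendsto i)).add
        (((Complex.continuous_ofReal.tendsto 0).comp him).mul_const Complex.I)
      simp only [Complex.ofReal_zero, zero_mul, add_zero] at h5
      refine h5.congr fun z => ?_
      exact (Complex.mk_eq_add_mul_I _ _).symm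
    have h2 := h1.norm
    rw [norm_zero] at h2
    obtain ⟨N, hN, h0N, hsub⟩ := mem_nhdsWithin.1 (h2.eventually (gt_mem_nhds (pow_pos hε (k + 1))))
    refine ⟨N, hN, h0N, fun z hz hzN => ?_⟩
    have h3 : ‖saddleCoord h e a τ i z‖ < ε ^ (k + 1) := hsub ⟨hzN, hz⟩
    rw [← saddleRoot_pow (k := k), norm_pow] at h3
    exact lt_of_pow_lt_pow_left₀ (k + 1) hε.le h3
  refine tendsto_nhdsWithin_iff.2 ⟨?_, ?_⟩
  · rw [Metric.tendsto_nhds]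
    intro ε hε
    choose N hN h0 hNε using hsmall ε hε
    have h1 : ∀ᶠ s in 𝓝[≠] q, ∃ i, ∃ z ∈ cell δ, z ∈ N i ∧ h i z = s :=
      eventually_nhdsWithin_iff.2 (hF.exists_vertex_nhd hN h0)
    filter_upwards [tendsto_comap.eventually h1] with p hp
    obtain ⟨i, z, hz, hzN, hzp⟩ := hp
    rw [← toPlane_eq hzp, hΞ i z hz, dist_zero_right]
    exact hNε i z hz hzN
  · have h1 : ∀ᶠ s in 𝓝[≠] q, ∃ i, ∃ z ∈ cell δ, z ∈ univ ∧ h i z = s :=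
      eventually_nhdsWithin_iff.2 (hF.exists_vertex_nhd (fun _ => isOpen_univ) fun _ => mem_univ _)
    filter_upwards [tendsto_comap.eventually h1] with p hp
    obtain ⟨i, z, hz, -, hzp⟩ := hp
    refine hF.saddleMap_ne_zero hτ hΞ (mem_iUnion.2 ⟨i, z, hz, toPlane_eq hzp⟩)

end SaddleFrame

/-- A multi-saddle is smoothly equivalent to its model. -/
theorem IsTranslationAtlas.isSmoothlyEquivalentToModel (hT : IsTranslationAtlas X U T)
    (hX : ContDiffOn ℝ ∞ X U) (hq : IsMultiSaddle X U q k) :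
    IsSmoothlyEquivalentToModel X U q k := by
  obtain ⟨h, hper, hs, hout, hin, hd, hn⟩ := hq
  have hdisj : ∀ i j, i % (2 * k + 2) ≠ j % (2 * k + 2) → ∀ z ∈ sectorModel, ∀ w ∈ sectorModel,
      h i z = h j w → z.2 = 0 ∧ w.2 = 0 := by
    intro i j hij z hz w hw hzw
    have hmod : ∀ i, h (i % (2 * k + 2)) = h i := fun i => eq_of_mod_eq hper (Nat.mod_mod _ _)
    have hlt : ∀ i, i % (2 * k + 2) < 2 * k + 2 := fun i => Nat.mod_lt _ (by omega)
    rw [← hmod i, ← hmod j] at hzw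
    rcases lt_or_gt_of_ne hij with h1 | h1
    · exact hd _ _ h1 (hlt j) z hz w hw hzw
    · exact (hd _ _ h1 (hlt i) w hw z hz hzw.symm).symm
  obtain ⟨e, a, δ₀, hF₀⟩ := hT.exists_saddleFrame hper hs hout hin hdisj hn
  obtain ⟨τ, δ, hF, hτ1, hτ2⟩ := hF₀.exists_time_function hT
  have hτ : IsSaddleTime X q h δ τ := ⟨fun i z hz => (hτ1 i z hz).1, fun i z hz => (hτ1 i z hz).2, hτ2⟩
  obtain ⟨Ξ, hΞ⟩ := hF.exists_saddleMap hτ hT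
  have hO := hF.isOpen_saddleDomain hT
  have hOU : saddleDomain h δ ⊆ U := fun p hp => by
    obtain ⟨i, z, hz, rfl⟩ := mem_iUnion.1 hp
    exact hF.toPlane_mem hz
  obtain ⟨φ, hφ, hsrc, htar, hsymm⟩ := exists_openPartialHomeomorph_of_injOn hO
    (fun p hp => (hF.saddleMap_hasFDerivAt hτ hΞ hT hp).1.contDiffWithinAt)
    (fun p hp => (hF.saddleMap_hasFDerivAt hτ hΞ hT hp).2.2.2) (hF.injOn_saddleMap hτ hΞ hT)
  refine ⟨φ, fun p => fderiv ℝ τ p (X p) / (k + 1 : ℕ), ?_⟩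
  rw [hsrc, htar, hφ]
  refine ⟨hOU, ?_, ?_, ?_, hF.saddleMap_image_mem_nhds hτ hΞ hT, ?_, htar ▸ hsymm,
    hF.tendsto_saddleMap hτ hΞ, ?_, ?_⟩
  · rintro ⟨p, hp, hpq⟩
    obtain ⟨i, z, hz, rfl⟩ := mem_iUnion.1 hp
    rw [(hF.sector i).toSphere_toPlane hz.1, ← (hF.sector i).vertex] at hpq
    exact hz.1.2 ((hF.sector i).inj hz.1.1 (by simp [sectorModel]) hpq)
  · filter_upwards [hF.exists_vertex_nhd (fun _ => isOpen_univ) fun _ => mem_univ _] with s hs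
    by_cases hsq : s = q
    · exact Or.inl hsq
    · obtain ⟨i, z, hz, -, hzs⟩ := hs hsq
      exact Or.inr ⟨_, mem_iUnion.2 ⟨i, z, hz, rfl⟩,
        by rw [(hF.sector i).toSphere_toPlane hz.1, hzs]⟩
  · rintro ⟨p, hp, hp0⟩
    exact hF.saddleMap_ne_zero hτ hΞ hp hp0
  · exact fun p hp => (hF.saddleMap_hasFDerivAt hτ hΞ hT hp).1.contDiffWithinAt
  · have hτs : ∀ p ∈ saddleDomain h δ, ContDiffAt ℝ ∞ τ p := fun p hp => by
      obtain ⟨i, z, hz, rfl⟩ := mem_iUnion.1 hp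
      exact hτ.smooth i z hz
    intro p hp
    have h1 : ContDiffAt ℝ ∞ (fderiv ℝ τ) p := (hτs p hp).fderiv_right (by simp)
    have h2 : ContDiffAt ℝ ∞ X p := hX.contDiffAt (hT.isOpen.mem_nhds (hOU hp))
    exact ((h1.clm_apply h2).div_const _).contDiffWithinAt
  · intro p hp
    obtain ⟨-, h1, h2, -⟩ := hF.saddleMap_hasFDerivAt hτ hΞ hT hp
    exact ⟨by positivity, h2⟩

end FlowBox


/-! ### Flow boxes and first returns to their vertical axis -/

namespace FlowBox

/-- The point with coordinates `(x, y)` relative to `c` in the chart `e`. -/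
noncomputable def box (e : OpenPartialHomeomorph Plane ℂ) (c : ℂ) (x y : ℝ) : Plane := e.symm (c + ⟨x, y⟩)

/-- The chart `e` of the atlas `T` contains the closed rectangle with centre `c`, half width `ρ`
and half height `r`. -/
structure IsFlowBox (T : Set (OpenPartialHomeomorph Plane ℂ))
    (e : OpenPartialHomeomorph Plane ℂ) (c : ℂ) (ρ r : ℝ) : Prop where
  mem : e ∈ T
  width : 0 < ρ
  height : 0 < r
  target : ∀ x y : ℝ, |x| ≤ ρ → |y| ≤ r → c + ⟨x, y⟩ ∈ e.target

/-- The trajectory that starts at height `y` on the vertical axis of the box meets this axis for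
the first time after the time `t`, at height `y'`. -/
def IsFirstHit (X : Plane → Plane) (U : Set Plane) (e : OpenPartialHomeomorph Plane ℂ) (c : ℂ)
    (r y t y' : ℝ) : Prop :=
  0 < t ∧ |y'| ≤ r ∧ FlowsTo X U (box e c 0 y) t (box e c 0 y') ∧
    ∀ s ∈ Ioo 0 t, ∀ z, |z| ≤ r → ¬ FlowsTo X U (box e c 0 y) s (box e c 0 z)

variable {X : Plane → Plane} {U : Set Plane} {T : Set (OpenPartialHomeomorph Plane ℂ)}
  {e e' : OpenPartialHomeomorph Plane ℂ} {c : ℂ} {ρ r x y t x' y' t' z : ℝ} {b b' : Plane}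

theorem box_zero_eq (hb : b ∈ e.source) : box e (e b) 0 0 = b := by
  have : (⟨0, 0⟩ : ℂ) = 0 := rfl
  rw [box, this, add_zero, e.left_inv hb]

theorem IsTranslationAtlas.exists_isFlowBox (he : e ∈ T) (hb : b ∈ e.source) {N : Set Plane}
    (hN : N ∈ 𝓝 b) : ∃ ρ, IsFlowBox T e (e b) ρ ρ ∧
      ∀ x y : ℝ, |x| ≤ ρ → |y| ≤ ρ → box e (e b) x y ∈ N := by
  have h1 : ∀ᶠ w in 𝓝 (e b), w ∈ e.target ∧ e.symm w ∈ N :=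
    Eventually.and (e.open_target.mem_nhds (e.map_source hb))
      ((e.continuousAt_symm (e.map_source hb)) (by rwa [e.left_inv hb]))
  obtain ⟨d, hd, hball⟩ := Metric.eventually_nhds_iff.1 h1
  have key : ∀ x y : ℝ, |x| ≤ d / 3 → |y| ≤ d / 3 → dist (e b + ⟨x, y⟩) (e b) < d := by
    intro x y hx hy
    have := Complex.norm_le_abs_re_add_abs_im (⟨x, y⟩ : ℂ)
    simp only [dist_self_add_left]
    simp only at this
    linarith
  exact ⟨d / 3, ⟨he, by positivity, by positivity, fun x y hx hy => (hball (key x y hx hy)).1⟩,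
    fun x y hx hy => (hball (key x y hx hy)).2⟩

namespace IsFlowBox

variable (hB : IsFlowBox T e c ρ r)
include hB

theorem mono {r' : ℝ} (h0 : 0 < r') (hr : r' ≤ r) : IsFlowBox T e c ρ r' :=
  ⟨hB.mem, hB.width, h0, fun x y hx hy => hB.target x y hx (hy.trans hr)⟩

theorem zero_le : |(0 : ℝ)| ≤ ρ := by simpa using hB.width.le

theorem box_mem (hx : |x| ≤ ρ) (hy : |y| ≤ r) : box e c x y ∈ e.source :=
  e.map_target (hB.target x y hx hy)

theorem chart_box (hx : |x| ≤ ρ) (hy : |y| ≤ r) : e (box e c x y) = c + ⟨x, y⟩ :=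
  e.right_inv (hB.target x y hx hy)

theorem box_injective (hx : |x| ≤ ρ) (hy : |y| ≤ r) (hx' : |x'| ≤ ρ) (hy' : |y'| ≤ r)
    (h : box e c x y = box e c x' y') : x = x' ∧ y = y' := by
  have h1 := congrArg e h
  rw [hB.chart_box hx hy, hB.chart_box hx' hy'] at h1
  simpa using h1

theorem continuousAt_box (hx : |x| ≤ ρ) (hy : |y| ≤ r) :
    ContinuousAt (fun w : ℝ × ℝ => box e c w.1 w.2) (x, y) := by
  have h1 : ContinuousAt e.symm (c + ⟨x, y⟩) := e.continuousAt_symm (hB.target x y hx hy)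
  refine ContinuousAt.comp (g := e.symm) (x := ((x, y) : ℝ × ℝ))
    (f := fun w : ℝ × ℝ => c + ⟨w.1, w.2⟩) h1 ?_
  exact (continuous_const.add
    (Complex.equivRealProdCLM.symm.continuous)).continuousAt

theorem continuousAt_cross (hy : |y| ≤ r) : ContinuousAt (box e c 0) y :=
  ContinuousAt.comp (f := fun y : ℝ => ((0 : ℝ), y)) (hB.continuousAt_box hB.zero_le hy)
    (by fun_prop)

theorem isCompact_cross : IsCompact (box e c 0 '' Icc (-r) r) :=
  isCompact_Icc.image_of_continuousOn fun _ hy =>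
    (hB.continuousAt_cross (abs_le.2 hy)).continuousWithinAt

theorem eventually_chart_cross (hy : |y| ≤ r) :
    ∀ᶠ z in 𝓝 y, e (box e c 0 z) = c + ⟨0, z⟩ := by
  have h1 : ContinuousAt (fun z : ℝ => c + (⟨0, z⟩ : ℂ)) y :=
    (continuous_const.add (Complex.equivRealProdCLM.symm.continuous.comp
      (Continuous.prodMk_right (0 : ℝ)))).continuousAt
  filter_upwards [h1 (e.open_target.mem_nhds (hB.target 0 y hB.zero_le hy))] with z hz
    using e.right_inv hz

theorem box_flowsTo (hT : IsTranslationAtlas X U T) (hx : |x| ≤ ρ) (hx' : |x'| ≤ ρ)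
    (hy : |y| ≤ r) : FlowsTo X U (box e c x y) (x' - x) (box e c x' y) := by
  have key : ∀ s : ℝ, c + ⟨x, y⟩ + (s : ℂ) = c + ⟨x + s, y⟩ := fun s => by
    apply Complex.ext <;> simp [add_assoc]
  have h := hT.flowsTo_of_chart (t := x' - x) hB.mem (hB.box_mem hx hy) fun s hs => by
    rw [hB.chart_box hx hy, key]
    refine hB.target _ _ ?_ hy
    rw [mem_uIcc] at hs
    rw [abs_le] at hx hx' ⊢
    rcases hs with hs | hs <;> constructor <;> linarith [hs.1, hs.2, hx.1, hx.2, hx'.1, hx'.2]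
  rwa [hB.chart_box hx hy, key, add_sub_cancel] at h

variable (hT : IsTranslationAtlas X U T)
include hT

theorem box_mem_domain (hx : |x| ≤ ρ) (hy : |y| ≤ r) : box e c x y ∈ U :=
  hT.source_subset e hB.mem (hB.box_mem hx hy)

theorem eq_of_flowsTo (hy : |y| ≤ r) (hy' : |y'| ≤ r)
    (h : FlowsTo X U (box e c 0 y) t (box e c 0 y')) (ht : |t| ≤ ρ) : t = 0 ∧ y = y' := by
  have h1 := hB.box_flowsTo hT hB.zero_le ht hy
  rw [sub_zero] at h1
  have h2 := hB.box_injective ht hy hB.zero_le hy' (hT.flowsTo_unique h1 h)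
  exact h2

theorem lt_of_flowsTo (hy : |y| ≤ r) (hy' : |y'| ≤ r)
    (h : FlowsTo X U (box e c 0 y) t (box e c 0 y')) (ht : 0 < t) : ρ < t := by
  by_contra hle
  exact ht.ne' (hB.eq_of_flowsTo hT hy hy' h (by rw [abs_of_pos ht]; linarith)).1

theorem flow_cross_local (hy : |y| ≤ r) (h : FlowsTo X U (box e c 0 y) x b) (he' : e' ∈ T)
    (hb : b ∈ e'.source) : ∀ᶠ w : ℝ × ℝ in 𝓝 (x, y), ∃ d ∈ e'.source,
      FlowsTo X U (box e c 0 w.2) w.1 d ∧ e' d = e' b + ⟨w.1 - x, w.2 - y⟩ := by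
  have h1 := hT.flow_joint' h hB.mem he' (hB.box_mem hB.zero_le hy) hb
  have h2 : ContinuousAt (fun w : ℝ × ℝ => (box e c 0 w.2, w.1)) (x, y) :=
    (ContinuousAt.comp (f := Prod.snd) (g := box e c 0)
      (hB.continuousAt_cross hy) continuousAt_snd).prodMk continuousAt_fst
  filter_upwards [h2.eventually h1, continuousAt_snd.eventually (hB.eventually_chart_cross hy)]
    with w hw hw'
  obtain ⟨d, hd, hf, heq⟩ := hw
  refine ⟨d, hd, hf, ?_⟩
  rw [heq, hw', hB.chart_box hB.zero_le hy]
  apply Complex.ext <;> simp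

theorem hit_eventually (hy : |y| ≤ r) (hy' : |y'| ≤ r)
    (h : FlowsTo X U (box e c 0 y) t (box e c 0 y')) :
    ∀ᶠ u in 𝓝 (0 : ℝ), FlowsTo X U (box e c 0 (y + u)) t (box e c 0 (y' + u)) := by
  have h1 := hB.flow_cross_local hT hy h hB.mem (hB.box_mem hB.zero_le hy')
  have h2 : Tendsto (fun u : ℝ => (t, y + u)) (𝓝 0) (𝓝 (t, y)) :=
    Continuous.tendsto' (by fun_prop) _ _ (by simp)
  filter_upwards [h2.eventually h1] with u hu
  obtain ⟨d, hd, hf, heq⟩ := hu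
  rw [hB.chart_box hB.zero_le hy'] at heq
  have : d = box e c 0 (y' + u) := by
    rw [← e.left_inv hd, heq, box]
    congr 1
    apply Complex.ext <;> simp [add_assoc]
  exact this ▸ hf

/-- No return is possible up to the time `ρ`, because the trajectory is still crossing the box; so
the first hit can be sought among times at least `ρ`. -/
theorem exists_isFirstHit (hy : |y| ≤ r) (hy' : |y'| ≤ r) (ht : 0 < t)
    (h : FlowsTo X U (box e c 0 y) t (box e c 0 y')) :
    ∃ t₁ ≤ t, ∃ y₁, IsFirstHit X U e c r y t₁ y₁ := by
  obtain ⟨t₁, ht₁, _, ⟨y₁, hy₁, rfl⟩, hf, hmin⟩ := hT.exists_first_hit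
    hB.isCompact_cross.isClosed hB.width.le (hB.lt_of_flowsTo hT hy hy' h ht).le h
    ⟨y', abs_le.1 hy', rfl⟩
  refine ⟨t₁, ht₁.2, y₁, hB.width.trans_le ht₁.1, abs_le.2 hy₁, hf, fun s hs z hz hsz => ?_⟩
  exact hmin s ⟨(hB.lt_of_flowsTo hT hy hz hsz hs.1).le, hs.2⟩ _ hsz ⟨z, abs_le.1 hz, rfl⟩

/-- The flow for the fixed time `t` is a translation, so the hit moves vertically by the same `u`.
Earlier hits within `ρ` of either end are excluded by the width of the box; on the compact interval
between, avoiding the compact axis is an open condition. -/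
theorem isFirstHit_eventually (hy : |y| ≤ r) (h : IsFirstHit X U e c r y t y') :
    ∀ᶠ u in 𝓝 (0 : ℝ), |y + u| ≤ r → |y' + u| ≤ r →
      IsFirstHit X U e c r (y + u) t (y' + u) := by
  obtain ⟨ht, hy', hf, hmin⟩ := h
  have hno : ∀ s ∈ Icc ρ (t - ρ), ∃ b ∈ (box e c 0 '' Icc (-r) r)ᶜ,
      FlowsTo X U (box e c 0 y) s b := by
    intro s hs
    have hs0 : 0 < s := hB.width.trans_le hs.1
    have hst : s < t := by linarith [hs.2, hB.width]
    obtain ⟨b, hb, -⟩ := hf.exists_of_mem (s := s) (by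
      rw [uIcc_of_le ht.le]; exact ⟨hs0.le, hst.le⟩)
    refine ⟨b, ?_, hb⟩
    rintro ⟨z, hz, rfl⟩
    exact hmin s ⟨hs0, hst⟩ z (abs_le.2 hz) hb
  have h1 : Tendsto (fun u : ℝ => box e c 0 (y + u)) (𝓝 0) (𝓝 (box e c 0 y)) := by
    refine Tendsto.comp (g := box e c 0) (y := 𝓝 y) (hB.continuousAt_cross hy) ?_
    exact Continuous.tendsto' (by fun_prop) _ _ (by simp)
  filter_upwards [hB.hit_eventually hT hy hy' hf,
    h1.eventually (hT.flow_compact hB.isCompact_cross.isClosed.isOpen_compl hno)]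
    with u hu hu' hyu hyu'
  refine ⟨ht, hyu', hu, fun s hs z hz hsz => ?_⟩
  have h2 := hB.lt_of_flowsTo hT hyu hz hsz hs.1
  have h3 : ρ < t - s :=
    hB.lt_of_flowsTo hT hz hyu' (hT.flowsTo_of_flowsTo hsz hu) (by linarith [hs.2])
  obtain ⟨b, hb, hb'⟩ := hu' s ⟨h2.le, by linarith⟩
  exact hb (hT.flowsTo_unique hb' hsz ▸ ⟨z, abs_le.1 hz, rfl⟩)

theorem isFirstHit_unique (h : IsFirstHit X U e c r y t y') (h' : IsFirstHit X U e c r y t' z) :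
    t = t' ∧ y' = z := by
  have htt : t = t' := by
    rcases lt_trichotomy t t' with hlt | heq | hlt
    · exact absurd h.2.2.1 (h'.2.2.2 t ⟨h.1, hlt⟩ y' h.2.1)
    · exact heq
    · exact absurd h'.2.2.1 (h.2.2.2 t' ⟨h'.1, hlt⟩ z h'.2.1)
  subst htt
  exact ⟨rfl, (hB.box_injective hB.zero_le h.2.1 hB.zero_le h'.2.1
    (hT.flowsTo_unique h.2.2.1 h'.2.2.1)).2⟩

/-- If two points hit first at the same place, the one with the longer time passes through the
other, which would be an earlier hit. -/
theorem isFirstHit_injective (hy : |y| ≤ r) (hy' : |y'| ≤ r) (h : IsFirstHit X U e c r y t z)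
    (h' : IsFirstHit X U e c r y' t' z) : y = y' := by
  have key : ∀ {y y' t t' : ℝ}, |y| ≤ r → IsFirstHit X U e c r y t z →
      IsFirstHit X U e c r y' t' z → t' ≤ t := by
    intro y y' t t' hy h h'
    by_contra! hlt
    have h1 := hT.flowsTo_trans h.2.2.1 h'.2.2.1.symm
    have h2 := h1.symm
    exact h'.2.2.2 (t' - t) ⟨by linarith, by linarith [h.1]⟩ y hy (by
      rwa [show -(t + -t') = t' - t by ring] at h2)
  have htt : t = t' := le_antisymm (key hy' h' h) (key hy h h')
  subst htt
  exact (hB.box_injective hB.zero_le hy hB.zero_le hy'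
    (hT.flowsTo_injective h.2.2.1 h'.2.2.1)).2

end IsFlowBox

/-- A family of flow lines that start on the vertical axis of a box is continuous. -/
theorem IsFlowBox.continuousOn_strip (hB : IsFlowBox T e c ρ r) (hT : IsTranslationAtlas X U T)
    {D : Set (ℝ × ℝ)} {E : ℝ × ℝ → Plane}
    (hD : ∀ w ∈ D, |w.2| ≤ r ∧ FlowsTo X U (box e c 0 w.2) w.1 (E w)) : ContinuousOn E D := by
  intro w hw
  obtain ⟨hy, hf⟩ := hD w hw
  obtain ⟨e', he', hb⟩ := hT.covers _ hf.right_mem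
  have h1 : ∀ᶠ v in 𝓝[D] w, E v = e'.symm (e' (E w) + ⟨v.1 - w.1, v.2 - w.2⟩) := by
    filter_upwards [mem_nhdsWithin_of_mem_nhds (hB.flow_cross_local hT hy hf he' hb),
      self_mem_nhdsWithin] with v hv hvD
    obtain ⟨d, hd, hdf, heq⟩ := hv
    rw [hT.flowsTo_unique (hD v hvD).2 hdf, ← heq, e'.left_inv hd]
  have h2 : Tendsto (fun v : ℝ × ℝ => (⟨v.1 - w.1, v.2 - w.2⟩ : ℂ)) (𝓝[D] w) (𝓝 0) :=
    ((Complex.equivRealProdCLM.symm.continuous.comp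
      (continuous_id.sub continuous_const)).tendsto' w 0 (by simp)).mono_left nhdsWithin_le_nhds
  exact (tendsto_symm_add hb h2).congr' (h1.mono fun v hv => hv.symm)

theorem IsFlowBox.strip_mem_nhds (hB : IsFlowBox T e c ρ r) (hT : IsTranslationAtlas X U T)
    {D : Set (ℝ × ℝ)} {E : ℝ × ℝ → Plane}
    (hD : ∀ w ∈ D, |w.2| ≤ r ∧ FlowsTo X U (box e c 0 w.2) w.1 (E w)) {w : ℝ × ℝ}
    (hw : D ∈ 𝓝 w) : E '' D ∈ 𝓝 (E w) := by
  obtain ⟨hy, hf⟩ := hD w (mem_of_mem_nhds hw)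
  obtain ⟨e', he', hb⟩ := hT.covers _ hf.right_mem
  let g : Plane → ℝ × ℝ := fun v => (w.1 + (e' v - e' (E w)).re, w.2 + (e' v - e' (E w)).im)
  have hg : ContinuousAt g (E w) := by
    have := e'.continuousAt hb
    exact (continuousAt_const.add (Complex.continuous_re.continuousAt.comp
      (this.sub continuousAt_const))).prodMk (continuousAt_const.add
      (Complex.continuous_im.continuousAt.comp (this.sub continuousAt_const)))
  have hgw : g (E w) = w := by simp [g]
  have hgt : Tendsto g (𝓝 (E w)) (𝓝 w) := by simpa [ContinuousAt, hgw] using hg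
  filter_upwards [hgt (hB.flow_cross_local hT hy hf he' hb), hgt hw,
    e'.open_source.mem_nhds hb] with v hv hvD hvs
  obtain ⟨d, hd, hdf, heq⟩ := hv
  refine ⟨g v, hvD, ?_⟩
  rw [hT.flowsTo_unique (hD _ hvD).2 hdf]
  refine e'.injOn hd hvs ?_
  rw [heq]
  apply Complex.ext <;> simp [g]

end FlowBox


/-! ### Circle-valued maps on the plane, and the angle in a flow box -/

namespace FlowBox

/-- Both maps take the value `b` wherever the outside can be reached, so the constant extension is
continuous. It is used to extend the angle from the box and the returning strip to the plane. -/
theorem exists_continuous_glue {α β : Type*} [TopologicalSpace α] [TopologicalSpace β]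
    {K K' : Set α} {f f' : α → β} {b : β} (hK : IsClosed K) (hK' : IsClosed K')
    (hf : ContinuousOn f K) (hf' : ContinuousOn f' K') (heq : ∀ z ∈ K ∩ K', f z = f' z)
    (hb : ∀ z ∈ K, z ∉ interior (K ∪ K') → f z = b)
    (hb' : ∀ z ∈ K', z ∉ interior (K ∪ K') → f' z = b) :
    ∃ u : α → β, Continuous u ∧ EqOn u f K ∧ EqOn u f' K' ∧ ∀ z ∉ K ∪ K', u z = b := by
  classical
  let u : α → β := fun z => if z ∈ K then f z else if z ∈ K' then f' z else b
  have h1 : EqOn u f K := fun z hz => if_pos hz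
  have h2 : EqOn u f' K' := fun z hz => by
    by_cases hzK : z ∈ K
    · exact (if_pos hzK).trans (heq z ⟨hzK, hz⟩)
    · exact (if_neg hzK).trans (if_pos hz)
  have h3 : ∀ z ∉ interior (K ∪ K'), u z = b := fun z hz => by
    by_cases hzK : z ∈ K
    · exact (h1 hzK).trans (hb z hzK hz)
    by_cases hzK' : z ∈ K'
    · exact (h2 hzK').trans (hb' z hzK' hz)
    · exact (if_neg hzK).trans (if_neg hzK')
  refine ⟨u, ?_, h1, h2, fun z hz => h3 z fun hi => hz (interior_subset hi)⟩
  have h4 : ContinuousOn u (interior (K ∪ K'))ᶜ := continuousOn_const.congr fun z hz => h3 z hz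
  have h5 := ((hf.congr h1).union_of_isClosed (hf'.congr h2) hK hK').union_of_isClosed h4
    (hK.union hK') isOpen_interior.isClosed_compl
  rw [← continuousOn_univ]
  refine h5.mono fun z _ => ?_
  by_cases hz : z ∈ interior (K ∪ K')
  · exact Or.inl (interior_subset hz)
  · exact Or.inr hz

theorem exists_lift_addCircle {u : ℂ → AddCircle (1 : ℝ)} (hu : Continuous u) :
    ∃ F : ℂ → ℝ, Continuous F ∧ ∀ z, (F z : AddCircle (1 : ℝ)) = u z := by
  obtain ⟨a, ha⟩ := QuotientAddGroup.mk_surjective (u 0)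
  obtain ⟨F, ⟨-, hF⟩, -⟩ := (AddCircle.isCoveringMap_coe (1 : ℝ)).existsUnique_continuousMap_lifts
    ⟨u, hu⟩ 0 a ha
  exact ⟨F, F.continuous, fun z => congrFun hF z⟩

theorem eq_of_coe_addCircle_eq_zero {α : Type*} [TopologicalSpace α] {s : Set α} {f : α → ℝ}
    (hs : IsPreconnected s) (hf : ContinuousOn f s)
    (h : ∀ x ∈ s, (f x : AddCircle (1 : ℝ)) = 0) {x y : α} (hx : x ∈ s) (hy : y ∈ s) :
    f x = f y := by
  have hint : ∀ x ∈ s, ∃ n : ℤ, (n : ℝ) = f x := fun x hx => by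
    obtain ⟨n, hn⟩ := (AddCircle.coe_eq_zero_iff (1 : ℝ)).1 (h x hx)
    exact ⟨n, by simpa using hn⟩
  refine eq_of_eventually_eq hs (fun x hx => ?_) hx hy
  filter_upwards [hf x hx (Metric.ball_mem_nhds (f x) one_pos), self_mem_nhdsWithin]
    with y hy hys
  obtain ⟨m, hm⟩ := hint x hx
  obtain ⟨n, hn⟩ := hint y hys
  rw [mem_preimage, Metric.mem_ball, Real.dist_eq, ← hm, ← hn, ← Int.cast_sub, ← Int.cast_abs] at hy
  have : |n - m| < 1 := by exact_mod_cast hy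
  rw [← hm, ← hn, sub_eq_zero.1 (Int.abs_lt_one_iff.1 this)]

theorem continuousOn_invFunOn_image {α β : Type*} [TopologicalSpace α] [TopologicalSpace β]
    [T2Space β] [Nonempty α] {K : Set α} {f : α → β} (hK : IsCompact K) (hf : ContinuousOn f K)
    (hi : InjOn f K) : ContinuousOn (Function.invFunOn f K) (f '' K) := by
  rintro _ ⟨x, hx, rfl⟩
  rw [ContinuousWithinAt, hi.leftInvOn_invFunOn hx]
  intro N hN
  obtain ⟨N', hN', ho, hxN⟩ := mem_nhds_iff.1 hN
  have h1 := eventually_mem_of_isCompact hK hf ho (b := f x)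
    fun y hy hyx => hi hy hx hyx ▸ hxN
  change ∀ᶠ y in 𝓝[f '' K] f x, Function.invFunOn f K y ∈ N
  filter_upwards [mem_nhdsWithin_of_mem_nhds h1, self_mem_nhdsWithin] with y hy hyK
  exact hN' (hy _ (Function.invFunOn_mem hyK) (Function.invFunOn_eq hyK))

/-- The cut-off function that grows from `0` at `-1` to `1` at `0`. -/
def ramp (s : ℝ) : ℝ := max 0 (min 1 (s + 1))

theorem continuous_ramp : Continuous ramp := by unfold ramp; fun_prop

theorem ramp_of_nonneg {s : ℝ} (h : 0 ≤ s) : ramp s = 1 := by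
  rw [ramp, min_eq_left (by linarith), max_eq_right zero_le_one]

theorem ramp_of_le {s : ℝ} (h : s ≤ -1) : ramp s = 0 :=
  max_eq_left ((min_le_right _ _).trans (by linarith))

theorem nonneg_of_ramp_eq_one {s : ℝ} (h : ramp s = 1) : 0 ≤ s := by
  by_contra! hs
  have : ramp s < 1 := max_lt one_pos ((min_le_right _ _).trans_lt (by linarith))
  exact this.ne h

theorem coe_ramp_eq_zero {s : ℝ} (h : s ≤ -1 ∨ 0 ≤ s) : (ramp s : AddCircle (1 : ℝ)) = 0 := by
  rcases h with h | h
  · rw [ramp_of_le h, AddCircle.coe_zero]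
  · rw [ramp_of_nonneg h, AddCircle.coe_period]

/-- The angle, in a box, of a map to the circle that winds once along the vertical segment between
the heights `y₀` and `y₁`. -/
noncomputable def boxAngle (ρ ε y₀ y₁ x y : ℝ) : ℝ :=
  (1 - ramp (x / ρ - 1 / 2)) * ramp ((y - y₁) / ε) + ramp (x / ρ - 1 / 2) * ramp ((y - y₀) / ε)

variable {ρ ε y₀ y₁ x y : ℝ}

theorem continuous_boxAngle : Continuous fun w : ℝ × ℝ => boxAngle ρ ε y₀ y₁ w.1 w.2 := by
  have := continuous_ramp
  unfold boxAngle
  fun_prop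

theorem continuousOn_coe_addCircle {α : Type*} [TopologicalSpace α] {s : Set α} {f : α → ℝ}
    (hf : ContinuousOn f s) : ContinuousOn (fun z => (f z : AddCircle (1 : ℝ))) s := by
  have h : Continuous fun x : ℝ => (x : AddCircle (1 : ℝ)) := continuous_quotient_mk'
  exact h.comp_continuousOn hf

theorem continuousOn_boxAngle {α : Type*} [TopologicalSpace α] {s : Set α} {g : α → ℂ}
    (hg : ContinuousOn g s) :
    ContinuousOn (fun z => boxAngle ρ ε y₀ y₁ (g z).re (g z).im) s := by
  have h1 : ContinuousOn (fun z => (g z).re) s := Complex.continuous_re.comp_continuousOn hg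
  have h2 : ContinuousOn (fun z => (g z).im) s := Complex.continuous_im.comp_continuousOn hg
  have h3 := continuous_ramp
  unfold boxAngle
  fun_prop

theorem boxAngle_right (hρ : 0 < ρ) (hx : ρ / 2 ≤ x) :
    boxAngle ρ ε y₀ y₁ x y = ramp ((y - y₀) / ε) := by
  have : 0 ≤ x / ρ - 1 / 2 := by
    rw [sub_nonneg, div_le_div_iff₀ two_pos hρ]; linarith
  rw [boxAngle, ramp_of_nonneg this]; ring

theorem boxAngle_left (hρ : 0 < ρ) (hx : x ≤ -(ρ / 2)) :
    boxAngle ρ ε y₀ y₁ x y = ramp ((y - y₁) / ε) := by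
  have : x / ρ - 1 / 2 ≤ -1 := by
    have : x / ρ ≤ -(1 / 2) := by rw [div_le_iff₀ hρ]; linarith
    linarith
  rw [boxAngle, ramp_of_le this]; ring

theorem boxAngle_above (hε : 0 < ε) (h₀ : y₀ ≤ y) (h₁ : y₁ ≤ y) :
    boxAngle ρ ε y₀ y₁ x y = 1 := by
  rw [boxAngle, ramp_of_nonneg (div_nonneg (sub_nonneg.2 h₀) hε.le),
    ramp_of_nonneg (div_nonneg (sub_nonneg.2 h₁) hε.le)]
  ring

theorem div_le_neg_one (hε : 0 < ε) (h : y ≤ y₀ - ε) : (y - y₀) / ε ≤ -1 := by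
  rw [div_le_iff₀ hε]; linarith

theorem boxAngle_below (hε : 0 < ε) (h₀ : y ≤ y₀ - ε) (h₁ : y ≤ y₁ - ε) :
    boxAngle ρ ε y₀ y₁ x y = 0 := by
  rw [boxAngle, ramp_of_le (div_le_neg_one hε h₀), ramp_of_le (div_le_neg_one hε h₁)]
  ring

/-- Leaving the box takes the time `ρ`, and so does coming back from the opposite side. A shorter
return would put one point of the box at the abscissas `t / 2` and `-t / 2`. -/
theorem IsFlowBox.two_mul_lt_of_flowsTo {X : Plane → Plane} {U : Set Plane}
    {T : Set (OpenPartialHomeomorph Plane ℂ)} {e : OpenPartialHomeomorph Plane ℂ} {c : ℂ}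
    {r t y' : ℝ} (hB : IsFlowBox T e c ρ r) (hT : IsTranslationAtlas X U T) (hy : |y| ≤ r)
    (hy' : |y'| ≤ r) (h : FlowsTo X U (box e c 0 y) t (box e c 0 y')) (ht : 0 < t) :
    2 * ρ < t := by
  by_contra! hle
  have h1 : |t / 2| ≤ ρ := by rw [abs_of_pos (by positivity)]; linarith
  have h2 : |-(t / 2)| ≤ ρ := by rwa [abs_neg]
  have h3 := hB.box_flowsTo hT hB.zero_le h1 hy
  have h4 := hT.flowsTo_trans h (hB.box_flowsTo hT hB.zero_le h2 hy')
  rw [show t + (-(t / 2) - 0) = t / 2 - 0 by ring] at h4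
  have := (hB.box_injective h1 hy h2 hy' (hT.flowsTo_unique h3 h4)).1
  linarith

end FlowBox


/-! ### Monotonicity of returns in the plane -/

namespace FlowBox

variable {X : Plane → Plane} {U : Set Plane} {T : Set (OpenPartialHomeomorph Plane ℂ)}
  {e e' : OpenPartialHomeomorph Plane ℂ} {c : ℂ} {ρ r x y t x' y' t' z ε y₀ y₁ y₂ : ℝ}
  {b b' : Plane}

namespace IsFlowBox

variable (hB : IsFlowBox T e c ρ r)
include hB

theorem isCompact_box :
    IsCompact ((fun w : ℝ × ℝ => box e c w.1 w.2) '' (Icc (-ρ) ρ ×ˢ Icc (-r) r)) :=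
  (isCompact_Icc.prod isCompact_Icc).image_of_continuousOn fun _ hw =>
    (hB.continuousAt_box (abs_le.2 hw.1) (abs_le.2 hw.2)).continuousWithinAt

theorem box_mem_interior (hx : |x| < ρ) (hy : |y| < r) :
    box e c x y ∈ interior ((fun w : ℝ × ℝ => box e c w.1 w.2) '' (Icc (-ρ) ρ ×ˢ Icc (-r) r)) := by
  rw [mem_interior_iff_mem_nhds]
  have hs := hB.box_mem hx.le hy.le
  have h1 : Tendsto (fun z => e z - c) (𝓝 (box e c x y)) (𝓝 ⟨x, y⟩) := by
    have := (e.continuousAt hs).tendsto.sub_const c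
    rwa [hB.chart_box hx.le hy.le, add_sub_cancel_left] at this
  have h2 := (Complex.continuous_re.tendsto _).comp h1
  have h3 := (Complex.continuous_im.tendsto _).comp h1
  filter_upwards [e.open_source.mem_nhds hs, h2 (Ioo_mem_nhds (abs_lt.1 hx).1 (abs_lt.1 hx).2),
    h3 (Ioo_mem_nhds (abs_lt.1 hy).1 (abs_lt.1 hy).2)] with z hz hz1 hz2
  refine ⟨((e z - c).re, (e z - c).im), ⟨Ioo_subset_Icc_self hz1, Ioo_subset_Icc_self hz2⟩, ?_⟩
  have : c + (⟨(e z - c).re, (e z - c).im⟩ : ℂ) = e z := by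
    rw [Complex.eta, add_sub_cancel]
  change e.symm (c + (⟨(e z - c).re, (e z - c).im⟩ : ℂ)) = z
  rw [this, e.left_inv hz]

variable (hT : IsTranslationAtlas X U T)
include hT

/-- The strip of trajectories that return to the vertical axis of the box for the first time. -/
theorem exists_strip (hε : 0 < ε) (hr : -r ≤ y₀ - ε) (hr' : y₁ ≤ r) (hlt : y₀ < y₁)
    (h : ∀ y ∈ Icc (y₀ - ε) y₀, IsFirstHit X U e c r y t (y + (y₁ - y₀))) :
    2 * ρ < t ∧ ∃ Θ : ℝ × ℝ → Plane,
      (∀ w ∈ Icc (ρ / 2) (t - ρ / 2) ×ˢ Icc (y₀ - ε) y₀,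
        |w.2| ≤ r ∧ FlowsTo X U (box e c 0 w.2) w.1 (Θ w)) ∧
      InjOn Θ (Icc (ρ / 2) (t - ρ / 2) ×ˢ Icc (y₀ - ε) y₀) ∧
      (∀ w ∈ Icc (ρ / 2) (t - ρ / 2) ×ˢ Icc (y₀ - ε) y₀, ∀ x y, |x| ≤ ρ → |y| ≤ r →
        Θ w = box e c x y → (x = w.1 ∧ y = w.2) ∨ (x = w.1 - t ∧ y = w.2 + (y₁ - y₀))) ∧
      (∀ x ∈ Icc (ρ / 2) ρ, ∀ y ∈ Icc (y₀ - ε) y₀, Θ (x, y) = box e c x y) ∧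
      ∀ x ∈ Icc (ρ / 2) ρ, ∀ y ∈ Icc (y₀ - ε) y₀,
        Θ (t - x, y) = box e c (-x) (y + (y₁ - y₀)) := by
  have hρ := hB.width
  have habs : ∀ y ∈ Icc (y₀ - ε) y₀, |y| ≤ r := fun y hy =>
    abs_le.2 ⟨by linarith [hy.1], by linarith [hy.2]⟩
  have ht : 2 * ρ < t := by
    have := h y₀ ⟨by linarith, le_rfl⟩
    exact hB.two_mul_lt_of_flowsTo hT (habs y₀ ⟨by linarith, le_rfl⟩) this.2.1 this.2.2.1 this.1
  have hex : ∀ w : ℝ × ℝ, w ∈ Icc 0 t ×ˢ Icc (y₀ - ε) y₀ →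
      ∃ b, FlowsTo X U (box e c 0 w.2) w.1 b := fun w hw => by
    obtain ⟨b, hb, -⟩ := (h w.2 hw.2).2.2.1.exists_of_mem (s := w.1) (by
      rw [uIcc_of_le (by linarith)]; exact hw.1)
    exact ⟨b, hb⟩
  choose! Θ hΘ using hex
  set D : Set (ℝ × ℝ) := Icc (ρ / 2) (t - ρ / 2) ×ˢ Icc (y₀ - ε) y₀ with hD
  have hDs : ∀ w ∈ D, |w.2| ≤ r ∧ FlowsTo X U (box e c 0 w.2) w.1 (Θ w) := fun w hw =>
    ⟨habs _ hw.2, hΘ w ⟨⟨by linarith [hw.1.1], by linarith [hw.1.2]⟩, hw.2⟩⟩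
  -- the strip is embedded
  have hΘle : ∀ w ∈ D, ∀ w' ∈ D, Θ w = Θ w' → w'.1 ≤ w.1 := by
    intro w hw w' hw' heq
    by_contra! hlt
    have h1 := (hDs w hw).2
    rw [heq] at h1
    have h2 := hT.flowsTo_trans (hDs w' hw').2 h1.symm
    rw [← sub_eq_add_neg] at h2
    exact (h _ hw'.2).2.2.2 _ ⟨by linarith, by linarith [hw.1.1, hw'.1.2]⟩ _ (habs _ hw.2) h2
  have hΘi : InjOn Θ D := by
    intro w hw w' hw' heq
    have h1 : w.1 = w'.1 := le_antisymm (hΘle w' hw' w hw heq.symm) (hΘle w hw w' hw' heq)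
    have h2 := (hDs w hw).2
    rw [heq, h1] at h2
    exact Prod.ext h1 (hB.box_injective hB.zero_le (habs _ hw.2) hB.zero_le (habs _ hw'.2)
      (hT.flowsTo_injective h2 (hDs w' hw').2)).2
  -- the strip meets the box at its two ends
  have hmeet : ∀ w ∈ D, ∀ x y, |x| ≤ ρ → |y| ≤ r → Θ w = box e c x y →
      (x = w.1 ∧ y = w.2) ∨ (x = w.1 - t ∧ y = w.2 + (y₁ - y₀)) := by
    intro w hw x y hx hy heq
    have h1 := (hDs w hw).2
    rw [heq] at h1
    have h2 := hT.flowsTo_trans h1 (hB.box_flowsTo hT hx hB.zero_le hy)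
    rw [show w.1 + (0 - x) = w.1 - x by ring] at h2
    have hx' := abs_le.1 hx
    rcases le_or_gt (w.1 - x) 0 with h3 | h3
    · obtain ⟨h4, h5⟩ := hB.eq_of_flowsTo hT (habs _ hw.2) hy h2
        (abs_le.2 ⟨by linarith [hw.1.1], by linarith⟩)
      exact Or.inl ⟨by linarith, h5.symm⟩
    rcases lt_or_ge (w.1 - x) t with h4 | h4
    · exact absurd h2 ((h _ hw.2).2.2.2 _ ⟨h3, h4⟩ y hy)
    · have h5 := hT.flowsTo_of_flowsTo (h _ hw.2).2.2.1 h2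
      obtain ⟨h6, h7⟩ := hB.eq_of_flowsTo hT (h _ hw.2).2.1 hy h5
        (abs_le.2 ⟨by linarith, by linarith [hw.1.2]⟩)
      exact Or.inr ⟨by linarith, h7.symm⟩
  have hright : ∀ x ∈ Icc (ρ / 2) ρ, ∀ y ∈ Icc (y₀ - ε) y₀, Θ (x, y) = box e c x y := by
    intro x hx y hy
    have h1 := hB.box_flowsTo hT hB.zero_le (x' := x)
      (abs_le.2 ⟨by linarith [hx.1], hx.2⟩) (habs y hy)
    rw [sub_zero] at h1
    exact hT.flowsTo_unique (hDs (x, y) ⟨⟨hx.1, by linarith [hx.2]⟩, hy⟩).2 h1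
  have hleft : ∀ x ∈ Icc (ρ / 2) ρ, ∀ y ∈ Icc (y₀ - ε) y₀,
      Θ (t - x, y) = box e c (-x) (y + (y₁ - y₀)) := by
    intro x hx y hy
    have h1 := hT.flowsTo_trans (h y hy).2.2.1 (hB.box_flowsTo hT hB.zero_le (x' := -x)
      (abs_le.2 ⟨by linarith [hx.2], by linarith [hx.1]⟩) (h y hy).2.1)
    rw [sub_zero, ← sub_eq_add_neg] at h1
    exact hT.flowsTo_unique (hDs (t - x, y) ⟨⟨by linarith [hx.2], by linarith [hx.1]⟩, hy⟩).2 h1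
  exact ⟨ht, Θ, hDs, hΘi, hmeet, hright, hleft⟩

/-- A first return of the vertical axis of a box defines a map from the plane to the circle that
is constant along the trajectories outside the box. -/
theorem exists_angle_map (hε : 0 < ε) (hr : -r ≤ y₀ - ε) (hr' : y₁ ≤ r) (hlt : y₀ < y₁)
    (h : ∀ y ∈ Icc (y₀ - ε) y₀, IsFirstHit X U e c r y t (y + (y₁ - y₀))) :
    ∃ u : ℂ → AddCircle (1 : ℝ), Continuous u ∧
      (∀ x y, |x| ≤ ρ → |y| ≤ r → u (box e c x y) = (boxAngle ρ ε y₀ y₁ x y : ℝ)) ∧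
      ∀ z, (∀ x y, |x| ≤ ρ → |y| ≤ r → z ≠ box e c x y) →
        (∀ x ∈ Icc (ρ / 2) (t - ρ / 2), ∀ y ∈ Icc (y₀ - ε) y₀,
          ¬ FlowsTo X U (box e c 0 y) x z) → u z = 0 := by
  have hρ := hB.width
  obtain ⟨ht, Θ, hDs, hΘi, hmeet, hright, hleft⟩ := hB.exists_strip hT hε hr hr' hlt h
  set D : Set (ℝ × ℝ) := Icc (ρ / 2) (t - ρ / 2) ×ˢ Icc (y₀ - ε) y₀ with hD
  have hDc : IsCompact D := isCompact_Icc.prod isCompact_Icc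
  have hΘc : ContinuousOn Θ D := hB.continuousOn_strip hT hDs
  have hint : ∀ w : ℝ × ℝ, w.1 ∈ Ioo (ρ / 2) (t - ρ / 2) → w.2 ∈ Ioo (y₀ - ε) y₀ →
      Θ w ∈ interior (Θ '' D) := fun w h1 h2 =>
    mem_interior_iff_mem_nhds.2 (hB.strip_mem_nhds hT hDs
      (prod_mem_nhds (Icc_mem_nhds h1.1 h1.2) (Icc_mem_nhds h2.1 h2.2)))
  set K : Set Plane := (fun w : ℝ × ℝ => box e c w.1 w.2) '' (Icc (-ρ) ρ ×ˢ Icc (-r) r) with hK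
  let f : Plane → AddCircle (1 : ℝ) := fun z =>
    (boxAngle ρ ε y₀ y₁ (e z - c).re (e z - c).im : ℝ)
  let f' : Plane → AddCircle (1 : ℝ) := fun z =>
    (ramp (((Function.invFunOn Θ D z).2 - y₀) / ε) : ℝ)
  have hfb : ∀ x y, |x| ≤ ρ → |y| ≤ r → f (box e c x y) = (boxAngle ρ ε y₀ y₁ x y : ℝ) :=
    fun x y hx hy => by simp [f, hB.chart_box hx hy]
  have hfs : ∀ w ∈ D, f' (Θ w) = (ramp ((w.2 - y₀) / ε) : ℝ) := fun w hw => by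
    simp only [f', hΘi.leftInvOn_invFunOn hw]
  have hfc : ContinuousOn f K := by
    have h1 : ContinuousOn (fun z => e z - c) K := (e.continuousOn.mono (by
      rintro _ ⟨w, hw, rfl⟩
      exact hB.box_mem (abs_le.2 hw.1) (abs_le.2 hw.2))).sub continuousOn_const
    exact continuousOn_coe_addCircle (continuousOn_boxAngle h1)
  have hfc' : ContinuousOn f' (Θ '' D) := by
    have h1 := continuousOn_invFunOn_image hDc hΘc hΘi
    have h2 : Continuous fun w : ℝ × ℝ => ramp ((w.2 - y₀) / ε) :=
      continuous_ramp.comp (by fun_prop)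
    have h3 : ContinuousOn (fun z => ramp (((Function.invFunOn Θ D z).2 - y₀) / ε)) (Θ '' D) :=
      h2.comp_continuousOn h1
    exact continuousOn_coe_addCircle h3
  have hagree : ∀ z ∈ K ∩ Θ '' D, f z = f' z := by
    rintro _ ⟨⟨⟨x, y⟩, hxy, rfl⟩, w, hw, heq⟩
    have hx := abs_le.2 hxy.1
    have hy := abs_le.2 hxy.2
    rw [hfb x y hx hy, ← heq, hfs w hw]
    rcases hmeet w hw x y hx hy heq with ⟨rfl, rfl⟩ | ⟨rfl, rfl⟩
    · rw [boxAngle_right hρ hw.1.1]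
    · rw [boxAngle_left hρ (by linarith [hw.1.2])]
      congr 3; ring
  -- On the upper and lower edges of the box the angle is an integer. On the lateral edges it is one
  -- too, except where the strip leaves or enters, and there the point is interior to the strip.
  have hzero : ∀ z ∈ K, z ∉ interior (K ∪ Θ '' D) → f z = 0 := by
    rintro _ ⟨⟨x, y⟩, hxy, rfl⟩ hni
    have hx := abs_le.2 hxy.1
    have hy := abs_le.2 hxy.2
    rw [hfb x y hx hy]
    simp only at hxy hni
    rcases hxy.2.2.eq_or_lt with rfl | hy1
    · rw [boxAngle_above hε (by linarith) hr', AddCircle.coe_period]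
    rcases hxy.2.1.eq_or_lt with rfl | hy2
    · rw [boxAngle_below hε hr (by linarith), AddCircle.coe_zero]
    rcases hxy.1.2.eq_or_lt with rfl | hx1
    · rw [boxAngle_right hρ (by linarith)]
      apply coe_ramp_eq_zero
      by_contra! hcon
      rw [lt_div_iff₀ hε, div_lt_iff₀ hε] at hcon
      refine hni (interior_mono subset_union_right ?_)
      rw [← hright x ⟨by linarith, le_rfl⟩ y ⟨by linarith, by linarith⟩]
      exact hint _ ⟨by simp only; linarith, by simp only; linarith⟩
        ⟨by simp only; linarith, by simp only; linarith⟩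
    rcases hxy.1.1.eq_or_lt with rfl | hx2
    · rw [boxAngle_left hρ (by linarith)]
      apply coe_ramp_eq_zero
      by_contra! hcon
      rw [lt_div_iff₀ hε, div_lt_iff₀ hε] at hcon
      refine hni (interior_mono subset_union_right ?_)
      have := hleft ρ ⟨by linarith, le_rfl⟩ (y - (y₁ - y₀)) ⟨by linarith, by linarith⟩
      rw [sub_add_cancel] at this
      rw [← this]
      exact hint _ ⟨by simp only; linarith, by simp only; linarith⟩
        ⟨by simp only; linarith, by simp only; linarith⟩
    exact absurd (interior_mono subset_union_left
      (hB.box_mem_interior (abs_lt.2 ⟨hx2, hx1⟩) (abs_lt.2 ⟨hy2, hy1⟩))) hni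
  -- The long edges of the strip carry integer angles, and its two short ends lie inside the box.
  have hzero' : ∀ z ∈ Θ '' D, z ∉ interior (K ∪ Θ '' D) → f' z = 0 := by
    rintro _ ⟨⟨x, y⟩, hw, rfl⟩ hni
    rw [hfs _ hw]
    obtain ⟨hx, hy⟩ := hw
    simp only at hx hy hni
    rcases hy.1.eq_or_lt with rfl | hy1
    · exact coe_ramp_eq_zero (Or.inl (div_le_neg_one hε le_rfl))
    rcases hy.2.eq_or_lt with rfl | hy2
    · exact coe_ramp_eq_zero (Or.inr (by simp))
    rcases hx.1.eq_or_lt with rfl | hx1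
    · refine absurd (interior_mono subset_union_left ?_) hni
      rw [hright _ ⟨le_rfl, by linarith⟩ y hy]
      exact hB.box_mem_interior (abs_lt.2 ⟨by linarith, by linarith⟩)
        (abs_lt.2 ⟨by linarith, by linarith⟩)
    rcases hx.2.eq_or_lt with rfl | hx2
    · refine absurd (interior_mono subset_union_left ?_) hni
      rw [hleft _ ⟨le_rfl, by linarith⟩ y hy]
      exact hB.box_mem_interior (abs_lt.2 ⟨by linarith, by linarith⟩)
        (abs_lt.2 ⟨by linarith, by linarith⟩)
    exact absurd (interior_mono subset_union_right (hint (x, y) ⟨hx1, hx2⟩ ⟨hy1, hy2⟩)) hni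
  obtain ⟨u, hu, hu1, -, hu3⟩ := exists_continuous_glue hB.isCompact_box.isClosed
    (hDc.image_of_continuousOn hΘc).isClosed hfc hfc' hagree hzero hzero'
  refine ⟨u, hu, fun x y hx hy => ?_, fun z hz hz' => hu3 z ?_⟩
  · rw [← hfb x y hx hy]
    exact hu1 ⟨(x, y), ⟨abs_le.1 hx, abs_le.1 hy⟩, rfl⟩
  · rintro (⟨w, hw, rfl⟩ | ⟨w, hw, rfl⟩)
    · exact hz w.1 w.2 (abs_le.2 hw.1) (abs_le.2 hw.2) rfl
    · exact hz' w.1 hw.1 w.2 hw.2 (hDs w hw).2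

/-- In the plane, successive returns to the vertical axis of a box are monotone. -/
theorem lt_of_isFirstHit (hr : -r < y₀) (hlt : y₀ < y₁) (h : IsFirstHit X U e c r y₀ t y₁)
    (h' : IsFirstHit X U e c r y₁ t' y₂) : y₁ < y₂ := by
  have hρ := hB.width
  have hy₁ := abs_le.1 h.2.1
  have hy₀ : |y₀| ≤ r := abs_le.2 ⟨hr.le, by linarith⟩
  suffices hle : y₁ ≤ y₂ by
    refine hle.lt_of_ne ?_
    rintro rfl
    exact hlt.ne (hB.isFirstHit_injective hT hy₀ h.2.1 h h')
  obtain ⟨ε, hε, hεr, hnear⟩ : ∃ ε > 0, ε ≤ y₀ + r ∧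
      ∀ u, |u| ≤ ε → |y₀ + u| ≤ r → |y₁ + u| ≤ r →
        IsFirstHit X U e c r (y₀ + u) t (y₁ + u) := by
    obtain ⟨d, hd, hball⟩ := Metric.eventually_nhds_iff.1 (hB.isFirstHit_eventually hT hy₀ h)
    refine ⟨min (d / 2) (y₀ + r), lt_min (by positivity) (by linarith), min_le_right _ _,
      fun u hu => hball ?_⟩
    rw [Real.dist_0_eq_abs]
    linarith [min_le_left (d / 2) (y₀ + r)]
  have hstrip : ∀ y ∈ Icc (y₀ - ε) y₀, IsFirstHit X U e c r y t (y + (y₁ - y₀)) := by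
    intro y hy
    have := hnear (y - y₀) (abs_le.2 ⟨by linarith [hy.1], by linarith [hy.2]⟩)
      (abs_le.2 ⟨by linarith [hy.1], by linarith [hy.2]⟩)
      (abs_le.2 ⟨by linarith [hy.1], by linarith [hy.2]⟩)
    rwa [add_sub_cancel, show y₁ + (y - y₀) = y + (y₁ - y₀) by ring] at this
  obtain ⟨u, hu, hub, huz⟩ := hB.exists_angle_map hT hε (by linarith) hy₁.2 hlt hstrip
  -- The plane is simply connected, so the circle-valued map lifts to a real function. This is the
  -- only place where planar topology enters the study of returns.
  obtain ⟨F, hF, hFu⟩ := exists_lift_addCircle hu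
  have hρρ : |ρ| ≤ ρ := (abs_of_pos hρ).le
  have hρρ' : |-ρ| ≤ ρ := by rw [abs_neg, abs_of_pos hρ]
  have ht' := hB.two_mul_lt_of_flowsTo hT h.2.1 h'.2.1 h'.2.2.1 h'.1
  -- along the trajectory outside the box
  have h1 : F (box e c ρ y₁) = F (box e c (-ρ) y₂) := by
    obtain ⟨γ, hγ, hγ0, hγt⟩ := h'.2.2.1.exists_arc
    rw [uIcc_of_le h'.1.le] at hγ
    have hγf : ∀ s ∈ Icc 0 t', FlowsTo X U (box e c 0 y₁) s (γ s) := fun s hs => by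
      have := hγ.flowsTo ordConnected_Icc ⟨le_rfl, h'.1.le⟩ hs
      rwa [hγ0, sub_zero] at this
    have hγc : ContinuousOn γ (Icc ρ (t' - ρ)) :=
      hγ.continuousOn.mono (Icc_subset_Icc hρ.le (by linarith))
    have hγρ : γ ρ = box e c ρ y₁ := by
      have := hB.box_flowsTo hT hB.zero_le hρρ h.2.1
      rw [sub_zero] at this
      exact hT.flowsTo_unique (hγf ρ ⟨hρ.le, by linarith⟩) this
    have hγρ' : γ (t' - ρ) = box e c (-ρ) y₂ := by
      have := hT.flowsTo_trans h'.2.2.1 (hB.box_flowsTo hT hB.zero_le hρρ' h'.2.1)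
      rw [sub_zero, ← sub_eq_add_neg] at this
      exact hT.flowsTo_unique (hγf _ ⟨by linarith, by linarith⟩) this
    have hz : ∀ s ∈ Ioo ρ (t' - ρ), u (γ s) = 0 := by
      intro s hs
      have hf := hγf s ⟨by linarith [hs.1], by linarith [hs.2]⟩
      refine huz _ (fun x y hx hy heq => ?_) fun x hx y hy hfx => ?_
      · rw [heq] at hf
        have h2 := hT.flowsTo_trans hf (hB.box_flowsTo hT hx hB.zero_le hy)
        have hx' := abs_le.1 hx
        exact h'.2.2.2 _ ⟨by linarith [hs.1], by linarith [hs.2]⟩ y hy h2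
      · have hyr : |y| ≤ r := abs_le.2 ⟨by linarith [hy.1], by linarith [hy.2]⟩
        have h2 := hT.flowsTo_trans hf hfx.symm
        rcases lt_trichotomy (s + -x) 0 with h3 | h3 | h3
        · have h4 := h2.symm
          exact (hstrip y hy).2.2.2 _ ⟨by linarith, by linarith [hs.1, hx.2]⟩ y₁ h.2.1 h4
        · rw [h3] at h2
          have := (hB.eq_of_flowsTo hT h.2.1 hyr h2 hB.zero_le).2
          linarith [hy.2]
        · exact h'.2.2.2 _ ⟨h3, by linarith [hs.2, hx.1]⟩ y hyr h2
    have hz' : ∀ s ∈ Icc ρ (t' - ρ), ((F (γ s) : ℝ) : AddCircle (1 : ℝ)) = 0 := by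
      intro s hs
      rw [hFu]
      have hc : ContinuousOn (fun s => u (γ s)) (Icc ρ (t' - ρ)) := hu.comp_continuousOn hγc
      have hcl : closure (Ioo ρ (t' - ρ)) = Icc ρ (t' - ρ) := closure_Ioo (by linarith)
      have h0 : EqOn (fun s => u (γ s)) (fun _ => 0) (Ioo ρ (t' - ρ)) := hz
      exact h0.of_subset_closure hc continuousOn_const Ioo_subset_Icc_self hcl.ge hs
    have := eq_of_coe_addCircle_eq_zero isPreconnected_Icc (hF.comp_continuousOn hγc) hz'
      (left_mem_Icc.2 (by linarith)) (right_mem_Icc.2 (by linarith : ρ ≤ t' - ρ))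
    simpa only [Function.comp, hγρ, hγρ'] using this
  -- inside the box
  have h2 : F (box e c ρ y₁) - boxAngle ρ ε y₀ y₁ ρ y₁ =
      F (box e c (-ρ) y₂) - boxAngle ρ ε y₀ y₁ (-ρ) y₂ := by
    have hc : ContinuousOn (fun w : ℝ × ℝ => F (box e c w.1 w.2) - boxAngle ρ ε y₀ y₁ w.1 w.2)
        (Icc (-ρ) ρ ×ˢ Icc (-r) r) := fun w hw =>
      ((hF.continuousAt.comp (hB.continuousAt_box (abs_le.2 hw.1) (abs_le.2 hw.2))).sub
        continuous_boxAngle.continuousAt).continuousWithinAt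
    exact eq_of_coe_addCircle_eq_zero (isPreconnected_Icc.prod isPreconnected_Icc) hc
      (fun w hw => by
        rw [AddCircle.coe_sub, hFu, hub _ _ (abs_le.2 hw.1) (abs_le.2 hw.2), sub_self])
      (x := (ρ, y₁)) (y := (-ρ, y₂)) ⟨abs_le.1 hρρ, hy₁⟩ ⟨abs_le.1 hρρ', abs_le.1 h'.2.1⟩
  -- The lift is constant along the next return outside the box, where the angle is zero in the
  -- circle, and equals the box angle up to a constant inside it. So the angle `1` at `(ρ, y₁)`
  -- recurs at `(-ρ, y₂)`, which forces `y₂` not to lie below `y₁`.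
  rw [h1, boxAngle_right hρ (by linarith), boxAngle_left hρ (by linarith),
    ramp_of_nonneg (div_nonneg (by linarith) hε.le)] at h2
  have h3 : 0 ≤ (y₂ - y₁) / ε := nonneg_of_ramp_eq_one (by linarith)
  rw [le_div_iff₀ hε] at h3
  linarith

end IsFlowBox

end FlowBox


/-! ### Reflection of heights and absence of returns -/

namespace FlowBox

variable {X : Plane → Plane} {U : Set Plane} {T : Set (OpenPartialHomeomorph Plane ℂ)}
  {e e' : OpenPartialHomeomorph Plane ℂ} {c : ℂ} {ρ r x y t x' y' t' z ε y₀ y₁ y₂ : ℝ}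
  {b b' : Plane}

/-- The chart `e` followed by the complex conjugation. -/
noncomputable def conjChart (e : OpenPartialHomeomorph Plane ℂ) : OpenPartialHomeomorph Plane ℂ :=
  e.transHomeomorph Complex.conjCLE.toHomeomorph

theorem conjChart_apply (p : Plane) : conjChart e p = Complex.conjCLE (e p) := rfl

theorem conjChart_symm_apply (w : ℂ) :
    (conjChart e).symm w = e.symm (Complex.conjCLE.symm w) := rfl

/-- Conjugation keeps the constant field `1` and reverses heights, so statements on descending
returns follow from those on ascending ones. -/
theorem IsTranslationAtlas.conj (hT : IsTranslationAtlas X U T) :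
    IsTranslationAtlas X U (conjChart '' T) where
  isOpen := hT.isOpen
  source_subset := by rintro _ ⟨e, he, rfl⟩; exact hT.source_subset e he
  covers := by
    intro p hp
    obtain ⟨e, he, hpe⟩ := hT.covers p hp
    exact ⟨_, ⟨e, he, rfl⟩, hpe⟩
  smooth := by
    rintro _ ⟨e, he, rfl⟩
    exact Complex.conjCLE.contDiff.comp_contDiffOn (hT.smooth e he)
  smooth_symm := by
    rintro _ ⟨e, he, rfl⟩
    exact (hT.smooth_symm e he).comp (Complex.conjCLE.symm.contDiff.contDiffOn) (fun x hx => hx)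
  straighten := by
    rintro _ ⟨e, he, rfl⟩ p hp
    have hd : DifferentiableAt ℝ e p :=
      ((hT.smooth e he).contDiffAt (e.open_source.mem_nhds hp)).differentiableAt (by simp)
    have h : HasFDerivAt (conjChart e) ((Complex.conjCLE : ℂ →L[ℝ] ℂ).comp (fderiv ℝ e p)) p :=
      (Complex.conjCLE : ℂ →L[ℝ] ℂ).hasFDerivAt.comp p hd.hasFDerivAt
    rw [h.fderiv]
    simp [hT.straighten e he p hp]
  transition := by
    rintro _ ⟨e, he, rfl⟩ _ ⟨e', he', rfl⟩ p hp
    filter_upwards [hT.transition e he e' he' p hp] with z hz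
    simp only [conjChart_apply]
    rw [← map_sub, ← map_sub, hz]

theorem box_conj : box (conjChart e) (Complex.conjCLE c) x y = box e c x (-y) := by
  rw [box, box, conjChart_symm_apply]
  congr 1
  rw [ContinuousLinearEquiv.symm_apply_eq]
  apply Complex.ext <;> simp

theorem IsFlowBox.conj (hB : IsFlowBox T e c ρ r) :
    IsFlowBox (conjChart '' T) (conjChart e) (Complex.conjCLE c) ρ r := by
  refine ⟨⟨e, hB.mem, rfl⟩, hB.width, hB.height, fun x y hx hy => ?_⟩
  change Complex.conjCLE.symm _ ∈ e.target
  have : Complex.conjCLE.symm (Complex.conjCLE c + ⟨x, y⟩) = c + ⟨x, -y⟩ := by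
    rw [ContinuousLinearEquiv.symm_apply_eq]
    apply Complex.ext <;> simp
  rw [this]
  exact hB.target x (-y) hx (by rwa [abs_neg])

theorem IsFirstHit.conj (h : IsFirstHit X U e c r y t y') :
    IsFirstHit X U (conjChart e) (Complex.conjCLE c) r (-y) t (-y') := by
  refine ⟨h.1, by rw [abs_neg]; exact h.2.1, ?_, fun s hs z hz => ?_⟩
  · rw [box_conj, box_conj, neg_neg, neg_neg]
    exact h.2.2.1
  · rw [box_conj, box_conj, neg_neg]
    exact h.2.2.2 s hs (-z) (by rwa [abs_neg])

namespace IsFlowBox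

variable (hB : IsFlowBox T e c ρ r) (hT : IsTranslationAtlas X U T)
include hB hT

/-- Induction over the successive first returns. Each of them takes longer than `ρ`, so at most `t'
/ ρ` of them occur. -/
theorem le_of_isFirstHit (hr : -r < y₀) (hlt : y₀ < y₁) (h : IsFirstHit X U e c r y₀ t y₁)
    (ht' : 0 ≤ t') (hz : |z| ≤ r) (h' : FlowsTo X U (box e c 0 y₁) t' (box e c 0 z)) :
    y₁ ≤ z := by
  obtain ⟨n, hn⟩ := exists_nat_ge (t' / ρ)
  rw [div_le_iff₀ hB.width] at hn
  induction n generalizing y₀ y₁ t t' with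
  | zero =>
    have h0 : t' = 0 := le_antisymm (by simpa using hn) ht'
    subst h0
    exact (hB.box_injective hB.zero_le hz hB.zero_le h.2.1 (hT.flowsTo_zero h')).2.ge
  | succ n ih =>
    rcases ht'.eq_or_lt with rfl | hpos
    · exact (hB.box_injective hB.zero_le hz hB.zero_le h.2.1 (hT.flowsTo_zero h')).2.ge
    obtain ⟨s, hs, y₂, h2⟩ := hB.exists_isFirstHit hT h.2.1 hz hpos h'
    have h3 := hB.lt_of_isFirstHit hT hr hlt h h2
    have h4 := hB.lt_of_flowsTo hT h.2.1 h2.2.1 h2.2.2.1 h2.1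
    push_cast at hn
    exact h3.le.trans (ih (hr.trans hlt) h3 h2 (sub_nonneg.2 hs)
      (hT.flowsTo_of_flowsTo h2.2.2.1 h') (by linarith))

/-- The first return lies between the initial point and any later return. -/
theorem exists_isFirstHit_mem_uIcc (hy : |y| < r) (hz : |z| ≤ r) (ht : 0 < t)
    (h : FlowsTo X U (box e c 0 y) t (box e c 0 z)) :
    ∃ s y', IsFirstHit X U e c r y s y' ∧ y' ∈ uIcc y z := by
  obtain ⟨s, hs, y', h1⟩ := hB.exists_isFirstHit hT hy.le hz ht h
  refine ⟨s, y', h1, ?_⟩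
  have h2 := hT.flowsTo_of_flowsTo h1.2.2.1 h
  rw [mem_uIcc]
  rcases lt_trichotomy y y' with hlt | rfl | hlt
  · exact Or.inl ⟨hlt.le, hB.le_of_isFirstHit hT (abs_lt.1 hy).1 hlt h1 (sub_nonneg.2 hs) hz h2⟩
  · rcases le_total y z with h3 | h3
    · exact Or.inl ⟨le_rfl, h3⟩
    · exact Or.inr ⟨h3, le_rfl⟩
  · have h3 := hB.conj.le_of_isFirstHit hT.conj (neg_lt_neg (abs_lt.1 hy).2) (neg_lt_neg hlt)
      h1.conj (sub_nonneg.2 hs) (z := -z) (by rwa [abs_neg])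
      (by rw [box_conj, box_conj, neg_neg, neg_neg]; exact h2)
    exact Or.inr ⟨by linarith, hlt.le⟩

/-- By monotonicity every return of the centre is at least as far away as the first one, and the
first one is not at the centre, since this is not periodic. Half of that distance is free of
returns. -/
theorem exists_forall_not_flowsTo (hper : ¬ IsPeriodicPt X U (box e c 0 0)) :
    ∃ r' > 0, r' ≤ r ∧ ∀ t > 0, ∀ z, |z| ≤ r' → ¬ FlowsTo X U (box e c 0 0) t (box e c 0 z) := by
  have h0 : |(0 : ℝ)| < r := by simpa using hB.height
  by_cases hex : ∃ t > 0, ∃ z, |z| ≤ r ∧ FlowsTo X U (box e c 0 0) t (box e c 0 z)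
  · obtain ⟨t, ht, z, hz, hf⟩ := hex
    obtain ⟨s, y', h1, -⟩ := hB.exists_isFirstHit_mem_uIcc hT h0 hz ht hf
    have hy' : y' ≠ 0 := by
      rintro rfl
      exact hper ⟨s, h1.1, h1.2.2.1⟩
    refine ⟨|y'| / 2, by positivity, by linarith [h1.2.1, abs_nonneg y'], fun t' ht' z' hz' hf' => ?_⟩
    obtain ⟨s', y'', h2, h3⟩ := hB.exists_isFirstHit_mem_uIcc hT h0
      (hz'.trans (by linarith [h1.2.1, abs_nonneg y'])) ht' hf'
    obtain ⟨-, rfl⟩ := hB.isFirstHit_unique hT h1 h2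
    have h4 : |y' - 0| ≤ |z' - 0| := abs_sub_left_of_mem_uIcc h3
    rw [sub_zero, sub_zero] at h4
    have := abs_pos.2 hy'
    linarith
  · push Not at hex
    exact ⟨r, hB.height, le_rfl, hex⟩

/-- If the trajectory of the centre of a box is complete and does not return to the vertical axis,
and if only finitely many incomplete trajectories meet this axis, then near the centre there are
no returns at all. -/
theorem exists_forall_forall_not_flowsTo
    (hno : ∀ t > 0, ∀ z, |z| ≤ r → ¬ FlowsTo X U (box e c 0 0) t (box e c 0 z))
    (hcomp : ∀ t, ∃ b, FlowsTo X U (box e c 0 0) t b)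
    (hfin : {A | ∃ y, |y| ≤ r ∧ IsIncomplete X U (box e c 0 y) ∧
      A = trajectory X U (box e c 0 y)}.Finite) :
    ∃ ε > 0, ε ≤ r ∧ ∀ y z, |y| ≤ ε → |z| ≤ ε → ∀ t > 0,
      ¬ FlowsTo X U (box e c 0 y) t (box e c 0 z) := by
  have hr := hB.height
  have h0 : |(0 : ℝ)| ≤ r := by simpa using hr.le
  set Z₁ : Set ℝ := {y | |y| ≤ r ∧ IsIncomplete X U (box e c 0 y) ∧
    ∀ t > 0, ∀ z, |z| ≤ r → ¬ FlowsTo X U (box e c 0 y) t (box e c 0 z)} with hZ₁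
  -- Two points of `Z₁` on one trajectory would give a return of one to the other, so `Z₁` injects
  -- into the finite set of incomplete trajectories.
  have hZ₁f : Z₁.Finite := by
    refine Finite.of_finite_image (f := fun y => trajectory X U (box e c 0 y)) (hfin.subset ?_) ?_
    · rintro _ ⟨y, hy, rfl⟩
      exact ⟨y, hy.1, hy.2.1, rfl⟩
    · intro y hy z hz heq
      have h1 : box e c 0 z ∈ trajectory X U (box e c 0 y) := by
        simp only at heq
        rw [heq]
        exact ⟨0, FlowsTo.refl (hB.box_mem_domain hT hB.zero_le hz.1)⟩
      obtain ⟨t, ht⟩ := h1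
      rcases lt_trichotomy t 0 with hlt | rfl | hlt
      · exact absurd ht.symm (hz.2.2 _ (neg_pos.2 hlt) y hy.1)
      · exact (hB.box_injective hB.zero_le hz.1 hB.zero_le hy.1 (hT.flowsTo_zero ht)).2.symm
      · exact absurd ht (hy.2.2 _ hlt z hz.1)
  -- At most one point has its first hit at a given height. For the end points `±r` these starts are
  -- discarded, since there a first hit need not persist under translation.
  have hZ₂f : ∀ a, {y | |y| ≤ r ∧ ∃ t, IsFirstHit X U e c r y t a}.Finite := fun a =>
    Set.Subsingleton.finite fun y hy z hz => by
      obtain ⟨hy, s, h1⟩ := hy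
      obtain ⟨hz, t, h2⟩ := hz
      exact hB.isFirstHit_injective hT hy hz h1 h2
  have hev : ∀ᶠ y in 𝓝 (0 : ℝ), |y| < r ∧ y ∉ Z₁ ∧
      y ∉ {y | |y| ≤ r ∧ ∃ t, IsFirstHit X U e c r y t r} ∧
      y ∉ {y | |y| ≤ r ∧ ∃ t, IsFirstHit X U e c r y t (-r)} := by
    refine (continuous_abs.continuousAt.eventually_lt continuousAt_const (by simpa using hr)).and
      (Eventually.and ?_ (Eventually.and ?_ ?_))
    · exact hZ₁f.isClosed.isOpen_compl.mem_nhds fun h => h.2.1 hcomp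
    · exact (hZ₂f r).isClosed.isOpen_compl.mem_nhds fun ⟨_, t, ht⟩ =>
        hno t ht.1 r ht.2.1 ht.2.2.1
    · exact (hZ₂f (-r)).isClosed.isOpen_compl.mem_nhds fun ⟨_, t, ht⟩ =>
        hno t ht.1 (-r) ht.2.1 ht.2.2.1
  obtain ⟨d, hd, hball⟩ := Metric.eventually_nhds_iff.1 hev
  have hsmall : ∀ y, |y| ≤ min (d / 2) r → |y| < d := fun y hy => by
    linarith [min_le_left (d / 2) r]
  refine ⟨min (d / 2) r, lt_min (by positivity) hr, min_le_right _ _, fun y z hy hz t ht hf => ?_⟩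
  have hgood : ∀ w ∈ uIcc 0 y, |w| ≤ min (d / 2) r ∧ (|w| < r ∧ w ∉ Z₁ ∧
      w ∉ {y | |y| ≤ r ∧ ∃ t, IsFirstHit X U e c r y t r} ∧
      w ∉ {y | |y| ≤ r ∧ ∃ t, IsFirstHit X U e c r y t (-r)}) := fun w hw => by
    have h1 : |w - 0| ≤ |y - 0| := abs_sub_left_of_mem_uIcc hw
    rw [sub_zero, sub_zero] at h1
    have h2 := h1.trans hy
    exact ⟨h2, hball (by rw [Real.dist_0_eq_abs]; exact hsmall w h2)⟩
  obtain ⟨s, y', h1, h2⟩ := hB.exists_isFirstHit_mem_uIcc hT (hgood y right_mem_uIcc).2.1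
    (hz.trans (min_le_right _ _)) ht hf
  -- the points with the same first return as `y`
  let D : ℝ → Prop := fun w => IsFirstHit X U e c r w s (w + (y' - y))
  -- Where a return exists, it persists with the same time and the same displacement. Where none
  -- exists, the trajectory is complete, so the flow for the time `s` is defined and ends off the
  -- axis, an open condition. Thus `D` is locally constant and would hold at `0`.
  have hloc : ∀ w ∈ uIcc 0 y, ∀ᶠ v in 𝓝[uIcc 0 y] w, D v = D w := by
    intro w hw
    obtain ⟨-, hwr, hw1, hw2, hw3⟩ := hgood w hw
    by_cases hhit : ∃ t > 0, ∃ z, |z| ≤ r ∧ FlowsTo X U (box e c 0 w) t (box e c 0 z)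
    · obtain ⟨t, ht, z, hz, hf⟩ := hhit
      obtain ⟨t₁, -, y₁, h3⟩ := hB.exists_isFirstHit hT hwr.le hz ht hf
      have hy₁ : |y₁| < r := by
        refine h3.2.1.lt_of_ne fun heq => ?_
        rcases (abs_eq hr.le).1 heq with rfl | rfl
        · exact hw2 ⟨hwr.le, t₁, h3⟩
        · exact hw3 ⟨hwr.le, t₁, h3⟩
      have h4 : Tendsto (fun v => v - w) (𝓝[uIcc 0 y] w) (𝓝 0) :=
        (Continuous.tendsto' (by fun_prop) _ _ (by simp)).mono_left nhdsWithin_le_nhds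
      have h5 : ∀ᶠ v in 𝓝[uIcc 0 y] w, |y₁ + (v - w)| < r := by
        refine (h4.const_add y₁).abs.eventually_lt_const ?_
        rwa [add_zero]
      filter_upwards [h4.eventually (hB.isFirstHit_eventually hT hwr.le h3), h5,
        self_mem_nhdsWithin] with v hv hv5 hvI
      rw [add_sub_cancel] at hv
      have h6 := hv (hgood v hvI).2.1.le hv5.le
      refine propext ⟨fun h7 => ?_, fun h7 => ?_⟩
      · obtain ⟨rfl, h8⟩ := hB.isFirstHit_unique hT h6 h7
        rwa [show y₁ = w + (y' - y) by linarith] at h3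
      · obtain ⟨rfl, h8⟩ := hB.isFirstHit_unique hT h3 h7
        rwa [show y₁ + (v - w) = v + (y' - y) by linarith] at h6
    · push Not at hhit
      have hc : ∀ t, ∃ b, FlowsTo X U (box e c 0 w) t b := by
        by_contra hc
        exact hw1 ⟨hwr.le, hc, hhit⟩
      obtain ⟨b, hb⟩ := hc s
      have hbK : b ∈ (box e c 0 '' Icc (-r) r)ᶜ := by
        rintro ⟨z, hz, rfl⟩
        exact hhit s h1.1 z (abs_le.2 hz) hb
      have h3 := hT.flow_eventually_mem hb (hB.isCompact_cross.isClosed.isOpen_compl.mem_nhds hbK)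
      have h4 : Tendsto (fun v => (box e c 0 v, s)) (𝓝[uIcc 0 y] w) (𝓝 (box e c 0 w, s)) :=
        ((hB.continuousAt_cross hwr.le).tendsto.prodMk_nhds tendsto_const_nhds).mono_left
          nhdsWithin_le_nhds
      filter_upwards [h4.eventually h3] with v hv
      obtain ⟨a, ha, hav⟩ := hv
      refine propext ⟨fun h7 => ?_, fun h7 => ?_⟩
      · exact absurd ⟨_, abs_le.1 h7.2.1, hT.flowsTo_unique h7.2.2.1 hav⟩ ha
      · exact absurd h7.2.2.1 (hhit s h1.1 _ h7.2.1)
  have hDy : D y := by simpa [D] using h1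
  have hD0 : D 0 := by
    rw [eq_of_eventually_eq isPreconnected_uIcc hloc left_mem_uIcc right_mem_uIcc]
    exact hDy
  exact hno s hD0.1 _ hD0.2.1 hD0.2.2.1

end IsFlowBox

end FlowBox


/-! ### Limit sets of strips in the sphere -/

namespace FlowBox

variable {X : Plane → Plane} {U P : Set Plane}

theorem mem_singularPoints_iff {q : Sphere} : q ∈ singularPoints P ↔ q ∉ toSphere '' Pᶜ := by
  constructor
  · rintro (rfl | ⟨p, hp, rfl⟩) ⟨b, hb, hbq⟩
    · exact OnePoint.coe_ne_infty b hbq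
    · exact hb (toSphere_injective hbq ▸ hp)
  · intro hq
    induction q using OnePoint.rec with
    | infty => exact Or.inl rfl
    | coe p => exact Or.inr ⟨p, by_contra fun hp => hq ⟨p, hp, rfl⟩, rfl⟩

/-- One of the two points is finite. In the locally compact totally disconnected space `P` it has a
clopen neighbourhood inside a ball, hence a compact one; this set and the remaining singular points
are both closed in the sphere. -/
theorem exists_separation_singularPoints (hP : IsClosed P) (hPt : IsTotallyDisconnected P)
    {a b : Sphere} (ha : a ∈ singularPoints P) (hb : b ∈ singularPoints P) (hab : a ≠ b) :
    ∃ A B : Set Sphere, IsClosed A ∧ IsClosed B ∧ Disjoint A B ∧ a ∈ A ∧ b ∈ B ∧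
      singularPoints P ⊆ A ∪ B := by
  wlog hinf : a ≠ OnePoint.infty generalizing a b
  · push Not at hinf
    obtain ⟨A, B, hA, hB, hd, ha', hb', hs⟩ := this hb ha hab.symm (hinf ▸ hab.symm)
    exact ⟨B, A, hB, hA, hd.symm, hb', ha', by rwa [union_comm]⟩
  obtain ⟨x, hxP, rfl⟩ : ∃ x ∈ P, toSphere x = a := ha.resolve_left hinf
  have : TotallyDisconnectedSpace P := totallyDisconnectedSpace_subtype_iff.2 hPt
  have : LocallyCompactSpace P := hP.isClosedEmbedding_subtypeVal.locallyCompactSpace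
  have hO : {z : P | (z : Plane) ∈ Metric.ball x 1 ∧ toSphere z ≠ b} ∈ 𝓝 (⟨x, hxP⟩ : P) := by
    refine (IsOpen.inter (Metric.isOpen_ball.preimage continuous_subtype_val)
      (isOpen_compl_singleton.preimage (isOpenEmbedding_toSphere.continuous.comp
        continuous_subtype_val))).mem_nhds ⟨Metric.mem_ball_self one_pos, hab⟩
  obtain ⟨W, hW, hxW, hWO⟩ := loc_compact_Haus_tot_disc_of_zero_dim.mem_nhds_iff.1 hO
  have hWc : IsCompact ((↑) '' W : Set Plane) :=
    (isCompact_closedBall x 1).of_isClosed_subset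
      (hP.isClosedEmbedding_subtypeVal.isClosedMap W hW.1) (by
        rintro _ ⟨z, hz, rfl⟩
        exact Metric.ball_subset_closedBall (hWO hz).1)
  have hopen : IsOpen ((↑) '' W ∪ Pᶜ : Set Plane) := by
    have h1 : ((↑) '' W ∪ Pᶜ : Set Plane) = ((↑) '' Wᶜ : Set Plane)ᶜ := by
      ext z
      by_cases hz : z ∈ P
      · simp [hz]
      · simp [hz]
    rw [h1]
    exact (hP.isClosedEmbedding_subtypeVal.isClosedMap _ hW.compl.1).isOpen_compl
  refine ⟨toSphere '' ((↑) '' W), (toSphere '' ((↑) '' W ∪ Pᶜ))ᶜ,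
    (hWc.image isOpenEmbedding_toSphere.continuous).isClosed,
    (isOpenEmbedding_toSphere.isOpenMap _ hopen).isClosed_compl, ?_, ?_, ?_, ?_⟩
  · exact disjoint_compl_right_iff_subset.2 (image_mono subset_union_left)
  · exact ⟨x, ⟨_, hxW, rfl⟩, rfl⟩
  · rintro ⟨_, (⟨z, hz, rfl⟩ | hz), hzb⟩
    · exact (hWO hz).2 hzb
    · exact mem_singularPoints_iff.1 hb ⟨_, hz, hzb⟩
  · intro s hs
    by_cases hsW : s ∈ toSphere '' ((↑) '' W)
    · exact Or.inl hsW
    · refine Or.inr ?_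
      rintro ⟨z, (hz | hz), rfl⟩
      · exact hsW ⟨z, hz, rfl⟩
      · exact mem_singularPoints_iff.1 hs ⟨z, hz, rfl⟩

/-- Two points of the intersection could be separated by open sets that cover the intersection; by
compactness they would cover, and disconnect, some `K M`. -/
theorem subsingleton_iInter_of_subset_singularPoints (hP : IsClosed P)
    (hPt : IsTotallyDisconnected P) {K : ℝ → Set Sphere} (hK : Antitone K)
    (hKc : ∀ M, IsClosed (K M)) (hKp : ∀ M, IsPreconnected (K M))
    (hKs : ⋂ M, K M ⊆ singularPoints P) : (⋂ M, K M).Subsingleton := by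
  intro a ha b hb
  by_contra hab
  obtain ⟨A, B, hA, hB, hd, haA, hbB, hs⟩ :=
    exists_separation_singularPoints hP hPt (hKs ha) (hKs hb) hab
  obtain ⟨O, O', hO, hO', hAO, hBO, hOO⟩ := SeparatedNhds.of_isCompact_isCompact hA.isCompact hB.isCompact hd
  obtain ⟨M, hM⟩ := exists_subset_nhds_of_compactSpace (V := K) (U := O ∪ O') hK.directed_ge hKc
    fun x hx => (hO.union hO').mem_nhds ((hs (hKs hx)).imp (fun h => hAO h) fun h => hBO h)
  obtain ⟨x, -, hx⟩ := hKp M O O' hO hO' hM ⟨a, mem_iInter.1 ha M, hAO haA⟩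
    ⟨b, mem_iInter.1 hb M, hBO hbB⟩
  exact hOO.le_bot hx

/-- The closure in the sphere of the part after the time `M` of a strip of trajectories. -/
def stripEnd (G : ℝ × ℝ → Plane) (ε M : ℝ) : Set Sphere :=
  closure (toSphere '' (G '' (Ici M ×ˢ Icc (-ε) ε)))

variable {G : ℝ × ℝ → Plane} {ε : ℝ}

theorem antitone_stripEnd : Antitone (stripEnd G ε) := fun _ _ h =>
  closure_mono (image_mono (image_mono (prod_mono_left (Ici_subset_Ici.2 h))))

/-- The trajectories of a strip that leaves all compact subsets of `Pᶜ` tend to one point. -/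
theorem exists_omegaLimitSet_eq (hP : IsClosed P) (hPt : IsTotallyDisconnected P) (hε : 0 < ε)
    (hG : ContinuousOn G (univ ×ˢ Icc (-ε) ε))
    (hfwd : ∀ x y, |y| ≤ ε → forwardOrbit X U (G (x, y)) = (fun x' => G (x', y)) '' Ici x)
    (hproper : ∀ b ∈ Pᶜ, ∃ N ∈ 𝓝 b, ∃ M, ∀ x y, |y| ≤ ε → G (x, y) ∈ N → |x| ≤ M) :
    ∃ q, ⋂ M, stripEnd G ε M = {q} ∧ ∀ x y, |y| ≤ ε → omegaLimitSet X U (G (x, y)) = {q} := by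
  -- A regular point has a neighbourhood that the strip meets only for bounded times.
  have hsub : ⋂ M, stripEnd G ε M ⊆ singularPoints P := by
    intro s hs
    rw [mem_singularPoints_iff]
    rintro ⟨b, hb, rfl⟩
    obtain ⟨N, hN, M, hM⟩ := hproper b hb
    obtain ⟨_, ⟨z, hzN, rfl⟩, _, ⟨⟨x, y⟩, hxy, rfl⟩, hz⟩ := mem_closure_iff_nhds.1
      (mem_iInter.1 hs (M + 1)) _ (isOpenEmbedding_toSphere.image_mem_nhds.2 hN)
    have h1 := hM x y (abs_le.2 hxy.2) (toSphere_injective hz ▸ hzN)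
    have h2 : M + 1 ≤ x := hxy.1
    linarith [le_abs_self x]
  have hprec : ∀ M, IsPreconnected (stripEnd G ε M) := fun M =>
    (((isPreconnected_Ici.prod isPreconnected_Icc).image G
      (hG.mono (prod_mono_left (subset_univ _)))).image toSphere
      isOpenEmbedding_toSphere.continuous.continuousOn).closure
  have hss := subsingleton_iInter_of_subset_singularPoints hP hPt antitone_stripEnd
    (fun M => isClosed_closure) hprec hsub
  have hom : ∀ x y, |y| ≤ ε → omegaLimitSet X U (G (x, y)) ⊆ ⋂ M, stripEnd G ε M := by
    intro x y hy s hs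
    refine mem_iInter.2 fun M => ?_
    have h1 : G (max x M, y) ∈ forwardOrbit X U (G (x, y)) := by
      rw [hfwd x y hy]
      exact ⟨max x M, mem_Ici.2 (le_max_left _ _), rfl⟩
    have h2 := mem_iInter₂.1 hs _ h1
    rw [hfwd _ y hy] at h2
    refine closure_mono (image_mono ?_) h2
    rintro _ ⟨x', hx', rfl⟩
    exact ⟨(x', y), ⟨mem_Ici.2 ((le_max_right x M).trans hx'), abs_le.1 hy⟩, rfl⟩
  -- The sphere is compact, so each trajectory has a cluster point.
  have hne : ∀ x y, |y| ≤ ε → (omegaLimitSet X U (G (x, y))).Nonempty := by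
    intro x y hy
    obtain ⟨q, hq⟩ := exists_clusterPt_of_compactSpace (map (fun t => toSphere (G (t, y))) atTop)
    refine ⟨q, mem_iInter₂.2 fun b hb => ?_⟩
    rw [hfwd x y hy] at hb
    obtain ⟨x', -, rfl⟩ := hb
    rw [hfwd x' y hy]
    refine mem_closure_iff_clusterPt.2 (hq.mono (le_principal_iff.2 (mem_map.2 ?_)))
    filter_upwards [Ici_mem_atTop x'] with t ht using ⟨_, ⟨t, ht, rfl⟩, rfl⟩
  obtain ⟨q, hq⟩ := (hne 0 0 (by simpa using hε.le)).mono (hom 0 0 (by simpa using hε.le))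
  have hqeq := hss.eq_singleton_of_mem hq
  refine ⟨q, hqeq, fun x y hy => ?_⟩
  exact (hne x y hy).subset_singleton_iff.1 (hqeq ▸ hom x y hy)

end FlowBox


/-! ### Strips of complete trajectories -/

namespace FlowBox

variable {X : Plane → Plane} {U P : Set Plane} {T : Set (OpenPartialHomeomorph Plane ℂ)}
  {e : OpenPartialHomeomorph Plane ℂ} {c : ℂ} {ρ ε : ℝ} {p : Plane} {G : ℝ × ℝ → Plane}

/-- The flow for the time `t` is a translation in a chart that fixes one point, hence the identity
nearby. So the fixed points of this flow map form an open set, and it is invariant. -/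
theorem IsTranslationAtlas.hasPeriodicNeighbourhood (hT : IsTranslationAtlas X U T)
    (hp : IsPeriodicPt X U p) : HasPeriodicNeighbourhood X U p := by
  obtain ⟨t, ht, hpt⟩ := hp
  refine ⟨{b | FlowsTo X U b t b}, ?_, hpt, fun b hb => hb.left_mem, ?_⟩
  · refine isOpen_iff_mem_nhds.2 fun b hb => ?_
    obtain ⟨e, he, hbe⟩ := hT.covers b (FlowsTo.left_mem hb)
    filter_upwards [hT.holonomy hb he he hbe hbe, e.open_source.mem_nhds hbe] with z hz hze
    rwa [add_sub_cancel, e.left_inv hze] at hz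
  · rintro b hb
    refine ⟨?_, t, ht, hb⟩
    rintro b' ⟨s, hs⟩
    have h1 := hT.flowsTo_trans (hT.flowsTo_trans hs.symm hb) hs
    rwa [show -s + t + s = t by ring] at h1

namespace IsTranslationAtlas

variable (hT : IsTranslationAtlas X U T)
  (hG : ∀ x y, |y| ≤ ε → FlowsTo X U (box e c 0 y) x (G (x, y)))
include hT hG

theorem flow_flowsTo (x x' y : ℝ) (hy : |y| ≤ ε) : FlowsTo X U (G (x, y)) (x' - x) (G (x', y)) :=
  hT.flowsTo_of_flowsTo (hG x y hy) (hG x' y hy)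

theorem eq_of_flowsTo_flow {x y t : ℝ} {b : Plane} (hy : |y| ≤ ε) (h : FlowsTo X U (G (x, y)) t b) :
    b = G (x + t, y) :=
  hT.flowsTo_unique h (by simpa using hT.flow_flowsTo hG x (x + t) y hy)

theorem trajectory_flow (x y : ℝ) (hy : |y| ≤ ε) :
    trajectory X U (G (x, y)) = range fun x' => G (x', y) := by
  ext b
  constructor
  · rintro ⟨t, ht⟩
    exact ⟨x + t, (hT.eq_of_flowsTo_flow hG hy ht).symm⟩
  · rintro ⟨x', rfl⟩
    exact ⟨x' - x, hT.flow_flowsTo hG x x' y hy⟩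

theorem forwardOrbit_flow (x y : ℝ) (hy : |y| ≤ ε) :
    forwardOrbit X U (G (x, y)) = (fun x' => G (x', y)) '' Ici x := by
  ext b
  constructor
  · rintro ⟨t, ht, h⟩
    exact ⟨x + t, le_add_of_nonneg_right ht, (hT.eq_of_flowsTo_flow hG hy h).symm⟩
  · rintro ⟨x', hx', rfl⟩
    exact ⟨x' - x, sub_nonneg.2 hx', hT.flow_flowsTo hG x x' y hy⟩

theorem backwardOrbit_flow (x y : ℝ) (hy : |y| ≤ ε) :
    backwardOrbit X U (G (x, y)) = (fun x' => G (x', y)) '' Iic x := by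
  ext b
  constructor
  · rintro ⟨t, ht, h⟩
    exact ⟨x + t, add_le_of_nonpos_right ht, (hT.eq_of_flowsTo_flow hG hy h).symm⟩
  · rintro ⟨x', hx', rfl⟩
    exact ⟨x' - x, sub_nonpos.2 hx', hT.flow_flowsTo hG x x' y hy⟩

end IsTranslationAtlas

namespace IsFlowBox

variable (hB : IsFlowBox T e c ρ ε) (hT : IsTranslationAtlas X U T)
  (hG : ∀ x y, |y| ≤ ε → FlowsTo X U (box e c 0 y) x (G (x, y)))
include hB hT hG

theorem continuousOn_flow : ContinuousOn G (univ ×ˢ Icc (-ε) ε) :=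
  hB.continuousOn_strip hT fun w hw => ⟨abs_le.2 hw.2, hG w.1 w.2 (abs_le.2 hw.2)⟩

/-- The strip is vertical in each box. -/
theorem flow_vertical {e' : OpenPartialHomeomorph Plane ℂ} {c' : ℂ} {ρ' r' x y x' y' v : ℝ}
    (hB' : IsFlowBox T e' c' ρ' r') (hx' : |x'| ≤ ρ') (hy' : |y'| ≤ r') (hv' : |y' + v| ≤ r')
    (hy : |y| ≤ ε) (hv : |y + v| ≤ ε) (h : G (x, y) = box e' c' x' y') :
    G (x, y + v) = box e' c' x' (y' + v) := by
  have hseg : ∀ {a s w : ℝ}, |a| ≤ s → |a + v| ≤ s → w ∈ uIcc 0 v → |a + w| ≤ s := by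
    intro a s w ha hav hw
    rw [abs_le] at *
    rw [mem_uIcc] at hw
    rcases hw with hw | hw <;> constructor <;> linarith [hw.1, hw.2, ha.1, ha.2, hav.1, hav.2]
  let Q : ℝ → Prop := fun w => G (x, y + w) = box e' c' x' (y' + w)
  -- Agreement of the two vertical curves is open, because both are vertical in the chart, and it is
  -- closed by continuity.
  have hloc : ∀ w ∈ uIcc 0 v, ∀ᶠ w' in 𝓝[uIcc 0 v] w, Q w' = Q w := by
    intro w hw
    have hyw := hseg hy hv hw
    have hyw' := hseg hy' hv' hw
    have htend : Tendsto (fun w' => (x, y + w')) (𝓝[uIcc 0 v] w) (𝓝 (x, y + w)) :=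
      (Continuous.tendsto (f := fun w' : ℝ => (x, y + w')) (by fun_prop) w).mono_left
        nhdsWithin_le_nhds
    by_cases hQ : Q w
    · have hQ' : G (x, y + w) = box e' c' x' (y' + w) := hQ
      have hs : G (x, y + w) ∈ e'.source := hQ' ▸ hB'.box_mem hx' hyw'
      filter_upwards [htend.eventually (hB.flow_cross_local hT hyw (hG x (y + w) hyw) hB'.mem hs),
        self_mem_nhdsWithin] with w' hw' hwI
      obtain ⟨d, hd, hf, heq⟩ := hw'
      rw [hQ', hB'.chart_box hx' hyw'] at heq
      refine propext ⟨fun _ => hQ, fun _ => ?_⟩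
      change G (x, y + w') = _
      rw [hT.flowsTo_unique (hG x (y + w') (hseg hy hv hwI)) hf]
      refine e'.injOn hd (hB'.box_mem hx' (hseg hy' hv' hwI)) ?_
      rw [heq, hB'.chart_box hx' (hseg hy' hv' hwI)]
      apply Complex.ext <;> simp [add_assoc]
    · have h1 : Tendsto (fun w' => G (x, y + w')) (𝓝[uIcc 0 v] w) (𝓝 (G (x, y + w))) := by
        refine ((hB.continuousOn_flow hT hG) (x, y + w) ⟨mem_univ _, abs_le.1 hyw⟩).tendsto.comp
          (tendsto_nhdsWithin_iff.2 ⟨htend, ?_⟩)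
        filter_upwards [self_mem_nhdsWithin] with w' hw' using
          ⟨mem_univ _, abs_le.1 (hseg hy hv hw')⟩
      have h2 : Tendsto (fun w' => box e' c' x' (y' + w')) (𝓝[uIcc 0 v] w)
          (𝓝 (box e' c' x' (y' + w))) := by
        have h3 : Tendsto (fun w' => (x', y' + w')) (𝓝[uIcc 0 v] w) (𝓝 (x', y' + w)) :=
          (Continuous.tendsto (f := fun w' : ℝ => (x', y' + w')) (by fun_prop) w).mono_left
            nhdsWithin_le_nhds
        exact (hB'.continuousAt_box hx' hyw').tendsto.comp h3
      filter_upwards [(h1.prodMk_nhds h2).eventually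
        (isClosed_diagonal.isOpen_compl.mem_nhds hQ)] with w' hw'
      exact propext ⟨fun h => absurd h hw', fun h => absurd h hQ⟩
  have h0 : Q 0 := by simpa [Q] using h
  have : Q v := by
    rw [← eq_of_eventually_eq isPreconnected_uIcc hloc left_mem_uIcc right_mem_uIcc]
    exact h0
  exact this

/-- A strip of complete trajectories without returns leaves all compact subsets of `U`. -/
theorem flow_proper (hinj : InjOn G (univ ×ˢ Icc (-ε) ε)) {b : Plane} (hb : b ∈ U) :
    ∃ N ∈ 𝓝 b, ∃ M, ∀ x y, |y| ≤ ε → G (x, y) ∈ N → |x| ≤ M := by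
  have hpt : ∀ a : Plane, ∃ M, ∀ x y, |y| ≤ ε → G (x, y) = a → |x| ≤ M := by
    intro a
    by_cases h : ∃ x y, |y| ≤ ε ∧ G (x, y) = a
    · obtain ⟨x, y, hy, rfl⟩ := h
      refine ⟨|x|, fun x' y' hy' heq => ?_⟩
      have := hinj ⟨mem_univ (x', y').1, abs_le.1 hy'⟩ ⟨mem_univ (x, y).1, abs_le.1 hy⟩ heq
      rw [(Prod.mk.inj this).1]
    · exact ⟨0, fun x y hy heq => absurd ⟨x, y, hy, heq⟩ h⟩
  obtain ⟨e', he', hbe⟩ := hT.covers b hb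
  obtain ⟨r, hB', -⟩ := IsTranslationAtlas.exists_isFlowBox he' hbe univ_mem
  have hr := hB'.height
  set η := min (r / 2) ε with hη
  have hη0 : 0 < η := lt_min (by positivity) hB.height
  have hηr : η ≤ r / 2 := min_le_left _ _
  have hηε : η ≤ ε := min_le_right _ _
  obtain ⟨M₁, hM₁⟩ := hpt (box e' (e' b) 0 (η / 2))
  obtain ⟨M₂, hM₂⟩ := hpt (box e' (e' b) 0 (-(η / 2)))
  have hN : (fun w : ℝ × ℝ => box e' (e' b) w.1 w.2) ''
      (Icc (-(η / 4)) (η / 4) ×ˢ Icc (-(η / 4)) (η / 4)) ∈ 𝓝 b := by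
    have h1 : IsFlowBox T e' (e' b) (η / 4) (η / 4) := ⟨he', by positivity, by positivity,
      fun x y hx hy => hB'.target x y (by linarith) (by linarith)⟩
    have := mem_interior_iff_mem_nhds.1 (h1.box_mem_interior (x := 0) (y := 0)
      (by rw [abs_zero]; positivity) (by rw [abs_zero]; positivity))
    rwa [box_zero_eq hbe] at this
  -- A point of the strip near `b` is moved vertically, inside both the strip and the box, to one of
  -- the two fixed points at the heights `±η / 2`. The strip passes through each of these for at
  -- most one parameter, which bounds `x`. The sign is chosen opposite to that of `y`, so that the
  -- strip is not left.
  have key : ∀ x y x' y' v, |y| ≤ ε → |x'| ≤ η / 4 → |y'| ≤ η / 4 → |y' + v| ≤ η →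
      |y + v| ≤ ε → G (x, y) = box e' (e' b) x' y' →
      G (x - x', y + v) = box e' (e' b) 0 (y' + v) := by
    intro x y x' y' v hy hx' hy' hv' hv h
    have h1 := hB.flow_vertical hT hG hB' (by linarith) (by linarith) (by linarith) hy hv h
    have h2 := hB'.box_flowsTo hT (show |x'| ≤ r by linarith) hB'.zero_le
      (show |y' + v| ≤ r by linarith)
    rw [← h1] at h2
    rw [hT.eq_of_flowsTo_flow hG hv h2, zero_sub, sub_eq_add_neg]
  refine ⟨_, hN, max M₁ M₂ + η, fun x y hy ⟨⟨x', y'⟩, hxy, heq⟩ => ?_⟩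
  have hx' := hxy.1
  have hy' := hxy.2
  simp only at hx' hy' heq
  have hyε := abs_le.1 hy
  have habs : ∀ M, |x - x'| ≤ M → |x| ≤ M + η := fun M hM => by
    rw [abs_le] at hM ⊢
    constructor <;> linarith [hx'.1, hx'.2, hM.1, hM.2]
  rcases le_total y 0 with h | h
  · have h1 := key x y x' y' (η / 2 - y') hy (abs_le.2 hx') (abs_le.2 hy')
      (by rw [add_sub_cancel, abs_of_pos (by positivity)]; linarith)
      (abs_le.2 ⟨by linarith [hy'.2], by linarith [hy'.1]⟩) heq.symm
    rw [add_sub_cancel] at h1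
    have h2 := habs _ (hM₁ _ _ (abs_le.2 ⟨by linarith [hy'.2], by linarith [hy'.1]⟩) h1)
    linarith [le_max_left M₁ M₂]
  · have h1 := key x y x' y' (-(η / 2) - y') hy (abs_le.2 hx') (abs_le.2 hy')
      (by rw [add_sub_cancel, abs_neg, abs_of_pos (by positivity)]; linarith)
      (abs_le.2 ⟨by linarith [hy'.2], by linarith [hy'.1]⟩) heq.symm
    rw [add_sub_cancel] at h1
    have h2 := habs _ (hM₂ _ _ (abs_le.2 ⟨by linarith [hy'.2], by linarith [hy'.1]⟩) h1)
    linarith [le_max_right M₁ M₂]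

end IsFlowBox

end FlowBox


/-! ### Parallel neighbourhoods, and local finiteness of separatrices -/

namespace FlowBox

variable {X : Plane → Plane} {U P : Set Plane} {T : Set (OpenPartialHomeomorph Plane ℂ)}
  {e : OpenPartialHomeomorph Plane ℂ} {c : ℂ} {ρ ε r : ℝ} {p : Plane} {G : ℝ × ℝ → Plane}

theorem forwardOrbit_neg : forwardOrbit (-X) U p = backwardOrbit X U p := by
  ext b
  constructor
  · rintro ⟨t, ht, h⟩
    exact ⟨-t, neg_nonpos.2 ht, flowsTo_neg_iff.1 h⟩
  · rintro ⟨t, ht, h⟩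
    exact ⟨-t, neg_nonneg.2 ht, flowsTo_neg_iff.2 (by rwa [neg_neg])⟩

theorem omegaLimitSet_neg : omegaLimitSet (-X) U p = alphaLimitSet X U p := by
  simp only [omegaLimitSet, alphaLimitSet, forwardOrbit_neg]

/-- The part of the strip over a bounded interval is compact, so it adds no new limit points. Any
other point of the closure lies in one of the two ends for every `M`, because the ends shrink with
`M`. -/
theorem closure_strip_subset (hG : ContinuousOn G (univ ×ˢ Icc (-ε) ε)) :
    closure (toSphere '' (G '' (univ ×ˢ Icc (-ε) ε))) ⊆
      toSphere '' (G '' (univ ×ˢ Icc (-ε) ε)) ∪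
        (⋂ M, stripEnd (fun w => G (-w.1, w.2)) ε M) ∪ ⋂ M, stripEnd G ε M := by
  intro s hs
  by_cases h : ∃ M, s ∉ stripEnd (fun w => G (-w.1, w.2)) ε M ∧ s ∉ stripEnd G ε M
  · obtain ⟨M, h1, h2⟩ := h
    have hc : IsCompact (toSphere '' (G '' (Icc (-M) M ×ˢ Icc (-ε) ε))) :=
      ((isCompact_Icc.prod isCompact_Icc).image_of_continuousOn
        (hG.mono (prod_mono_left (subset_univ _)))).image isOpenEmbedding_toSphere.continuous
    have hsub : toSphere '' (G '' (univ ×ˢ Icc (-ε) ε)) ⊆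
        toSphere '' (G '' (Icc (-M) M ×ˢ Icc (-ε) ε)) ∪
          (toSphere '' ((fun w : ℝ × ℝ => G (-w.1, w.2)) '' (Ici M ×ˢ Icc (-ε) ε)) ∪
            toSphere '' (G '' (Ici M ×ˢ Icc (-ε) ε))) := by
      rintro _ ⟨_, ⟨⟨x, y⟩, ⟨-, hy⟩, rfl⟩, rfl⟩
      by_cases hx : M ≤ x
      · exact Or.inr (Or.inr ⟨_, ⟨(x, y), ⟨hx, hy⟩, rfl⟩, rfl⟩)
      by_cases hx' : M ≤ -x
      · exact Or.inr (Or.inl ⟨_, ⟨(-x, y), ⟨hx', hy⟩, by simp⟩, rfl⟩)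
      · exact Or.inl ⟨_, ⟨(x, y), ⟨⟨by linarith, by linarith⟩, hy⟩, rfl⟩, rfl⟩
    have h3 := closure_mono hsub hs
    rw [closure_union, closure_union, hc.isClosed.closure_eq] at h3
    rcases h3 with h3 | h3 | h3
    · exact Or.inl (Or.inl (image_mono (image_mono (prod_mono_left (subset_univ _))) h3))
    · exact absurd h3 h1
    · exact absurd h3 h2
  · push Not at h
    by_cases h1 : ∀ M, s ∈ stripEnd G ε M
    · exact Or.inr (mem_iInter.2 h1)
    · push Not at h1
      obtain ⟨M, hM⟩ := h1
      refine Or.inl (Or.inr (mem_iInter.2 fun M' => ?_))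
      by_contra h2
      have h3 := h (max M M') fun h4 => h2 (antitone_stripEnd (le_max_right M M') h4)
      exact hM (antitone_stripEnd (le_max_left M M') h3)

/-- A strip of complete trajectories that do not return is a parallel neighbourhood. -/
theorem IsFlowBox.hasParallelNeighbourhood (hP : IsClosed P) (hPt : IsTotallyDisconnected P)
    (hB : IsFlowBox T e c ρ ε) (hT : IsTranslationAtlas X Pᶜ T)
    (hcomp : ∀ y, |y| ≤ ε → ∀ t, ∃ b, FlowsTo X Pᶜ (box e c 0 y) t b)
    (hno : ∀ y z, |y| ≤ ε → |z| ≤ ε → ∀ t > 0,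
      ¬ FlowsTo X Pᶜ (box e c 0 y) t (box e c 0 z)) :
    HasParallelNeighbourhood X Pᶜ (box e c 0 0) := by
  have hε := hB.height
  have h0 : |(0 : ℝ)| ≤ ε := by simpa using hε.le
  obtain ⟨G, hG⟩ : ∃ G : ℝ × ℝ → Plane, ∀ x y, |y| ≤ ε →
      FlowsTo X Pᶜ (box e c 0 y) x (G (x, y)) := by
    have : ∀ w : ℝ × ℝ, ∃ b, |w.2| ≤ ε → FlowsTo X Pᶜ (box e c 0 w.2) w.1 b := fun w => by
      by_cases hw : |w.2| ≤ ε
      · obtain ⟨b, hb⟩ := hcomp w.2 hw w.1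
        exact ⟨b, fun _ => hb⟩
      · exact ⟨0, fun h => absurd h hw⟩
    choose G hG using this
    exact ⟨G, fun x y hy => hG (x, y) hy⟩
  have hGc := hB.continuousOn_flow hT hG
  have hG0 : G (0, 0) = box e c 0 0 := hT.flowsTo_zero (hG 0 0 h0)
  have hGi : InjOn G (univ ×ˢ Icc (-ε) ε) := by
    rintro ⟨x, y⟩ ⟨-, hy⟩ ⟨x', y'⟩ ⟨-, hy'⟩ heq
    simp only at hy hy'
    have h1 := hG x y (abs_le.2 hy)
    rw [heq] at h1
    have h2 := hT.flowsTo_trans h1 (hG x' y' (abs_le.2 hy')).symm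
    rcases lt_trichotomy (x + -x') 0 with h3 | h3 | h3
    · exact absurd h2.symm (hno _ _ (abs_le.2 hy') (abs_le.2 hy) _ (neg_pos.2 h3))
    · rw [h3] at h2
      have h4 := (hB.box_injective hB.zero_le (abs_le.2 hy') hB.zero_le (abs_le.2 hy)
        (hT.flowsTo_zero h2)).2
      rw [h4, show x = x' by linarith]
    · exact absurd h2 (hno _ _ (abs_le.2 hy) (abs_le.2 hy') _ h3)
  have hproper : ∀ b ∈ Pᶜ, ∃ N ∈ 𝓝 b, ∃ M, ∀ x y, |y| ≤ ε → G (x, y) ∈ N → |x| ≤ M :=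
    fun b hb => hB.flow_proper hT hG hGi hb
  obtain ⟨q, hq, hqo⟩ := exists_omegaLimitSet_eq hP hPt hε hGc
    (fun x y hy => hT.forwardOrbit_flow hG x y hy) hproper
  -- The `α`-limit set is the `ω`-limit set for `-X`, with the strip run through backwards.
  obtain ⟨q', hq', hqa⟩ := exists_omegaLimitSet_eq (X := -X) (G := fun w => G (-w.1, w.2)) hP hPt hε
    (hGc.comp (by fun_prop) fun w hw => ⟨mem_univ _, hw.2⟩)
    (fun x y hy => by
      rw [forwardOrbit_neg, hT.backwardOrbit_flow hG _ y hy, ← image_neg_Ici, image_image])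
    (fun b hb => by
      obtain ⟨N, hN, M, hM⟩ := hproper b hb
      exact ⟨N, hN, M, fun x y hy h => abs_neg x ▸ hM (-x) y hy h⟩)
  have hqa' : ∀ x y, |y| ≤ ε → alphaLimitSet X Pᶜ (G (x, y)) = {q'} := fun x y hy => by
    have := hqa (-x) y hy
    rwa [omegaLimitSet_neg, neg_neg] at this
  -- The strip has heights up to `ε`, and the definition asks for `[-1, 1]`; the second coordinate
  -- is rescaled.
  have hscale : ∀ y ∈ Icc (-1 : ℝ) 1, |ε * y| ≤ ε := fun y hy => by
    rw [abs_mul, abs_of_pos hε]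
    exact mul_le_of_le_one_right hε.le (abs_le.2 hy)
  have hmaps : MapsTo (fun w : ℝ × ℝ => (w.1, ε * w.2)) (univ ×ˢ Icc (-1) 1)
      (univ ×ˢ Icc (-ε) ε) := fun w hw => ⟨mem_univ _, abs_le.1 (hscale _ hw.2)⟩
  have himage : (fun w : ℝ × ℝ => G (w.1, ε * w.2)) '' (univ ×ˢ Icc (-1) 1) =
      G '' (univ ×ˢ Icc (-ε) ε) := by
    refine Subset.antisymm ?_ ?_
    · rintro _ ⟨w, hw, rfl⟩
      exact ⟨_, hmaps hw, rfl⟩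
    · rintro _ ⟨w, hw, rfl⟩
      refine ⟨(w.1, w.2 / ε), ⟨mem_univ _, ?_, ?_⟩, ?_⟩
      · rw [le_div_iff₀ hε]; linarith [hw.2.1]
      · rw [div_le_iff₀ hε]; linarith [hw.2.2]
      · simp only [mul_div_cancel₀ _ hε.ne']
  have himage' : (fun w : ℝ × ℝ => G (w.1, ε * w.2)) '' (univ ×ˢ Ioo (-1) 1) =
      G '' (univ ×ˢ Ioo (-ε) ε) := by
    refine Subset.antisymm ?_ ?_
    · rintro _ ⟨w, hw, rfl⟩
      exact ⟨(w.1, ε * w.2), ⟨mem_univ _, by nlinarith [hw.2.1], by nlinarith [hw.2.2]⟩, rfl⟩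
    · rintro _ ⟨w, hw, rfl⟩
      refine ⟨(w.1, w.2 / ε), ⟨mem_univ _, ?_, ?_⟩, ?_⟩
      · rw [lt_div_iff₀ hε]; linarith [hw.2.1]
      · rw [div_lt_iff₀ hε]; linarith [hw.2.2]
      · simp only [mul_div_cancel₀ _ hε.ne']
  refine ⟨fun w => G (w.1, ε * w.2), hGc.comp (by fun_prop) hmaps, ?_, ?_, ?_, ?_, ?_, ?_⟩
  · intro w hw w' hw' heq
    have := hGi (hmaps hw) (hmaps hw') heq
    simp only [Prod.mk.injEq, mul_right_inj' hε.ne'] at this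
    exact Prod.ext this.1 this.2
  · simpa using hG0
  · exact fun w hw => (hG _ _ (hscale _ hw.2)).right_mem
  · rw [himage', isOpen_iff_mem_nhds]
    rintro _ ⟨w, hw, rfl⟩
    exact hB.strip_mem_nhds hT
      (fun w hw => ⟨(abs_lt.2 hw.2).le, hG _ _ (abs_lt.2 hw.2).le⟩)
      ((isOpen_univ.prod isOpen_Ioo).mem_nhds hw)
  · intro y hy x
    have hy' := hscale y hy
    refine ⟨hT.trajectory_flow hG x _ hy', fun x' hx => ⟨x' - x, sub_pos.2 hx,
      hT.flow_flowsTo hG x x' _ hy'⟩, ?_, ?_⟩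
    · rw [← hG0, hqa' _ _ hy', hqa' _ _ h0]
    · rw [← hG0, hqo _ _ hy', hqo _ _ h0]
  · rw [himage, ← hG0, hqa' _ _ h0, hqo _ _ h0, ← hq, ← hq']
    exact closure_strip_subset hGc

/-- A complete trajectory is not a separatrix. -/
theorem IsTranslationAtlas.not_isSeparatrixPt (hP : IsClosed P) (hPt : IsTotallyDisconnected P)
    (hT : IsTranslationAtlas X Pᶜ T)
    (hfin : LocallyFiniteTrajectories X Pᶜ (IsIncomplete X Pᶜ)) (hp : p ∈ Pᶜ)
    (hcomp : ¬ IsIncomplete X Pᶜ p) : ¬ IsSeparatrixPt X Pᶜ p := by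
  rw [IsSeparatrixPt, not_not]
  by_cases hper : IsPeriodicPt X Pᶜ p
  · exact Or.inl (hT.hasPeriodicNeighbourhood hper)
  right
  obtain ⟨V, hV, hVf⟩ := hfin p hp
  obtain ⟨e, he, hpe⟩ := hT.covers p hp
  obtain ⟨ρ, hB, hBV⟩ := IsTranslationAtlas.exists_isFlowBox he hpe hV
  have hbox := box_zero_eq hpe
  generalize e p = c at hB hBV hbox
  have hcomp' : ∀ t, ∃ b, FlowsTo X Pᶜ (box e c 0 0) t b := by
    rw [hbox]
    exact not_not.1 hcomp
  rw [← hbox] at hper ⊢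
  -- The box is shortened three times: until the centre does not return, until no neighbour returns,
  -- and until all trajectories through the axis are complete.
  obtain ⟨r, hr, hrρ, hno⟩ := hB.exists_forall_not_flowsTo hT hper
  have hBr := hB.mono hr hrρ
  have hinc : {A | ∃ y, |y| ≤ r ∧ IsIncomplete X Pᶜ (box e c 0 y) ∧
      A = trajectory X Pᶜ (box e c 0 y)}.Finite := by
    refine hVf.subset ?_
    rintro _ ⟨y, hy, hi, rfl⟩
    have hm := hBr.box_mem_domain hT hB.zero_le hy
    exact ⟨_, hm, hi, rfl, _, ⟨0, FlowsTo.refl hm⟩, hBV 0 y hB.zero_le (hy.trans hrρ)⟩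
  obtain ⟨ε, hε, hεr, hno'⟩ := hBr.exists_forall_forall_not_flowsTo hT hno hcomp' hinc
  -- each incomplete trajectory meets the axis at most once
  have hW : {y | |y| ≤ ε ∧ IsIncomplete X Pᶜ (box e c 0 y)}.Finite := by
    refine Finite.of_finite_image (f := fun y => trajectory X Pᶜ (box e c 0 y)) (hinc.subset ?_) ?_
    · rintro _ ⟨y, hy, rfl⟩
      exact ⟨y, hy.1.trans hεr, hy.2, rfl⟩
    · intro y hy z hz heq
      have h1 : box e c 0 z ∈ trajectory X Pᶜ (box e c 0 y) := by
        simp only at heq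
        rw [heq]
        exact ⟨0, FlowsTo.refl (hBr.box_mem_domain hT hB.zero_le (hz.1.trans hεr))⟩
      obtain ⟨t, ht⟩ := h1
      rcases lt_trichotomy t 0 with hlt | rfl | hlt
      · exact absurd ht.symm (hno' z y hz.1 hy.1 _ (neg_pos.2 hlt))
      · exact (hBr.box_injective hB.zero_le (hz.1.trans hεr) hB.zero_le (hy.1.trans hεr)
          (hT.flowsTo_zero ht)).2.symm
      · exact absurd ht (hno' y z hy.1 hz.1 _ hlt)
  have hev : ∀ᶠ y in 𝓝 (0 : ℝ), y ∉ {y | |y| ≤ ε ∧ IsIncomplete X Pᶜ (box e c 0 y)} :=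
    hW.isClosed.isOpen_compl.mem_nhds fun h => h.2 hcomp'
  obtain ⟨d, hd, hball⟩ := Metric.eventually_nhds_iff.1 hev
  have hmin : 0 < min (d / 2) ε := lt_min (by positivity) hε
  refine (hBr.mono hmin ((min_le_right _ _).trans hεr)).hasParallelNeighbourhood hP hPt hT ?_ ?_
  · intro y hy
    by_contra hc
    refine hball ?_ ⟨hy.trans (min_le_right _ _), hc⟩
    rw [Real.dist_0_eq_abs]
    linarith [min_le_left (d / 2) ε]
  · exact fun y z hy hz => hno' y z (hy.trans (min_le_right _ _)) (hz.trans (min_le_right _ _))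

theorem IsTranslationAtlas.locallyFinite_separatrices (hP : IsClosed P)
    (hPt : IsTotallyDisconnected P) (hT : IsTranslationAtlas X Pᶜ T)
    (hfin : LocallyFiniteTrajectories X Pᶜ (IsIncomplete X Pᶜ)) :
    LocallyFiniteTrajectories X Pᶜ (IsSeparatrixPt X Pᶜ) := by
  intro p hp
  obtain ⟨V, hV, hVf⟩ := hfin p hp
  refine ⟨V, hV, hVf.subset ?_⟩
  rintro _ ⟨b, hb, hs, rfl, hne⟩
  exact ⟨b, hb, by_contra fun hc => hT.not_isSeparatrixPt hP hPt hfin hb hc hs, rfl, hne⟩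

end FlowBox

/-! ### Assembly of the four statements from the translation atlas -/

theorem mainTheorem4 (S : Set FlowBox.Plane) (hS : IsClosed S) (hSacc : (derivedSet S).Finite)
    (X : FlowBox.Plane → FlowBox.Plane) (hX : ContDiffOn ℝ ∞ X Sᶜ)
    (P : Set FlowBox.Plane) (hP : P = FlowBox.punctures X S) (hPtd : IsTotallyDisconnected P)
    (J : FlowBox.ComplexStructure Pᶜ) (V : FlowBox.AnalyticVectorField J)
    (hV : FlowBox.IsRealPart V X)
    (hfin : FlowBox.LocallyFiniteTrajectories X Pᶜ (FlowBox.IsIncomplete X Pᶜ)) :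
    FlowBox.LocallyFiniteTrajectories X Pᶜ (FlowBox.IsSeparatrixPt X Pᶜ) ∧
    ((∀ p ∈ Pᶜ, FlowBox.IsPeriodicPt X Pᶜ p → FlowBox.PeriodicHolonomyIsIdentity X Pᶜ p) ∧
      ∀ L : Set FlowBox.Sphere, FlowBox.IsPolycycle X P L →
        FlowBox.PolycycleHolonomyIsIdentity X Pᶜ L) ∧
    (∀ q ∈ FlowBox.singularPoints P, ∀ h : ℝ × ℝ → FlowBox.Sphere,
      FlowBox.IsHyperbolicSector X Pᶜ q h → FlowBox.SectorHolonomyIsDiffeo X Pᶜ h) ∧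
    (∀ q ∈ FlowBox.singularPoints P, ∀ k : ℕ, FlowBox.IsMultiSaddle X Pᶜ q k →
      FlowBox.IsSmoothlyEquivalentToModel X Pᶜ q k) := by
  have hU : IsOpen Pᶜ := hP ▸ FlowBox.isOpen_compl_punctures hS hX
  have hX0 : ∀ p ∈ Pᶜ, X p ≠ 0 := fun p hp h0 => hp (hP ▸ by
    by_cases hpS : p ∈ S
    · exact Or.inl hpS
    · exact Or.inr ⟨hpS, h0⟩)
  obtain ⟨T, hT⟩ := FlowBox.exists_isTranslationAtlas hV hU hX0
  refine ⟨?_, ⟨fun p _ hper => hT.periodicHolonomyIsIdentity hper,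
    fun L _ => hT.polycycleHolonomyIsIdentity L⟩,
    fun q _ h hh => hT.sectorHolonomyIsDiffeo hh, ?_⟩
  · have hPc : IsClosed P := isOpen_compl_iff.1 hU
    exact hT.locallyFinite_separatrices hPc hPtd hfin
  · exact fun q _ k hq => hT.isSmoothlyEquivalentToModel
      (hX.mono (compl_subset_compl.2 (hP ▸ subset_union_left))) hq
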